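/- **Model.** Base stations (BSs) form a homogeneous Poisson point process in $\mathbb R^2$ of density $\lambda_b>0$; RISs form an independent one of density $\lambda_r=\mu\lambda_o$, where $\lambda_o>0$ is the obstacle density and $0\le\mu\le1$. The typical user is at the origin and every BS transmits. Let $\beta=2\lambda_oL_o/\pi$ with mean obstacle length $L_o>0$, $\mathcal P_L(t)=e^{-\beta t}$, $\mathcal P_N=1-\mathcal P_L$. A link of length $t$ from a BS or a RIS to the user is LoS with probability $\mathcal P_L(t)$, independently of the other links; BS–RIS links are LoS. RIS orientations are independent and uniform. The tagged BS $b_0$ is the nearest one, at distance $t_{bu}$. The serving link is DL if the tagged link is LoS; otherwise it is CL if some RIS has a LoS link to the user and has both the user and $b_0$ on its front side, and the nearest such RIS, at distance $t_{ru}$, serves; otherwise it is DN. The BS–RIS distance is $t_{br}=\sqrt{t_{bu}^2+t_{ru}^2-2t_{bu}t_{ru}\cos\theta_0}$, where $\theta_0$ is taken uniform on $(-\pi,\pi)$ and independent of everything else. Fix integers $N_b\ge2$, $N_r,m_L,m_N\ge1$ and reals $p_b,\sigma^2,\lambda_f,\delta,\alpha_L>0$, $\alpha_N>2$. Put $\zeta=(\lambda_f/4\pi)^2$,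 $\mathcal E=\lambda_f^2/4\pi$, $m_{DL}=m_{CL}=m_L$, $m_{DN}=m_N$, $$P^a_{DL}=p_bN_b\zeta t_{bu}^{-\alpha_L},\quad P^a_{DN}=p_bN_b\zeta t_{bu}^{-\alpha_N},\quad P^a_{CL}=p_bN_bN_r^2\zeta(t_{ru}t_{br})^{-\alpha_L}.$$ The serving power is $P_q=P^a_qH_q$. The fading $H_q$ is Gamma with shape and rate $m_q$; its CDF is $F_{H_q}(h)=\frac1{\Gamma(m_q)}\int_0^{m_qh}x^{m_q-1}e^{-x}dx$. The interference is $$I_B=\sum_{i\ne0}p_bG_B(\Delta_i)\zeta d_i^{-\alpha_{v_i}}H_{v_i,i},$$ where $d_i$ is the distance of BS $i$ and $v_i\in\{L,N\}$ the state of its link to the user, the fading $H_{v,i}$ is Gamma with shape and rate $m_v$, and $\Delta_i=\frac12\cos\phi_i-\frac12\cos\phi_i^*$ with $\phi_i,\phi_i^*$ uniform on $[0,2\pi]$; all these variables are independent. With $G_{ULA}(x)=\frac{\sin^2(\pi N_bx)}{N_b\sin^2(\pi x)}$, $G_{ULA}(0)=N_b$, $\tilde N=\lfloor N_b/2\rfloor-1$,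 let $G_0=\frac\delta2N_b$, $G_n=\frac\delta2G_{ULA}(\frac{2n+1}{2N_b})$ for $1\le n\le\tilde N$, $G_{\tilde N+1}=0$. For $|\Delta|\le\frac12$, $G_B(\Delta)=G_0$ if $|\Delta|\le\frac1{N_b}$, $G_B(\Delta)=G_n$ if $\frac n{N_b}<|\Delta|\le\frac{n+1}{N_b}$ with $1\le n\le\tilde N$, and $G_B(\Delta)=0$ otherwise; for $\frac12<|\Delta|\le1$, $G_B(\Delta)=G_B(1-|\Delta|)$. Finally $$\Upsilon_q=\frac{P_q}{\sigma^2+I_B},\qquad \mathcal W_q=\frac{P_q+I_B}{\mathcal E},$$ and $\Upsilon,\mathcal W$ are $\Upsilon_q,\mathcal W_q$ for the actual link type $q$. **Closed forms.** With $f_\Phi(x)=\frac2{\pi\sqrt{1-4x^2}}$ on $[-\frac12,\frac12]$ (zero elsewhere) and $f_\Delta(y)=\int_{-1/2}^{1/2}f_\Phi(x)f_\Phi(x+y)dx$, put $$p_n=2\int_{n/N_b}^{(n+1)/N_b}f_\Delta+2\int_{1-(n+1)/N_b}^{1-n/N_b}f_\Delta\quad(0\le n\le\tilde N),\qquad p_{\tilde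 N+1}=1-\sum_{n\le\tilde N}p_n,$$ $$\kappa_v(x)=\sum_{n=0}^{\tilde N+1}p_n\Big(1+\frac{xG_n}{m_v}\Big)^{-m_v},$$ $$\mathcal L_{I_B|t}(s)=\prod_{v\in\{L,N\}}\exp\Big(-2\pi\lambda_b\int_t^\infty[1-\kappa_v(sp_b\zeta r^{-\alpha_v})]\,r\,\mathcal P_v(r)\,dr\Big).$$ Put $$\bar a(t,s)=\int_{-\pi}^{\pi}\mathcal P_L(s)\Big(\frac12-\frac1{2\pi}\arccos\frac{s-t\cos\theta}{\sqrt{t^2+s^2-2ts\cos\theta}}\Big)d\theta,\qquad \mathcal P_{CL}(t)=1-e^{-\lambda_r\int_0^\infty\bar a(t,s)s\,ds},$$ $$\mathcal A_{DL}=\mathcal P_L,\quad \mathcal A_{CL}=\mathcal P_N\mathcal P_{CL},\quad \mathcal A_{DN}=\mathcal P_N(1-\mathcal P_{CL}),$$ $$f_{bu}(t)=2\pi\lambda_bte^{-\pi\lambda_bt^2},\qquad f_{ru|t}(s)=\frac{\lambda_rs\,\bar a(t,s)e^{-\lambda_r\int_0^s\bar a(t,u)u\,du}}{\mathcal P_{CL}(t)}$$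 (the term with $f_{ru|t}$ below is zero if $\lambda_r=0$). For $\gamma>0$ and $\omega\in\mathbb R$ put $U=\mathbb 1(\mathcal E\omega\ge\sigma^2\gamma)$, $P_1=\frac{\gamma(\mathcal E\omega+\sigma^2)}{1+\gamma}$, $A^{\iota+1}_{k+1}=\frac{(k+1)!}{(k-\iota)!}$, $c_1=\frac{jxP^a_q+m_q\gamma}{\gamma}$, $c_2=m_q-jxP^a_q$, and $$\Xi_1^q(-jx)=-e^{-c_1h}\sum_{k=0}^{m_q-1}\frac{(m_qh)^k}{k!}\Big(1-\frac{jxP^a_q}{\gamma(k+1)}\sum_{\iota=0}^k\frac{h^{-\iota}}{c_1^{\iota+1}}A^{\iota+1}_{k+1}\Big)\Big|_{h=\sigma^2\gamma/P^a_q}^{h=P_1/P^a_q},$$ $$\Xi_2^q(jx)=-e^{-c_2h}\sum_{k=0}^{m_q-1}\frac{(m_qh)^k}{k!}\Big(1+\frac{jxP^a_q}{k+1}\sum_{\iota=0}^k\frac{h^{-\iota}}{c_2^{\iota+1}}A^{\iota+1}_{k+1}\Big)\Big|_{h=P_1/P^a_q}^{h=\mathcal E\omega/P^a_q}.$$ **Theorem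 (Downlink joint probability).** The series $I_B$ converges almost surely. Given the link type $q$ and its serving distances $\mathcal T_q$ ($\mathcal T_{DL}=\mathcal T_{DN}=\{t_{bu}\}$, $\mathcal T_{CL}=\{t_{bu},t_{ru},t_{br}\}$), almost surely $$\mathbb P(\Upsilon_q>\gamma,\mathcal W_q\le\omega\mid\mathcal T_q)=J_q(\mathcal T_q),$$ where $$J_q=U\Big(\tfrac12F_{H_q}(h)\Big|_{\sigma^2\gamma/P^a_q}^{\mathcal E\omega/P^a_q}-\int_0^\infty\frac1{\pi x}\,\mathrm{Im}\big[(\Xi_1^q(-jx)e^{jx\sigma^2}+\Xi_2^q(jx)e^{-jx\mathcal E\omega})\,\mathcal L_{I_B|t_{bu}}(-jx)\big]dx\Big),$$ the integral converging absolutely when $U=1$. Moreover $$\mathbb P(\Upsilon>\gamma,\mathcal W\le\omega)=\int_0^\infty\Big[\mathcal A_{DL}(t)J_{DL}(t)+\int_0^\infty\!\!\int_{-\pi}^{\pi}\mathcal A_{CL}(t)J_{CL}\big(t,s,\sqrt{t^2+s^2-2ts\cos\theta}\big)\frac{f_{ru|t}(s)}{2\pi}\,d\theta\,ds+\mathcal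 A_{DN}(t)J_{DN}(t)\Big]f_{bu}(t)\,dt,$$ where the outer integrand is integrable on $(0,\infty)$ and, for almost every $t>0$, the inner one is integrable on $(0,\infty)\times(-\pi,\pi)$. -/

import Mathlib

open MeasureTheory ProbabilityTheory Set

namespace RisNet

/-! # Parameters and closed-form functions -/

/-- Parameters of the downlink of a network assisted by reconfigurable intelligent surfaces. -/
structure Params where
  /-- density of the base stations (BSs) -/
  lamB : ℝ
  /-- density of the obstacles -/
  lamO : ℝ
  /-- mean length of an obstacle -/
  Lo : ℝ
  /-- fraction of the obstacles that carry a RIS -/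
  mu : ℝ
  /-- number of antennas of a BS -/
  Nb : ℕ
  /-- number of elements of a RIS -/
  Nr : ℕ
  /-- compensation factor of the discrete antenna pattern -/
  delta : ℝ
  /-- wavelength -/
  lamF : ℝ
  /-- LoS path-loss exponent -/
  alphaL : ℝ
  /-- NLoS path-loss exponent -/
  alphaN : ℝ
  /-- LoS Nakagami shape parameter -/
  mL : ℕ
  /-- NLoS Nakagami shape parameter -/
  mN : ℕ
  /-- transmit power of a BS -/
  pb : ℝ
  /-- noise power (the variance itself) -/
  noise : ℝ
  lamB_pos : 0 < lamB
  lamO_pos : 0 < lamO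
  Lo_pos : 0 < Lo
  mu_nonneg : 0 ≤ mu
  mu_le_one : mu ≤ 1
  two_le_Nb : 2 ≤ Nb
  one_le_Nr : 1 ≤ Nr
  delta_pos : 0 < delta
  lamF_pos : 0 < lamF
  alphaL_pos : 0 < alphaL
  two_lt_alphaN : 2 < alphaN
  one_le_mL : 1 ≤ mL
  one_le_mN : 1 ≤ mN
  pb_pos : 0 < pb
  noise_pos : 0 < noise

/-- State of a propagation link: line of sight or not. -/
inductive LinkState
  | L
  | N

/-- Type of the serving link: direct LoS, cascaded LoS, direct NLoS. -/
inductive Serving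
  | DL
  | CL
  | DN

noncomputable section

namespace Params

variable (p : Params)

/-- Path-loss exponent. -/
def alpha : LinkState → ℝ
  | .L => p.alphaL
  | .N => p.alphaN

/-- Nakagami shape parameter of a link in a given state. -/
def shape : LinkState → ℕ
  | .L => p.mL
  | .N => p.mN

/-- Nakagami shape parameter of the serving link. -/
def servingShape : Serving → ℕ
  | .DL => p.mL
  | .CL => p.mL
  | .DN => p.mN

/-- Density of the RISs. -/
def lamR : ℝ := p.mu * p.lamO

/-- Blockage parameter. -/
def beta : ℝ := 2 * p.lamO * p.Lo / Real.pi

/-- Reference path loss. -/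
def zeta : ℝ := (p.lamF / (4 * Real.pi)) ^ 2

/-- Effective area of the (unit gain) antenna of the user. -/
def area : ℝ := p.lamF ^ 2 / (4 * Real.pi)

/-- Maximal gain of a RIS. -/
def Gr : ℝ := (p.Nr : ℝ) ^ 2

open Classical in
/-- Gain of a uniform linear array; at integers it takes its limit value. -/
def gULA (x : ℝ) : ℝ :=
  if ∃ k : ℤ, x = k then (p.Nb : ℝ)
  else Real.sin (Real.pi * p.Nb * x) ^ 2 / (p.Nb * Real.sin (Real.pi * x) ^ 2)

/-- Maximal gain of a BS, seen on the serving link. -/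
def Gb : ℝ := p.gULA 0

/-- The number `⌊Nb / 2⌋ - 1`. -/
def nTilde : ℕ := p.Nb / 2 - 1

/-- Levels of the discrete antenna pattern. -/
def gain (n : ℕ) : ℝ :=
  if n = 0 then p.delta / 2 * p.gULA 0
  else if n ≤ p.nTilde then p.delta / 2 * p.gULA ((2 * n + 1) / (2 * p.Nb))
  else 0

open Classical in
/-- The discrete pattern as a function of a modulus `u` in `[0, 1/2]`. -/
def gainCore (u : ℝ) : ℝ :=
  if u ≤ 1 / p.Nb then p.gain 0
  else ∑ n ∈ Finset.Icc 1 p.nTilde,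
    if (n : ℝ) / p.Nb < u ∧ u ≤ ((n : ℝ) + 1) / p.Nb then p.gain n else 0

open Classical in
/-- Discrete multi-lobe antenna pattern on `[-1, 1]`. -/
def gB (D : ℝ) : ℝ :=
  if D < -(1 / 2) then p.gainCore |D + 1|
  else if 1 / 2 < D then p.gainCore |D - 1|
  else p.gainCore |D|

/-- LoS and NLoS probability of a link of length `t`. -/
def probState : LinkState → ℝ → ℝ
  | .L, t => Real.exp (-p.beta * t)
  | .N, t => 1 - Real.exp (-p.beta * t)

/-- Probability that BS (at distance `t` of the user) and user are both in front of a RIS at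
distance `s` of the user, `th` being the angle from the user-BS link to the user-RIS link. -/
def probRefl (t s th : ℝ) : ℝ :=
  1 / 2 - 1 / (2 * Real.pi) *
    Real.arccos ((s - t * Real.cos th) / Real.sqrt (t ^ 2 + s ^ 2 - 2 * t * s * Real.cos th))

/-- Angular integral of the probability that a RIS can create a cascaded LoS link. -/
def aBar (t s : ℝ) : ℝ :=
  ∫ th in (-Real.pi)..Real.pi, p.probState .L s * probRefl t s th

/-- Probability that a cascaded LoS link exists. -/
def probCL (t : ℝ) : ℝ :=
  1 - Real.exp (-p.lamR * ∫ s in Ioi (0 : ℝ), p.aBar t s * s)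

/-- Association probabilities, given the BS-user distance `t`. -/
def assoc : Serving → ℝ → ℝ
  | .DL, t => p.probState .L t
  | .CL, t => p.probState .N t * p.probCL t
  | .DN, t => p.probState .N t * (1 - p.probCL t)

/-- Density of the BS-user distance. -/
def pdfBU (t : ℝ) : ℝ :=
  2 * Real.pi * p.lamB * t * Real.exp (-Real.pi * p.lamB * t ^ 2)

/-- Density of the RIS-user distance `s`, given the BS-user distance `t`. -/
def pdfRU (t s : ℝ) : ℝ :=
  p.lamR * s * p.aBar t s * Real.exp (-p.lamR * ∫ u in (0 : ℝ)..s, p.aBar t u * u) / p.probCL t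

/-- BS-RIS distance through the law of cosines. -/
def distBR (t s th : ℝ) : ℝ := Real.sqrt (t ^ 2 + s ^ 2 - 2 * t * s * Real.cos th)

open Classical in
/-- Density of a spatial angle of departure `cos φ / 2`, `φ` uniform on `[0, 2π]`. -/
def pdfPhi (x : ℝ) : ℝ :=
  if -(1 / 2) ≤ x ∧ x ≤ 1 / 2 then 2 / (Real.pi * Real.sqrt (1 - 4 * x ^ 2)) else 0

open Classical in
/-- Density of the difference of two independent spatial angles of departure. -/
def pdfDelta (y : ℝ) : ℝ :=
  if -1 ≤ y ∧ y ≤ 1 then ∫ x in (-(1 / 2) : ℝ)..(1 / 2), pdfPhi x * pdfPhi (y + x) else 0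

/-- Probability of the gain level `n`, for `n ≤ nTilde`. -/
def probLobe (n : ℕ) : ℝ :=
  2 * (∫ y in ((n : ℝ) / p.Nb)..(((n : ℝ) + 1) / p.Nb), pdfDelta y) +
    2 * (∫ y in (1 - ((n : ℝ) + 1) / p.Nb)..(1 - (n : ℝ) / p.Nb), pdfDelta y)

/-- Probability of the gain level `n`, for `n ≤ nTilde + 1`. -/
def probGain (n : ℕ) : ℝ :=
  if n ≤ p.nTilde then p.probLobe n else 1 - ∑ k ∈ Finset.range (p.nTilde + 1), p.probLobe k

/-- The function `κ_v`. -/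
def kappa (v : LinkState) (x : ℂ) : ℂ :=
  ∑ n ∈ Finset.range (p.nTilde + 2),
    (p.probGain n : ℂ) * ((1 + x * (p.gain n : ℂ) / (p.shape v : ℂ)) ^ p.shape v)⁻¹

/-- Laplace transform of the interference from BSs whose link is in state `v`, given `t`. -/
def laplaceState (v : LinkState) (t : ℝ) (s : ℂ) : ℂ :=
  Complex.exp (-2 * Real.pi * p.lamB *
    ∫ d in Ioi t, (1 - p.kappa v (s * (p.pb : ℂ) * (p.zeta : ℂ) * ((d ^ (-p.alpha v) : ℝ) : ℂ))) *
      (d : ℂ) * (p.probState v d : ℂ))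

/-- Laplace transform of the interference, given the BS-user distance `t`. -/
def laplaceI (t : ℝ) (s : ℂ) : ℂ := p.laplaceState .L t s * p.laplaceState .N t s

/-- Mean received serving power on a direct link in state `v`. -/
def powDirect (v : LinkState) (t : ℝ) : ℝ := p.pb * p.Gb * p.zeta * t ^ (-p.alpha v)

/-- Mean received serving power on a cascaded link (`s` RIS-user, `z` BS-RIS distance). -/
def powCasc (s z : ℝ) : ℝ := p.pb * p.Gb * p.Gr * p.zeta * (s * z) ^ (-p.alphaL)

/-- Mean received serving power for each link type. -/
def pow : Serving → ℝ → ℝ → ℝ → ℝ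
  | .DL, t, _, _ => p.powDirect .L t
  | .CL, _, s, z => p.powCasc s z
  | .DN, t, _, _ => p.powDirect .N t

/-- Distribution function of Nakagami fading power with shape `m`. -/
def cdfH (m : ℕ) (h : ℝ) : ℝ :=
  (∫ x in (0 : ℝ)..(m * h), x ^ (m - 1) * Real.exp (-x)) / Real.Gamma m

/-- The number `A^{i+1}_{k+1} = (k+1)! / (k-i)!`, for `i ≤ k`. -/
def arr (k i : ℕ) : ℂ := (Nat.factorial (k + 1) : ℂ) / (Nat.factorial (k - i) : ℂ)

/-- Antiderivative in `h` defining `Ξ₁(-jx)`; `m` is the shape, `w` the mean serving power. -/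
def xi1Anti (m : ℕ) (w gam x h : ℝ) : ℂ :=
  let c : ℂ := (Complex.I * x * w + m * gam) / gam;
  -(Complex.exp (-c * h)) * ∑ k ∈ Finset.range m, ((m : ℂ) * h) ^ k / (Nat.factorial k : ℂ) *
    (1 - Complex.I * x * w / (gam * ((k : ℂ) + 1)) *
      ∑ i ∈ Finset.range (k + 1), ((h : ℂ) ^ i)⁻¹ / c ^ (i + 1) * arr k i)

/-- Antiderivative in `h` defining `Ξ₂(jx)`. -/
def xi2Anti (m : ℕ) (w x h : ℝ) : ℂ :=
  let c : ℂ := m - Complex.I * x * w;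
  -(Complex.exp (-c * h)) * ∑ k ∈ Finset.range m, ((m : ℂ) * h) ^ k / (Nat.factorial k : ℂ) *
    (1 + Complex.I * x * w / ((k : ℂ) + 1) *
      ∑ i ∈ Finset.range (k + 1), ((h : ℂ) ^ i)⁻¹ / c ^ (i + 1) * arr k i)

/-- The power level `P₁` separating the two regimes. -/
def P1 (gam om : ℝ) : ℝ := gam * (p.area * om + p.noise) / (1 + gam)

/-- `Ξ₁(-jx)`. -/
def xi1 (m : ℕ) (w gam om x : ℝ) : ℂ :=
  xi1Anti m w gam x (p.P1 gam om / w) - xi1Anti m w gam x (p.noise * gam / w)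

/-- `Ξ₂(jx)`. -/
def xi2 (m : ℕ) (w gam om x : ℝ) : ℂ :=
  xi2Anti m w x (p.area * om / w) - xi2Anti m w x (p.P1 gam om / w)

/-- Integrand of the Gil-Pelaez integral. -/
def gpIntegrand (m : ℕ) (w t gam om x : ℝ) : ℝ :=
  1 / (Real.pi * x) *
    ((p.xi1 m w gam om x * Complex.exp (Complex.I * x * p.noise) +
        p.xi2 m w gam om x * Complex.exp (-(Complex.I * x * p.area * om))) *
      p.laplaceI t (-(Complex.I * x))).im

open Classical in
/-- The indicator `U`. -/
def U (gam om : ℝ) : ℝ := if 0 ≤ p.area * om - p.noise * gam then 1 else 0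

/-- Conditional joint probability, as a function of the shape `m` and the mean power `w` of the
serving link and of the BS-user distance `t`. -/
def jointOf (m : ℕ) (w t gam om : ℝ) : ℝ :=
  p.U gam om *
    (1 / 2 * (cdfH m (p.area * om / w) - cdfH m (p.noise * gam / w)) -
      ∫ x in Ioi (0 : ℝ), p.gpIntegrand m w t gam om x)

/-- Conditional joint probability for link type `q`, given the distances. -/
def jointCond (gam om : ℝ) (q : Serving) (t s z : ℝ) : ℝ :=
  p.jointOf (p.servingShape q) (p.pow q t s z) t gam om

/-- Conditional joint probability on a direct link in state `v`. -/
def jointDirect (gam om : ℝ) (v : LinkState) (t : ℝ) : ℝ :=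
  p.jointOf (p.shape v) (p.powDirect v t) t gam om

/-- Conditional joint probability on a cascaded link. -/
def jointCasc (gam om t s th : ℝ) : ℝ :=
  p.jointOf p.mL (p.powCasc s (distBR t s th)) t gam om

/-- Integrand of the average over the RIS-user distance and the angle. -/
def cascIntegrand (gam om t s th : ℝ) : ℝ :=
  p.assoc .CL t * p.jointCasc gam om t s th * (1 / (2 * Real.pi) * p.pdfRU t s)

/-- Integrand of the average over the BS-user distance. -/
def avgIntegrand (gam om t : ℝ) : ℝ :=
  (p.assoc .DL t * p.jointDirect gam om .L t +
      (∫ s in Ioi (0 : ℝ), ∫ th in (-Real.pi)..Real.pi, p.cascIntegrand gam om t s th) +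
      p.assoc .DN t * p.jointDirect gam om .N t) * p.pdfBU t

end Params

/-! # The random network -/

/-- The plane; the typical user is at its origin. -/
abbrev Plane : Type := EuclideanSpace ℝ (Fin 2)

/-- `X` enumerates a Poisson point process with intensity measure `Λ`: the numbers of points in
disjoint sets of finite intensity are independent Poisson variables. -/
def IsPoissonProcess {Ω E ι : Type*} [MeasurableSpace Ω] [MeasurableSpace E] (P : Measure Ω)
    (X : ι → Ω → E) (Λ : Measure E) : Prop :=
  (∀ i, Measurable (X i)) ∧
    ∀ (n : ℕ) (B : Fin n → Set E), (∀ k, MeasurableSet (B k)) →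
      (∀ k l, k ≠ l → Disjoint (B k) (B l)) → (∀ k, Λ (B k) ≠ ⊤) → ∀ c : Fin n → ℕ,
        P {ω | ∀ k, {i | X i ω ∈ B k}.encard = (c k : ℕ∞)} =
          ∏ k, poissonMeasure (Λ (B k)).toNNReal {c k}

/-- The elementary real random variables attached to BSs (`ιb`), to RISs (`ιr`) and to the
serving link. -/
inductive Mark (ιb ιr : Type*)
  /-- uniform variable deciding whether the BS-user link is LoS -/
  | losB (i : ιb)
  /-- physical angle of departure of a BS towards the user -/
  | aod (i : ιb)
  /-- physical angle of departure of the beam of a BS -/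
  | beam (i : ιb)
  /-- fading of the interfering link of a BS, if in state `v` -/
  | fade (v : LinkState) (i : ιb)
  /-- uniform variable deciding whether the RIS-user link is LoS -/
  | losR (j : ιr)
  /-- direction of the front normal of a RIS -/
  | orient (j : ιr)
  /-- fading of the serving link of type `q` -/
  | serve (q : Serving)
  /-- angle from the user-BS link to the user-RIS link -/
  | angle

/-- Laws of the elementary variables (`volume[|s]` is the uniform law on `s`; the fading powers
are Gamma variables with mean one). -/
def markLaw {ιb ιr : Type*} (p : Params) : Mark ιb ιr → Measure ℝ
  | .losB _ => cond volume (Icc 0 1)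
  | .aod _ => cond volume (Icc 0 (2 * Real.pi))
  | .beam _ => cond volume (Icc 0 (2 * Real.pi))
  | .fade v _ => gammaMeasure (p.shape v) (p.shape v)
  | .losR _ => cond volume (Icc 0 1)
  | .orient _ => cond volume (Icc 0 (2 * Real.pi))
  | .serve q => gammaMeasure (p.servingShape q) (p.servingShape q)
  | .angle => cond volume (Ioo (-Real.pi) Real.pi)

/-- The random elements of the network: two independent homogeneous Poisson point processes (BSs
and RISs) and independent marks. -/
structure Network {Ω : Type*} [MeasurableSpace Ω] (P : Measure Ω) (p : Params)
    (ιb ιr : Type*) where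
  /-- positions of the BSs -/
  b : ιb → Ω → Plane
  /-- positions of the RISs -/
  r : ιr → Ω → Plane
  /-- marks -/
  X : Mark ιb ιr → Ω → ℝ
  b_poisson : IsPoissonProcess P b (ENNReal.ofReal p.lamB • volume)
  r_poisson : IsPoissonProcess P r (ENNReal.ofReal p.lamR • volume)
  X_measurable : ∀ k, Measurable (X k)
  X_law : ∀ k, P.map (X k) = markLaw p k
  X_indep : iIndepFun X P
  b_indep_r : IndepFun (fun ω i => b i ω) (fun ω j => r j ω) P
  pos_indep_X : IndepFun (fun ω => ((fun i => b i ω), (fun j => r j ω))) (fun ω k => X k ω) P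

namespace Network

variable {Ω : Type*} [MeasurableSpace Ω] {P : Measure Ω} {p : Params} {ιb ιr : Type*}
variable (M : Network P p ιb ιr)

/-- BS `i` is the tagged one, i.e. the nearest to the user. -/
def IsTagged (i : ιb) (ω : Ω) : Prop := ∀ k, k ≠ i → ‖M.b i ω‖ < ‖M.b k ω‖

open Classical in
/-- Position of the tagged BS (it exists almost surely). -/
def b0 (ω : Ω) : Plane := if h : ∃ i, M.IsTagged i ω then M.b h.choose ω else 0

/-- BS-user distance. -/
def tBU (ω : Ω) : ℝ := ‖M.b0 ω‖

/-- State of the link between BS `i` and the user. -/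
def InState : LinkState → ιb → Ω → Prop
  | .L, i, ω => M.X (.losB i) ω ≤ p.probState .L ‖M.b i ω‖
  | .N, i, ω => ¬ M.X (.losB i) ω ≤ p.probState .L ‖M.b i ω‖

/-- The point `y` is strictly in front of RIS `j`. -/
def InFront (j : ιr) (ω : Ω) (y : Plane) : Prop :=
  0 < inner ℝ (!₂[Real.cos (M.X (.orient j) ω), Real.sin (M.X (.orient j) ω)] : Plane)
    (y - M.r j ω)

/-- RIS `j` offers a cascaded LoS link: its link to the user is LoS (the link to the BS is always
taken to be), and user and tagged BS are both on its front side. -/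
def Offers (j : ιr) (ω : Ω) : Prop :=
  M.X (.losR j) ω ≤ p.probState .L ‖M.r j ω‖ ∧ M.InFront j ω 0 ∧ M.InFront j ω (M.b0 ω)

/-- RIS `j` is the nearest one among those that offer a cascaded LoS link. -/
def IsServingRIS (j : ιr) (ω : Ω) : Prop :=
  M.Offers j ω ∧ ∀ k, k ≠ j → M.Offers k ω → ‖M.r j ω‖ < ‖M.r k ω‖

open Classical in
/-- RIS-user distance of the serving RIS (zero if there is none). -/
def tRU (ω : Ω) : ℝ := if h : ∃ j, M.IsServingRIS j ω then ‖M.r h.choose ω‖ else 0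

/-- BS-RIS distance: law of cosines, with a uniform angle. -/
def tBR (ω : Ω) : ℝ := Params.distBR (M.tBU ω) (M.tRU ω) (M.X .angle ω)

open Classical in
/-- Type of the serving link. -/
def link (ω : Ω) : Serving :=
  if ∃ i, M.IsTagged i ω ∧ M.InState .L i ω then .DL
  else if ∃ j, M.Offers j ω then .CL
  else .DN

/-- The set of serving distances relevant to link type `q`, as the sigma-algebra they generate. -/
@[reducible] def distSigma : Serving → MeasurableSpace Ω
  | .DL => MeasurableSpace.comap M.tBU inferInstance
  | .CL => MeasurableSpace.comap (fun ω => (M.tBU ω, M.tRU ω, M.tBR ω)) inferInstance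
  | .DN => MeasurableSpace.comap M.tBU inferInstance

/-- Received serving power for link type `q`. -/
def servingPower (q : Serving) (ω : Ω) : ℝ :=
  p.pow q (M.tBU ω) (M.tRU ω) (M.tBR ω) * M.X (.serve q) ω

/-- Deviation of the spatial angle of departure of BS `i`. -/
def dev (i : ιb) (ω : Ω) : ℝ :=
  1 / 2 * Real.cos (M.X (.aod i) ω) - 1 / 2 * Real.cos (M.X (.beam i) ω)

open Classical in
/-- Contribution of BS `i` to the interference from links in state `v`. -/
def interfTerm (v : LinkState) (ω : Ω) (i : ιb) : ℝ :=
  if ¬ M.IsTagged i ω ∧ M.InState v i ω then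
    p.pb * p.gB (M.dev i ω) * p.zeta * ‖M.b i ω‖ ^ (-p.alpha v) * M.X (.fade v i) ω
  else 0

/-- Aggregate interference. -/
def interference (ω : Ω) : ℝ := (∑' i, M.interfTerm .L ω i) + ∑' i, M.interfTerm .N ω i

/-- SINR on a serving link of type `q`. -/
def sinrOf (q : Serving) (ω : Ω) : ℝ := M.servingPower q ω / (p.noise + M.interference ω)

/-- Electromagnetic field exposure with a serving link of type `q`. -/
def emfeOf (q : Serving) (ω : Ω) : ℝ := (M.servingPower q ω + M.interference ω) / p.area

/-- SINR of the typical user. -/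
def sinr (ω : Ω) : ℝ := M.sinrOf (M.link ω) ω

/-- Exposure of the typical user. -/
def emfe (ω : Ω) : ℝ := M.emfeOf (M.link ω) ω

end Network

end

end RisNet

/-! Everything is conditioned on the distance t of the nearest BS. Given t, the following are
independent: the state of the tagged link, the RIS side (distance of the nearest offering RIS, and
the angle), the serving fading, and the interference, which is a sum of independently marked
contributions over a Poisson process outside the disc of radius t. The link type is determined by
the first two, so knowing it biases neither the fading nor the interference. For mean serving power
w, the conditional probability is therefore an average over one Gamma variable h and over the law of
the interference u given t.

Gil-Pelaez inversion. The two constraints read γ(σ²+u) < wh ≤ 𝓔ω − u. Up to a single value of h this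
is u < y(h), with y(h) = min(wh/γ − σ², 𝓔ω − wh), the function `slack`. Since the Dirichlet integral
of sin(ax)/x is (π/2)·sign a, the indicator of u < y equals 1/2 − (1/π)∫ sin((u−y)x)/x dx when u ≠
y. Averaging over u produces the characteristic function of the interference. Averaging over h
produces integrals of exponentials against the Erlang density; the minimum changes branch at wh =
P₁, and the two sides give Ξ₁ and Ξ₂ (`gpPhase_eq_integral`). The integrals are exchanged on
truncated x-ranges, where Fubini applies, and the truncation is removed by the uniform bound
`abs_dirichletInt_le`. Atoms of the interference do no harm because the level sets of y are Lebesgue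
null. The x-integral converges absolutely: the phase average is O(1/x) at infinity by one
integration by parts, and its product with the characteristic function is real at 0 up to O(x)
(`integrableOn_gp`, `half_sub_gp_eq`, `jointOf_eq_integral`).

Interference. The definition of the Poisson process by counts gives the Laplace functional, first
for simple functions and then by approximation; marks are averaged first, with the positions frozen
(`integral_finprod`, `integral_marks_of_tendsto`). The conditional law given the nearest distance T
comes from the fact that {T > a} is a void event, hence itself a product over the points: such
events factor from the process farther out (`integral_indicator_annProd`), and rounding T up to a
grid and refining the grid reaches T itself (`integral_Iio_annProd`). With the state of the tagged
link included this becomes `integral_tagState_exp`. Campbell's formula makes the series summable: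
LoS contributions decay exponentially through blockage, NLoS ones through α_N > 2. The weights p_n
are the law of the antenna gain at a difference of two arcsine variables, folded to the distance
from the nearest integer (`integral_comp_gB`).

RIS side. Offering RISs are an independent thinning, so the probability of having none within
distance s is exp(−λ_r∫₀ˢ ā(t,u)u du) (`measureReal_le_offerDist`). The arccosine is the overlap of
two half-circles of orientations, and rotation invariance leaves only the norm of the BS position.
Differentiating in s gives the defective density 𝒫_CL·f_ru.

These parts meet in `map_geom_interference`: on each state of the tagged link, the distances and
angle together with the interference have the law of a composition with the kernel t ↦ law of the
interference given t. Integrating the fading and then the interference gives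
`measureReal_link_inter`, from which both the conditional expectation and the averaged formula
follow. -/

namespace RisNet
noncomputable section

/-! ### The sine integral and truncated Dirichlet integrals -/

section SineIntegral

open Filter Topology

/-- The sine integral. -/
def sineIntegral (y : ℝ) : ℝ := ∫ x in (0 : ℝ)..y, Real.sinc x

/-- The auxiliary function of the sine integral. -/
def sineAux (y : ℝ) : ℝ :=
  ∫ s in Ioi (0 : ℝ), Real.exp (-s * y) * (Real.cos y + s * Real.sin y) * (1 + s ^ 2)⁻¹

lemma hasDerivAt_sineIntegral (y : ℝ) : HasDerivAt sineIntegral (Real.sinc y) y :=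
  intervalIntegral.integral_hasDerivAt_right (Real.continuous_sinc.intervalIntegrable _ _)
    Real.continuous_sinc.stronglyMeasurable.stronglyMeasurableAtFilter Real.continuous_sinc.continuousAt

lemma continuous_sineIntegral : Continuous sineIntegral :=
  continuous_iff_continuousAt.2 fun y => (hasDerivAt_sineIntegral y).continuousAt

lemma sineIntegral_neg (y : ℝ) : sineIntegral (-y) = -sineIntegral y := by
  have h := intervalIntegral.integral_comp_neg (a := 0) (b := y) (f := Real.sinc)
  simp only [Real.sinc_neg, neg_zero] at h
  rw [sineIntegral, sineIntegral, h, intervalIntegral.integral_symm]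

/-- The elementary bound 1 + sy ≤ e^{sy} absorbs the exponential factor. The majorant does not
depend on y, which is what the limit y → 0 needs, where the exponential decay is lost. -/
lemma sineAux_integrand_abs_le {y s : ℝ} (hy : 0 ≤ y) (hs : 0 ≤ s) :
    ‖Real.exp (-s * y) * (Real.cos y + s * Real.sin y) * (1 + s ^ 2)⁻¹‖ ≤ 2 * (1 + s ^ 2)⁻¹ := by
  rw [norm_mul, norm_mul, Real.norm_eq_abs, Real.norm_eq_abs, Real.norm_eq_abs,
    abs_of_nonneg (Real.exp_pos _).le, abs_of_nonneg (by positivity : (0:ℝ) ≤ (1 + s ^ 2)⁻¹)]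
  gcongr
  have h1 : |Real.cos y + s * Real.sin y| ≤ 1 + s * y := by
    refine (abs_add_le _ _).trans ?_
    rw [abs_mul, abs_of_nonneg hs]
    have : |Real.sin y| ≤ y := (Real.abs_sin_le_abs).trans (abs_of_nonneg hy).le
    have := Real.abs_cos_le_one y
    gcongr
  have h2 : 1 + s * y ≤ Real.exp (s * y) := by linarith [Real.add_one_le_exp (s * y)]
  have h3 : Real.exp (-s * y) * Real.exp (s * y) = 1 := by rw [← Real.exp_add]; simp
  nlinarith [Real.exp_pos (-s * y), Real.exp_pos (s * y)]

lemma integrableOn_inv_one_add_sq : IntegrableOn (fun s : ℝ => 2 * (1 + s ^ 2)⁻¹) (Ioi 0) :=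
  (integrable_inv_one_add_sq.const_mul 2).integrableOn

lemma tendsto_sineAux_zero : Tendsto sineAux (𝓝[>] 0) (𝓝 (Real.pi / 2)) := by
  have h0 : ∫ s in Ioi (0 : ℝ), (1 + s ^ 2)⁻¹ = Real.pi / 2 := by
    rw [integral_Ioi_inv_one_add_sq]; simp
  rw [← h0]
  refine tendsto_integral_filter_of_dominated_convergence (fun s => 2 * (1 + s ^ 2)⁻¹) ?_ ?_
    integrableOn_inv_one_add_sq ?_
  · exact Eventually.of_forall fun y => (by fun_prop : Measurable _).aestronglyMeasurable
  · filter_upwards [self_mem_nhdsWithin] with y hy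
    filter_upwards [ae_restrict_mem measurableSet_Ioi] with s hs
    exact sineAux_integrand_abs_le (le_of_lt hy) (le_of_lt hs)
  · refine Eventually.of_forall fun s => ?_
    have : Continuous fun y : ℝ =>
        Real.exp (-s * y) * (Real.cos y + s * Real.sin y) * (1 + s ^ 2)⁻¹ := by fun_prop
    have := (this.tendsto 0).mono_left (nhdsWithin_le_nhds (s := Ioi 0))
    simpa using this

/-- Here the exponential is kept and the weight is spent instead: 1 + s ≤ 2(1 + s²), and ∫ 2e^{−ys}
ds = 2/y. -/
lemma abs_sineAux_le {y : ℝ} (hy : 0 < y) : |sineAux y| ≤ 2 / y := by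
  have hi : IntegrableOn (fun s : ℝ => 2 * Real.exp (-y * s)) (Ioi 0) :=
    (integrableOn_exp_mul_Ioi (by linarith : -y < 0) 0).const_mul 2
  have : ‖sineAux y‖ ≤ ∫ s in Ioi (0 : ℝ), 2 * Real.exp (-y * s) := by
    refine norm_integral_le_of_norm_le hi ?_
    filter_upwards [ae_restrict_mem measurableSet_Ioi] with s hs
    have hs : 0 < s := hs
    rw [norm_mul, norm_mul, Real.norm_eq_abs, Real.norm_eq_abs, Real.norm_eq_abs,
      abs_of_nonneg (Real.exp_pos _).le, abs_of_nonneg (by positivity : (0:ℝ) ≤ (1 + s ^ 2)⁻¹),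
      mul_assoc, mul_comm (2 : ℝ)]
    have e : -s * y = -y * s := by ring
    rw [e]
    gcongr
    rw [← div_eq_mul_inv, div_le_iff₀ (by positivity)]
    refine (abs_add_le _ _).trans ?_
    rw [abs_mul, abs_of_pos hs]
    have h1 := Real.abs_cos_le_one y
    have h2 := Real.abs_sin_le_one y
    nlinarith [sq_nonneg (s - 1)]
  rw [integral_const_mul, integral_exp_mul_Ioi (by linarith)] at this
  simpa [div_eq_mul_inv] using this

/-- Differentiating e^{−sy}(cos y + s sin y) in y produces −(1+s²)e^{−sy} sin y, so the weight
cancels and sin y · ∫ e^{−sy} ds = sin y / y remains. Restricting to arguments above y/2 keeps a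
common exponential majorant. -/
lemma hasDerivAt_sineAux {y : ℝ} (hy : 0 < y) : HasDerivAt sineAux (-Real.sinc y) y := by
  have key := hasDerivAt_integral_of_dominated_loc_of_deriv_le (μ := volume.restrict (Ioi (0 : ℝ)))
    (F := fun y s => Real.exp (-s * y) * (Real.cos y + s * Real.sin y) * (1 + s ^ 2)⁻¹)
    (F' := fun y s => -(Real.exp (-s * y) * Real.sin y)) (x₀ := y) (s := Ioi (y / 2))
    (bound := fun s => Real.exp (-(y / 2) * s)) (Ioi_mem_nhds (by linarith))
    (Eventually.of_forall fun y => (by fun_prop : Measurable _).aestronglyMeasurable)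
    ?_ (by fun_prop : Measurable _).aestronglyMeasurable ?_
    (integrableOn_exp_mul_Ioi (by linarith) 0) ?_
  · have e : ∫ s in Ioi (0 : ℝ), -(Real.exp (-s * y) * Real.sin y) = -Real.sinc y := by
      have : ∀ s : ℝ, -(Real.exp (-s * y) * Real.sin y) = -Real.sin y * Real.exp (-y * s) := by
        intro s; rw [show -s * y = -y * s by ring]; ring
      simp only [this]
      rw [integral_const_mul, integral_exp_mul_Ioi (by linarith), Real.sinc_of_ne_zero hy.ne']
      simp; field_simp
    rw [← e]
    exact key.2
  · refine integrableOn_inv_one_add_sq.mono' (by fun_prop : Measurable _).aestronglyMeasurable ?_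
    filter_upwards [ae_restrict_mem measurableSet_Ioi] with s hs
    exact sineAux_integrand_abs_le hy.le (le_of_lt hs)
  · filter_upwards [ae_restrict_mem measurableSet_Ioi] with s hs z hz
    have hz : y / 2 < z := hz
    have hs : 0 < s := hs
    rw [norm_neg, norm_mul, Real.norm_eq_abs, Real.norm_eq_abs, abs_of_pos (Real.exp_pos _)]
    calc Real.exp (-s * z) * |Real.sin z| ≤ Real.exp (-s * z) * 1 := by
          gcongr; exact Real.abs_sin_le_one z
      _ ≤ Real.exp (-(y / 2) * s) := by
          rw [mul_one]; apply Real.exp_le_exp.2; nlinarith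
  · filter_upwards [ae_restrict_mem measurableSet_Ioi] with s hs z hz
    have h1 : HasDerivAt (fun y : ℝ => Real.exp (-s * y)) (Real.exp (-s * z) * (-s)) z := by
      have := ((hasDerivAt_id z).const_mul (-s)).exp
      simpa using this
    have h2 : HasDerivAt (fun y : ℝ => Real.cos y + s * Real.sin y)
        (-Real.sin z + s * Real.cos z) z :=
      (Real.hasDerivAt_cos z).add ((Real.hasDerivAt_sin z).const_mul s)
    refine ((h1.mul h2).mul_const ((1 + s ^ 2)⁻¹)).congr_deriv ?_
    have : (1 + s ^ 2) ≠ 0 := by positivity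
    field_simp
    ring

/-- The sum of the two functions has derivative zero on the half-line and tends to π/2 at 0, hence
is that constant. This yields the Dirichlet integral, with a rate at infinity. -/
lemma sineIntegral_eq {y : ℝ} (hy : 0 < y) : sineIntegral y = Real.pi / 2 - sineAux y := by
  have hd : ∀ z ∈ Ioi (0 : ℝ), HasDerivAt (fun z => sineIntegral z + sineAux z) 0 z := by
    intro z hz
    exact ((hasDerivAt_sineIntegral z).add (hasDerivAt_sineAux hz)).congr_deriv (by simp)
  have hc : ∀ z ∈ Ioi (0 : ℝ), sineIntegral z + sineAux z = sineIntegral y + sineAux y := by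
    intro z hz
    exact (convex_Ioi (0 : ℝ)).is_const_of_fderivWithin_eq_zero (𝕜 := ℝ)
      (fun w hw => (hd w hw).differentiableAt.differentiableWithinAt)
      (fun w hw => by
        rw [fderivWithin_of_isOpen isOpen_Ioi hw]
        have := (hd w hw).hasFDerivAt.fderiv
        rw [this]; ext; simp) hz hy
  have hl : Tendsto (fun z => sineIntegral z + sineAux z) (𝓝[>] 0) (𝓝 (0 + Real.pi / 2)) := by
    refine Tendsto.add ?_ tendsto_sineAux_zero
    have := (continuous_sineIntegral.tendsto 0).mono_left (nhdsWithin_le_nhds (s := Ioi 0))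
    simpa [sineIntegral] using this
  have hl' : Tendsto (fun z => sineIntegral z + sineAux z) (𝓝[>] 0)
      (𝓝 (sineIntegral y + sineAux y)) :=
    tendsto_const_nhds.congr' (by
      filter_upwards [self_mem_nhdsWithin] with z hz using (hc z hz).symm)
  have := tendsto_nhds_unique hl hl'
  linarith

/-- The constant is generous: the modulus is at most 1 on [0,1], at most π/2 + 2 beyond, and the
function is odd. -/
lemma abs_sineIntegral_le (y : ℝ) : |sineIntegral y| ≤ 4 := by
  have pos : ∀ y : ℝ, 0 ≤ y → |sineIntegral y| ≤ 4 := by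
    intro y hy
    rcases le_or_gt y 1 with h | h
    · have := intervalIntegral.norm_integral_le_of_norm_le_const (a := 0) (b := y) (C := 1)
        (f := Real.sinc) (fun x _ => Real.abs_sinc_le_one x)
      simp only [sub_zero, one_mul, abs_of_nonneg hy, Real.norm_eq_abs] at this
      exact this.trans (by linarith)
    · rw [sineIntegral_eq (by linarith)]
      have h1 := abs_sineAux_le (by linarith : 0 < y)
      have h2 : 2 / y ≤ 2 := by rw [div_le_iff₀ (by linarith)]; linarith
      have := Real.pi_le_four
      have := Real.pi_pos
      rw [abs_le] at h1 ⊢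
      constructor <;> linarith
  rcases le_total 0 y with h | h
  · exact pos y h
  · have := pos (-y) (by linarith)
    rwa [sineIntegral_neg, abs_neg] at this

lemma tendsto_sineIntegral_atTop : Tendsto sineIntegral atTop (𝓝 (Real.pi / 2)) := by
  have h : Tendsto sineAux atTop (𝓝 0) := by
    refine squeeze_zero_norm' (a := fun y => 2 / y) ?_ (tendsto_const_nhds.div_atTop tendsto_id)
    filter_upwards [eventually_gt_atTop 0] with y hy using abs_sineAux_le hy
  have := (tendsto_const_nhds (x := Real.pi / 2)).sub h
  rw [sub_zero] at this
  refine this.congr' ?_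
  filter_upwards [eventually_gt_atTop 0] with y hy using (sineIntegral_eq hy).symm

/-- The truncated Dirichlet integral. -/
def dirichletInt (n : ℕ) (a : ℝ) : ℝ :=
  sineIntegral (a * (n + 1)) - sineIntegral (a * (n + 1 : ℝ)⁻¹)

lemma dirichletInt_eq (n : ℕ) (a : ℝ) :
    dirichletInt n a = ∫ x in ((n : ℝ) + 1)⁻¹..((n : ℝ) + 1), Real.sin (a * x) / x := by
  have h1 : ∀ x ∈ uIcc ((n : ℝ) + 1)⁻¹ ((n : ℝ) + 1), HasDerivAt (fun x => sineIntegral (a * x))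
      (Real.sin (a * x) / x) x := by
    intro x hx
    have hx0 : 0 < x := by
      refine lt_of_lt_of_le ?_ (Set.mem_uIcc.1 hx |>.elim (fun h => h.1) (fun h => ?_))
      · positivity
      · refine le_trans ?_ h.1
        have : (1 : ℝ) ≤ n + 1 := by linarith [(Nat.cast_nonneg n : (0 : ℝ) ≤ n)]
        exact (inv_le_one_of_one_le₀ this).trans this
    have := (hasDerivAt_sineIntegral (a * x)).comp x ((hasDerivAt_id x).const_mul a)
    refine this.congr_deriv ?_
    by_cases ha : a = 0
    · simp [ha]
    · rw [Real.sinc_of_ne_zero (mul_ne_zero ha hx0.ne')]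
      field_simp
  rw [intervalIntegral.integral_eq_sub_of_hasDerivAt h1]
  · rfl
  · apply ContinuousOn.intervalIntegrable
    apply ContinuousOn.div (by fun_prop) continuousOn_id
    intro x hx h0
    simp only [id] at h0
    rw [h0, mem_uIcc] at hx
    have : 0 < ((n : ℝ) + 1)⁻¹ := by positivity
    have : 0 < ((n : ℝ) + 1) := by positivity
    rcases hx with hx | hx <;> linarith [hx.1]

/-- Uniformity in both the truncation and the frequency is the point: it dominates the passage to
the limit under the average over interference and fading. -/
lemma abs_dirichletInt_le (n : ℕ) (a : ℝ) : |dirichletInt n a| ≤ 8 := by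
  have h1 := abs_sineIntegral_le (a * (n + 1))
  have h2 := abs_sineIntegral_le (a * (n + 1 : ℝ)⁻¹)
  rw [dirichletInt]
  rw [abs_le] at *
  constructor <;> linarith

lemma continuous_dirichletInt (n : ℕ) : Continuous (dirichletInt n) :=
  (continuous_sineIntegral.comp (by fun_prop)).sub (continuous_sineIntegral.comp (by fun_prop))

lemma dirichletInt_neg (n : ℕ) (a : ℝ) : dirichletInt n (-a) = -dirichletInt n a := by
  simp only [dirichletInt, neg_mul, sineIntegral_neg]; ring

lemma tendsto_dirichletInt_of_pos {a : ℝ} (ha : 0 < a) :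
    Tendsto (fun n => dirichletInt n a) atTop (𝓝 (Real.pi / 2)) := by
  have hn : Tendsto (fun n : ℕ => (n : ℝ) + 1) atTop atTop :=
    tendsto_atTop_add_const_right _ _ tendsto_natCast_atTop_atTop
  have h1 := tendsto_sineIntegral_atTop.comp (hn.const_mul_atTop ha)
  have h2 : Tendsto (fun n : ℕ => sineIntegral (a * ((n : ℝ) + 1)⁻¹)) atTop (𝓝 0) := by
    have := (continuous_sineIntegral.tendsto (a * 0)).comp
      ((tendsto_inv_atTop_zero.comp hn).const_mul a)
    rw [mul_zero, show sineIntegral 0 = 0 by simp [sineIntegral]] at this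
    exact this
  simpa [dirichletInt] using h1.sub h2

lemma tendsto_dirichletInt_of_neg {a : ℝ} (ha : a < 0) :
    Tendsto (fun n => dirichletInt n a) atTop (𝓝 (-(Real.pi / 2))) := by
  have := (tendsto_dirichletInt_of_pos (neg_pos.2 ha)).neg
  simpa [dirichletInt_neg] using this

end SineIntegral
end
end RisNet

namespace RisNet
noncomputable section

/-! ### Closed antiderivatives of the Erlang density times an exponential -/

section ErlangAntiderivative

open Params

/-- Density of the Erlang distribution with shape and rate `m`. -/
def erlang (m : ℕ) (h : ℝ) : ℝ :=
  m * (m * h) ^ (m - 1) / (m - 1).factorial * Real.exp (-(m * h))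

/-- The sums occurring in the antiderivatives of `h ^ k * exp (-c * h)`. -/
def expPolySum (c : ℂ) (k : ℕ) (h : ℂ) : ℂ :=
  ∑ i ∈ Finset.range (k + 1), h ^ (k - i) / ((k - i).factorial : ℂ) / c ^ (i + 1)

lemma expPolySum_zero (c h : ℂ) : expPolySum c 0 h = 1 / c := by simp [expPolySum]

lemma expPolySum_succ (c : ℂ) (k : ℕ) (h : ℂ) :
    expPolySum c (k + 1) h = (h ^ (k + 1) / ((k + 1).factorial : ℂ) + expPolySum c k h) / c := by
  rw [expPolySum, Finset.sum_range_succ', expPolySum, add_div, Finset.sum_div, add_comm]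
  congr 1
  · simp
  · refine Finset.sum_congr rfl fun i _ => ?_
    rw [Nat.add_sub_add_right, pow_succ c (i + 1), ← div_div]

lemma hasDerivAt_pow_div_factorial (k : ℕ) (h : ℂ) :
    HasDerivAt (fun h : ℂ => h ^ (k + 1) / ((k + 1).factorial : ℂ)) (h ^ k / (k.factorial : ℂ)) h := by
  refine ((hasDerivAt_pow (k + 1) h).div_const _).congr_deriv ?_
  have h1 : (k.factorial : ℂ) ≠ 0 := by exact_mod_cast k.factorial_ne_zero
  have h2 : ((k : ℂ) + 1) ≠ 0 := by exact_mod_cast k.succ_ne_zero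
  rw [Nat.factorial_succ]
  push_cast
  field_simp

/-- By induction on the recursion E_{k+1} = (h^{k+1}/(k+1)! + E_k)/c: differentiating the right side
reproduces the same recursion one step lower. -/
lemma hasDerivAt_expPolySum_succ (c : ℂ) (k : ℕ) (h : ℂ) :
    HasDerivAt (expPolySum c (k + 1)) (expPolySum c k h) h := by
  have e : expPolySum c (k + 1) =
      fun h => (h ^ (k + 1) / ((k + 1).factorial : ℂ) + expPolySum c k h) / c :=
    funext (expPolySum_succ c k)
  rw [e]
  induction k with
  | zero =>
    have h0 : expPolySum c 0 = fun _ => 1 / c := funext (expPolySum_zero c)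
    refine (((hasDerivAt_pow_div_factorial 0 h).add
      (h0 ▸ hasDerivAt_const h (1 / c))).div_const c).congr_deriv ?_
    simp [expPolySum_zero]
  | succ k ih =>
    have e' : expPolySum c (k + 1) =
        fun h => (h ^ (k + 1) / ((k + 1).factorial : ℂ) + expPolySum c k h) / c :=
      funext (expPolySum_succ c k)
    refine (((hasDerivAt_pow_div_factorial (k + 1) h).add (e' ▸ ih e')).div_const c).congr_deriv ?_
    rw [expPolySum_succ]

/-- The product rule gives e^{−ch}(E_{k−1} − cE_k), and the recursion says exactly that the bracket
is −h^k/k!. -/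
lemma mul_expPolySum {c : ℂ} (hc : c ≠ 0) (k : ℕ) (h : ℂ) :
    HasDerivAt (fun h => Complex.exp (-c * h) * expPolySum c k h)
      (-(Complex.exp (-c * h) * (h ^ k / (k.factorial : ℂ)))) h := by
  have he : HasDerivAt (fun h : ℂ => Complex.exp (-c * h)) (Complex.exp (-c * h) * -c) h := by
    simpa using ((hasDerivAt_id h).const_mul (-c)).cexp
  cases k with
  | zero =>
    have h0 : expPolySum c 0 = fun _ => 1 / c := funext (expPolySum_zero c)
    refine (he.mul (h0 ▸ hasDerivAt_const h (1 / c))).congr_deriv ?_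
    rw [expPolySum_zero]; field_simp; simp
  | succ k =>
    refine (he.mul (hasDerivAt_expPolySum_succ c k h)).congr_deriv ?_
    rw [expPolySum_succ]; field_simp; ring

/-- Truncated exponential sum. -/
def expSum (m : ℕ) (a h : ℂ) : ℂ := ∑ k ∈ Finset.range m, (a * h) ^ k / (k.factorial : ℂ)

lemma hasDerivAt_expSum (m : ℕ) (a h : ℂ) :
    HasDerivAt (expSum (m + 1) a) (a * expSum m a h) h := by
  induction m with
  | zero =>
    have : expSum (0 + 1) a = fun _ => 1 := by ext h; simp [expSum]
    rw [this]
    simpa [expSum] using hasDerivAt_const h (1 : ℂ)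
  | succ m ih =>
    have e : expSum (m + 1 + 1) a = fun h => expSum (m + 1) a h +
        (a * h) ^ (m + 1) / ((m + 1).factorial : ℂ) := by
      ext h; simp only [expSum, Finset.sum_range_succ _ (m + 1)]
    rw [e]
    have h2 := (hasDerivAt_pow_div_factorial m (a * h)).comp h ((hasDerivAt_id h).const_mul a)
    refine (ih.add h2).congr_deriv ?_
    simp only [expSum, Finset.sum_range_succ _ m]
    ring

/-- Common form of `xi1Anti` and `xi2Anti`. -/
def erlangAnti (m : ℕ) (z h : ℂ) : ℂ :=
  -(Complex.exp (-(m + z) * h)) * ∑ k ∈ Finset.range m, ((m : ℂ) * h) ^ k / (k.factorial : ℂ) *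
    (1 - z / ((k : ℂ) + 1) * ∑ i ∈ Finset.range (k + 1), (h ^ i)⁻¹ / (m + z) ^ (i + 1) * arr k i)

/-- The factorial quotient A turns (mh)^k/k! · h^{−i}/(k+1) into m^k h^{k−i}/(k−i)!, which exposes
the sums whose derivatives are known. Nonvanishing h only serves to cancel the negative powers. -/
lemma erlangAnti_eq {m : ℕ} {z h : ℂ} (hh : h ≠ 0) :
    erlangAnti m z h = -(Complex.exp (-(m + z) * h) * expSum m m h) +
      z * ∑ k ∈ Finset.range m, (m : ℂ) ^ k * (Complex.exp (-(m + z) * h) *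
        expPolySum (m + z) k h) := by
  have key : ∀ k : ℕ, ((m : ℂ) * h) ^ k / (k.factorial : ℂ) *
      (1 - z / ((k : ℂ) + 1) * ∑ i ∈ Finset.range (k + 1),
        (h ^ i)⁻¹ / (m + z) ^ (i + 1) * arr k i) =
      ((m : ℂ) * h) ^ k / (k.factorial : ℂ) - z * ((m : ℂ) ^ k * expPolySum (m + z) k h) := by
    intro k
    have h1 : (k.factorial : ℂ) ≠ 0 := by exact_mod_cast k.factorial_ne_zero
    have h2 : ((k : ℂ) + 1) ≠ 0 := by exact_mod_cast k.succ_ne_zero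
    rw [mul_sub, mul_one]
    congr 1
    rw [expPolySum, Finset.mul_sum, Finset.mul_sum, Finset.mul_sum, Finset.mul_sum]
    refine Finset.sum_congr rfl fun i hi => ?_
    have hik : i ≤ k := Nat.lt_succ_iff.1 (Finset.mem_range.1 hi)
    have h3 : ((k - i).factorial : ℂ) ≠ 0 := by exact_mod_cast (k - i).factorial_ne_zero
    have h4 : h ^ k = h ^ (k - i) * h ^ i := by rw [← pow_add, Nat.sub_add_cancel hik]
    rw [arr, Nat.factorial_succ, mul_pow, h4]
    push_cast
    have h5 : h ^ i ≠ 0 := pow_ne_zero _ hh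
    -- When this power vanishes, both sides are zero by the convention for division by zero.
    by_cases hz : ((m : ℂ) + z) ^ (i + 1) = 0
    · rw [hz]; simp
    · field_simp
  rw [erlangAnti, Finset.sum_congr rfl fun k _ => key k, Finset.sum_sub_distrib, expSum,
    ← Finset.mul_sum]
  have : ∀ k : ℕ, (m : ℂ) ^ k * (Complex.exp (-(m + z) * h) * expPolySum (m + z) k h) =
    Complex.exp (-(m + z) * h) * ((m : ℂ) ^ k * expPolySum (m + z) k h) := fun k => by ring
  simp only [this, ← Finset.mul_sum]
  ring

/-- Write c = m + z and S_m for the exponential sum with m terms. The first summand contributes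
e^{−ch}(cS_m − mS_{m−1}), the second −z e^{−ch}S_m. The total is m e^{−ch}(S_m − S_{m−1}), a single
term: the Erlang density times e^{−zh}. -/
lemma hasDerivAt_erlangAnti_complex {m : ℕ} (hm : 1 ≤ m) {z h : ℂ} (hz : (m : ℂ) + z ≠ 0)
    (hh : h ≠ 0) :
    HasDerivAt (erlangAnti m z)
      (m * (m * h) ^ (m - 1) / ((m - 1).factorial : ℂ) * Complex.exp (-(m + z) * h)) h := by
  obtain ⟨n, rfl⟩ : ∃ n, m = n + 1 := ⟨m - 1, by omega⟩
  have he : HasDerivAt (fun h : ℂ => Complex.exp (-((n + 1 : ℕ) + z) * h))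
      (Complex.exp (-((n + 1 : ℕ) + z) * h) * -((n + 1 : ℕ) + z)) h := by
    simpa using ((hasDerivAt_id h).const_mul (-(((n + 1 : ℕ) : ℂ) + z))).cexp
  have h1 := (he.mul (hasDerivAt_expSum n ((n + 1 : ℕ) : ℂ) h)).neg
  have h2 := (HasDerivAt.fun_sum (u := Finset.range (n + 1)) fun k _ =>
    (mul_expPolySum hz k h).const_mul (((n + 1 : ℕ) : ℂ) ^ k)).const_mul z
  refine ((h1.add h2).congr_of_eventuallyEq ?_).congr_deriv ?_
  · filter_upwards [isOpen_ne.mem_nhds hh] with w hw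
    rw [erlangAnti_eq hw]; rfl
  · have e1 : expSum (n + 1) ((n + 1 : ℕ) : ℂ) h = expSum n ((n + 1 : ℕ) : ℂ) h +
        (((n + 1 : ℕ) : ℂ) * h) ^ n / (n.factorial : ℂ) := by
      simp only [expSum, Finset.sum_range_succ _ n]
    have e2 : ∑ k ∈ Finset.range (n + 1), ((n + 1 : ℕ) : ℂ) ^ k *
        -(Complex.exp (-((n + 1 : ℕ) + z) * h) * (h ^ k / (k.factorial : ℂ))) =
        -(Complex.exp (-((n + 1 : ℕ) + z) * h) * expSum (n + 1) ((n + 1 : ℕ) : ℂ) h) := by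
      rw [expSum, Finset.mul_sum, ← Finset.sum_neg_distrib]
      refine Finset.sum_congr rfl fun k _ => ?_
      rw [mul_pow]; ring
    rw [e2, e1, Nat.add_sub_cancel]
    ring

lemma ofReal_erlang (m : ℕ) (h : ℝ) : (erlang m h : ℂ) =
    m * (m * h) ^ (m - 1) / ((m - 1).factorial : ℂ) * Complex.exp (-(m * h)) := by
  simp [erlang]

lemma hasDerivAt_erlangAnti {m : ℕ} (hm : 1 ≤ m) (b : ℝ) {h : ℝ} (hh : 0 < h) :
    HasDerivAt (fun h : ℝ => erlangAnti m (Complex.I * b) h)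
      (erlang m h * Complex.exp (-(Complex.I * b * h))) h := by
  have hz : (m : ℂ) + Complex.I * b ≠ 0 := by
    intro h0
    have := congrArg Complex.re h0
    simp at this
    omega
  refine (hasDerivAt_erlangAnti_complex hm hz (h := (h : ℂ)) (by exact_mod_cast hh.ne')).comp_ofReal.congr_deriv ?_
  rw [ofReal_erlang, mul_assoc (_ / _), ← Complex.exp_add]
  congr 2; ring

/-- Both closed forms of the theorem are one and the same antiderivative: here at z = jxw/γ, and for
the second regime at z = −jxw. -/
lemma xi1Anti_eq (m : ℕ) (w x h : ℝ) {gam : ℝ} (hg : 0 < gam) :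
    xi1Anti m w gam x h = erlangAnti m (Complex.I * ((x * w / gam : ℝ) : ℂ)) h := by
  have hg' : (gam : ℂ) ≠ 0 := by exact_mod_cast hg.ne'
  have e : (Complex.I * x * w + m * gam) / gam = m + Complex.I * ((x * w / gam : ℝ) : ℂ) := by
    push_cast; field_simp; ring
  simp only [xi1Anti, erlangAnti, e]
  congr 1
  refine Finset.sum_congr rfl fun k _ => ?_
  congr 3
  push_cast
  rw [← div_div]
  congr 1
  field_simp

lemma xi2Anti_eq (m : ℕ) (w x h : ℝ) :
    xi2Anti m w x h = erlangAnti m (Complex.I * ((-(x * w) : ℝ) : ℂ)) h := by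
  have e : (m : ℂ) - Complex.I * x * w = m + Complex.I * ((-(x * w) : ℝ) : ℂ) := by
    push_cast; ring
  simp only [xi2Anti, erlangAnti, e]
  congr 1
  refine Finset.sum_congr rfl fun k _ => ?_
  have e' : Complex.I * ((-(x * w) : ℝ) : ℂ) / ((k : ℂ) + 1) =
      -(Complex.I * x * w / ((k : ℂ) + 1)) := by push_cast; ring
  rw [e', neg_mul, sub_neg_eq_add]

lemma continuous_erlang (m : ℕ) : Continuous (erlang m) := by
  unfold erlang; fun_prop

lemma erlang_nonneg (m : ℕ) {h : ℝ} (hh : 0 ≤ h) : 0 ≤ erlang m h := by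
  unfold erlang; positivity

lemma integral_erlang_mul_exp {m : ℕ} (hm : 1 ≤ m) (b : ℝ) {a c : ℝ} (ha : 0 < a) (hac : a ≤ c) :
    ∫ h in a..c, (erlang m h : ℂ) * Complex.exp (-(Complex.I * b * h)) =
      erlangAnti m (Complex.I * b) c - erlangAnti m (Complex.I * b) a := by
  refine intervalIntegral.integral_eq_sub_of_hasDerivAt (f := fun h : ℝ => erlangAnti m (Complex.I * b) h)
    (fun h hh => hasDerivAt_erlangAnti hm b ?_) ?_
  · rw [uIcc_of_le hac] at hh; exact ha.trans_le hh.1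
  · have := continuous_erlang m
    exact (by fun_prop : Continuous _).intervalIntegrable _ _

lemma gammaPDFReal_eq_erlang {m : ℕ} (hm : 1 ≤ m) {h : ℝ} (hh : 0 ≤ h) :
    gammaPDFReal m m h = erlang m h := by
  obtain ⟨n, rfl⟩ : ∃ n, m = n + 1 := ⟨m - 1, by omega⟩
  rw [gammaPDFReal, if_pos hh, erlang]
  push_cast
  rw [Real.Gamma_nat_eq_factorial, show (n : ℝ) + 1 - 1 = (n : ℕ) by ring, Real.rpow_natCast, show ((n : ℝ) + 1) ^ ((n : ℝ) + 1) = ((n : ℝ) + 1) ^ (n + 1) by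
      exact_mod_cast Real.rpow_natCast ((n : ℝ) + 1) (n + 1)]
  rw [mul_pow, pow_succ]
  ring

lemma cdfH_sub_cdfH {m : ℕ} (hm : 1 ≤ m) (a c : ℝ) :
    cdfH m c - cdfH m a = ∫ h in a..c, erlang m h := by
  obtain ⟨n, rfl⟩ : ∃ n, m = n + 1 := ⟨m - 1, by omega⟩
  have hc : Continuous fun x : ℝ => x ^ (n + 1 - 1) * Real.exp (-x) := by fun_prop
  rw [cdfH, cdfH, ← sub_div, intervalIntegral.integral_interval_sub_left
    (hc.intervalIntegrable _ _) (hc.intervalIntegrable _ _)]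
  have e : ∀ h, erlang (n + 1) h = (((n + 1 : ℕ) : ℝ) *
      ((((n + 1 : ℕ) : ℝ) * h) ^ (n + 1 - 1) * Real.exp (-(((n + 1 : ℕ) : ℝ) * h)))) / n.factorial := by
    intro h; rw [erlang, Nat.add_sub_cancel]; ring
  simp only [e]
  rw [intervalIntegral.integral_div, intervalIntegral.integral_const_mul,
    intervalIntegral.mul_integral_comp_mul_left (f := fun x => x ^ (n + 1 - 1) * Real.exp (-x))]
  congr 1
  exact_mod_cast Real.Gamma_nat_eq_factorial n

end ErlangAntiderivative
end
end RisNet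

namespace RisNet
noncomputable section

/-! ### The phase average and absolute convergence of the inversion integral -/

section GilPelaez

open Filter Topology Params

/-- Largest interference compatible with a serving fading power `h`. -/
def slack (n0 A γ w h : ℝ) : ℝ := min (w * h / γ - n0) (A - w * h)

lemma continuous_slack (n0 A γ w : ℝ) : Continuous (slack n0 A γ w) := by
  unfold slack; fun_prop

/-- One integration by parts: the antiderivative of the exponential has modulus 1/|b|, and the
remaining terms do not see b. -/
lemma norm_integral_mul_exp_le {g g' : ℝ → ℝ} (hg : ∀ x, HasDerivAt g (g' x) x)
    (hg' : Continuous g') {a c b : ℝ} (hb : b ≠ 0) :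
    ‖∫ h in a..c, (g h : ℂ) * Complex.exp (-(Complex.I * b * h))‖ ≤
      (|g a| + |g c| + |∫ h in a..c, (|g' h|)|) / |b| := by
  have hgc : Continuous g := continuous_iff_continuousAt.2 fun x => (hg x).continuousAt
  have hb' : (Complex.I * b : ℂ) ≠ 0 := by simp [hb]
  have hv : ∀ x ∈ uIcc a c, HasDerivAt
      (fun h : ℝ => -(Complex.exp (-(Complex.I * b * h)) / (Complex.I * b)))
      (Complex.exp (-(Complex.I * b * x))) x := by
    intro x _
    have h0 : HasDerivAt (fun h : ℂ => -(Complex.exp (-(Complex.I * b * h)) / (Complex.I * b)))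
        (Complex.exp (-(Complex.I * b * x))) (x : ℂ) := by
      refine ((((hasDerivAt_id (x : ℂ)).const_mul (Complex.I * b)).neg.cexp).div_const _).neg.congr_deriv ?_
      have : (b : ℂ) ≠ 0 := by exact_mod_cast hb
      simp
      field_simp
    exact h0.comp_ofReal
  rw [intervalIntegral.integral_mul_deriv_eq_deriv_mul (u := fun h => (g h : ℂ))
    (u' := fun h => (g' h : ℂ)) (fun x _ => (hg x).ofReal_comp) hv
    ((by fun_prop : Continuous _).intervalIntegrable _ _)
    ((by fun_prop : Continuous _).intervalIntegrable _ _)]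
  have hn : ∀ h : ℝ, ‖-(Complex.exp (-(Complex.I * b * h)) / (Complex.I * b))‖ = 1 / |b| := by
    intro h
    rw [norm_neg, norm_div, norm_mul, Complex.norm_I, one_mul, Complex.norm_real, Real.norm_eq_abs,
      show -(Complex.I * b * h) = ((-(b * h) : ℝ) : ℂ) * Complex.I by push_cast; ring,
      Complex.norm_exp_ofReal_mul_I]
  have h3 : ‖∫ x in a..c, (g' x : ℂ) * -(Complex.exp (-(Complex.I * b * x)) / (Complex.I * b))‖ ≤
      |∫ h in a..c, |g' h| * (1 / |b|)| := by
    refine (intervalIntegral.norm_integral_le_abs_integral_norm).trans (le_of_eq ?_)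
    simp only [norm_mul, hn, Complex.norm_real, Real.norm_eq_abs]
  rw [intervalIntegral.integral_mul_const, abs_mul, abs_of_nonneg (by positivity : 0 ≤ 1 / |b|)] at h3
  refine (norm_sub_le _ _).trans ((add_le_add (norm_sub_le _ _) h3).trans_eq ?_)
  rw [norm_mul, norm_mul, hn, hn, Complex.norm_real, Complex.norm_real, Real.norm_eq_abs,
    Real.norm_eq_abs]
  ring

variable (p : Params)

lemma area_pos : 0 < p.area := by
  have := p.lamF_pos
  unfold area; positivity

/-- The complex phase average in the integrand of the Gil-Pelaez integral. -/
def gpPhase (m : ℕ) (w gam om x : ℝ) : ℂ :=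
  p.xi1 m w gam om x * Complex.exp (Complex.I * x * p.noise) +
    p.xi2 m w gam om x * Complex.exp (-(Complex.I * x * p.area * om))

lemma gpIntegrand_eq (m : ℕ) (w t gam om x : ℝ) : p.gpIntegrand m w t gam om x =
    1 / (Real.pi * x) * (gpPhase p m w gam om x * p.laplaceI t (-(Complex.I * x))).im := rfl

section

variable {m : ℕ} (hm : 1 ≤ m) {w gam om : ℝ} (hw : 0 < w) (hg : 0 < gam)
  (hU : p.noise * gam ≤ p.area * om)

include hw hg hU in
omit hm in
-- With P₁ = γ(𝓔ω + σ²)/(1+γ), each of the inequalities σ²γ ≤ P₁ and P₁ ≤ 𝓔ω is equivalent to σ²γ ≤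
-- 𝓔ω.
lemma thresholds_order : 0 < p.noise * gam / w ∧ p.noise * gam / w ≤ p.P1 gam om / w ∧
    p.P1 gam om / w ≤ p.area * om / w := by
  have hn := p.noise_pos
  refine ⟨by positivity, ?_, ?_⟩
  · gcongr
    rw [P1, le_div_iff₀ (by positivity)]
    nlinarith
  · gcongr
    rw [P1, div_le_iff₀ (by positivity)]
    nlinarith

include hm hw hg hU in
lemma xi1_eq_integral (x : ℝ) : p.xi1 m w gam om x =
    ∫ h in (p.noise * gam / w)..(p.P1 gam om / w),
      (erlang m h : ℂ) * Complex.exp (-(Complex.I * ((x * w / gam : ℝ) : ℂ) * h)) := by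
  obtain ⟨h0, h1, h2⟩ := thresholds_order p hw hg hU
  rw [xi1, xi1Anti_eq _ _ _ _ hg, xi1Anti_eq _ _ _ _ hg, integral_erlang_mul_exp hm _ h0 h1]

include hm hw hg hU in
lemma xi2_eq_integral (x : ℝ) : p.xi2 m w gam om x =
    ∫ h in (p.P1 gam om / w)..(p.area * om / w),
      (erlang m h : ℂ) * Complex.exp (-(Complex.I * ((-(x * w) : ℝ) : ℂ) * h)) := by
  obtain ⟨h0, h1, h2⟩ := thresholds_order p hw hg hU
  rw [xi2, xi2Anti_eq, xi2Anti_eq, integral_erlang_mul_exp hm _ (h0.trans_le h1) h2]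

include hm hw hg hU in
-- The outer factors e^{jxσ²} and e^{−jx𝓔ω} complete the exponents to −jx(wh/γ − σ²) and −jx(𝓔ω −
-- wh). The two branches of the minimum cross at wh = P₁, so the two pieces join into one integral.
lemma gpPhase_eq_integral (x : ℝ) : gpPhase p m w gam om x =
    ∫ h in (p.noise * gam / w)..(p.area * om / w), (erlang m h : ℂ) *
      Complex.exp (-(Complex.I * x * (slack p.noise (p.area * om) gam w h : ℝ))) := by
  obtain ⟨h0, h1, h2⟩ := thresholds_order p hw hg hU
  have hc : Continuous fun h : ℝ => (erlang m h : ℂ) *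
      Complex.exp (-(Complex.I * x * (slack p.noise (p.area * om) gam w h : ℝ))) := by
    have := continuous_erlang m
    have := continuous_slack p.noise (p.area * om) gam w
    fun_prop
  rw [gpPhase, xi1_eq_integral p hm hw hg hU, xi2_eq_integral p hm hw hg hU,
    ← intervalIntegral.integral_add_adjacent_intervals (hc.intervalIntegrable _ (p.P1 gam om / w))
      (hc.intervalIntegrable _ _),
    ← intervalIntegral.integral_mul_const, ← intervalIntegral.integral_mul_const]
  congr 1
  · refine intervalIntegral.integral_congr fun h hh => ?_
    rw [uIcc_of_le h1] at hh
    have : slack p.noise (p.area * om) gam w h = w * h / gam - p.noise := by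
      rw [slack, min_eq_left]
      have := hh.2
      rw [P1, div_div, le_div_iff₀ (by positivity)] at this
      rw [sub_le_iff_le_add, div_le_iff₀ hg]
      nlinarith
    simp only [this]
    rw [mul_assoc, ← Complex.exp_add]
    congr 2
    push_cast; ring
  · refine intervalIntegral.integral_congr fun h hh => ?_
    rw [uIcc_of_le h2] at hh
    have : slack p.noise (p.area * om) gam w h = p.area * om - w * h := by
      rw [slack, min_eq_right]
      have := hh.1
      rw [P1, div_div, div_le_iff₀ (by positivity)] at this
      rw [le_sub_iff_add_le, le_div_iff₀ hg]
      nlinarith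
    simp only [this]
    rw [mul_assoc, ← Complex.exp_add]
    congr 2
    push_cast; ring

include hm hw hg hU in
lemma continuous_gpPhase : Continuous (gpPhase p m w gam om) := by
  have e : gpPhase p m w gam om = _ := funext (gpPhase_eq_integral p hm hw hg hU)
  rw [e]
  apply intervalIntegral.continuous_parametric_intervalIntegral_of_continuous'
  have := continuous_erlang m
  have := continuous_slack p.noise (p.area * om) gam w
  fun_prop

lemma hasDerivAt_erlang (m : ℕ) : ∃ g' : ℝ → ℝ, Continuous g' ∧ ∀ h, HasDerivAt (erlang m) (g' h) h := by
  have hs : ContDiff ℝ 1 (erlang m) := by unfold erlang; fun_prop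
  exact ⟨deriv (erlang m), hs.continuous_deriv le_rfl,
    fun h => (hs.differentiable (by norm_num) h).hasDerivAt⟩

include hm hw hg hU in
-- On each side of P₁ the exponent is linear in h with slope proportional to x, so integration by
-- parts applies with a smooth density and gains 1/x.
lemma exists_norm_gpPhase_le : ∃ C, 0 ≤ C ∧ ∀ x, 0 < x → ‖gpPhase p m w gam om x‖ ≤ C / x := by
  obtain ⟨g', hc, hd⟩ := hasDerivAt_erlang m
  obtain ⟨C1, hC1, h1⟩ : ∃ C, 0 ≤ C ∧ ∀ x, 0 < x → ‖p.xi1 m w gam om x‖ ≤ C / x := by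
    refine ⟨(|erlang m (p.noise * gam / w)| + |erlang m (p.P1 gam om / w)| +
      |∫ h in (p.noise * gam / w)..(p.P1 gam om / w), (|g' h|)|) * (gam / w), by positivity, ?_⟩
    intro x hx
    rw [xi1_eq_integral p hm hw hg hU]
    refine (norm_integral_mul_exp_le hd hc (by positivity)).trans_eq ?_
    rw [abs_of_pos (by positivity : 0 < x * w / gam)]
    field_simp
  obtain ⟨C2, hC2, h2⟩ : ∃ C, 0 ≤ C ∧ ∀ x, 0 < x → ‖p.xi2 m w gam om x‖ ≤ C / x := by
    refine ⟨(|erlang m (p.P1 gam om / w)| + |erlang m (p.area * om / w)| +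
      |∫ h in (p.P1 gam om / w)..(p.area * om / w), (|g' h|)|) / w, by positivity, ?_⟩
    intro x hx
    rw [xi2_eq_integral p hm hw hg hU]
    refine (norm_integral_mul_exp_le hd hc (neg_ne_zero.2 (by positivity))).trans_eq ?_
    rw [abs_neg, abs_of_pos (by positivity : 0 < x * w)]
    field_simp
  refine ⟨C1 + C2, by positivity, fun x hx => ?_⟩
  rw [gpPhase, add_div]
  refine (norm_add_le _ _).trans (add_le_add ?_ ?_)
  · rw [norm_mul, show Complex.I * x * p.noise = ((x * p.noise : ℝ) : ℂ) * Complex.I by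
      push_cast; ring, Complex.norm_exp_ofReal_mul_I, mul_one]
    exact h1 x hx
  · rw [norm_mul, show -(Complex.I * x * p.area * om) = ((-(x * p.area * om) : ℝ) : ℂ) * Complex.I by
      push_cast; ring, Complex.norm_exp_ofReal_mul_I, mul_one]
    exact h2 x hx

include hm hw hg hU in
-- At x = 0 the phase average is the real mass of the Erlang law between the thresholds, and |e^{iθ}
-- − 1| ≤ |θ| controls the deviation linearly.
lemma exists_norm_gpPhase_sub_le : ∃ C, 0 ≤ C ∧ ∀ x, 0 < x → ‖gpPhase p m w gam om x -
    ((∫ h in (p.noise * gam / w)..(p.area * om / w), erlang m h : ℝ) : ℂ)‖ ≤ C * x := by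
  obtain ⟨h0, h1, h2⟩ := thresholds_order p hw hg hU
  have hce := continuous_erlang m
  have hcs := continuous_slack p.noise (p.area * om) gam w
  refine ⟨∫ h in (p.noise * gam / w)..(p.area * om / w),
    |erlang m h| * |slack p.noise (p.area * om) gam w h|, ?_, ?_⟩
  · exact intervalIntegral.integral_nonneg (h1.trans h2) fun h _ => by positivity
  intro x hx
  rw [gpPhase_eq_integral p hm hw hg hU, ← intervalIntegral.integral_ofReal,
    ← intervalIntegral.integral_sub ((by fun_prop : Continuous _).intervalIntegrable _ _)
      ((by fun_prop : Continuous _).intervalIntegrable _ _),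
    ← intervalIntegral.integral_mul_const]
  refine intervalIntegral.norm_integral_le_of_norm_le (h1.trans h2) ?_
    ((by fun_prop : Continuous _).intervalIntegrable _ _)
  refine Eventually.of_forall fun h _ => ?_
  set y := slack p.noise (p.area * om) gam w h
  rw [show (erlang m h : ℂ) * Complex.exp (-(Complex.I * x * y)) - (erlang m h : ℂ) =
    (erlang m h : ℂ) * (Complex.exp (Complex.I * ((-(x * y) : ℝ) : ℂ)) - 1) by
      push_cast; ring_nf, norm_mul, Complex.norm_real, Real.norm_eq_abs, mul_assoc]
  gcongr
  refine (Real.norm_exp_I_mul_ofReal_sub_one_le).trans_eq ?_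
  rw [norm_neg, norm_mul, Real.norm_eq_abs, Real.norm_eq_abs, abs_of_pos hx, mul_comm]

include hm hw hg hU in
-- The singularity of 1/x at 0 is harmless because phase and characteristic function both approach
-- real values at rate O(x). At infinity the extra 1/x of the phase gives an integrable 1/x².
lemma integrableOn_gp {φ : ℝ → ℂ} (hφm : Measurable φ) (hφ1 : ∀ x, 0 < x → ‖φ x‖ ≤ 1) {K : ℝ}
    (hφK : ∀ x, 0 < x → ‖φ x - 1‖ ≤ K * x) :
    IntegrableOn (fun x => 1 / (Real.pi * x) * (gpPhase p m w gam om x * φ x).im) (Ioi 0) := by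
  obtain ⟨C, hC, h1⟩ := exists_norm_gpPhase_le p hm hw hg hU
  obtain ⟨D, hD, h2⟩ := exists_norm_gpPhase_sub_le p hm hw hg hU
  set F := ∫ h in (p.noise * gam / w)..(p.area * om / w), erlang m h
  have hmeas : Measurable fun x => 1 / (Real.pi * x) * (gpPhase p m w gam om x * φ x).im := by
    have aux : ∀ f : ℝ → ℂ, Measurable f → Measurable fun x => 1 / (Real.pi * x) * (f x * φ x).im := by
      intro f hf; fun_prop
    exact aux _ (continuous_gpPhase p hm hw hg hU).measurable
  rw [← Ioc_union_Ioi_eq_Ioi (zero_le_one' ℝ)]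
  refine IntegrableOn.union ?_ ?_
  · refine Measure.integrableOn_of_bounded (M := (D + |F| * K) / Real.pi) (by simp)
      hmeas.aestronglyMeasurable ?_
    filter_upwards [ae_restrict_mem measurableSet_Ioc] with x hx
    have hx0 : 0 < x := hx.1
    -- Subtracting the real number F leaves the imaginary part unchanged and exhibits both small
    -- differences.
    have e : (gpPhase p m w gam om x * φ x).im =
        ((gpPhase p m w gam om x - (F : ℂ)) * φ x + F * (φ x - 1)).im := by
      have : gpPhase p m w gam om x * φ x =
        (gpPhase p m w gam om x - (F : ℂ)) * φ x + F * (φ x - 1) + F := by ring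
      rw [this, Complex.add_im _ (F : ℂ), Complex.ofReal_im, add_zero]
    have b : |(gpPhase p m w gam om x * φ x).im| ≤ (D + |F| * K) * x := by
      rw [e]
      refine (Complex.abs_im_le_norm _).trans ((norm_add_le _ _).trans ?_)
      rw [norm_mul, norm_mul, Complex.norm_real, Real.norm_eq_abs]
      have := mul_le_mul (h2 x hx0) (hφ1 x hx0) (norm_nonneg _) (by positivity)
      have := mul_le_mul_of_nonneg_left (hφK x hx0) (abs_nonneg F)
      nlinarith
    rw [norm_mul, Real.norm_eq_abs, Real.norm_eq_abs, abs_of_pos (by positivity), one_div_mul_eq_div,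
      div_le_div_iff₀ (by positivity) (by positivity)]
    nlinarith [Real.pi_pos]
  · have hi : IntegrableOn (fun x : ℝ => C / Real.pi * x ^ (-2 : ℝ)) (Ioi 1) :=
      (integrableOn_Ioi_rpow_of_lt (by norm_num) one_pos).const_mul _
    refine hi.mono' hmeas.aestronglyMeasurable ?_
    filter_upwards [ae_restrict_mem measurableSet_Ioi] with x hx
    have hx0 : 0 < x := one_pos.trans hx
    have b : |(gpPhase p m w gam om x * φ x).im| ≤ C / x := by
      refine (Complex.abs_im_le_norm _).trans ?_
      rw [norm_mul]
      have := mul_le_mul (h1 x hx0) (hφ1 x hx0) (norm_nonneg _) (by positivity)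
      simpa using this
    rw [norm_mul, Real.norm_eq_abs, Real.norm_eq_abs, abs_of_pos (by positivity), Real.rpow_neg hx0.le]
    calc 1 / (Real.pi * x) * |(gpPhase p m w gam om x * φ x).im| ≤ 1 / (Real.pi * x) * (C / x) := by
          gcongr
      _ = _ := by norm_cast; field_simp

end
end GilPelaez
end
end RisNet

namespace RisNet
noncomputable section

/-! ### The Gil-Pelaez formula for the joint event -/

section GilPelaezFormula

open Filter Topology Params

/-- Fading powers for which both the SINR and the exposure constraints hold, if the interference is `u`. -/
def goodFading (n0 A γ w u : ℝ) : Set ℝ := {h | γ * (n0 + u) < w * h ∧ w * h ≤ A - u}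

lemma measurableSet_goodFading (n0 A γ w u : ℝ) : MeasurableSet (goodFading n0 A γ w u) := by
  rw [goodFading, ofPred_and]
  exact (measurableSet_lt (by fun_prop) (by fun_prop)).inter
    (measurableSet_le (by fun_prop) (by fun_prop))

lemma gammaMeasure_real_eq {m : ℕ} (hm : 1 ≤ m) {a c : ℝ} (ha : 0 ≤ a) {S : Set ℝ}
    (hS : MeasurableSet S) (hSI : S ⊆ Ioc a c) :
    (gammaMeasure m m).real S = ∫ h in Ioc a c, S.indicator (erlang m) h := by
  rw [setIntegral_indicator hS, inter_eq_right.2 hSI, measureReal_def, gammaMeasure,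
    withDensity_apply _ hS, integral_eq_lintegral_of_nonneg_ae]
  · congr 1
    refine setLIntegral_congr_fun hS fun h hh => ?_
    have h0 : 0 ≤ h := ha.trans (hSI hh).1.le
    rw [gammaPDF, gammaPDFReal_eq_erlang hm h0]
  · filter_upwards [ae_restrict_mem hS] with h hh
    exact erlang_nonneg m (ha.trans (hSI hh).1.le)
  · exact (continuous_erlang m).aestronglyMeasurable

lemma tendsto_truncated_integral {f : ℝ → ℝ} (hf : IntegrableOn f (Ioi 0)) :
    Tendsto (fun n : ℕ => ∫ x in Ioc ((n : ℝ) + 1)⁻¹ ((n : ℝ) + 1), f x) atTop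
      (𝓝 (∫ x in Ioi 0, f x)) := by
  have hU : ⋃ n : ℕ, Ioc ((n : ℝ) + 1)⁻¹ ((n : ℝ) + 1) = Ioi 0 := by
    ext x
    simp only [mem_iUnion, mem_Ioc, mem_Ioi]
    constructor
    · rintro ⟨n, h1, h2⟩
      exact lt_trans (by positivity) h1
    · intro hx
      obtain ⟨n, hn⟩ := exists_nat_gt (max x x⁻¹)
      refine ⟨n, ?_, ?_⟩
      · rw [inv_lt_comm₀ (by positivity) hx]
        linarith [le_max_right x x⁻¹]
      · linarith [le_max_left x x⁻¹]
  rw [← hU] at hf ⊢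
  refine tendsto_setIntegral_of_monotone (fun n => measurableSet_Ioc) ?_ hf
  intro a b hab
  have : (a : ℝ) ≤ b := by exact_mod_cast hab
  apply Ioc_subset_Ioc <;> gcongr

variable (p : Params) {m : ℕ} (hm : 1 ≤ m) {w gam om : ℝ} (hw : 0 < w) (hg : 0 < gam)
  (hU : p.noise * gam ≤ p.area * om)

include hm hw hg hU in
-- Phase average times characteristic function is the integral of e^{jx(u − y(h))} over independent
-- u and h; its imaginary part is the sine that the Dirichlet integral needs.
lemma gp_integrand_eq_integral_prod (ν : Measure ℝ) [IsProbabilityMeasure ν] {x : ℝ} :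
    1 / (Real.pi * x) * (gpPhase p m w gam om x * charFun ν x).im =
    ∫ z, erlang m z.2 / Real.pi * (Real.sin ((z.1 - slack p.noise (p.area * om) gam w z.2) * x) / x)
      ∂(ν.prod (volume.restrict (Ioc (p.noise * gam / w) (p.area * om / w)))) := by
  obtain ⟨h0, h1, h2⟩ := thresholds_order p hw hg hU
  set μ := volume.restrict (Ioc (p.noise * gam / w) (p.area * om / w)) with hμ
  have hce := continuous_erlang m
  have hcs := continuous_slack p.noise (p.area * om) gam w
  have hI : Integrable (fun z : ℝ × ℝ => Complex.exp (z.1 * x * Complex.I) * ((erlang m z.2 : ℂ) *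
      Complex.exp (-(Complex.I * x * (slack p.noise (p.area * om) gam w z.2 : ℝ))))) (ν.prod μ) := by
    refine Integrable.mul_prod (f := fun u : ℝ => Complex.exp (u * x * Complex.I))
      (g := fun h : ℝ => (erlang m h : ℂ) *
        Complex.exp (-(Complex.I * x * (slack p.noise (p.area * om) gam w h : ℝ)))) ?_ ?_
    · refine Integrable.of_bound (by fun_prop) 1 (Eventually.of_forall fun u => ?_)
      rw [show (u * x * Complex.I : ℂ) = ((u * x : ℝ) : ℂ) * Complex.I by push_cast; ring,
        Complex.norm_exp_ofReal_mul_I]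
    · exact ((by fun_prop : Continuous _).integrableOn_Ioc)
  have e : gpPhase p m w gam om x * charFun ν x = ∫ z : ℝ × ℝ, Complex.exp (z.1 * x * Complex.I) *
      ((erlang m z.2 : ℂ) *
        Complex.exp (-(Complex.I * x * (slack p.noise (p.area * om) gam w z.2 : ℝ)))) ∂(ν.prod μ) := by
    rw [integral_prod_mul (μ := ν) (ν := μ) (fun u : ℝ => Complex.exp (u * x * Complex.I))
      (fun h : ℝ => (erlang m h : ℂ) *
        Complex.exp (-(Complex.I * x * (slack p.noise (p.area * om) gam w h : ℝ)))),
      gpPhase_eq_integral p hm hw hg hU, intervalIntegral.integral_of_le (h1.trans h2), mul_comm,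
      charFun_apply_real]
    congr 1
    refine integral_congr_ae (Eventually.of_forall fun u => ?_)
    simp only
    congr 1; ring
  rw [e, ← Complex.imCLM_apply, ← Complex.imCLM.integral_comp_comm hI, ← integral_const_mul]
  refine integral_congr_ae (Eventually.of_forall fun z => ?_)
  simp only [Complex.imCLM_apply]
  rw [mul_left_comm, ← Complex.exp_add, Complex.im_ofReal_mul,
    show (z.1 * x * Complex.I + -(Complex.I * x * (slack p.noise (p.area * om) gam w z.2 : ℝ)) : ℂ) =
      (((z.1 - slack p.noise (p.area * om) gam w z.2) * x : ℝ) : ℂ) * Complex.I by push_cast; ring,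
    Complex.exp_ofReal_mul_I_im]
  rcases eq_or_ne x 0 with rfl | hx
  · simp
  · field_simp

include hm hw hg hU in
-- Fubini is available here because on the truncated range |sin|/x ≤ n + 1. On the whole half-line
-- sin(ax)/x is not absolutely integrable, which is why the truncation is introduced.
lemma truncated_gp_eq (ν : Measure ℝ) [IsProbabilityMeasure ν] (n : ℕ) :
    ∫ x in Ioc ((n : ℝ) + 1)⁻¹ ((n : ℝ) + 1),
      1 / (Real.pi * x) * (gpPhase p m w gam om x * charFun ν x).im =
    ∫ z, erlang m z.2 / Real.pi * dirichletInt n (z.1 - slack p.noise (p.area * om) gam w z.2)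
      ∂(ν.prod (volume.restrict (Ioc (p.noise * gam / w) (p.area * om / w)))) := by
  set μ := volume.restrict (Ioc (p.noise * gam / w) (p.area * om / w)) with hμ
  have hce := continuous_erlang m
  have hcs := continuous_slack p.noise (p.area * om) gam w
  have hn : ((n : ℝ) + 1)⁻¹ ≤ (n : ℝ) + 1 := by
    have : (1 : ℝ) ≤ n + 1 := by linarith [(Nat.cast_nonneg n : (0 : ℝ) ≤ n)]
    exact (inv_le_one_of_one_le₀ this).trans this
  simp_rw [gp_integrand_eq_integral_prod p hm hw hg hU ν]
  rw [integral_integral_swap]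
  · refine integral_congr_ae (Eventually.of_forall fun z => ?_)
    simp only
    rw [integral_const_mul, dirichletInt_eq, intervalIntegral.integral_of_le hn]
  · have hE : Integrable (fun z : ℝ × ℝ => |erlang m z.2| / Real.pi) (ν.prod μ) := by
      have : IntegrableOn (fun h => |erlang m h| / Real.pi)
        (Ioc (p.noise * gam / w) (p.area * om / w)) := (by fun_prop : Continuous _).integrableOn_Ioc
      exact this.integrable.comp_snd ν
    have hE2 : Integrable (fun q : ℝ × (ℝ × ℝ) => ((n : ℝ) + 1) * (|erlang m q.2.2| / Real.pi))
        ((volume.restrict (Ioc ((n : ℝ) + 1)⁻¹ ((n : ℝ) + 1))).prod (ν.prod μ)) :=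
      Integrable.comp_snd (f := fun z : ℝ × ℝ => ((n : ℝ) + 1) * (|erlang m z.2| / Real.pi))
        (hE.const_mul _) _
    refine hE2.mono' ?_ ?_
    · refine Measurable.aestronglyMeasurable ?_
      simp only [Function.uncurry_def]
      fun_prop
    · have hx : ∀ᵐ q : ℝ × (ℝ × ℝ) ∂((volume.restrict (Ioc ((n : ℝ) + 1)⁻¹ ((n : ℝ) + 1))).prod (ν.prod μ)),
          ((n : ℝ) + 1)⁻¹ < q.1 := by
        have : ∀ᵐ x : ℝ ∂(volume.restrict (Ioc ((n : ℝ) + 1)⁻¹ ((n : ℝ) + 1))), ((n : ℝ) + 1)⁻¹ < x := by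
          filter_upwards [ae_restrict_mem measurableSet_Ioc] with x hx using hx.1
        exact Measure.quasiMeasurePreserving_fst.ae this
      filter_upwards [hx] with q hq
      have hq0 : 0 < q.1 := lt_trans (by positivity) hq
      simp only [Function.uncurry_def, norm_mul, norm_div, Real.norm_eq_abs, abs_of_pos Real.pi_pos,
        abs_of_pos hq0]
      rw [mul_comm]
      gcongr
      rw [div_le_iff₀ hq0]
      refine (Real.abs_sin_le_one _).trans ?_
      rw [inv_lt_iff_one_lt_mul₀ (by positivity)] at hq
      linarith

include hw hg in
omit hm in
-- Each branch of the minimum is affine with nonzero slope, so a level is attained at most twice.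
-- Hence the value 1/2 that the inversion formula would give at u = y(h) is never seen, even if the
-- interference has atoms.
lemma volume_slack_eq (n0 A u : ℝ) : volume {h | slack n0 A gam w h = u} = 0 := by
  refine measure_mono_null (t := {(u + n0) * gam / w, (A - u) / w}) ?_ (Set.Finite.measure_zero (by simp) _)
  intro h hh
  simp only [mem_ofPred_eq, slack] at hh
  simp only [mem_insert_iff, mem_singleton_iff]
  rcases min_choice (w * h / gam - n0) (A - w * h) with h1 | h1
  · left
    rw [h1] at hh
    rw [← hh]; field_simp; ring
  · right
    rw [h1] at hh
    rw [← hh]; field_simp; ring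

include hm hw hg hU in
-- The truncated Dirichlet integrals tend boundedly to (π/2)·sign(u − y(h)), and 1/2 minus half that
-- sign is the indicator of u < y(h). Slicing at fixed u then gives the Gamma probability of the
-- admissible fading powers.
lemma half_sub_gp_eq (ν : Measure ℝ) [IsProbabilityMeasure ν] (hν : ν (Iio 0) = 0)
    (hi : IntegrableOn (fun x => 1 / (Real.pi * x) * (gpPhase p m w gam om x * charFun ν x).im) (Ioi 0)) :
    1 / 2 * (∫ h in (p.noise * gam / w)..(p.area * om / w), erlang m h) -
      ∫ x in Ioi (0 : ℝ), 1 / (Real.pi * x) * (gpPhase p m w gam om x * charFun ν x).im =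
    ∫ u, (gammaMeasure m m).real (goodFading p.noise (p.area * om) gam w u) ∂ν := by
  obtain ⟨h0, h1, h2⟩ := thresholds_order p hw hg hU
  set μ := volume.restrict (Ioc (p.noise * gam / w) (p.area * om / w)) with hμ
  set y := slack p.noise (p.area * om) gam w with hy
  have hce := continuous_erlang m
  have hcs : Continuous y := continuous_slack p.noise (p.area * om) gam w
  have hE : Integrable (fun z : ℝ × ℝ => erlang m z.2) (ν.prod μ) := by
    have : IntegrableOn (erlang m) (Ioc (p.noise * gam / w) (p.area * om / w)) := hce.integrableOn_Ioc
    exact this.integrable.comp_snd ν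
  have hne : ∀ᵐ z : ℝ × ℝ ∂(ν.prod μ), y z.2 ≠ z.1 := by
    rw [ae_iff]
    simp only [not_not]
    refine (Measure.measure_prod_null ?_).2 (Eventually.of_forall fun u => ?_)
    · exact measurableSet_eq_fun (by fun_prop) (by fun_prop)
    · exact Measure.absolutelyContinuous_of_le Measure.restrict_le_self
        (volume_slack_eq hw hg _ _ u)
  have lim1 := tendsto_truncated_integral hi
  have lim2 : Tendsto (fun n : ℕ => ∫ z, erlang m z.2 / Real.pi * dirichletInt n (z.1 - y z.2) ∂(ν.prod μ))
      atTop (𝓝 (∫ z, (if z.1 < y z.2 then -(erlang m z.2 / 2) else erlang m z.2 / 2) ∂(ν.prod μ))) := by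
    refine tendsto_integral_of_dominated_convergence (fun z => |erlang m z.2 / Real.pi| * 8) ?_ ?_ ?_ ?_
    · intro n
      have := continuous_dirichletInt n
      exact (by fun_prop : Continuous _).aestronglyMeasurable
    · exact ((hE.div_const _).abs).mul_const _
    · intro n
      refine Eventually.of_forall fun z => ?_
      rw [norm_mul, Real.norm_eq_abs, Real.norm_eq_abs]
      gcongr
      exact abs_dirichletInt_le _ _
    · filter_upwards [hne] with z hz
      have hpi := Real.pi_ne_zero
      split_ifs with hlt
      · have := (tendsto_dirichletInt_of_neg (sub_neg.2 hlt)).const_mul (erlang m z.2 / Real.pi)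
        refine this.trans_eq ?_
        congr 1; field_simp
      · have hgt : y z.2 < z.1 := lt_of_le_of_ne (not_lt.1 hlt) hz
        have := (tendsto_dirichletInt_of_pos (sub_pos.2 hgt)).const_mul (erlang m z.2 / Real.pi)
        refine this.trans_eq ?_
        congr 1; field_simp
  simp_rw [truncated_gp_eq p hm hw hg hU ν] at lim1
  rw [tendsto_nhds_unique lim1 lim2]
  have hF : ∫ h in (p.noise * gam / w)..(p.area * om / w), erlang m h =
      ∫ z : ℝ × ℝ, erlang m z.2 ∂(ν.prod μ) := by
    rw [intervalIntegral.integral_of_le (h1.trans h2), integral_fun_snd]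
    simp [hμ]
  have hmlt : MeasurableSet {z : ℝ × ℝ | z.1 < y z.2} := measurableSet_lt (by fun_prop) (by fun_prop)
  have hI2 : Integrable (fun z : ℝ × ℝ => if z.1 < y z.2 then -(erlang m z.2 / 2) else erlang m z.2 / 2)
      (ν.prod μ) := by
    refine hE.norm.mono' (Measurable.ite hmlt (by fun_prop) (by fun_prop)).aestronglyMeasurable
      (Eventually.of_forall fun z => ?_)
    split_ifs <;> simp only [norm_neg, norm_div, Real.norm_eq_abs] <;>
      norm_num
  rw [hF, ← integral_const_mul, ← integral_sub (hE.const_mul _) hI2]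
  have e1 : ∀ z : ℝ × ℝ, 1 / 2 * erlang m z.2 -
      (if z.1 < y z.2 then -(erlang m z.2 / 2) else erlang m z.2 / 2) =
      {z : ℝ × ℝ | z.1 < y z.2}.indicator (fun z => erlang m z.2) z := by
    intro z
    simp only [indicator, mem_ofPred_eq]
    split_ifs <;> ring
  simp_rw [e1]
  rw [integral_prod _ (hE.indicator hmlt)]
  have hν' : ∀ᵐ u ∂ν, 0 ≤ u := by
    rw [ae_iff]; simp only [not_le]; exact hν
  refine integral_congr_ae ?_
  filter_upwards [hν'] with u hu
  rw [gammaMeasure_real_eq hm h0.le (measurableSet_goodFading _ _ _ _ _)]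
  · refine integral_congr_ae ?_
    -- The exposure constraint is a weak inequality whereas u < y(h) is strict; they differ only at
    -- this value of h.
    have hne' : ∀ᵐ h ∂μ, h ≠ (p.area * om - u) / w :=
      ae_restrict_of_ae (Measure.ae_ne volume _)
    filter_upwards [hne'] with h hh
    have hiff : u < y h ↔ h ∈ goodFading p.noise (p.area * om) gam w u := by
      simp only [hy, slack, lt_min_iff, goodFading, mem_ofPred_eq]
      constructor
      · rintro ⟨ha, hb⟩
        rw [lt_sub_iff_add_lt, lt_div_iff₀ hg] at ha
        exact ⟨by linarith, by linarith⟩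
      · rintro ⟨ha, hb⟩
        refine ⟨by rw [lt_sub_iff_add_lt, lt_div_iff₀ hg]; linarith, ?_⟩
        refine lt_of_le_of_ne (by linarith) fun hc => hh ?_
        rw [hc]; field_simp; ring
    by_cases hc : u < y h
    · rw [indicator_of_mem (show (u, h) ∈ {z : ℝ × ℝ | z.1 < y z.2} from hc),
        indicator_of_mem (hiff.1 hc)]
    · rw [indicator_of_notMem (show (u, h) ∉ {z : ℝ × ℝ | z.1 < y z.2} from hc),
        indicator_of_notMem (fun h' => hc (hiff.2 h'))]
  · rintro h ⟨ha, hb⟩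
    constructor
    · rw [div_lt_iff₀ hw]
      have : 0 ≤ gam * u := by positivity
      linarith
    · rw [le_div_iff₀ hw]; linarith

include hm hw hg in
omit hU in
/-- The closed form `jointOf` is the probability that both constraints hold, if the interference has
law `ν` and the fading is Gamma. -/
lemma jointOf_eq_integral (ν : Measure ℝ) [IsProbabilityMeasure ν] (hν : ν (Iio 0) = 0) (t : ℝ)
    (hφ : ∀ x : ℝ, 0 < x → p.laplaceI t (-(Complex.I * x)) = charFun ν x)
    (hi : p.noise * gam ≤ p.area * om → IntegrableOn (p.gpIntegrand m w t gam om) (Ioi 0)) :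
    p.jointOf m w t gam om =
      ∫ u, (gammaMeasure m m).real (goodFading p.noise (p.area * om) gam w u) ∂ν := by
  by_cases hU : p.noise * gam ≤ p.area * om
  · have hU1 : p.U gam om = 1 := by rw [U, if_pos (by linarith)]
    have e : EqOn (p.gpIntegrand m w t gam om)
        (fun x => 1 / (Real.pi * x) * (gpPhase p m w gam om x * charFun ν x).im) (Ioi 0) := by
      intro x hx
      simp only [gpIntegrand_eq, hφ x hx]
    rw [jointOf, hU1, one_mul, cdfH_sub_cdfH hm, setIntegral_congr_fun measurableSet_Ioi e,
      half_sub_gp_eq p hm hw hg hU ν hν ((hi hU).congr_fun e measurableSet_Ioi)]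
  -- If 𝓔ω < σ²γ the two constraints exclude each other for every nonnegative interference, so both
  -- sides vanish.
  · have hU0 : p.U gam om = 0 := by rw [U, if_neg (by linarith)]
    rw [jointOf, hU0, zero_mul]
    have hν' : ∀ᵐ u ∂ν, 0 ≤ u := by
      rw [ae_iff]; simp only [not_le]; exact hν
    symm
    refine integral_eq_zero_of_ae ?_
    filter_upwards [hν'] with u hu
    have : goodFading p.noise (p.area * om) gam w u = ∅ := by
      ext h
      simp only [goodFading, mem_ofPred_eq, mem_empty_iff_false, iff_false, not_and, not_le]
      intro ha
      have : 0 ≤ gam * u := by positivity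
      linarith
    simp [this]

end GilPelaezFormula
end
end RisNet

namespace RisNet
noncomputable section

/-! ### Poisson processes: finiteness, Laplace functional, Campbell's formula -/

section PoissonProcess

set_option linter.unusedSectionVars false

open Filter Topology

variable {Ω E ι : Type*} [MeasurableSpace Ω] [MeasurableSpace E] {P : Measure Ω}
  [IsProbabilityMeasure P] [Countable ι] {X : ι → Ω → E} {Λ : Measure E}

lemma measurable_encard_preimage (hX : ∀ i, Measurable (X i)) {B : Set E} (hB : MeasurableSet B) :
    Measurable fun ω => ∑' i, B.indicator (1 : E → ENNReal) (X i ω) := by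
  refine Measurable.tsum fun i => ?_
  exact (measurable_one.indicator hB).comp (hX i)

lemma tsum_indicator_eq_encard (B : Set E) (ω : Ω) :
    ∑' i, B.indicator (1 : E → ENNReal) (X i ω) = ({i | X i ω ∈ B}.encard : ENNReal) := by
  rw [← ENNReal.tsum_set_one, tsum_subtype {i | X i ω ∈ B} (fun _ => (1 : ENNReal))]
  rfl

lemma integral_pow_poissonMeasure (r : NNReal) (c : ℂ) :
    ∫ n, c ^ n ∂(poissonMeasure r) = Complex.exp (r * (c - 1)) := by
  rw [integral_poissonMeasure]
  have : ∀ n : ℕ, (Real.exp (-r) * r ^ n / n.factorial) • c ^ n =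
      (Real.exp (-r) : ℂ) * ((r * c) ^ n / n.factorial) := by
    intro n
    rw [Complex.real_smul]; push_cast; rw [mul_pow]; ring
  simp_rw [this]
  rw [tsum_mul_left, (NormedSpace.expSeries_div_hasSum_exp (r * c : ℂ)).tsum_eq,
    ← Complex.exp_eq_exp_ℂ, Complex.ofReal_exp, ← Complex.exp_add]
  congr 1; push_cast; ring

namespace IsPoissonProcess

section
omit [Countable ι]

lemma measure_encard_eq (hX : IsPoissonProcess P X Λ) {B : Set E} (hB : MeasurableSet B)
    (hΛ : Λ B ≠ ⊤) (c : ℕ) :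
    P {ω | {i | X i ω ∈ B}.encard = (c : ℕ∞)} = poissonMeasure (Λ B).toNNReal {c} := by
  have := hX.2 1 (fun _ => B) (fun _ => hB) (fun k l h => (h (Subsingleton.elim k l)).elim)
    (fun _ => hΛ) (fun _ => c)
  simpa using this

lemma measure_forall_notMem (hX : IsPoissonProcess P X Λ) {B : Set E} (hB : MeasurableSet B)
    (hΛ : Λ B ≠ ⊤) : P {ω | ∀ i, X i ω ∉ B} = ENNReal.ofReal (Real.exp (-Λ.real B)) := by
  have h := hX.measure_encard_eq hB hΛ 0
  have e : {ω | ∀ i, X i ω ∉ B} = {ω | {i | X i ω ∈ B}.encard = ((0 : ℕ) : ℕ∞)} := by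
    ext ω
    simp [Set.encard_eq_zero, Set.eq_empty_iff_forall_notMem]
  rw [e, h, poissonMeasure_singleton]
  simp [measureReal_def, ENNReal.coe_toNNReal_eq_toReal]

end

lemma measurableSet_encard_eq (hX : IsPoissonProcess P X Λ) {B : Set E} (hB : MeasurableSet B)
    (c : ℕ) : MeasurableSet {ω | {i | X i ω ∈ B}.encard = (c : ℕ∞)} := by
  have e : {ω | {i | X i ω ∈ B}.encard = (c : ℕ∞)} =
      (fun ω => ∑' i, B.indicator (1 : E → ENNReal) (X i ω)) ⁻¹' {(c : ENNReal)} := by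
    ext ω
    simp only [mem_ofPred_eq, mem_preimage, mem_singleton_iff, tsum_indicator_eq_encard]
    norm_cast
  rw [e]
  exact measurable_encard_preimage hX.1 hB (measurableSet_singleton _)

/-- The defining property prescribes only the probabilities of finite counts, but these already sum
to one, which leaves no mass for infinite counts. -/
lemma ae_finite (hX : IsPoissonProcess P X Λ) {B : Set E} (hB : MeasurableSet B)
    (hΛ : Λ B ≠ ⊤) : ∀ᵐ ω ∂P, {i | X i ω ∈ B}.Finite := by
  have h1 : P (⋃ c : ℕ, {ω | {i | X i ω ∈ B}.encard = (c : ℕ∞)}) = 1 := by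
    rw [measure_iUnion]
    · simp_rw [hX.measure_encard_eq hB hΛ]
      rw [← measure_iUnion]
      · rw [Set.iUnion_of_singleton, measure_univ]
      · intro a b hab; simpa using hab
      · intro a; exact measurableSet_singleton a
    · intro a b hab
      refine Set.disjoint_left.2 fun ω (h1 : _ = _) (h2 : _ = _) => hab ?_
      rw [h1] at h2
      exact_mod_cast h2
    · exact fun c => hX.measurableSet_encard_eq hB c
  have h2 : ∀ᵐ ω ∂P, ω ∈ ⋃ c : ℕ, {ω | {i | X i ω ∈ B}.encard = (c : ℕ∞)} :=
    (prob_compl_eq_zero_iff (MeasurableSet.iUnion fun c => hX.measurableSet_encard_eq hB c)).2 h1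
  filter_upwards [h2] with ω hω
  obtain ⟨c, hc⟩ := mem_iUnion.1 hω
  exact Set.finite_of_encard_eq_coe hc

lemma measurable_ncard (hX : IsPoissonProcess P X Λ) {B : Set E} (hB : MeasurableSet B) :
    Measurable fun ω => {i | X i ω ∈ B}.ncard := by
  have e : (fun ω => {i | X i ω ∈ B}.ncard) =
      fun ω => ⌊(∑' i, B.indicator (1 : E → ENNReal) (X i ω)).toReal⌋₊ := by
    ext ω
    rw [tsum_indicator_eq_encard]
    rcases Set.finite_or_infinite {i | X i ω ∈ B} with h | h
    · rw [← h.cast_ncard_eq]; simp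
    · rw [h.encard_eq, h.ncard]; simp
  rw [e]
  exact Nat.measurable_floor.comp (measurable_encard_preimage hX.1 hB).ennreal_toReal

/-- Counts as natural numbers send infinite sets to 0; almost sure finiteness makes this convention
invisible. -/
lemma map_ncard (hX : IsPoissonProcess P X Λ) {n : ℕ} {B : Fin n → Set E}
    (hB : ∀ k, MeasurableSet (B k)) (hd : ∀ k l, k ≠ l → Disjoint (B k) (B l))
    (hΛ : ∀ k, Λ (B k) ≠ ⊤) :
    P.map (fun ω k => {i | X i ω ∈ B k}.ncard) =
      Measure.pi fun k => poissonMeasure (Λ (B k)).toNNReal := by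
  refine Measure.ext_of_singleton fun c => ?_
  rw [Measure.map_apply (measurable_pi_lambda _ fun k => hX.measurable_ncard (hB k))
    (measurableSet_singleton _), Measure.pi_singleton, ← hX.2 n B hB hd hΛ c]
  refine measure_congr ?_
  have hf : ∀ᵐ ω ∂P, ∀ k, {i | X i ω ∈ B k}.Finite := ae_all_iff.2 fun k => hX.ae_finite (hB k) (hΛ k)
  filter_upwards [hf] with ω hω
  refine propext ?_
  change (fun k => {i | X i ω ∈ B k}.ncard) = c ↔ ∀ k, {i | X i ω ∈ B k}.encard = (c k : ℕ∞)
  rw [funext_iff]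
  refine forall_congr' fun k => ?_
  rw [← (hω k).cast_ncard_eq]
  norm_cast

lemma integral_prod_pow_fin (hX : IsPoissonProcess P X Λ) {n : ℕ} {B : Fin n → Set E}
    (hB : ∀ k, MeasurableSet (B k)) (hd : ∀ k l, k ≠ l → Disjoint (B k) (B l))
    (hΛ : ∀ k, Λ (B k) ≠ ⊤) (c : Fin n → ℂ) :
    ∫ ω, ∏ k, c k ^ {i | X i ω ∈ B k}.ncard ∂P =
      Complex.exp (∑ k, (Λ.real (B k) : ℂ) * (c k - 1)) := by
  have h := integral_map (μ := P) (φ := fun ω k => {i | X i ω ∈ B k}.ncard)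
    (f := fun N : Fin n → ℕ => ∏ k, c k ^ N k)
    (measurable_pi_lambda _ fun k => hX.measurable_ncard (hB k)).aemeasurable
    (measurable_of_countable _).aestronglyMeasurable
  rw [← h, hX.map_ncard hB hd hΛ, integral_fintype_prod_eq_prod
    (f := fun k => fun m : ℕ => c k ^ m), Complex.exp_sum]
  refine Finset.prod_congr rfl fun k _ => ?_
  rw [integral_pow_poissonMeasure]
  rfl

lemma integral_prod_pow (hX : IsPoissonProcess P X Λ) {κ : Type*} [Fintype κ] {B : κ → Set E}
    (hB : ∀ k, MeasurableSet (B k)) (hd : ∀ k l, k ≠ l → Disjoint (B k) (B l))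
    (hΛ : ∀ k, Λ (B k) ≠ ⊤) (c : κ → ℂ) :
    ∫ ω, ∏ k, c k ^ {i | X i ω ∈ B k}.ncard ∂P =
      Complex.exp (∑ k, (Λ.real (B k) : ℂ) * (c k - 1)) := by
  let e := (Fintype.equivFin κ).symm
  have := hX.integral_prod_pow_fin (B := fun k => B (e k)) (fun k => hB _)
    (fun k l h => hd _ _ (e.injective.ne h)) (fun k => hΛ _) (fun k => c (e k))
  rw [Equiv.sum_comp e (fun k => (Λ.real (B k) : ℂ) * (c k - 1))] at this
  rw [← this]
  congr 1
  ext ω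
  exact (Equiv.prod_comp e (fun k => c k ^ {i | X i ω ∈ B k}.ncard)).symm

open Classical in
-- Grouping the points of B by the value c of g turns the product into ∏ c^{N_c} with independent
-- Poisson counts N_c, and each generating function is an exponential.
lemma integral_finprod_simpleFunc (hX : IsPoissonProcess P X Λ) (g : SimpleFunc E ℂ) {B : Set E}
    (hB : MeasurableSet B) (hΛ : Λ B ≠ ⊤) :
    ∫ ω, ∏ᶠ i, (if X i ω ∈ B then g (X i ω) else 1) ∂P =
      Complex.exp (∫ x in B, (g x - 1) ∂Λ) := by
  have hBm : ∀ c : ↥g.range, MeasurableSet (g ⁻¹' {(c : ℂ)} ∩ B) :=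
    fun c => (g.measurableSet_preimage _).inter hB
  have hfin : IsFiniteMeasure (Λ.restrict B) := ⟨by simpa [lt_top_iff_ne_top] using hΛ⟩
  have key := hX.integral_prod_pow hBm (fun k l h => by
      refine Set.disjoint_left.2 fun x h1 h2 => h ?_
      exact Subtype.ext (h1.1.symm.trans h2.1))
    (fun k => measure_ne_top_of_subset inter_subset_right hΛ) (fun k => (k : ℂ))
  have hl : ∀ᵐ ω ∂P, ∏ᶠ i, (if X i ω ∈ B then g (X i ω) else 1) =
      ∏ k : ↥g.range, (k : ℂ) ^ {i | X i ω ∈ g ⁻¹' {(k : ℂ)} ∩ B}.ncard := by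
    filter_upwards [hX.ae_finite hB hΛ] with ω hω
    rw [finprod_eq_prod_of_mulSupport_subset (s := hω.toFinset)]
    · rw [Finset.prod_congr rfl (g := fun i => g (X i ω)) (fun i hi => by
        rw [if_pos]; simpa using hi)]
      rw [← Finset.prod_fiberwise_of_maps_to (t := g.range) (g := fun i => g (X i ω))
        (fun i _ => g.mem_range_self _), ← Finset.prod_coe_sort g.range (fun c =>
          ∏ i ∈ hω.toFinset with g (X i ω) = c, g (X i ω))]
      refine Finset.prod_congr rfl fun k _ => ?_
      rw [Finset.prod_congr rfl (g := fun _ => (k : ℂ)) (fun i hi => (Finset.mem_filter.1 hi).2),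
        Finset.prod_const]
      congr 1
      rw [← Set.ncard_coe_finset]
      congr 1
      ext i
      simp [and_comm]
    · intro i hi
      by_contra h
      refine hi ?_
      simp only [if_neg (show ¬ X i ω ∈ B by simpa using h)]
  rw [integral_congr_ae hl, key]
  congr 1
  have hgi : Integrable g (Λ.restrict B) := g.integrable_of_isFiniteMeasure
  rw [integral_sub hgi (integrable_const _), SimpleFunc.integral_eq_sum g hgi]
  have h1 := SimpleFunc.sum_range_measure_preimage_singleton g (Λ.restrict B)
  have h2 : ∫ _ in B, (1 : ℂ) ∂Λ = ∑ x ∈ g.range, ((Λ.restrict B).real (g ⁻¹' {x}) : ℂ) := by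
    rw [integral_const, Complex.real_smul, mul_one, measureReal_def, ← h1,
      ENNReal.toReal_sum (fun _ _ => measure_ne_top _ _)]
    push_cast; rfl
  rw [h2, ← Finset.sum_sub_distrib]
  refine (Finset.sum_coe_sort g.range (fun c => (Λ.real (g ⁻¹' {c} ∩ B) : ℂ) * (c - 1))).trans
    (Finset.sum_congr rfl fun k _ => ?_)
  rw [measureReal_restrict_apply (g.measurableSet_preimage _), Complex.real_smul]
  ring

/-- Laplace functional of a Poisson process. -/
lemma integral_finprod (hX : IsPoissonProcess P X Λ) {f : E → ℂ} (hf : Measurable f)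
    (hf1 : ∀ x, ‖f x‖ ≤ 1) {B : Set E} (hB : MeasurableSet B) (hΛ : Λ B ≠ ⊤)
    (hfB : ∀ x ∉ B, f x = 1) :
    ∫ ω, ∏ᶠ i, f (X i ω) ∂P = Complex.exp (∫ x, (f x - 1) ∂Λ) := by
  classical
  have h0 : (0 : ℂ) ∈ Metric.closedBall (0 : ℂ) 1 := by simp
  -- Approximating within the closed unit ball keeps all products bounded by one, so dominated
  -- convergence applies on both sides.
  let g : ℕ → SimpleFunc E ℂ := SimpleFunc.approxOn f hf (Metric.closedBall (0 : ℂ) 1) 0 h0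
  have hg1 : ∀ n x, ‖g n x‖ ≤ 1 := fun n x => by
    simpa using SimpleFunc.approxOn_mem hf h0 n x
  have hgt : ∀ x, Tendsto (fun n => g n x) atTop (𝓝 (f x)) := fun x =>
    SimpleFunc.tendsto_approxOn hf h0 (subset_closure (by simpa using hf1 x))
  have hfin : IsFiniteMeasure (Λ.restrict B) := ⟨by simpa [lt_top_iff_ne_top] using hΛ⟩
  have heq : ∀ᵐ ω ∂P, ∀ h : E → ℂ, ∃ S : Finset ι, ∏ᶠ i, (if X i ω ∈ B then h (X i ω) else 1) =
      ∏ i ∈ S, h (X i ω) := by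
    filter_upwards [hX.ae_finite hB hΛ] with ω hω h
    refine ⟨hω.toFinset, ?_⟩
    rw [finprod_eq_prod_of_mulSupport_subset (s := hω.toFinset)]
    · exact Finset.prod_congr rfl fun i hi => by rw [if_pos]; simpa using hi
    · intro i hi
      by_contra h'
      exact hi (if_neg (show ¬ X i ω ∈ B by simpa using h'))
  have hmeas : ∀ h : E → ℂ, Measurable h →
      AEStronglyMeasurable (fun ω => ∏ᶠ i, (if X i ω ∈ B then h (X i ω) else 1)) P := by
    intro h hh
    refine aestronglyMeasurable_of_tendsto_ae (u := (atTop : Filter (Finset ι)))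
      (f := fun S ω => ∏ i ∈ S, (if X i ω ∈ B then h (X i ω) else 1)) ?_ ?_
    · intro S
      refine (Finset.measurable_fun_prod S fun i _ => ?_).aestronglyMeasurable
      exact Measurable.ite (hX.1 i hB) (hh.comp (hX.1 i)) measurable_const
    · filter_upwards [hX.ae_finite hB hΛ] with ω hω
      refine tendsto_const_nhds.congr' ?_
      filter_upwards [eventually_ge_atTop hω.toFinset] with S hS
      refine finprod_eq_prod_of_mulSupport_subset _ ?_
      intro i hi
      refine hS ?_
      by_contra h'
      exact hi (if_neg (show ¬ X i ω ∈ B by simpa using h'))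
  have e1 : ∀ x, f x = if x ∈ B then f x else 1 := fun x => by
    split_ifs with h
    · rfl
    · exact hfB x h
  have lim1 : Tendsto (fun n => ∫ ω, ∏ᶠ i, (if X i ω ∈ B then g n (X i ω) else 1) ∂P) atTop
      (𝓝 (∫ ω, ∏ᶠ i, f (X i ω) ∂P)) := by
    refine tendsto_integral_of_dominated_convergence (fun _ => 1) (fun n => hmeas _ (g n).measurable)
      (integrable_const _) ?_ ?_
    · intro n
      filter_upwards [heq] with ω hω
      obtain ⟨S, hS⟩ := hω (g n)
      rw [hS, norm_prod]
      exact Finset.prod_le_one (fun _ _ => norm_nonneg _) fun i _ => hg1 _ _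
    · filter_upwards [hX.ae_finite hB hΛ] with ω hω
      have hp : ∀ h : E → ℂ, ∏ᶠ i, (if X i ω ∈ B then h (X i ω) else 1) =
          ∏ i ∈ hω.toFinset, h (X i ω) := by
        intro h
        rw [finprod_eq_prod_of_mulSupport_subset (s := hω.toFinset)]
        · exact Finset.prod_congr rfl fun i hi => by rw [if_pos]; simpa using hi
        · intro i hi
          by_contra h'
          exact hi (if_neg (show ¬ X i ω ∈ B by simpa using h'))
      have : ∏ᶠ i, f (X i ω) = ∏ᶠ i, (if X i ω ∈ B then f (X i ω) else 1) :=
        finprod_congr fun i => e1 _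
      rw [this, hp]
      simp_rw [hp]
      exact tendsto_finsetProd _ fun i _ => hgt _
  have lim2 : Tendsto (fun n => Complex.exp (∫ x in B, (g n x - 1) ∂Λ)) atTop
      (𝓝 (Complex.exp (∫ x in B, (f x - 1) ∂Λ))) := by
    refine (Complex.continuous_exp.tendsto _).comp ?_
    refine tendsto_integral_of_dominated_convergence (fun _ => 2)
      (fun n => ((g n).measurable.sub_const 1).aestronglyMeasurable) (integrable_const _) ?_ ?_
    · intro n
      refine Eventually.of_forall fun x => (norm_sub_le _ _).trans ?_
      have := hg1 n x
      rw [norm_one]; linarith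
    · exact Eventually.of_forall fun x => (hgt x).sub_const 1
  have lim1' := lim1.congr fun n => hX.integral_finprod_simpleFunc (g n) hB hΛ
  rw [tendsto_nhds_unique lim1' lim2, setIntegral_eq_integral_of_forall_compl_eq_zero]
  intro x hx
  rw [hfB x hx, sub_self]

/-- Campbell's formula for sets. -/
lemma tsum_measure_preimage (hX : IsPoissonProcess P X Λ) {B : Set E} (hB : MeasurableSet B)
    (hΛ : Λ B ≠ ⊤) : ∑' i, P (X i ⁻¹' B) = Λ B := by
  have h1 : ∑' i, P (X i ⁻¹' B) = ∫⁻ ω, ∑' i, B.indicator (1 : E → ENNReal) (X i ω) ∂P := by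
    rw [lintegral_tsum (f := fun i ω => B.indicator (1 : E → ENNReal) (X i ω))
      fun i => ((measurable_one.indicator hB).comp (hX.1 i)).aemeasurable]
    refine tsum_congr fun i => ?_
    rw [← lintegral_indicator_one (hX.1 i hB)]
    rfl
  have h2 : ∫⁻ ω, ∑' i, B.indicator (1 : E → ENNReal) (X i ω) ∂P =
      ∫⁻ ω, (({i | X i ω ∈ B}.ncard : ℕ) : ENNReal) ∂P := by
    refine lintegral_congr_ae ?_
    filter_upwards [hX.ae_finite hB hΛ] with ω hω
    rw [tsum_indicator_eq_encard, ← hω.cast_ncard_eq]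
    simp
  have h3 : P.map (fun ω => {i | X i ω ∈ B}.ncard) = poissonMeasure (Λ B).toNNReal := by
    refine Measure.ext_of_singleton fun c => ?_
    rw [Measure.map_apply (hX.measurable_ncard hB) (measurableSet_singleton _),
      ← hX.measure_encard_eq hB hΛ c]
    refine measure_congr ?_
    filter_upwards [hX.ae_finite hB hΛ] with ω hω
    refine propext ?_
    change {i | X i ω ∈ B}.ncard = c ↔ {i | X i ω ∈ B}.encard = (c : ℕ∞)
    rw [← hω.cast_ncard_eq]
    norm_cast
  rw [h1, h2, ← lintegral_map (f := fun n : ℕ => (n : ENNReal)) (measurable_of_countable _)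
    (hX.measurable_ncard hB), h3, lintegral_countable']
  set r := (Λ B).toNNReal with hr
  -- The mean of the Poisson law: the term n = 0 vanishes, and shifting the index turns n r^n/n!
  -- into r · r^{n−1}/(n−1)!.
  have hs : HasSum (fun n : ℕ => (n : ℝ) * (Real.exp (-r) * r ^ n / n.factorial)) r := by
    rw [← hasSum_nat_add_iff' 1]
    have h := (hasSum_one_poissonMeasure r).mul_left (r : ℝ)
    simp only [Finset.range_one, Finset.sum_singleton, Nat.cast_zero, zero_mul, sub_zero]
    rw [mul_one] at h
    refine h.congr_fun ?_ |> fun h => h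
    intro n
    have h1 : (n.factorial : ℝ) ≠ 0 := by exact_mod_cast n.factorial_ne_zero
    have h2 : ((n : ℝ) + 1) ≠ 0 := by exact_mod_cast n.succ_ne_zero
    rw [Nat.factorial_succ, pow_succ]; push_cast
    field_simp
  have e : ∀ n : ℕ, (n : ENNReal) * poissonMeasure r {n} =
      ENNReal.ofReal ((n : ℝ) * (Real.exp (-r) * r ^ n / n.factorial)) := by
    intro n
    rw [poissonMeasure_singleton, ENNReal.ofReal_mul (Nat.cast_nonneg n), ENNReal.ofReal_natCast]
  simp_rw [e]
  rw [← ENNReal.ofReal_tsum_of_nonneg (fun n => by positivity) hs.summable, hs.tsum_eq,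
    ENNReal.ofReal_coe_nnreal, hr, ENNReal.coe_toNNReal hΛ]

/-- Campbell's formula. -/
lemma tsum_lintegral [SigmaFinite Λ] (hX : IsPoissonProcess P X Λ) {g : E → ENNReal}
    (hg : Measurable g) : ∑' i, ∫⁻ ω, g (X i ω) ∂P = ∫⁻ x, g x ∂Λ := by
  -- The formula for sets identifies the sum of the laws of the points on sets of finite intensity,
  -- a π-system that generates the σ-algebra and exhausts the space.
  have h : Measure.sum (fun i => P.map (X i)) = Λ := by
    refine (Measure.ext_of_generateFrom_of_iUnion {B | MeasurableSet B ∧ Λ B ≠ ⊤} (spanningSets Λ) ?_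
      ?_ (iUnion_spanningSets Λ) ?_ ?_ ?_).symm
    · refine le_antisymm (fun B hB => ?_) (MeasurableSpace.generateFrom_le fun B hB => hB.1)
      have : B = ⋃ n, B ∩ spanningSets Λ n := by
        rw [← inter_iUnion, iUnion_spanningSets, inter_univ]
      rw [this]
      refine MeasurableSet.iUnion fun n => MeasurableSpace.measurableSet_generateFrom
        ⟨hB.inter (measurableSet_spanningSets Λ n), ?_⟩
      exact measure_ne_top_of_subset inter_subset_right (measure_spanningSets_lt_top Λ n).ne
    · rintro A hA B hB -
      exact ⟨hA.1.inter hB.1, measure_ne_top_of_subset inter_subset_right hB.2⟩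
    · exact fun n => ⟨measurableSet_spanningSets Λ n, (measure_spanningSets_lt_top Λ n).ne⟩
    · exact fun n => (measure_spanningSets_lt_top Λ n).ne
    · rintro B ⟨hB, hΛ⟩
      rw [Measure.sum_apply _ hB, ← hX.tsum_measure_preimage hB hΛ]
      exact tsum_congr fun i => (Measure.map_apply (hX.1 i) hB).symm
  rw [← h, lintegral_sum_measure]
  exact tsum_congr fun i => (lintegral_map hg (hX.1 i)).symm

/-- With a the intensity of B, the probability of at least two points is 1 − e^{−a}(1+a), and e^{−a}
≥ 1 − a bounds it by 1 − (1−a)(1+a) = a². The quadratic order is what rules out coincidences. -/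
lemma measure_two_points_le (hX : IsPoissonProcess P X Λ) {B : Set E} (hB : MeasurableSet B)
    (hΛ : Λ B ≠ ⊤) : P {ω | ∃ i j, i ≠ j ∧ X i ω ∈ B ∧ X j ω ∈ B} ≤ ENNReal.ofReal (Λ.real B ^ 2) := by
  have hsub : {ω | ∃ i j, i ≠ j ∧ X i ω ∈ B ∧ X j ω ∈ B} ⊆
      ({ω | {i | X i ω ∈ B}.encard = ((0 : ℕ) : ℕ∞)} ∪ {ω | {i | X i ω ∈ B}.encard = ((1 : ℕ) : ℕ∞)})ᶜ := by
    rintro ω ⟨i, j, hij, hi, hj⟩ (h | h)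
    · have : {i | X i ω ∈ B} = ∅ := by simpa using h
      exact (this ▸ (show i ∈ {i | X i ω ∈ B} from hi) : i ∈ (∅ : Set ι))
    · have h : {i | X i ω ∈ B}.encard = 1 := by simpa using h
      obtain ⟨k, hk⟩ := Set.encard_eq_one.1 h
      have h1 : i ∈ ({k} : Set ι) := hk ▸ (show i ∈ {i | X i ω ∈ B} from hi)
      have h2 : j ∈ ({k} : Set ι) := hk ▸ (show j ∈ {i | X i ω ∈ B} from hj)
      exact hij (h1.trans h2.symm)
  refine (measure_mono hsub).trans ?_
  have hm0 := hX.measurableSet_encard_eq hB 0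
  have hm1 := hX.measurableSet_encard_eq hB 1
  rw [prob_compl_eq_one_sub (hm0.union hm1), measure_union _ hm1, hX.measure_encard_eq hB hΛ,
    hX.measure_encard_eq hB hΛ, poissonMeasure_singleton, poissonMeasure_singleton,
    ENNReal.coe_toNNReal_eq_toReal, ← ENNReal.ofReal_add (by positivity) (by positivity),
    ← ENNReal.ofReal_one, ← ENNReal.ofReal_sub _ (by positivity)]
  · refine ENNReal.ofReal_le_ofReal ?_
    simp only [← measureReal_def, pow_zero, mul_one, Nat.factorial_zero, Nat.cast_one, div_one, pow_one,
      Nat.factorial_one]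
    have h0 : 0 ≤ Λ.real B := measureReal_nonneg
    nlinarith [Real.add_one_le_exp (-Λ.real B)]
  · refine Set.disjoint_left.2 fun ω (h1 : _ = _) (h2 : _ = _) => ?_
    rw [h1] at h2
    norm_num at h2

end IsPoissonProcess
end PoissonProcess
end
end RisNet

namespace RisNet
noncomputable section

/-! ### Integrating marks with positions frozen -/

section Freezing

open Filter Topology

set_option linter.unusedSectionVars false

variable {Ω : Type*} [MeasurableSpace Ω] {P : Measure Ω} [IsProbabilityMeasure P]

lemma integrable_of_measurable_of_norm_le {α : Type*} [MeasurableSpace α] {μ : Measure α}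
    [IsFiniteMeasure μ] {f : α → ℂ} (hf : AEStronglyMeasurable f μ) {C : ℝ} (hC : ∀ x, ‖f x‖ ≤ C) :
    Integrable f μ := Integrable.of_bound hf C (Eventually.of_forall hC)

/-- Fubini on the product law: the second variable is replaced by an independent copy, integrated
first. -/
lemma integral_indep_eq {α β : Type*} [MeasurableSpace α] [MeasurableSpace β] {U : Ω → α} {V : Ω → β}
    (hU : Measurable U) (hV : Measurable V) (h : IndepFun U V P) {f : α → β → ℂ}
    (hf : Measurable (Function.uncurry f)) {C : ℝ} (hC : ∀ x y, ‖f x y‖ ≤ C) :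
    ∫ ω, f (U ω) (V ω) ∂P = ∫ ω, ∫ ω', f (U ω) (V ω') ∂P ∂P := by
  have hmU := Measure.isProbabilityMeasure_map (μ := P) hU.aemeasurable
  have hmV := Measure.isProbabilityMeasure_map (μ := P) hV.aemeasurable
  have h1 := (indepFun_iff_map_prod_eq_prod_map_map hU.aemeasurable hV.aemeasurable).1 h
  have h2 := integral_map (μ := P) (φ := fun ω => (U ω, V ω)) (f := Function.uncurry f)
    (hU.prodMk hV).aemeasurable hf.aestronglyMeasurable
  have h2' : ∫ ω, f (U ω) (V ω) ∂P = ∫ ω, Function.uncurry f (U ω, V ω) ∂P := rfl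
  rw [h2', ← h2, h1, integral_prod _ (integrable_of_measurable_of_norm_le hf.aestronglyMeasurable
    (fun z => hC z.1 z.2)), integral_map hU.aemeasurable]
  · refine integral_congr_ae (Eventually.of_forall fun ω => ?_)
    simp only
    rw [integral_map hV.aemeasurable]
    · rfl
    · exact (hf.comp measurable_prodMk_left).aestronglyMeasurable
  · exact (hf.stronglyMeasurable.integral_prod_right).aestronglyMeasurable

variable {E M ι : Type*} [MeasurableSpace E] [MeasurableSpace M] [Countable ι]
  {X : ι → Ω → E} {m : ι → Ω → M}

lemma measurable_integral_mark {α : Type*} [MeasurableSpace α] {V : Ω → M} (hV : Measurable V)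
    {f : α → M → ℂ} (hf : Measurable (Function.uncurry f)) :
    Measurable fun x => ∫ ω, f x (V ω) ∂P := by
  have : Measurable (Function.uncurry fun x ω => f x (V ω)) :=
    hf.comp (measurable_fst.prodMk (hV.comp measurable_snd))
  exact (this.stronglyMeasurable.integral_prod_right).measurable

/-- With positions frozen, the integral of the product over independent marks factors. The factor of
a point may depend on the whole configuration, because whether a BS is the nearest one does. -/
lemma integral_prod_marks (hX : ∀ i, Measurable (X i)) (hm : ∀ i, Measurable (m i))
    (hind : IndepFun (fun ω i => X i ω) (fun ω i => m i ω) P) (hmi : iIndepFun m P)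
    {A : (ι → E) → ℂ} (hA : Measurable A) {C : ℝ} (hAC : ∀ x, ‖A x‖ ≤ C)
    {f : ι → (ι → E) → M → ℂ} (hf : ∀ i, Measurable (Function.uncurry (f i)))
    (hf1 : ∀ i x y, ‖f i x y‖ ≤ 1) (S : Finset ι) :
    ∫ ω, A (fun i => X i ω) * ∏ k ∈ S, f k (fun i => X i ω) (m k ω) ∂P =
      ∫ ω, A (fun i => X i ω) * ∏ k ∈ S, ∫ ω', f k (fun i => X i ω) (m k ω') ∂P ∂P := by
  have h := integral_indep_eq (P := P) (U := fun ω i => X i ω) (V := fun ω i => m i ω)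
    (measurable_pi_lambda _ hX) (measurable_pi_lambda _ hm) hind
    (f := fun x y => A x * ∏ k ∈ S, f k x (y k)) (C := C) ?_ ?_
  · rw [h]
    refine integral_congr_ae (Eventually.of_forall fun ω => ?_)
    simp only
    rw [integral_const_mul]
    congr 1
    set x := fun i => X i ω
    have hS : iIndepFun (fun k : S => m k) P := hmi.precomp Subtype.val_injective
    have := hS.integral_fun_prod_comp (f := fun (k : S) (y : M) => f k x y)
      (fun k => (hm k).aemeasurable)
      (fun k => ((hf k).comp measurable_prodMk_left).aestronglyMeasurable)
    rw [Finset.prod_coe_sort S (fun k => ∫ ω', f k x (m k ω') ∂P)] at this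
    rw [← this]
    refine integral_congr_ae (Eventually.of_forall fun ω' => ?_)
    exact (Finset.prod_coe_sort S (fun k => f k x (m k ω'))).symm
  · refine (hA.comp measurable_fst).mul (Finset.measurable_fun_prod S fun k _ => ?_)
    exact (hf k).comp (measurable_fst.prodMk ((measurable_pi_apply k).comp measurable_snd))
  · intro x y
    rw [norm_mul, norm_prod]
    have h1 : ∏ k ∈ S, ‖f k x (y k)‖ ≤ 1 :=
      Finset.prod_le_one (fun _ _ => norm_nonneg _) fun i _ => hf1 _ _ _
    calc ‖A x‖ * ∏ k ∈ S, ‖f k x (y k)‖ ≤ ‖A x‖ * 1 := by gcongr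
      _ ≤ C := by rw [mul_one]; exact hAC x

/-- Averaging over the marks of all points, in the limit of an increasing set of points. -/
lemma integral_marks_of_tendsto (hX : ∀ i, Measurable (X i)) (hm : ∀ i, Measurable (m i))
    (hind : IndepFun (fun ω i => X i ω) (fun ω i => m i ω) P) (hmi : iIndepFun m P)
    {A : (ι → E) → ℂ} (hA : Measurable A) {C : ℝ} (hAC : ∀ x, ‖A x‖ ≤ C)
    {f : ι → (ι → E) → M → ℂ} (hf : ∀ i, Measurable (Function.uncurry (f i)))
    (hf1 : ∀ i x y, ‖f i x y‖ ≤ 1) {Z Z' : Ω → ℂ}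
    (hZ : ∀ᵐ ω ∂P, Tendsto (fun S : Finset ι => ∏ k ∈ S, f k (fun i => X i ω) (m k ω)) atTop (𝓝 (Z ω)))
    (hZ' : ∀ᵐ ω ∂P, Tendsto (fun S : Finset ι => ∏ k ∈ S, ∫ ω', f k (fun i => X i ω) (m k ω') ∂P)
      atTop (𝓝 (Z' ω))) :
    ∫ ω, A (fun i => X i ω) * Z ω ∂P = ∫ ω, A (fun i => X i ω) * Z' ω ∂P := by
  have hXm : Measurable fun ω i => X i ω := measurable_pi_lambda _ hX
  have hC0 : ∀ x : ι → E, 0 ≤ C := fun x => (norm_nonneg _).trans (hAC x)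
  have bd : ∀ (S : Finset ι) (x : ι → E) (g : ι → ℂ), (∀ k, ‖g k‖ ≤ 1) → ‖A x * ∏ k ∈ S, g k‖ ≤ C := by
    intro S x g hg
    rw [norm_mul, norm_prod]
    have h1 : ∏ k ∈ S, ‖g k‖ ≤ 1 :=
      Finset.prod_le_one (fun _ _ => norm_nonneg _) fun i _ => hg i
    calc ‖A x‖ * ∏ k ∈ S, ‖g k‖ ≤ ‖A x‖ * 1 := by gcongr
      _ ≤ C := by rw [mul_one]; exact hAC x
  have l1 : Tendsto (fun S : Finset ι =>
      ∫ ω, A (fun i => X i ω) * ∏ k ∈ S, f k (fun i => X i ω) (m k ω) ∂P) atTop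
      (𝓝 (∫ ω, A (fun i => X i ω) * Z ω ∂P)) := by
    refine tendsto_integral_filter_of_dominated_convergence (fun _ => C) ?_ ?_ (integrable_const _) ?_
    · refine Eventually.of_forall fun S => Measurable.aestronglyMeasurable ?_
      refine (hA.comp hXm).mul (Finset.measurable_fun_prod S fun k _ => ?_)
      exact (hf k).comp (hXm.prodMk (hm k))
    · exact Eventually.of_forall fun S => Eventually.of_forall fun ω => bd S _ _ fun k => hf1 _ _ _
    · filter_upwards [hZ] with ω hω using hω.const_mul _
  have l2 : Tendsto (fun S : Finset ι =>
      ∫ ω, A (fun i => X i ω) * ∏ k ∈ S, ∫ ω', f k (fun i => X i ω) (m k ω') ∂P ∂P) atTop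
      (𝓝 (∫ ω, A (fun i => X i ω) * Z' ω ∂P)) := by
    refine tendsto_integral_filter_of_dominated_convergence (fun _ => C) ?_ ?_ (integrable_const _) ?_
    · refine Eventually.of_forall fun S => Measurable.aestronglyMeasurable ?_
      refine (hA.comp hXm).mul (Finset.measurable_fun_prod S fun k _ => ?_)
      exact (measurable_integral_mark (hm k) (hf k)).comp hXm
    · refine Eventually.of_forall fun S => Eventually.of_forall fun ω => bd S _ _ fun k => ?_
      refine (norm_integral_le_of_norm_le_const (Eventually.of_forall fun ω' => hf1 _ _ _)).trans ?_
      simp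
    · filter_upwards [hZ'] with ω hω using hω.const_mul _
  simp_rw [integral_prod_marks hX hm hind hmi hA hAC hf hf1] at l1
  exact tendsto_nhds_unique l1 l2

lemma tendsto_prod_finprod {g : ι → ℂ} {S : Set ι} (hS : S.Finite) (hg : ∀ i ∉ S, g i = 1) :
    Tendsto (fun T : Finset ι => ∏ k ∈ T, g k) atTop (𝓝 (∏ᶠ k, g k)) := by
  refine tendsto_const_nhds.congr' ?_
  filter_upwards [eventually_ge_atTop hS.toFinset] with T hT
  refine finprod_eq_prod_of_mulSupport_subset _ fun i hi => hT ?_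
  by_contra h
  exact hi (hg i (by simpa using h))

lemma finprod_eq_prod_toFinset {g : ι → ℂ} {S : Set ι} (hS : S.Finite) (hg : ∀ i ∉ S, g i = 1) :
    ∏ᶠ k, g k = ∏ k ∈ hS.toFinset, g k := by
  refine finprod_eq_prod_of_mulSupport_subset _ fun i hi => ?_
  by_contra h
  exact hi (hg i (by simpa using h))

lemma norm_finprod_le_one {g : ι → ℂ} {S : Set ι} (hS : S.Finite) (hg : ∀ i ∉ S, g i = 1)
    (h1 : ∀ i, ‖g i‖ ≤ 1) : ‖∏ᶠ k, g k‖ ≤ 1 := by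
  rw [finprod_eq_prod_toFinset hS hg, norm_prod]
  exact Finset.prod_le_one (fun _ _ => norm_nonneg _) fun i _ => h1 _

lemma aestronglyMeasurable_finprod {g : ι → Ω → ℂ} (hg : ∀ i, Measurable (g i)) {S : Ω → Set ι}
    (hS : ∀ᵐ ω ∂P, (S ω).Finite ∧ ∀ i ∉ S ω, g i ω = 1) :
    AEStronglyMeasurable (fun ω => ∏ᶠ k, g k ω) P := by
  refine aestronglyMeasurable_of_tendsto_ae (u := (atTop : Filter (Finset ι)))
    (f := fun S ω => ∏ i ∈ S, g i ω) ?_ ?_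
  · exact fun S => (Finset.measurable_fun_prod S fun i _ => hg i).aestronglyMeasurable
  · filter_upwards [hS] with ω hω using tendsto_prod_finprod hω.1 hω.2

/-- Laplace functional of an independently marked Poisson process. -/
lemma IsPoissonProcess.integral_finprod_marks {Λ : Measure E} (hX : IsPoissonProcess P X Λ)
    (hm : ∀ i, Measurable (m i))
    (hind : IndepFun (fun ω i => X i ω) (fun ω i => m i ω) P) (hmi : iIndepFun m P)
    {f : E → M → ℂ} (hf : Measurable (Function.uncurry f)) (hf1 : ∀ x y, ‖f x y‖ ≤ 1)
    {B : Set E} (hB : MeasurableSet B) (hΛ : Λ B ≠ ⊤) (hfB : ∀ x ∉ B, ∀ y, f x y = 1)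
    {g : E → ℂ} (hg : Measurable g) (hfg : ∀ x k, ∫ ω, f x (m k ω) ∂P = g x)
    (hgB : ∀ x ∉ B, g x = 1) (hg1 : ∀ x, ‖g x‖ ≤ 1) :
    ∫ ω, ∏ᶠ k, f (X k ω) (m k ω) ∂P = Complex.exp (∫ x, (g x - 1) ∂Λ) := by
  have h := integral_marks_of_tendsto (P := P) hX.1 hm hind hmi (A := fun _ => 1) measurable_const
    (C := 1) (by simp) (f := fun i x y => f (x i) y)
    (fun i => by
      have hp : Measurable fun q : (ι → E) × M => (q.1 i, q.2) := by fun_prop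
      exact hf.comp hp)
    (fun i x y => hf1 _ _) (Z := fun ω => ∏ᶠ k, f (X k ω) (m k ω)) (Z' := fun ω => ∏ᶠ k, g (X k ω))
    ?_ ?_
  · simp only [one_mul] at h
    rw [h, hX.integral_finprod hg hg1 hB hΛ hgB]
  · filter_upwards [hX.ae_finite hB hΛ] with ω hω
    exact tendsto_prod_finprod hω fun i hi => hfB _ hi _
  · filter_upwards [hX.ae_finite hB hΛ] with ω hω
    simp only [hfg]
    exact tendsto_prod_finprod hω fun i hi => hgB _ hi

end Freezing
end
end RisNet

namespace RisNet
noncomputable section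

/-! ### Homogeneous processes in the plane and their nearest point -/

section PlanePoisson

open Filter Topology

set_option linter.unusedSectionVars false

variable {Ω ι : Type*} [MeasurableSpace Ω] {P : Measure Ω} [IsProbabilityMeasure P] [Countable ι]
  {X : ι → Ω → Plane}

/-- The homogeneous intensity measure of density `lam` on the plane. -/
abbrev homog (lam : ℝ) : Measure Plane := ENNReal.ofReal lam • volume

instance (lam : ℝ) : SigmaFinite (homog lam) :=
  SMul.sigmaFinite (μ := (volume : Measure Plane)) lam.toNNReal

lemma homog_closedBall_ne_top (lam R : ℝ) : homog lam (Metric.closedBall 0 R) ≠ ⊤ := by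
  rw [homog, Measure.smul_apply, smul_eq_mul]
  exact ENNReal.mul_ne_top ENNReal.ofReal_ne_top measure_closedBall_lt_top.ne

lemma homog_real_closedBall {lam R : ℝ} (hl : 0 ≤ lam) (hR : 0 ≤ R) :
    (homog lam).real (Metric.closedBall 0 R) = lam * (Real.pi * R ^ 2) := by
  rw [homog, measureReal_def, Measure.smul_apply, smul_eq_mul,
    EuclideanSpace.volume_closedBall_fin_two, ENNReal.toReal_mul, ENNReal.toReal_mul,
    ENNReal.toReal_ofReal hl, ENNReal.toReal_pow, ENNReal.toReal_ofReal hR]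
  simp [mul_comm, Real.pi_nonneg]

/-- The annulus of radii `a` and `c`. -/
def annulus (a c : ℝ) : Set Plane := {y | a < ‖y‖ ∧ ‖y‖ ≤ c}

lemma measurableSet_annulus (a c : ℝ) : MeasurableSet (annulus a c) := by
  rw [annulus, ofPred_and]
  exact (measurableSet_lt measurable_const measurable_norm).inter
    (measurableSet_le measurable_norm measurable_const)

lemma annulus_subset (a c : ℝ) : annulus a c ⊆ Metric.closedBall 0 c := fun y hy => by
  simpa using hy.2

lemma homog_annulus_ne_top (lam a c : ℝ) : homog lam (annulus a c) ≠ ⊤ :=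
  measure_ne_top_of_subset (annulus_subset a c) (homog_closedBall_ne_top lam c)

lemma homog_real_annulus {lam a c : ℝ} (hl : 0 ≤ lam) (ha : 0 ≤ a) (hac : a ≤ c) :
    (homog lam).real (annulus a c) = lam * (Real.pi * (c ^ 2 - a ^ 2)) := by
  have e : annulus a c = Metric.closedBall 0 c \ Metric.closedBall 0 a := by
    ext y; simp [annulus, and_comm]
  rw [e, measureReal_sdiff (Metric.closedBall_subset_closedBall hac) measurableSet_closedBall
    (homog_closedBall_ne_top lam c), homog_real_closedBall hl (ha.trans hac),
    homog_real_closedBall hl ha]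
  ring

lemma IsPoissonProcess.ae_locallyFinite {lam : ℝ} (hX : IsPoissonProcess P X (homog lam)) :
    ∀ᵐ ω ∂P, ∀ R : ℝ, {i | ‖X i ω‖ ≤ R}.Finite := by
  have h : ∀ᵐ ω ∂P, ∀ n : ℕ, {i | X i ω ∈ Metric.closedBall (0 : Plane) n}.Finite :=
    ae_all_iff.2 fun n => hX.ae_finite measurableSet_closedBall (homog_closedBall_ne_top lam n)
  filter_upwards [h] with ω hω R
  obtain ⟨n, hn⟩ := exists_nat_ge R
  exact (hω n).subset fun i hi => by simpa using le_trans hi hn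

lemma IsPoissonProcess.ae_ne_zero {lam : ℝ} (hX : IsPoissonProcess P X (homog lam)) :
    ∀ᵐ ω ∂P, ∀ i, X i ω ≠ 0 := by
  have h := hX.measure_forall_notMem (measurableSet_singleton (0 : Plane)) (by simp [homog])
  have h0 : (homog lam).real {0} = 0 := by simp [homog, measureReal_def]
  rw [h0] at h
  have hm : MeasurableSet {ω | ∀ i, X i ω ∉ ({0} : Set Plane)} := by
    have : {ω | ∀ i, X i ω ∉ ({0} : Set Plane)} = ⋂ i, (X i ⁻¹' {0})ᶜ := by ext; simp
    rw [this]
    exact MeasurableSet.iInter fun i => (hX.1 i (measurableSet_singleton _)).compl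
  have : ∀ᵐ ω ∂P, ω ∈ {ω | ∀ i, X i ω ∉ ({0} : Set Plane)} :=
    (prob_compl_eq_zero_iff hm).2 (by simpa using h)
  filter_upwards [this] with ω hω i
  simpa using hω i

/-- Two points at equal distance lie in the same thin annulus. Cutting a disc into N+1 annuli of
equal area, each contains two points with probability at most (K/(N+1))², where K is the intensity
of the disc; the sum K²/(N+1) tends to 0. The origin, outside every annulus, is almost surely not a
point. -/
lemma IsPoissonProcess.ae_injective_norm {lam : ℝ} (hl : 0 ≤ lam)
    (hX : IsPoissonProcess P X (homog lam)) :
    ∀ᵐ ω ∂P, ∀ i j, ‖X i ω‖ = ‖X j ω‖ → i = j := by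
  have key : ∀ R : ℕ, P {ω | ∃ i j, i ≠ j ∧ ‖X i ω‖ = ‖X j ω‖ ∧ 0 < ‖X i ω‖ ∧ ‖X i ω‖ ≤ R} = 0 := by
    intro R
    set K := lam * (Real.pi * (R : ℝ) ^ 2) with hK
    have hK0 : 0 ≤ K := by positivity
    have bound : ∀ N : ℕ, P {ω | ∃ i j, i ≠ j ∧ ‖X i ω‖ = ‖X j ω‖ ∧ 0 < ‖X i ω‖ ∧ ‖X i ω‖ ≤ R} ≤
        ENNReal.ofReal (K ^ 2 / (N + 1)) := by
      intro N
      -- The square roots make the squared radii, hence the areas, equally spaced.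
      let r : ℕ → ℝ := fun k => R * Real.sqrt (k / (N + 1))
      have hr0 : ∀ k, 0 ≤ r k := fun k => by positivity
      have hrm : Monotone r := fun a b hab => by
        have : (a : ℝ) ≤ b := by exact_mod_cast hab
        simp only [r]; gcongr
      have hrs : ∀ k, r k ^ 2 = (R : ℝ) ^ 2 * (k / (N + 1)) := fun k => by
        rw [mul_pow, Real.sq_sqrt (by positivity)]
      have hsub : {ω | ∃ i j, i ≠ j ∧ ‖X i ω‖ = ‖X j ω‖ ∧ 0 < ‖X i ω‖ ∧ ‖X i ω‖ ≤ R} ⊆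
          ⋃ k ∈ Finset.range (N + 1),
            {ω | ∃ i j, i ≠ j ∧ X i ω ∈ annulus (r k) (r (k + 1)) ∧ X j ω ∈ annulus (r k) (r (k + 1))} := by
        rintro ω ⟨i, j, hij, he, h0, hR⟩
        have hex : ∃ k, ‖X i ω‖ ≤ r k := ⟨N + 1, by
          have : ((N + 1 : ℕ) : ℝ) / (N + 1) = 1 := by push_cast; field_simp
          simp only [r, this]; simpa using hR⟩
        classical
        have hk0 : Nat.find hex ≠ 0 := by
          intro hz
          have := Nat.find_spec hex
          rw [hz] at this
          simp only [r, Nat.cast_zero, zero_div, Real.sqrt_zero, mul_zero] at this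
          linarith
        obtain ⟨k, hk⟩ := Nat.exists_eq_succ_of_ne_zero hk0
        have hkN : k < N + 1 := by
          have : Nat.find hex ≤ N + 1 := Nat.find_min' hex (by
            have : ((N + 1 : ℕ) : ℝ) / (N + 1) = 1 := by push_cast; field_simp
            simp only [r, this]; simpa using hR)
          omega
        have hup : ‖X i ω‖ ≤ r (k + 1) := by
          have := Nat.find_spec hex; rwa [hk] at this
        have hlo : r k < ‖X i ω‖ := not_le.1 (Nat.find_min hex (by omega))
        simp only [mem_iUnion]
        exact ⟨k, Finset.mem_range.2 hkN, i, j, hij, ⟨hlo, hup⟩, ⟨he ▸ hlo, he ▸ hup⟩⟩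
      refine (measure_mono hsub).trans ((measure_biUnion_finset_le _ _).trans ?_)
      have hper : ∀ k ∈ Finset.range (N + 1),
          P {ω | ∃ i j, i ≠ j ∧ X i ω ∈ annulus (r k) (r (k + 1)) ∧ X j ω ∈ annulus (r k) (r (k + 1))} ≤
          ENNReal.ofReal ((K / (N + 1)) ^ 2) := by
        intro k _
        refine (hX.measure_two_points_le (measurableSet_annulus _ _) (homog_annulus_ne_top _ _ _)).trans ?_
        rw [homog_real_annulus hl (hr0 k) (hrm (Nat.le_succ k)), hrs, hrs]
        refine ENNReal.ofReal_le_ofReal (le_of_eq ?_)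
        push_cast; rw [hK]; field_simp; ring
      refine (Finset.sum_le_sum hper).trans (le_of_eq ?_)
      rw [Finset.sum_const, Finset.card_range, nsmul_eq_mul, ← ENNReal.ofReal_natCast,
        ← ENNReal.ofReal_mul (by positivity)]
      congr 1; push_cast; field_simp
    have lim : Tendsto (fun N : ℕ => ENNReal.ofReal (K ^ 2 / (N + 1))) atTop (𝓝 0) := by
      have : Tendsto (fun N : ℕ => K ^ 2 / ((N : ℝ) + 1)) atTop (𝓝 0) :=
        tendsto_const_nhds.div_atTop (tendsto_atTop_add_const_right _ _ tendsto_natCast_atTop_atTop)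
      simpa using ENNReal.tendsto_ofReal this
    exact le_antisymm (ge_of_tendsto' lim bound) bot_le
  have hall : ∀ᵐ ω ∂P, ∀ R : ℕ, ¬ ∃ i j, i ≠ j ∧ ‖X i ω‖ = ‖X j ω‖ ∧ 0 < ‖X i ω‖ ∧ ‖X i ω‖ ≤ R :=
    ae_all_iff.2 fun R => by rw [ae_iff]; simp only [not_not]; exact key R
  filter_upwards [hall, hX.ae_ne_zero] with ω hω h0 i j hij
  by_contra hne
  obtain ⟨R, hR⟩ := exists_nat_ge ‖X i ω‖
  exact hω R ⟨i, j, hne, hij, norm_pos_iff.2 (h0 i), hR⟩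

/-- Point `i` of the configuration `b` is the one nearest to the origin. -/
def IsNearest (b : ι → Plane) (i : ι) : Prop := ∀ k, k ≠ i → ‖b i‖ < ‖b k‖

open Classical in
/-- The point of a configuration nearest to the origin. -/
def nearestPos (b : ι → Plane) : Plane := if h : ∃ i, IsNearest b i then b h.choose else 0

lemma IsNearest.unique {b : ι → Plane} {i j : ι} (hi : IsNearest b i) (hj : IsNearest b j) : i = j := by
  by_contra h
  exact lt_asymm (hi j (Ne.symm h)) (hj i h)

lemma IsNearest.nearestPos_eq {b : ι → Plane} {i : ι} (hi : IsNearest b i) : nearestPos b = b i := by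
  have h : ∃ i, IsNearest b i := ⟨i, hi⟩
  rw [nearestPos, dif_pos h, h.choose_spec.unique hi]

lemma measurableSet_isNearest (i : ι) : MeasurableSet {b : ι → Plane | IsNearest b i} := by
  have : {b : ι → Plane | IsNearest b i} = ⋂ k, ⋂ (_ : k ≠ i), {b | ‖b i‖ < ‖b k‖} := by
    ext b; simp [IsNearest]
  rw [this]
  exact MeasurableSet.iInter fun k => MeasurableSet.iInter fun _ =>
    measurableSet_lt (measurable_pi_apply i).norm (measurable_pi_apply k).norm

lemma measurable_nearestPos : Measurable (nearestPos : (ι → Plane) → Plane) := by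
  intro A hA
  have : nearestPos ⁻¹' A = (⋃ i, {b : ι → Plane | IsNearest b i} ∩ {b | b i ∈ A}) ∪
      ((⋃ i, {b : ι → Plane | IsNearest b i})ᶜ ∩ {_b | (0 : Plane) ∈ A}) := by
    ext b
    by_cases h : ∃ i, IsNearest b i
    · obtain ⟨i, hi⟩ := h
      simp only [mem_preimage, hi.nearestPos_eq, mem_union, mem_iUnion, mem_inter_iff, mem_ofPred_eq,
        mem_compl_iff]
      constructor
      · exact fun h => Or.inl ⟨i, hi, h⟩
      · rintro (⟨j, hj, h⟩ | ⟨h, -⟩)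
        · rwa [hi.unique hj]
        · exact (h ⟨i, hi⟩).elim
    · have h' : nearestPos b = 0 := by rw [nearestPos, dif_neg h]
      simp only [mem_preimage, h', mem_union, mem_iUnion, mem_inter_iff, mem_ofPred_eq, mem_compl_iff]
      constructor
      · exact fun h0 => Or.inr ⟨h, h0⟩
      · rintro (⟨j, hj, -⟩ | ⟨-, h0⟩)
        · exact (h ⟨j, hj⟩).elim
        · exact h0
  rw [this]
  refine MeasurableSet.union (MeasurableSet.iUnion fun i => (measurableSet_isNearest i).inter
    (measurable_pi_apply i hA)) (MeasurableSet.inter (MeasurableSet.iUnion fun i =>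
      measurableSet_isNearest i).compl (MeasurableSet.const _))

/-- A minimum exists among the finitely many points no farther than a given one; distinct norms make
it strict. -/
lemma exists_isNearest {b : ι → Plane} (hne : Nonempty ι) (hf : ∀ R : ℝ, {i | ‖b i‖ ≤ R}.Finite)
    (hinj : ∀ i j, ‖b i‖ = ‖b j‖ → i = j) : ∃ i, IsNearest b i := by
  obtain ⟨i0⟩ := hne
  obtain ⟨i, hi, hmin⟩ := Set.exists_min_image _ (fun i => ‖b i‖) (hf ‖b i0‖) ⟨i0, le_refl ‖b i0‖⟩
  refine ⟨i, fun k hk => ?_⟩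
  rcases le_or_gt ‖b k‖ ‖b i0‖ with h | h
  · exact lt_of_le_of_ne (hmin k h) fun he => hk (hinj i k he).symm
  · exact lt_of_le_of_lt hi h

/-- With no index at all, the unit disc would be void with probability 1, whereas the Poisson value
e^{−λπ} is smaller. -/
lemma IsPoissonProcess.nonempty {lam : ℝ} (hl : 0 < lam) (hX : IsPoissonProcess P X (homog lam)) :
    Nonempty ι := by
  by_contra h
  rw [not_nonempty_iff] at h
  have := hX.measure_forall_notMem (B := Metric.closedBall 0 1) measurableSet_closedBall
    (homog_closedBall_ne_top lam 1)
  rw [homog_real_closedBall hl.le zero_le_one] at this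
  simp only [IsEmpty.forall_iff] at this
  have h1 : P {_ω : Ω | True} = 1 := by
    rw [show {_ω : Ω | True} = univ from rfl, measure_univ]
  rw [h1, ← ENNReal.ofReal_one, ENNReal.ofReal_eq_ofReal_iff (by norm_num) (by positivity)] at this
  have h2 : Real.exp (-(lam * (Real.pi * 1 ^ 2))) < 1 := by
    rw [Real.exp_lt_one_iff]; have := Real.pi_pos; simp; positivity
  linarith

lemma IsPoissonProcess.ae_exists_isNearest {lam : ℝ} (hl : 0 < lam)
    (hX : IsPoissonProcess P X (homog lam)) : ∀ᵐ ω ∂P, ∃ i, IsNearest (fun i => X i ω) i := by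
  filter_upwards [hX.ae_locallyFinite, hX.ae_injective_norm hl.le] with ω h1 h2
  exact exists_isNearest (hX.nonempty hl) h1 h2

lemma lt_norm_nearestPos_iff {b : ι → Plane} (h : ∃ i, IsNearest b i) (a : ℝ) :
    a < ‖nearestPos b‖ ↔ ∀ i, b i ∉ Metric.closedBall (0 : Plane) a := by
  obtain ⟨i, hi⟩ := h
  rw [hi.nearestPos_eq]
  simp only [Metric.mem_closedBall, dist_zero_right, not_le]
  constructor
  · intro h k
    by_cases hk : k = i
    · rwa [hk]
    · exact h.trans (hi k hk)
  · exact fun h => h i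

lemma IsPoissonProcess.measure_lt_norm_nearestPos {lam : ℝ} (hl : 0 < lam)
    (hX : IsPoissonProcess P X (homog lam)) {a : ℝ} (ha : 0 ≤ a) :
    P {ω | a < ‖nearestPos fun i => X i ω‖} = ENNReal.ofReal (Real.exp (-(lam * (Real.pi * a ^ 2)))) := by
  rw [← homog_real_closedBall hl.le ha, ← hX.measure_forall_notMem measurableSet_closedBall
    (homog_closedBall_ne_top lam a)]
  refine measure_congr ?_
  filter_upwards [hX.ae_exists_isNearest hl] with ω hω
  exact propext (lt_norm_nearestPos_iff hω a)

end PlanePoisson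
end
end RisNet

namespace RisNet
noncomputable section

/-! ### The process beyond its nearest point -/

section Nearest

open Filter Topology

set_option linter.unusedSectionVars false

section Testing

variable {Ω α : Type*} [MeasurableSpace Ω] [MeasurableSpace α] {P : Measure Ω} [IsFiniteMeasure P]

/-- The hypothesis says that the conditional expectation of D given T vanishes; the bounded factor
G(T) is then pulled out. -/
lemma integral_comp_mul_eq_zero {T : Ω → α} (hT : Measurable T) {D : Ω → ℂ} (hD : Integrable D P)
    (h : ∀ S, MeasurableSet S → ∫ ω in T ⁻¹' S, D ω ∂P = 0) {G : α → ℂ} (hG : Measurable G)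
    {C : ℝ} (hGC : ∀ x, ‖G x‖ ≤ C) : ∫ ω, G (T ω) * D ω ∂P = 0 := by
  have hm : MeasurableSpace.comap T inferInstance ≤ ‹MeasurableSpace Ω› := hT.comap_le
  have h0 : (0 : Ω → ℂ) =ᵐ[P] P[D | MeasurableSpace.comap T inferInstance] := by
    refine ae_eq_condExp_of_forall_setIntegral_eq hm hD (fun s _ _ => integrableOn_zero) ?_ ?_
    · rintro s ⟨S, hS, rfl⟩ -
      rw [h S hS]
      simp
    · exact aestronglyMeasurable_zero
  have hGT : Measurable fun ω => G (T ω) := hG.comp hT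
  have hint : Integrable (fun ω => G (T ω) * D ω) P :=
    hD.bdd_mul hGT.aestronglyMeasurable (Eventually.of_forall fun ω => hGC (T ω))
  have hGm : StronglyMeasurable[MeasurableSpace.comap T inferInstance] fun ω => G (T ω) :=
    (hG.comp (comap_measurable T)).stronglyMeasurable
  have key := condExp_bilin_of_stronglyMeasurable_left (μ := P) (ContinuousLinearMap.mul ℝ ℂ) hGm
    (by simpa using hint) hD
  rw [← integral_condExp hm]
  have : P[fun ω => G (T ω) * D ω | MeasurableSpace.comap T inferInstance] =ᵐ[P] 0 := by
    refine EventuallyEq.trans (by simpa using key) ?_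
    filter_upwards [h0] with ω hω
    rw [← hω]; simp
  rw [integral_congr_ae this]
  simp

/-- Half-lines form a π-system that generates the Borel sets, and the sets on which the integral
vanishes form a λ-system; the whole space is reached along increasing half-lines. -/
lemma integral_comp_mul_eq_zero_of_Iio {T : Ω → ℝ} (hT : Measurable T) {D : Ω → ℂ}
    (hD : Integrable D P) (h : ∀ d : ℝ, ∫ ω in T ⁻¹' Iio d, D ω ∂P = 0) {G : ℝ → ℂ}
    (hG : Measurable G) {C : ℝ} (hGC : ∀ x, ‖G x‖ ≤ C) : ∫ ω, G (T ω) * D ω ∂P = 0 := by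
  have huniv : ∫ ω, D ω ∂P = 0 := by
    have h1 := tendsto_setIntegral_of_monotone (μ := P) (f := D) (s := fun n : ℕ => T ⁻¹' Iio (n : ℝ))
      (fun n => hT measurableSet_Iio)
      (fun a b hab => preimage_mono (Iio_subset_Iio (by exact_mod_cast hab))) hD.integrableOn
    have h2 : ⋃ n : ℕ, T ⁻¹' Iio (n : ℝ) = univ := by
      ext ω; simpa using exists_nat_gt (T ω)
    rw [h2, setIntegral_univ] at h1
    simp only [h] at h1
    exact (tendsto_nhds_unique h1 tendsto_const_nhds)
  refine integral_comp_mul_eq_zero hT hD (fun S hS => ?_) hG hGC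
  induction S, hS using MeasurableSpace.induction_on_inter
    (BorelSpace.measurable_eq.trans (borel_eq_generateFrom_Iio ℝ)) isPiSystem_Iio with
  | empty => simp
  | basic t ht => obtain ⟨d, rfl⟩ := ht; exact h d
  | compl t ht ih =>
    have := integral_add_compl (hT ht) hD
    rw [ih, huniv, zero_add] at this
    exact this
  | iUnion f hd hf ih =>
    rw [preimage_iUnion, integral_iUnion (fun i => hT (hf i))
      (fun i j hij => (hd hij).preimage T) hD.integrableOn]
    simp [ih]

end Testing

/-- The function equal to `h ‖y‖` on the annulus of radii `a` and `R`, and to `1` elsewhere. -/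
def annFactor (h : ℝ → ℂ) (R a : ℝ) (y : Plane) : ℂ := by
  classical exact if a < ‖y‖ ∧ ‖y‖ ≤ R then h ‖y‖ else 1

lemma annFactor_of_mem {h : ℝ → ℂ} {R a : ℝ} {y : Plane} (hy : a < ‖y‖ ∧ ‖y‖ ≤ R) :
    annFactor h R a y = h ‖y‖ := by
  rw [annFactor]; exact if_pos hy

lemma annFactor_of_notMem {h : ℝ → ℂ} {R a : ℝ} {y : Plane} (hy : ¬ (a < ‖y‖ ∧ ‖y‖ ≤ R)) :
    annFactor h R a y = 1 := by
  rw [annFactor]; exact if_neg hy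

lemma measurable_annFactor {h : ℝ → ℂ} (hh : Measurable h) (R : ℝ) :
    Measurable fun q : ℝ × Plane => annFactor h R q.1 q.2 := by
  classical
  have : (fun q : ℝ × Plane => annFactor h R q.1 q.2) =
      fun q => if q.1 < ‖q.2‖ ∧ ‖q.2‖ ≤ R then h ‖q.2‖ else 1 := by
    ext q
    split_ifs with hq
    · exact annFactor_of_mem hq
    · exact annFactor_of_notMem hq
  rw [this]
  refine Measurable.ite ?_ (hh.comp measurable_snd.norm) measurable_const
  rw [ofPred_and]
  exact (measurableSet_lt measurable_fst measurable_snd.norm).inter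
    (measurableSet_le measurable_snd.norm measurable_const)

lemma measurable_annFactor_right {h : ℝ → ℂ} (hh : Measurable h) (R a : ℝ) :
    Measurable (annFactor h R a) :=
  (measurable_annFactor hh R).comp (measurable_const.prodMk measurable_id)

lemma norm_annFactor_le {h : ℝ → ℂ} (h1 : ∀ d, ‖h d‖ ≤ 1) (R a : ℝ) (y : Plane) :
    ‖annFactor h R a y‖ ≤ 1 := by
  by_cases hy : a < ‖y‖ ∧ ‖y‖ ≤ R
  · rw [annFactor_of_mem hy]; exact h1 _
  · rw [annFactor_of_notMem hy]; simp

/-- The inner boundary is excluded, so the factor is continuous from the right in its inner radius.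
This forces the discretisation below to round distances upwards. -/
lemma eventually_annFactor_eq (h : ℝ → ℂ) (R : ℝ) (y : Plane) {c : ℝ} {u : ℕ → ℝ}
    (hu : Tendsto u atTop (𝓝 c)) (hcu : ∀ n, c ≤ u n) :
    ∀ᶠ n in atTop, annFactor h R (u n) y = annFactor h R c y := by
  by_cases hy : c < ‖y‖
  · filter_upwards [hu.eventually_lt_const hy] with n hn
    by_cases hR : ‖y‖ ≤ R
    · rw [annFactor_of_mem ⟨hn, hR⟩, annFactor_of_mem ⟨hy, hR⟩]
    · rw [annFactor_of_notMem (fun q => hR q.2), annFactor_of_notMem (fun q => hR q.2)]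
  · refine Eventually.of_forall fun n => ?_
    rw [annFactor_of_notMem (fun q => hy q.1), annFactor_of_notMem]
    exact fun q => hy ((hcu n).trans_lt q.1)

/-- Laplace functional of the restriction of a homogeneous process to an annulus. -/
def annLaplace (lam : ℝ) (h : ℝ → ℂ) (R a : ℝ) : ℂ :=
  Complex.exp (∫ y, (annFactor h R a y - 1) ∂(homog lam))

lemma measurable_annLaplace (lam : ℝ) {h : ℝ → ℂ} (hh : Measurable h) (R : ℝ) :
    Measurable (annLaplace lam h R) := by
  have : StronglyMeasurable fun q : ℝ × Plane => annFactor h R q.1 q.2 - 1 :=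
    ((measurable_annFactor hh R).sub_const 1).stronglyMeasurable
  exact Complex.measurable_exp.comp (this.integral_prod_right (ν := homog lam)).measurable

lemma norm_annFactor_sub_one_le {h : ℝ → ℂ} (h1 : ∀ d, ‖h d‖ ≤ 1) (R a : ℝ) (y : Plane) :
    ‖annFactor h R a y - 1‖ ≤ (Metric.closedBall (0 : Plane) R).indicator (fun _ => (2 : ℝ)) y := by
  by_cases hy : ‖y‖ ≤ R
  · rw [indicator_of_mem (by simpa using hy)]
    refine (norm_sub_le _ _).trans ?_
    have := norm_annFactor_le h1 R a y
    rw [norm_one]; linarith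
  · rw [indicator_of_notMem (by simpa using hy), annFactor_of_notMem (fun q => hy q.2)]
    simp

lemma integrable_ball_two (lam R : ℝ) :
    Integrable ((Metric.closedBall (0 : Plane) R).indicator fun _ => (2 : ℝ)) (homog lam) := by
  rw [integrable_indicator_iff measurableSet_closedBall]
  exact integrableOn_const (homog_closedBall_ne_top lam R)

lemma integrable_annFactor_sub_one (lam : ℝ) {h : ℝ → ℂ} (hh : Measurable h) (h1 : ∀ d, ‖h d‖ ≤ 1)
    (R a : ℝ) : Integrable (fun y => annFactor h R a y - 1) (homog lam) :=
  (integrable_ball_two lam R).mono' ((measurable_annFactor_right hh R a).sub_const 1).aestronglyMeasurable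
    (Eventually.of_forall fun y => norm_annFactor_sub_one_le h1 R a y)

lemma tendsto_annLaplace (lam : ℝ) {h : ℝ → ℂ} (hh : Measurable h) (h1 : ∀ d, ‖h d‖ ≤ 1) (R : ℝ)
    {c : ℝ} {u : ℕ → ℝ} (hu : Tendsto u atTop (𝓝 c)) (hcu : ∀ n, c ≤ u n) :
    Tendsto (fun n => annLaplace lam h R (u n)) atTop (𝓝 (annLaplace lam h R c)) := by
  refine (Complex.continuous_exp.tendsto _).comp ?_
  refine tendsto_integral_of_dominated_convergence _
    (fun n => ((measurable_annFactor_right hh R (u n)).sub_const 1).aestronglyMeasurable)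
    (integrable_ball_two lam R)
    (fun n => Eventually.of_forall fun y => norm_annFactor_sub_one_le h1 R (u n) y)
    (Eventually.of_forall fun y => ?_)
  refine tendsto_const_nhds.congr' ?_
  filter_upwards [eventually_annFactor_eq h R y hu hcu] with n hn
  rw [hn]

variable {Ω ι : Type*} [MeasurableSpace Ω] {P : Measure Ω} [IsProbabilityMeasure P] [Countable ι]
  {X : ι → Ω → Plane} {lam : ℝ}

lemma annFactor_eq_one_of_notMem (h : ℝ → ℂ) (R a : ℝ) (ω : Ω) :
    ∀ i ∉ {i | ‖X i ω‖ ≤ R}, annFactor h R a (X i ω) = 1 := fun _ hi =>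
  annFactor_of_notMem fun q => hi q.2

/-- Being the mean of a product of factors of modulus at most one, it needs no estimate of the
exponent. -/
lemma IsPoissonProcess.norm_annLaplace_le (hX : IsPoissonProcess P X (homog lam)) {h : ℝ → ℂ}
    (hh : Measurable h) (h1 : ∀ d, ‖h d‖ ≤ 1) (R a : ℝ) : ‖annLaplace lam h R a‖ ≤ 1 := by
  rw [annLaplace, ← hX.integral_finprod (measurable_annFactor_right hh R a)
    (norm_annFactor_le h1 R a) (measurableSet_closedBall (x := (0 : Plane)) (ε := R))
    (homog_closedBall_ne_top lam R) (fun y hy => annFactor_of_notMem fun q => hy (by simpa using q.2))]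
  refine (norm_integral_le_of_norm_le_const (C := 1) ?_).trans (by simp)
  filter_upwards [hX.ae_locallyFinite] with ω hω
  exact norm_finprod_le_one (hω R) (annFactor_eq_one_of_notMem h R a ω)
    fun _ => norm_annFactor_le h1 R a _

lemma measurable_tagged_norm (hX : ∀ i, Measurable (X i)) :
    Measurable fun ω => ‖nearestPos fun i => X i ω‖ :=
  (measurable_nearestPos.comp (measurable_pi_lambda _ hX)).norm

lemma aestronglyMeasurable_annProd (hX : IsPoissonProcess P X (homog lam)) {h : ℝ → ℂ}
    (hh : Measurable h) (R : ℝ) {t : Ω → ℝ} (ht : Measurable t) :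
    AEStronglyMeasurable (fun ω => ∏ᶠ k, annFactor h R (t ω) (X k ω)) P := by
  refine aestronglyMeasurable_finprod (S := fun ω => {i | ‖X i ω‖ ≤ R})
    (fun k => (measurable_annFactor hh R).comp (ht.prodMk (hX.1 k))) ?_
  filter_upwards [hX.ae_locallyFinite] with ω hω
  exact ⟨hω R, annFactor_eq_one_of_notMem h R _ ω⟩

/-- The event that the nearest point is farther than a is the product over the points of the
indicators of lying outside the disc of radius a. Multiplied by the annular factors, which are 1
inside radius c ≥ a, it is again a product to which the Laplace functional applies; the exponents of
disc and annulus add, so the expectation factors. -/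
lemma IsPoissonProcess.integral_indicator_annProd (hl : 0 < lam)
    (hX : IsPoissonProcess P X (homog lam)) {h : ℝ → ℂ} (hh : Measurable h) (h1 : ∀ d, ‖h d‖ ≤ 1)
    {R a c : ℝ} (ha : 0 ≤ a) (hac : a ≤ c) :
    ∫ ω in {ω | a < ‖nearestPos fun i => X i ω‖},
      (∏ᶠ k, annFactor h R c (X k ω) - annLaplace lam h R c) ∂P = 0 := by
  classical
  have hT := measurable_tagged_norm (X := X) hX.1
  have hS : MeasurableSet {ω | a < ‖nearestPos fun i => X i ω‖} := hT measurableSet_Ioi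
  have hZi : Integrable (fun ω => ∏ᶠ k, annFactor h R c (X k ω)) P := by
    refine Integrable.of_bound (aestronglyMeasurable_annProd hX hh R (t := fun _ => c) measurable_const) 1 ?_
    filter_upwards [hX.ae_locallyFinite] with ω hω
    exact norm_finprod_le_one (hω R) (annFactor_eq_one_of_notMem h R c ω)
      fun i => norm_annFactor_le h1 R c _
  rw [integral_sub hZi.integrableOn (integrable_const _), setIntegral_const, sub_eq_zero]
  set B : Set Plane := Metric.closedBall 0 a with hB
  have hBm : MeasurableSet B := measurableSet_closedBall
  -- The value 0 on the disc encodes the void event inside the product.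
  let F : Plane → ℂ := fun y => if y ∈ B then 0 else annFactor h R c y
  have hF : Measurable F := Measurable.ite hBm measurable_const (measurable_annFactor_right hh R c)
  have hF1 : ∀ y, ‖F y‖ ≤ 1 := fun y => by
    by_cases hy : y ∈ B
    · simp [F, hy]
    · simpa [F, hy] using norm_annFactor_le h1 R c y
  have hFB : ∀ y ∉ Metric.closedBall (0 : Plane) (max a R), F y = 1 := fun y hy => by
    have hy' : max a R < ‖y‖ := by simpa using hy
    have h2 : y ∉ B := by
      simp only [hB, Metric.mem_closedBall, dist_zero_right, not_le]
      exact (le_max_left _ _).trans_lt hy'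
    simp only [F, h2, if_false]
    exact annFactor_of_notMem fun q => not_le.2 ((le_max_right a R).trans_lt hy') q.2
  have key := hX.integral_finprod hF hF1 measurableSet_closedBall (homog_closedBall_ne_top lam _) hFB
  have e1 : ∫ ω in {ω | a < ‖nearestPos fun i => X i ω‖}, ∏ᶠ k, annFactor h R c (X k ω) ∂P =
      ∫ ω, ∏ᶠ k, F (X k ω) ∂P := by
    rw [← integral_indicator hS]
    refine integral_congr_ae ?_
    filter_upwards [hX.ae_exists_isNearest hl, hX.ae_locallyFinite] with ω h3 h4
    by_cases hω : a < ‖nearestPos fun i => X i ω‖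
    · rw [indicator_of_mem (by exact hω)]
      have := (lt_norm_nearestPos_iff h3 a).1 hω
      refine finprod_congr fun k => ?_
      have hk : X k ω ∉ B := this k
      simp only [F, hk, if_false]
    · rw [indicator_of_notMem (by exact hω)]
      have : ∃ k, X k ω ∈ B := by
        by_contra! h5
        exact hω ((lt_norm_nearestPos_iff h3 a).2 h5)
      obtain ⟨k, hk⟩ := this
      rw [finprod_eq_prod_toFinset (h4 (max a R)) (fun i hi => hFB _ (by simpa using hi))]
      refine (Finset.prod_eq_zero (i := k) ?_ (by simp [F, hk])).symm
      simp only [Finite.mem_toFinset, mem_ofPred_eq]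
      exact le_trans (by simpa [hB] using hk) (le_max_left a R)
  rw [e1, key, annLaplace]
  have e2 : ∫ y, (F y - 1) ∂(homog lam) =
      ∫ y, (annFactor h R c y - 1) ∂(homog lam) - (homog lam).real B := by
    have h5 : ∀ y, F y - 1 = (annFactor h R c y - 1) + B.indicator (fun _ => (-1 : ℂ)) y := fun y => by
      by_cases hy : y ∈ B
      · have : ¬ (c < ‖y‖ ∧ ‖y‖ ≤ R) := fun q => by
          have : ‖y‖ ≤ a := by simpa [hB] using hy
          linarith [q.1]
        simp [F, hy, annFactor_of_notMem this]
      · simp [F, hy]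
    have h6 : Integrable (B.indicator (fun _ => (-1 : ℂ))) (homog lam) := by
      rw [integrable_indicator_iff hBm]
      exact integrableOn_const (homog_closedBall_ne_top lam a)
    simp_rw [h5]
    rw [integral_add (integrable_annFactor_sub_one lam hh h1 R c) h6, integral_indicator hBm,
      setIntegral_const]
    simp [sub_eq_add_neg]
  rw [e2, sub_eq_add_neg, Complex.exp_add, measureReal_def (μ := P), hX.measure_lt_norm_nearestPos hl ha,
    ENNReal.toReal_ofReal (Real.exp_nonneg _), ← homog_real_closedBall hl.le ha, ← hB, mul_comm,
    Complex.real_smul]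
  push_cast
  rfl

/-- The inner radius is to be the random nearest distance itself. On a grid cell it is replaced by
the deterministic right end of the cell, where the factorisation for void events applies, and the
mesh is sent to 0 using right continuity. -/
lemma IsPoissonProcess.integral_Iio_annProd (hl : 0 < lam)
    (hX : IsPoissonProcess P X (homog lam)) {h : ℝ → ℂ} (hh : Measurable h) (h1 : ∀ d, ‖h d‖ ≤ 1)
    (R d : ℝ) :
    ∫ ω in (fun ω => ‖nearestPos fun i => X i ω‖) ⁻¹' Iio d,
      (∏ᶠ k, annFactor h R ‖nearestPos fun i => X i ω‖ (X k ω) -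
        annLaplace lam h R ‖nearestPos fun i => X i ω‖) ∂P = 0 := by
  classical
  set T : Ω → ℝ := fun ω => ‖nearestPos fun i => X i ω‖ with hTdef
  have hT : Measurable T := measurable_tagged_norm hX.1
  have hT0 : ∀ᵐ ω ∂P, 0 < T ω := by
    filter_upwards [hX.ae_exists_isNearest hl, hX.ae_ne_zero] with ω ⟨i, hi⟩ h2
    simp only [hTdef, hi.nearestPos_eq]
    exact norm_pos_iff.2 (h2 i)
  let D : ℝ → Ω → ℂ := fun c ω => ∏ᶠ k, annFactor h R c (X k ω) - annLaplace lam h R c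
  have hDb : ∀ᵐ ω ∂P, ∀ c, ‖D c ω‖ ≤ 2 := by
    filter_upwards [hX.ae_locallyFinite] with ω hω c
    have := norm_finprod_le_one (hω R) (annFactor_eq_one_of_notMem (X := X) h R c ω)
      fun i => norm_annFactor_le h1 R c _
    have h2 := hX.norm_annLaplace_le hh h1 R c
    exact (norm_sub_le _ _).trans (by linarith)
  have hDm : ∀ t : Ω → ℝ, Measurable t → AEStronglyMeasurable (fun ω => D (t ω) ω) P := fun t ht =>
    (aestronglyMeasurable_annProd hX hh R ht).sub
      ((measurable_annLaplace lam hh R).comp ht).aestronglyMeasurable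
  have hDi : ∀ c, Integrable (D c) P := fun c => Integrable.of_bound (hDm (fun _ => c) measurable_const) 2
    (hDb.mono fun ω hω => hω c)
  -- A cell is the difference of two void events, and its right end is at least as large as both
  -- thresholds.
  have hcell : ∀ n j : ℕ, ∫ ω in T ⁻¹' Ioc ((j : ℝ) / (n + 1)) (((j : ℝ) + 1) / (n + 1)),
      D (((j : ℝ) + 1) / (n + 1)) ω ∂P = 0 := by
    intro n j
    have hle : (j : ℝ) / (n + 1) ≤ ((j : ℝ) + 1) / (n + 1) := by gcongr; linarith
    have h0 : (0 : ℝ) ≤ (j : ℝ) / (n + 1) := by positivity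
    rw [← Ioi_sdiff_Ioi, preimage_sdiff, setIntegral_sdiff (hT measurableSet_Ioi) (hDi _).integrableOn
      (preimage_mono (Ioi_subset_Ioi hle))]
    have e1 := hX.integral_indicator_annProd hl hh h1 (R := R) h0 hle
    have e2 := hX.integral_indicator_annProd hl hh h1 (R := R) (h0.trans hle) le_rfl
    exact (congrArg₂ (· - ·) e1 e2).trans (sub_zero 0)
  -- The nearest distance rounded up to a multiple of 1/(n+1), so that it is approached from above.
  let u : ℕ → ℝ → ℝ := fun n t => (⌈t * (n + 1)⌉₊ : ℝ) / (n + 1)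
  have hum : ∀ n, Measurable (u n) := fun n =>
    (measurable_from_nat.comp (Nat.measurable_ceil.comp (measurable_id.mul_const _))).div_const _
  have hu1 : ∀ n t, t ≤ u n t := fun n t => by
    rw [le_div_iff₀ (by positivity)]; exact Nat.le_ceil _
  have hu2 : ∀ n t, 0 < t → u n t ≤ t + 1 / (n + 1) := fun n t ht => by
    rw [div_le_iff₀ (by positivity)]
    have := Nat.ceil_lt_add_one (a := t * (n + 1)) (by positivity)
    have h3 : ((n : ℝ) + 1) ≠ 0 := by positivity
    rw [add_mul, one_div, inv_mul_cancel₀ h3]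
    exact this.le
  have hut : ∀ t, 0 < t → Tendsto (fun n => u n t) atTop (𝓝 t) := fun t ht => by
    refine tendsto_of_tendsto_of_tendsto_of_le_of_le tendsto_const_nhds ?_ (fun n => hu1 n t)
      (fun n => hu2 n t ht)
    simpa using tendsto_const_nhds.add (tendsto_one_div_add_atTop_nhds_zero_nat (𝕜 := ℝ))
  have hstep : ∀ n, ∫ ω, (Iio d).indicator 1 (u n (T ω)) * D (u n (T ω)) ω ∂P = 0 := by
    intro n
    -- Only cells with right end below d contribute, and these have index less than J: the sum is
    -- finite.
    let J : ℕ := ⌈d * (n + 1)⌉₊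
    have e : ∀ᵐ ω ∂P, (Iio d).indicator 1 (u n (T ω)) * D (u n (T ω)) ω =
        ∑ j ∈ Finset.range J, (Iio d).indicator (1 : ℝ → ℂ) (((j : ℝ) + 1) / (n + 1)) *
          (T ⁻¹' Ioc ((j : ℝ) / (n + 1)) (((j : ℝ) + 1) / (n + 1))).indicator
            (D (((j : ℝ) + 1) / (n + 1))) ω := by
      filter_upwards [hT0] with ω hω
      have hnp : (0 : ℝ) < n + 1 := by positivity
      have hpos : 0 < ⌈T ω * (n + 1)⌉₊ := Nat.ceil_pos.2 (by positivity)
      obtain ⟨j, hj⟩ := Nat.exists_eq_succ_of_ne_zero hpos.ne'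
      have huj : u n (T ω) = ((j : ℝ) + 1) / (n + 1) := by
        simp only [u, hj]; push_cast; rfl
      have hmem : ∀ i : ℕ, ω ∈ T ⁻¹' Ioc ((i : ℝ) / (n + 1)) (((i : ℝ) + 1) / (n + 1)) ↔ i = j := by
        intro i
        rw [mem_preimage, mem_Ioc, div_lt_iff₀ hnp, le_div_iff₀ hnp]
        have := Nat.ceil_eq_iff (a := T ω * (n + 1)) (n := i + 1) (by simp)
        simp only [add_tsub_cancel_right, Nat.cast_add, Nat.cast_one] at this
        rw [← this, hj]
        simp [eq_comm]
      rw [huj]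
      by_cases hjd : ((j : ℝ) + 1) / (n + 1) < d
      · have hjJ : j ∈ Finset.range J := by
          rw [Finset.mem_range, Nat.lt_ceil]
          rw [div_lt_iff₀ hnp] at hjd
          linarith
        rw [Finset.sum_eq_single_of_mem j hjJ]
        · rw [indicator_of_mem ((hmem j).2 rfl)]
        · intro i _ hij
          rw [indicator_of_notMem (fun q => hij ((hmem i).1 q)), mul_zero]
      · rw [indicator_of_notMem (by simpa using hjd), zero_mul]
        symm
        refine Finset.sum_eq_zero fun i _ => ?_
        by_cases hij : i = j
        · subst hij
          rw [indicator_of_notMem (by simpa using hjd), zero_mul]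
        · rw [indicator_of_notMem (fun q => hij ((hmem i).1 q)), mul_zero]
    rw [integral_congr_ae e, integral_finsetSum]
    · refine Finset.sum_eq_zero fun j _ => ?_
      rw [integral_const_mul, integral_indicator (hT measurableSet_Ioc), hcell, mul_zero]
    · intro j _
      exact ((hDi _).indicator (hT measurableSet_Ioc)).const_mul _
  have hlim : Tendsto (fun n => ∫ ω, (Iio d).indicator 1 (u n (T ω)) * D (u n (T ω)) ω ∂P) atTop
      (𝓝 (∫ ω, (Iio d).indicator 1 (T ω) * D (T ω) ω ∂P)) := by
    refine tendsto_integral_of_dominated_convergence (fun _ => 2) ?_ (integrable_const _) ?_ ?_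
    · intro n
      have : Measurable fun ω => (Iio d).indicator (1 : ℝ → ℂ) (u n (T ω)) :=
        (measurable_one.indicator measurableSet_Iio).comp ((hum n).comp hT)
      exact this.aestronglyMeasurable.mul (hDm _ ((hum n).comp hT))
    · intro n
      filter_upwards [hDb] with ω hω
      by_cases hd : u n (T ω) ∈ Iio d
      · rw [indicator_of_mem hd, Pi.one_apply, one_mul]; exact hω _
      · rw [indicator_of_notMem hd, zero_mul, norm_zero]; norm_num
    · filter_upwards [hT0, hX.ae_locallyFinite] with ω h3 h4
      refine Tendsto.mul ?_ (Tendsto.sub ?_ ?_)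
      · refine tendsto_const_nhds.congr' ?_
        by_cases hd : T ω < d
        · filter_upwards [(hut _ h3).eventually_lt_const hd] with n hn
          rw [indicator_of_mem (by exact hd), indicator_of_mem (by exact hn)]
          rfl
        · refine Eventually.of_forall fun n => ?_
          beta_reduce
          rw [indicator_of_notMem (by exact hd), indicator_of_notMem]
          exact fun q => hd ((hu1 n _).trans_lt q)
      · refine tendsto_const_nhds.congr' ?_
        -- Only the finitely many points within radius R have a nontrivial factor, so one n serves
        -- for all of them.
        have := (h4 R).eventually_all (l := atTop) (p := fun i n =>
          annFactor h R (u n (T ω)) (X i ω) = annFactor h R (T ω) (X i ω)) |>.2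
          fun i _ => eventually_annFactor_eq h R _ (hut _ h3) (fun n => hu1 n _)
        filter_upwards [this] with n hn
        refine finprod_congr fun k => ?_
        by_cases hk : k ∈ {i | ‖X i ω‖ ≤ R}
        · exact (hn k hk).symm
        · rw [annFactor_eq_one_of_notMem h R _ ω k hk, annFactor_eq_one_of_notMem h R _ ω k hk]
      · exact tendsto_annLaplace lam hh h1 R (hut _ h3) (fun n => hu1 n _)
  have h0 := tendsto_nhds_unique hlim (tendsto_const_nhds.congr fun n => (hstep n).symm)
  rw [← integral_indicator (hT measurableSet_Iio), ← h0]
  refine integral_congr_ae (Eventually.of_forall fun ω => ?_)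
  beta_reduce
  by_cases hd : T ω < d
  · rw [indicator_of_mem (by exact hd), indicator_of_mem (by exact hd), Pi.one_apply, one_mul]
  · rw [indicator_of_notMem (by exact hd), indicator_of_notMem (by exact hd), zero_mul]

/-- The process outside the disk through its nearest point is Poisson given that point's norm. -/
lemma IsPoissonProcess.integral_comp_mul_annProd (hl : 0 < lam)
    (hX : IsPoissonProcess P X (homog lam)) {h : ℝ → ℂ} (hh : Measurable h) (h1 : ∀ d, ‖h d‖ ≤ 1)
    (R : ℝ) {G : ℝ → ℂ} (hG : Measurable G) {C : ℝ} (hGC : ∀ x, ‖G x‖ ≤ C) :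
    ∫ ω, G ‖nearestPos fun i => X i ω‖ *
      ∏ᶠ k, annFactor h R ‖nearestPos fun i => X i ω‖ (X k ω) ∂P =
    ∫ ω, G ‖nearestPos fun i => X i ω‖ * annLaplace lam h R ‖nearestPos fun i => X i ω‖ ∂P := by
  have hT := measurable_tagged_norm (X := X) hX.1
  have hGT := (hG.comp hT).aestronglyMeasurable (μ := P)
  have i1 : Integrable (fun ω => ∏ᶠ k, annFactor h R ‖nearestPos fun i => X i ω‖ (X k ω)) P := by
    refine Integrable.of_bound (aestronglyMeasurable_annProd hX hh R hT) 1 ?_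
    filter_upwards [hX.ae_locallyFinite] with ω hω
    exact norm_finprod_le_one (hω R) (annFactor_eq_one_of_notMem h R _ ω)
      fun i => norm_annFactor_le h1 R _ _
  have i2 : Integrable (fun ω => annLaplace lam h R ‖nearestPos fun i => X i ω‖) P :=
    Integrable.of_bound ((measurable_annLaplace lam hh R).comp hT).aestronglyMeasurable 1
      (Eventually.of_forall fun ω => hX.norm_annLaplace_le hh h1 R _)
  have key := integral_comp_mul_eq_zero_of_Iio hT (i1.sub i2)
    (fun d => hX.integral_Iio_annProd hl hh h1 R d) hG hGC
  rw [← sub_eq_zero, ← integral_sub, ← key]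
  · refine integral_congr_ae (Eventually.of_forall fun ω => ?_)
    simp [mul_sub]
  · exact i1.bdd_mul hGT (Eventually.of_forall fun ω => hGC _)
  · exact i2.bdd_mul hGT (Eventually.of_forall fun ω => hGC _)

end Nearest

end

end RisNet

namespace RisNet
noncomputable section

/-! ### Regrouping independent variables -/

section Independence

set_option linter.unusedSectionVars false

variable {Ω : Type*} [MeasurableSpace Ω] {P : Measure Ω} [IsProbabilityMeasure P]

/-- The triple has a product law in one bracketing, hence in the other, by associativity of the
product measure. -/
lemma indepFun_prodMk_right {α β γ : Type*} [MeasurableSpace α] [MeasurableSpace β]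
    [MeasurableSpace γ] {U : Ω → α} {V : Ω → β} {W : Ω → γ} (hU : Measurable U) (hV : Measurable V)
    (hW : Measurable W) (h : IndepFun U V P) (h' : IndepFun (fun ω => (U ω, V ω)) W P) :
    IndepFun U (fun ω => (V ω, W ω)) P := by
  have hVW : IndepFun V W P := h'.comp measurable_snd measurable_id
  rw [indepFun_iff_map_prod_eq_prod_map_map (by fun_prop) (by fun_prop)] at *
  have : IsProbabilityMeasure (P.map U) := Measure.isProbabilityMeasure_map hU.aemeasurable
  have : IsProbabilityMeasure (P.map V) := Measure.isProbabilityMeasure_map hV.aemeasurable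
  have : IsProbabilityMeasure (P.map W) := Measure.isProbabilityMeasure_map hW.aemeasurable
  rw [hVW, ← Measure.prodAssoc_prod, ← h, ← h', Measure.map_map (by fun_prop) (by fun_prop)]
  rfl

/-- The network is given as positions independent of marks; the argument needs the BS side
independent of the RIS side. This exchanges the two pairings. -/
lemma indepFun_exchange {α β γ δ : Type*} [MeasurableSpace α] [MeasurableSpace β]
    [MeasurableSpace γ] [MeasurableSpace δ] {A : Ω → α} {B : Ω → β} {C : Ω → γ} {D : Ω → δ}
    (hA : Measurable A) (hB : Measurable B) (hC : Measurable C) (hD : Measurable D)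
    (h : IndepFun (fun ω => (A ω, B ω)) (fun ω => (C ω, D ω)) P) (hAB : IndepFun A B P)
    (hCD : IndepFun C D P) : IndepFun (fun ω => (A ω, C ω)) (fun ω => (B ω, D ω)) P := by
  have h1 := indepFun_prodMk_right hA hB (hC.prodMk hD) hAB h
  have h2 := indepFun_prodMk_right hC hD (hA.prodMk hB) hCD h.symm
  have h3 : IndepFun A (fun ω => (B ω, D ω)) P :=
    h1.comp (φ := id) (ψ := fun q : β × γ × δ => (q.1, q.2.2)) measurable_id (by fun_prop)
  have h4 : IndepFun (fun ω => ((B ω, D ω), A ω)) C P :=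
    (h2.comp (φ := id) (ψ := fun q : δ × α × β => ((q.2.2, q.1), q.2.1)) measurable_id
      (by fun_prop)).symm
  exact (indepFun_prodMk_right (hB.prodMk hD) hA hC h3.symm h4).symm

/-- Measurability with respect to the σ-algebra of a block replaces an explicit function of its
members, so infinite blocks need no special treatment. -/
lemma indepFun_of_blocks {κ β γ : Type*} {E : κ → Type*} [∀ k, MeasurableSpace (E k)]
    [mβ : MeasurableSpace β] [mγ : MeasurableSpace γ] {f : ∀ k, Ω → E k} (hf : ∀ k, Measurable (f k))
    (h : iIndepFun f P) {S T : Set κ} (hST : Disjoint S T) {U : Ω → β} {V : Ω → γ}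
    (hU : Measurable[⨆ k ∈ S, MeasurableSpace.comap (f k) inferInstance] U)
    (hV : Measurable[⨆ k ∈ T, MeasurableSpace.comap (f k) inferInstance] V) : IndepFun U V P := by
  rw [IndepFun_iff_Indep]
  exact indep_of_indep_of_le (indep_iSup_of_disjoint (fun k => (hf k).comap_le)
    ((iIndepFun_iff_iIndep _ _ _).1 h) hST) hU.comap_le hV.comap_le

/-- Induction on the finite index set: the new block is disjoint from the union of the others, hence
independent of everything they generate. -/
lemma iIndepFun_of_blocks {κ ι : Type*} {E : κ → Type*} [∀ k, MeasurableSpace (E k)] {β : ι → Type*}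
    [∀ i, MeasurableSpace (β i)] {f : ∀ k, Ω → E k} (hf : ∀ k, Measurable (f k))
    (h : iIndepFun f P) {B : ι → Set κ} (hB : Pairwise fun i j => Disjoint (B i) (B j))
    {g : ∀ i, Ω → β i}
    (hg : ∀ i, Measurable[⨆ k ∈ B i, MeasurableSpace.comap (f k) inferInstance] (g i)) :
    iIndepFun g P := by
  classical
  rw [iIndepFun_iff_iIndep, iIndep_iff]
  intro S F hF
  induction S using Finset.induction_on with
  | empty => simp
  | insert i S hi ih =>
    rw [Finset.set_biInter_insert, Finset.prod_insert hi,
      ← ih (fun j hj => hF j (Finset.mem_insert_of_mem hj))]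
    have hd : Disjoint (B i) (⋃ j ∈ S, B j) := by
      rw [disjoint_iUnion₂_right]
      intro j hj
      exact hB fun e => hi (e ▸ hj)
    have hI := indep_iSup_of_disjoint (fun k => (hf k).comap_le) ((iIndepFun_iff_iIndep _ _ _).1 h) hd
    rw [Indep_iff] at hI
    refine hI _ _ ((hg i).comap_le _ (hF i (Finset.mem_insert_self _ _))) ?_
    refine MeasurableSet.biInter (S.countable_toSet) fun j hj => ?_
    have hle : (⨆ k ∈ B j, MeasurableSpace.comap (f k) inferInstance) ≤
        ⨆ k ∈ ⋃ j ∈ S, B j, MeasurableSpace.comap (f k) inferInstance :=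
      biSup_mono fun k hk => mem_iUnion₂.2 ⟨j, hj, hk⟩
    exact hle _ ((hg j).comap_le _ (hF j (Finset.mem_insert_of_mem hj)))

lemma measurable_of_mem_block {κ : Type*} {E : κ → Type*} [∀ k, MeasurableSpace (E k)]
    {f : ∀ k, Ω → E k} {B : Set κ} {k : κ} (hk : k ∈ B) :
    Measurable[⨆ k ∈ B, MeasurableSpace.comap (f k) inferInstance] (f k) :=
  (comap_measurable (f k)).mono
    (le_biSup (fun k => MeasurableSpace.comap (f k) inferInstance) hk) le_rfl

lemma measurable_pi_of_forall {Ω ι : Type*} {E : ι → Type*} {m : MeasurableSpace Ω}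
    [∀ i, MeasurableSpace (E i)] {f : Ω → ∀ i, E i} (hf : ∀ i, Measurable[m] fun ω => f ω i) :
    Measurable[m] f := measurable_pi_lambda f hf

end Independence

/-! ### Independence structure of the network -/

namespace Network

set_option linter.unusedSectionVars false

variable {Ω : Type*} [MeasurableSpace Ω] {P : Measure Ω} [IsProbabilityMeasure P] {p : Params}
  {ιb ιr : Type*} (M : Network P p ιb ιr)

/-- The marks of a BS: blockage, angles and fading powers. -/
def bsMark (i : ιb) (ω : Ω) : ℝ × ℝ × ℝ × ℝ × ℝ :=
  (M.X (.losB i) ω, M.X (.aod i) ω, M.X (.beam i) ω, M.X (.fade .L i) ω, M.X (.fade .N i) ω)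

/-- The marks of a RIS: blockage and orientation. -/
def risMark (j : ιr) (ω : Ω) : ℝ × ℝ := (M.X (.losR j) ω, M.X (.orient j) ω)

lemma measurable_bsMark (i : ιb) : Measurable (M.bsMark i) :=
  (M.X_measurable _).prodMk ((M.X_measurable _).prodMk ((M.X_measurable _).prodMk
    ((M.X_measurable _).prodMk (M.X_measurable _))))

lemma measurable_risMark (j : ιr) : Measurable (M.risMark j) :=
  (M.X_measurable _).prodMk (M.X_measurable _)

lemma measurable_bsMark' : Measurable fun ω i => M.bsMark i ω :=
  measurable_pi_lambda _ M.measurable_bsMark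

lemma measurable_risMark' : Measurable fun ω j => M.risMark j ω :=
  measurable_pi_lambda _ M.measurable_risMark

lemma measurable_b : Measurable fun ω i => M.b i ω := measurable_pi_lambda _ M.b_poisson.1

lemma measurable_r : Measurable fun ω j => M.r j ω := measurable_pi_lambda _ M.r_poisson.1

/-- The marks attached to a BS. -/
def bsBlock (i : ιb) : Set (Mark ιb ιr) := {.losB i, .aod i, .beam i, .fade .L i, .fade .N i}

/-- The marks attached to a RIS. -/
def risBlock (j : ιr) : Set (Mark ιb ιr) := {.losR j, .orient j}

lemma measurable_bsMark_of_subset {S : Set (Mark ιb ιr)} {i : ιb} (h : bsBlock i ⊆ S) :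
    Measurable[⨆ k ∈ S, MeasurableSpace.comap (M.X k) inferInstance] (M.bsMark i) := by
  have m : ∀ k ∈ bsBlock i, Measurable[⨆ k ∈ S, MeasurableSpace.comap (M.X k) inferInstance] (M.X k) :=
    fun k hk => measurable_of_mem_block (f := M.X) (h hk)
  exact (m _ (by simp [bsBlock])).prodMk ((m _ (by simp [bsBlock])).prodMk
    ((m _ (by simp [bsBlock])).prodMk ((m _ (by simp [bsBlock])).prodMk (m _ (by simp [bsBlock])))))

lemma measurable_risMark_of_subset {S : Set (Mark ιb ιr)} {j : ιr} (h : risBlock j ⊆ S) :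
    Measurable[⨆ k ∈ S, MeasurableSpace.comap (M.X k) inferInstance] (M.risMark j) := by
  have m : ∀ k ∈ risBlock j, Measurable[⨆ k ∈ S, MeasurableSpace.comap (M.X k) inferInstance] (M.X k) :=
    fun k hk => measurable_of_mem_block (f := M.X) (h hk)
  exact (m _ (by simp [risBlock])).prodMk (m _ (by simp [risBlock]))

lemma iIndepFun_bsMark : iIndepFun M.bsMark P :=
  iIndepFun_of_blocks M.X_measurable M.X_indep (B := bsBlock)
    (fun i j hij => by simp [bsBlock, hij.symm]) fun _ => M.measurable_bsMark_of_subset subset_rfl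

lemma iIndepFun_risMark : iIndepFun M.risMark P :=
  iIndepFun_of_blocks M.X_measurable M.X_indep (B := risBlock)
    (fun i j hij => by simp [risBlock, hij.symm]) fun _ => M.measurable_risMark_of_subset subset_rfl

lemma indepFun_bsMark_risSide : IndepFun (fun ω i => M.bsMark i ω)
    (fun ω => ((fun j => M.risMark j ω), M.X .angle ω)) P := by
  refine indepFun_of_blocks M.X_measurable M.X_indep (S := ⋃ i, bsBlock i)
    (T := (⋃ j, risBlock j) ∪ {.angle}) ?_ ?_ ?_
  · simp [bsBlock, risBlock]
  · exact measurable_pi_of_forall fun i => M.measurable_bsMark_of_subset (subset_iUnion bsBlock i)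
  · exact (measurable_pi_of_forall fun j => M.measurable_risMark_of_subset
      ((subset_iUnion risBlock j).trans subset_union_left)).prodMk
      (measurable_of_mem_block (f := M.X) (by simp))

lemma indepFun_risMark_angle : IndepFun (fun ω j => M.risMark j ω) (M.X .angle) P := by
  refine indepFun_of_blocks M.X_measurable M.X_indep (S := ⋃ j, risBlock j) (T := {.angle}) ?_ ?_ ?_
  · simp [risBlock]
  · exact measurable_pi_of_forall fun i => M.measurable_risMark_of_subset (subset_iUnion risBlock i)
  · exact measurable_of_mem_block (f := M.X) (by simp)

lemma indepFun_allMarks_serve (q : Serving) : IndepFun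
    (fun ω => ((fun i => M.bsMark i ω), ((fun j => M.risMark j ω), M.X .angle ω)))
    (M.X (.serve q)) P := by
  refine indepFun_of_blocks M.X_measurable M.X_indep
    (S := (⋃ i, bsBlock i) ∪ ((⋃ j, risBlock j) ∪ {.angle})) (T := {.serve q}) ?_ ?_ ?_
  · simp [bsBlock, risBlock]
  · exact (measurable_pi_of_forall fun i => M.measurable_bsMark_of_subset
      ((subset_iUnion bsBlock i).trans subset_union_left)).prodMk
      ((measurable_pi_of_forall fun j => M.measurable_risMark_of_subset
      ((subset_iUnion risBlock j).trans (subset_union_left.trans subset_union_right))).prodMk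
      (measurable_of_mem_block (f := M.X) (by simp)))
  · exact measurable_of_mem_block (f := M.X) (by simp)

lemma measurable_allMarks : Measurable fun ω =>
    ((fun i => M.bsMark i ω), ((fun j => M.risMark j ω), M.X .angle ω)) :=
  M.measurable_bsMark'.prodMk (M.measurable_risMark'.prodMk (M.X_measurable _))

lemma indepFun_pos_allMarks : IndepFun (fun ω => ((fun i => M.b i ω), (fun j => M.r j ω)))
    (fun ω => ((fun i => M.bsMark i ω), ((fun j => M.risMark j ω), M.X .angle ω))) P :=
  M.pos_indep_X.comp (φ := id) (ψ := fun x : Mark ιb ιr → ℝ =>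
    ((fun i => (x (.losB i), x (.aod i), x (.beam i), x (.fade .L i), x (.fade .N i))),
      ((fun j => (x (.losR j), x (.orient j))), x .angle))) measurable_id (by fun_prop)

lemma indepFun_b_bsMark : IndepFun (fun ω i => M.b i ω) (fun ω i => M.bsMark i ω) P :=
  M.indepFun_pos_allMarks.comp measurable_fst measurable_fst

lemma indepFun_r_risMark : IndepFun (fun ω j => M.r j ω) (fun ω j => M.risMark j ω) P :=
  M.indepFun_pos_allMarks.comp measurable_snd (measurable_fst.comp measurable_snd)

/-- The part of the network related to the BSs is independent of the part related to the RISs. -/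
lemma indepFun_bsSide_risSide :
    IndepFun (fun ω => ((fun i => M.b i ω), (fun i => M.bsMark i ω)))
      (fun ω => ((fun j => M.r j ω), ((fun j => M.risMark j ω), M.X .angle ω))) P :=
  indepFun_exchange M.measurable_b M.measurable_r M.measurable_bsMark'
    (M.measurable_risMark'.prodMk (M.X_measurable _)) M.indepFun_pos_allMarks M.b_indep_r
    M.indepFun_bsMark_risSide

lemma indepFun_ris_angle :
    IndepFun (fun ω => ((fun j => M.r j ω), (fun j => M.risMark j ω))) (M.X .angle) P := by
  -- The trivial variable `()` fills the slot of the exchange lemma for which there is no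
  -- counterpart.
  have h1 : IndepFun (fun ω => ((fun j => M.r j ω), ())) (fun ω => ((fun j => M.risMark j ω),
      M.X .angle ω)) P :=
    M.indepFun_pos_allMarks.comp (φ := fun q : (ιb → Plane) × (ιr → Plane) => (q.2, ()))
      (by fun_prop) measurable_snd
  exact (indepFun_exchange M.measurable_r measurable_const M.measurable_risMark' (M.X_measurable _)
    h1 (indepFun_const_right _ _) M.indepFun_risMark_angle).comp measurable_id measurable_snd

/-- The serving fading is independent of everything else. -/
lemma indepFun_network_serve (q : Serving) : IndepFun
    (fun ω => (((fun i => M.b i ω), (fun j => M.r j ω)),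
      ((fun i => M.bsMark i ω), ((fun j => M.risMark j ω), M.X .angle ω)))) (M.X (.serve q)) P := by
  have h1 : IndepFun (fun ω => (((fun i => M.b i ω), (fun j => M.r j ω)), ()))
      (fun ω => (((fun i => M.bsMark i ω), ((fun j => M.risMark j ω), M.X .angle ω)),
        M.X (.serve q) ω)) P :=
    M.pos_indep_X.comp (φ := fun q => (q, ())) (ψ := fun x : Mark ιb ιr → ℝ =>
    (((fun i => (x (.losB i), x (.aod i), x (.beam i), x (.fade .L i), x (.fade .N i))),
      ((fun j => (x (.losR j), x (.orient j))), x .angle)), x (.serve q))) (by fun_prop) (by fun_prop)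
  exact (indepFun_exchange (M.measurable_b.prodMk M.measurable_r) measurable_const
    M.measurable_allMarks (M.X_measurable _) h1 (indepFun_const_right _ _)
    (M.indepFun_allMarks_serve q)).comp measurable_id measurable_snd

end Network

end

end RisNet

namespace RisNet
noncomputable section

/-! ### Law of the antenna gain -/

section AntennaPattern

open Params

lemma measurable_pdfPhi : Measurable pdfPhi := by
  classical
  unfold pdfPhi
  refine Measurable.ite ?_ (by fun_prop) measurable_const
  rw [ofPred_and]
  exact (measurableSet_le measurable_const measurable_id).inter
    (measurableSet_le measurable_id measurable_const)

lemma pdfPhi_nonneg (x : ℝ) : 0 ≤ pdfPhi x := by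
  unfold pdfPhi; split_ifs <;> positivity

lemma pdfPhi_eq_zero {x : ℝ} (hx : x ∉ Icc (-(1 / 2) : ℝ) (1 / 2)) : pdfPhi x = 0 := by
  unfold pdfPhi; exact if_neg hx

/-- Uniform law of an angle. -/
def angleLaw : Measure ℝ := cond volume (Icc 0 (2 * Real.pi))

instance : IsProbabilityMeasure angleLaw := by
  refine cond_isProbabilityMeasure_of_finite ?_ ?_
  · simp [Real.pi_pos]
  · simp [Real.volume_Icc, ENNReal.mul_eq_top]

lemma integral_angleLaw {E : Type*} [NormedAddCommGroup E] [NormedSpace ℝ E] (f : ℝ → E) :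
    ∫ x, f x ∂angleLaw = (2 * Real.pi)⁻¹ • ∫ x in (0 : ℝ)..(2 * Real.pi), f x := by
  have h0 : 0 ≤ 2 * Real.pi := by positivity
  rw [angleLaw, ProbabilityTheory.cond, integral_smul_measure, Real.volume_Icc, sub_zero,
    ENNReal.toReal_inv, ENNReal.toReal_ofReal h0, intervalIntegral.integral_of_le h0,
    integral_Icc_eq_integral_Ioc]

lemma pdfPhi_eq (y : ℝ) (hy : y ∈ Icc (-(1 / 2) : ℝ) (1 / 2)) :
    pdfPhi y = 2 / Real.pi * √(1 - (2 * y) ^ 2)⁻¹ := by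
  unfold pdfPhi
  rw [if_pos (by exact hy), mul_pow, Real.sqrt_inv, div_mul_eq_div_div]
  norm_num [div_eq_mul_inv]

lemma integrable_pdfPhi : Integrable pdfPhi := by
  have h1 := (Polynomial.Chebyshev.intervalIntegrable_sqrt_one_sub_sq_inv.comp_mul_left (c := 2)).const_mul
    (2 / Real.pi)
  rw [intervalIntegrable_iff_integrableOn_Icc_of_le (by norm_num)] at h1
  norm_num at h1
  have h2 : IntegrableOn pdfPhi (Icc (-(1 / 2) : ℝ) (1 / 2)) := by
    refine IntegrableOn.congr_fun (f := fun y => 2 / Real.pi * √(1 - (2 * y) ^ 2)⁻¹) ?_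
      (fun y hy => (pdfPhi_eq y hy).symm) measurableSet_Icc
    norm_num
    exact h1
  rw [← integrableOn_univ]
  exact h2.of_forall_sdiff_eq_zero MeasurableSet.univ fun x hx => pdfPhi_eq_zero hx.2

/-- The cosine takes the same values on both half-periods, and substituting it on [0, π] gives the
Chebyshev weight 1/√(1−x²); rescaling by 2 gives the arcsine density on [−1/2, 1/2]. -/
lemma integral_comp_cos_angleLaw (S : Set ℝ) (hS : MeasurableSet S) :
    ∫ x, S.indicator (1 : ℝ → ℝ) (1 / 2 * Real.cos x) ∂angleLaw = ∫ y in S, pdfPhi y := by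
  let g : ℝ → ℝ := fun x => S.indicator (1 : ℝ → ℝ) (1 / 2 * x)
  have hg : Measurable g := (measurable_one.indicator hS).comp (by fun_prop)
  have hgi : ∀ a b, IntervalIntegrable (fun x => g (Real.cos x)) volume a b := fun a b => by
    rw [intervalIntegrable_iff]
    refine Measure.integrableOn_of_bounded (M := 1) (by simp)
      (hg.comp Real.measurable_cos).aestronglyMeasurable ?_
    refine Filter.Eventually.of_forall fun x => ?_
    simp only [g, indicator]
    split_ifs <;> simp
  rw [integral_angleLaw]
  change (2 * Real.pi)⁻¹ • ∫ x in (0 : ℝ)..(2 * Real.pi), g (Real.cos x) = _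
  rw [← intervalIntegral.integral_add_adjacent_intervals (hgi 0 Real.pi) (hgi _ _)]
  have h1 := intervalIntegral.integral_comp_sub_left (a := 0) (b := Real.pi)
    (fun x => g (Real.cos x)) (2 * Real.pi)
  simp only [Real.cos_two_pi_sub, sub_zero] at h1
  rw [show 2 * Real.pi - Real.pi = Real.pi by ring] at h1
  rw [← h1, ← Polynomial.Chebyshev.integral_measureT_eq_integral_cos,
    Polynomial.Chebyshev.integral_measureT]
  have h2 := intervalIntegral.integral_comp_mul_left (a := -(1 / 2)) (b := 1 / 2)
    (fun x => g x * √(1 - x ^ 2)⁻¹) (two_ne_zero (α := ℝ))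
  norm_num at h2
  have h3 : ∫ x in (-1 : ℝ)..1, g x * √(1 - x ^ 2)⁻¹ =
      2 * ∫ x in (-(1 / 2) : ℝ)..(1 / 2), g (2 * x) * √(1 - (2 * x) ^ 2)⁻¹ := by
    norm_num
    rw [h2]; ring
  rw [h3, ← integral_indicator hS]
  have h4 : ∫ y, S.indicator pdfPhi y = ∫ y in Icc (-(1 / 2) : ℝ) (1 / 2), S.indicator pdfPhi y := by
    refine (setIntegral_eq_integral_of_forall_compl_eq_zero fun x hx => ?_).symm
    by_cases hxS : x ∈ S
    · rw [indicator_of_mem hxS, pdfPhi_eq_zero hx]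
    · exact indicator_of_notMem hxS _
  rw [h4, integral_Icc_eq_integral_Ioc, ← intervalIntegral.integral_of_le (by norm_num),
    ← two_mul, ← intervalIntegral.integral_const_mul, ← intervalIntegral.integral_const_mul, smul_eq_mul,
    ← intervalIntegral.integral_const_mul]
  refine intervalIntegral.integral_congr fun y hy => ?_
  rw [uIcc_of_le (by norm_num)] at hy
  have e : 1 / 2 * (2 * y) = y := by ring
  simp only [g, e]
  by_cases hyS : y ∈ S
  · rw [indicator_of_mem hyS, indicator_of_mem hyS, pdfPhi_eq y hy, Pi.one_apply, one_mul]
    field_simp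
  · rw [indicator_of_notMem hyS, indicator_of_notMem hyS]; simp

lemma map_cos_angleLaw : angleLaw.map (fun x => 1 / 2 * Real.cos x) =
    volume.withDensity fun x => ENNReal.ofReal (pdfPhi x) := by
  have hm : Measurable fun x : ℝ => 1 / 2 * Real.cos x := by fun_prop
  ext S hS
  rw [withDensity_apply _ hS, Measure.map_apply hm hS,
    ← ofReal_integral_eq_lintegral_ofReal integrable_pdfPhi.integrableOn
      (Filter.Eventually.of_forall fun x => pdfPhi_nonneg x),
    ← integral_comp_cos_angleLaw S hS]
  have : (fun x => S.indicator (1 : ℝ → ℝ) (1 / 2 * Real.cos x)) =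
      ((fun x : ℝ => 1 / 2 * Real.cos x) ⁻¹' S).indicator 1 := rfl
  rw [this, integral_indicator_one (hm hS), ofReal_measureReal]

/-- Law of the deviation of the spatial angle of departure. -/
def devLaw : Measure ℝ :=
  (angleLaw.prod angleLaw).map fun q => 1 / 2 * Real.cos q.1 - 1 / 2 * Real.cos q.2

lemma measurable_devMap :
    Measurable fun q : ℝ × ℝ => 1 / 2 * Real.cos q.1 - 1 / 2 * Real.cos q.2 := by fun_prop

instance : IsProbabilityMeasure devLaw :=
  Measure.isProbabilityMeasure_map measurable_devMap.aemeasurable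

/-- Density of `devLaw`, as an extended nonnegative function. -/
def devDensity (y : ℝ) : ENNReal := ∫⁻ x, ENNReal.ofReal (pdfPhi x) * ENNReal.ofReal (pdfPhi (y + x))

lemma measurable_ofReal_pdfPhi : Measurable fun x => ENNReal.ofReal (pdfPhi x) :=
  ENNReal.measurable_ofReal.comp measurable_pdfPhi

lemma measurable_devDensity : Measurable devDensity := by
  have : Measurable fun q : ℝ × ℝ => ENNReal.ofReal (pdfPhi q.2) * ENNReal.ofReal (pdfPhi (q.1 + q.2)) :=
    (measurable_ofReal_pdfPhi.comp measurable_snd).mul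
      (measurable_ofReal_pdfPhi.comp (measurable_fst.add measurable_snd))
  exact this.lintegral_prod_right'

/-- Fixing the second variable and translating the first turns the law of the difference into the
correlation integral of the arcsine density; Fubini concludes. -/
lemma devLaw_eq_withDensity : devLaw = volume.withDensity devDensity := by
  have hm : Measurable fun x : ℝ => 1 / 2 * Real.cos x := by fun_prop
  have hf := measurable_ofReal_pdfPhi
  ext S hS
  have e1 : devLaw = (((angleLaw.map (fun x => 1 / 2 * Real.cos x)).prod
      (angleLaw.map (fun x => 1 / 2 * Real.cos x))).map fun q => q.1 - q.2) := by
    rw [Measure.map_prod_map _ _ hm hm, Measure.map_map (by fun_prop) (by fun_prop)]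
    rfl
  have : IsProbabilityMeasure (volume.withDensity fun x => ENNReal.ofReal (pdfPhi x)) := by
    rw [← map_cos_angleLaw]; exact Measure.isProbabilityMeasure_map hm.aemeasurable
  have hS' : MeasurableSet ((fun q : ℝ × ℝ => q.1 - q.2) ⁻¹' S) :=
    (measurable_fst.sub measurable_snd) hS
  rw [e1, map_cos_angleLaw, Measure.map_apply (by fun_prop) hS, Measure.prod_apply_symm hS',
    withDensity_apply _ hS,
    lintegral_withDensity_eq_lintegral_mul _ hf (measurable_measure_prodMk_right hS')]
  have e2 : ∀ x : ℝ, volume.withDensity (fun x => ENNReal.ofReal (pdfPhi x))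
      ((fun y => (y, x)) ⁻¹' ((fun q : ℝ × ℝ => q.1 - q.2) ⁻¹' S)) =
      ∫⁻ y in S, ENNReal.ofReal (pdfPhi (y + x)) := by
    intro x
    have hSx : MeasurableSet ((fun y => (y, x)) ⁻¹' ((fun q : ℝ × ℝ => q.1 - q.2) ⁻¹' S)) :=
      measurable_prodMk_right hS'
    rw [withDensity_apply _ hSx, ← lintegral_indicator hSx, ← lintegral_indicator hS,
      ← lintegral_add_right_eq_self _ x]
    refine lintegral_congr fun y => ?_
    by_cases hy : y ∈ S
    · rw [indicator_of_mem hy, indicator_of_mem (by simpa using hy)]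
    · rw [indicator_of_notMem hy, indicator_of_notMem (by simpa using hy)]
  simp only [Pi.mul_apply, e2]
  unfold devDensity
  rw [lintegral_lintegral_swap]
  · refine lintegral_congr fun x => ?_
    rw [lintegral_const_mul]
    exact hf.comp (measurable_id.add_const x)
  · exact ((hf.comp measurable_snd).mul (hf.comp (measurable_fst.add measurable_snd))).aemeasurable

/-- The identity holds pointwise, even where the correlation integral diverges (as at y = 0): both
conventions then give 0. Such points form a null set, so the density is unaffected. -/
lemma pdfDelta_eq (y : ℝ) : pdfDelta y = (devDensity y).toReal := by
  have h0 : ∀ x, 0 ≤ pdfPhi x * pdfPhi (y + x) := fun x =>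
    mul_nonneg (pdfPhi_nonneg _) (pdfPhi_nonneg _)
  have e : ∫ x, pdfPhi x * pdfPhi (y + x) = (devDensity y).toReal := by
    rw [integral_eq_lintegral_of_nonneg_ae (Filter.Eventually.of_forall h0)
      (measurable_pdfPhi.mul (measurable_pdfPhi.comp (measurable_const.add measurable_id))).aestronglyMeasurable]
    congr 1
    exact lintegral_congr fun x => ENNReal.ofReal_mul (pdfPhi_nonneg _)
  unfold pdfDelta
  split_ifs with hy
  · rw [← e, intervalIntegral.integral_of_le (by norm_num), ← integral_Icc_eq_integral_Ioc]
    exact setIntegral_eq_integral_of_forall_compl_eq_zero fun x hx => by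
      rw [pdfPhi_eq_zero hx, zero_mul]
  · rw [← e, ← integral_zero ℝ ℝ (μ := volume)]
    refine integral_congr_ae (Filter.Eventually.of_forall fun x => ?_)
    by_cases hx : x ∈ Icc (-(1 / 2) : ℝ) (1 / 2)
    · have : y + x ∉ Icc (-(1 / 2) : ℝ) (1 / 2) := fun h => hy ⟨by linarith [h.1, hx.2], by
        linarith [h.2, hx.1]⟩
      simp [pdfPhi_eq_zero this]
    · simp [pdfPhi_eq_zero hx]

lemma devDensity_neg (y : ℝ) : devDensity (-y) = devDensity y := by
  unfold devDensity
  rw [← lintegral_add_right_eq_self _ y]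
  refine lintegral_congr fun x => ?_
  rw [show -y + (x + y) = x by ring, mul_comm, add_comm]

lemma devDensity_lt_top : ∀ᵐ y, devDensity y < ⊤ := by
  refine ae_lt_top measurable_devDensity ?_
  rw [← setLIntegral_univ, ← withDensity_apply _ MeasurableSet.univ, ← devLaw_eq_withDensity]
  exact measure_ne_top _ _

lemma devLaw_real_eq {S : Set ℝ} (hS : MeasurableSet S) : devLaw.real S = ∫ y in S, pdfDelta y := by
  simp_rw [pdfDelta_eq]
  rw [integral_toReal measurable_devDensity.aemeasurable (ae_restrict_of_ae devDensity_lt_top),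
    ← withDensity_apply _ hS, ← devLaw_eq_withDensity]
  rfl

lemma devLaw_neg {S : Set ℝ} (hS : MeasurableSet S) : devLaw.real (Neg.neg ⁻¹' S) = devLaw.real S := by
  rw [measureReal_def, measureReal_def, devLaw_eq_withDensity, withDensity_apply _ hS,
    withDensity_apply _ (measurable_neg hS), ← lintegral_indicator hS,
    ← lintegral_indicator (measurable_neg hS), ← lintegral_neg_eq_self]
  congr 1
  refine lintegral_congr fun y => ?_
  by_cases hy : y ∈ S
  · rw [indicator_of_mem hy, indicator_of_mem (by simpa using hy), devDensity_neg]
  · rw [indicator_of_notMem hy, indicator_of_notMem (by simpa using hy)]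

lemma devLaw_absolutelyContinuous : devLaw ≪ volume := by
  rw [devLaw_eq_withDensity]; exact withDensity_absolutelyContinuous _ _

lemma devLaw_real_Ioc {a b : ℝ} (hab : a ≤ b) : devLaw.real (Ioc a b) = ∫ y in a..b, pdfDelta y := by
  rw [devLaw_real_eq measurableSet_Ioc, intervalIntegral.integral_of_le hab]

lemma ae_devLaw_mem : ∀ᵐ y ∂devLaw, y ∈ Icc (-1 : ℝ) 1 := by
  refine (ae_map_iff measurable_devMap.aemeasurable (measurableSet_Icc (a := (-1 : ℝ)) (b := 1))).2 ?_
  refine Filter.Eventually.of_forall fun q => ?_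
  have := Real.cos_le_one q.1; have := Real.neg_one_le_cos q.1
  have := Real.cos_le_one q.2; have := Real.neg_one_le_cos q.2
  constructor <;> linarith

/-- Distance to the nearest integer of a deviation in `[-1, 1]`. -/
def foldDev (D : ℝ) : ℝ := by
  classical exact if D < -(1 / 2) then |D + 1| else if 1 / 2 < D then |D - 1| else |D|

variable (p : Params)

lemma gB_eq_gainCore (D : ℝ) : p.gB D = p.gainCore (foldDev D) := by
  classical
  unfold gB foldDev
  split_ifs <;> rfl

/-- Lobe number `n` of the pattern. -/
def lobe (n : ℕ) : Set ℝ := Ioc ((n : ℝ) / p.Nb) (((n : ℝ) + 1) / p.Nb)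

lemma Nb_pos : (0 : ℝ) < p.Nb := by
  have := p.two_le_Nb
  exact_mod_cast (by omega : 0 < p.Nb)

variable {p} in
lemma lobe_unique {n k : ℕ} {u : ℝ} (hn : u ∈ lobe p n) (hk : u ∈ lobe p k) : n = k := by
  have h := Nb_pos p
  rw [lobe, mem_Ioc, div_lt_iff₀ h, le_div_iff₀ h] at hn hk
  have h1 : (n : ℝ) < k + 1 := by linarith [hn.1, hk.2]
  have h2 : (k : ℝ) < n + 1 := by linarith [hk.1, hn.2]
  have h1' : n < k + 1 := by exact_mod_cast h1
  have h2' : k < n + 1 := by exact_mod_cast h2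
  omega

lemma gainCore_of_mem_lobe {n : ℕ} (hn : n ≤ p.nTilde) {u : ℝ} (hu : u ∈ lobe p n) :
    p.gainCore u = p.gain n := by
  classical
  unfold gainCore
  by_cases h0 : n = 0
  · subst h0
    rw [if_pos]
    simpa [lobe] using hu.2
  · have h1 : ¬ u ≤ 1 / p.Nb := by
      intro hle
      have : u ∈ lobe p 0 := by
        refine ⟨?_, by simpa using hle⟩
        have : (0 : ℝ) ≤ (n : ℝ) / p.Nb := by positivity
        simpa using this.trans_lt hu.1
      exact h0 (lobe_unique hu this)
    rw [if_neg h1, Finset.sum_eq_single_of_mem n (by simp; omega)]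
    · exact if_pos hu
    · intro k _ hk
      exact if_neg fun q => hk (lobe_unique q hu)

lemma gainCore_of_forall_notMem {u : ℝ} (h0 : 0 < u) (hu : ∀ n ≤ p.nTilde, u ∉ lobe p n) :
    p.gainCore u = 0 := by
  classical
  unfold gainCore
  rw [if_neg]
  · refine Finset.sum_eq_zero fun k hk => if_neg ?_
    exact hu k (Finset.mem_Icc.1 hk).2
  · intro hle
    exact hu 0 (Nat.zero_le _) ⟨by simpa using h0, by simpa using hle⟩

/-- The lobes are disjoint, so at most one term is active. Positivity of u matters because the first
lobe is open at 0, where the pattern still takes its top level. -/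
lemma comp_gainCore_eq (F : ℝ → ℂ) {u : ℝ} (h0 : 0 < u) : F (p.gainCore u) =
    F 0 + ∑ n ∈ Finset.range (p.nTilde + 1), (lobe p n).indicator (fun _ => F (p.gain n) - F 0) u := by
  by_cases h : ∃ n ≤ p.nTilde, u ∈ lobe p n
  · obtain ⟨n, hn, hu⟩ := h
    rw [gainCore_of_mem_lobe p hn hu, Finset.sum_eq_single_of_mem n (by simp; omega)]
    · rw [indicator_of_mem hu]; ring
    · intro k _ hk
      exact indicator_of_notMem (fun q => hk (lobe_unique q hu)) _
  · push Not at h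
    rw [gainCore_of_forall_notMem p h0 h, Finset.sum_eq_zero, add_zero]
    intro k hk
    exact indicator_of_notMem (h k (by simpa [Nat.lt_succ_iff] using hk)) _

/-- Folding to the distance from the nearest integer pulls an interval (a, b] of [0, 1/2] back to
four pieces: itself, its mirror image in 1/2, and their negatives. Reflection swaps the open and
closed ends, so the identity is only claimed off finitely many values, which are null for an
absolutely continuous law. -/
lemma ae_foldDev : ∀ᵐ D ∂devLaw, 0 < foldDev D ∧ ∀ a b : ℝ, 0 ≤ a → b ≤ 1 / 2 →
    |D| ≠ 1 - a → |D| ≠ 1 - b → |D| ≠ 1 / 2 →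
    (Ioc a b).indicator (1 : ℝ → ℝ) (foldDev D) = (Ioc a b).indicator 1 D + (Ioc a b).indicator 1 (-D) +
      (Ioc (1 - b) (1 - a)).indicator 1 D + (Ioc (1 - b) (1 - a)).indicator 1 (-D) := by
  have h0 : ∀ c : ℝ, ∀ᵐ D ∂devLaw, D ≠ c := fun c =>
    devLaw_absolutelyContinuous (by simp)
  filter_upwards [ae_devLaw_mem, h0 0, h0 1, h0 (-1)] with D hD h1 h2 h3
  have hlt : D < 1 := lt_of_le_of_ne hD.2 h2
  have hgt : -1 < D := lt_of_le_of_ne hD.1 (Ne.symm h3)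
  constructor
  · unfold foldDev
    split_ifs
    · exact abs_pos.2 (by linarith)
    · exact abs_pos.2 (by linarith)
    · exact abs_pos.2 h1
  · intro a b ha hb q1 q2 q3
    rcases lt_or_gt_of_ne h1 with hneg | hpos
    · rw [abs_of_neg hneg] at q1 q2 q3
      have e1 : D ∉ Ioc a b := fun q => by linarith [q.1]
      have e2 : D ∉ Ioc (1 - b) (1 - a) := fun q => by linarith [q.1]
      rw [indicator_of_notMem e1, indicator_of_notMem e2, zero_add, add_zero]
      unfold foldDev
      split_ifs with c1 c2
      · rw [abs_of_pos (by linarith)]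
        have e3 : -D ∉ Ioc a b := fun q => by linarith [q.2]
        rw [indicator_of_notMem e3, zero_add]
        simp only [indicator, mem_Ioc, Pi.one_apply]
        congr 1
        refine propext ⟨fun q => ⟨lt_of_le_of_ne (by linarith [q.2]) (Ne.symm q2), by linarith [q.1]⟩,
          fun q => ⟨?_, by linarith [q.1]⟩⟩
        have : -D < 1 - a := lt_of_le_of_ne q.2 q1
        linarith
      · linarith
      · rw [abs_of_neg hneg]
        have e3 : -D ∉ Ioc (1 - b) (1 - a) := fun q => by linarith [q.1]
        rw [indicator_of_notMem e3, add_zero]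
    · rw [abs_of_pos hpos] at q1 q2 q3
      have e1 : -D ∉ Ioc a b := fun q => by linarith [q.1]
      have e2 : -D ∉ Ioc (1 - b) (1 - a) := fun q => by linarith [q.1]
      rw [indicator_of_notMem e1, indicator_of_notMem e2, add_zero, add_zero]
      unfold foldDev
      split_ifs with c1 c2
      · linarith
      · rw [abs_of_neg (by linarith)]
        have e3 : D ∉ Ioc a b := fun q => by linarith [q.2]
        rw [indicator_of_notMem e3, zero_add]
        simp only [indicator, mem_Ioc, Pi.one_apply]
        congr 1
        refine propext ⟨fun q => ⟨lt_of_le_of_ne (by linarith [q.2]) (Ne.symm q2), by linarith [q.1]⟩,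
          fun q => ⟨?_, by linarith [q.1]⟩⟩
        have : D < 1 - a := lt_of_le_of_ne q.2 q1
        linarith
      · rw [abs_of_pos hpos]
        have e3 : D ∉ Ioc (1 - b) (1 - a) := fun q => by linarith [q.1]
        rw [indicator_of_notMem e3, add_zero]

lemma measurable_foldDev : Measurable foldDev := by
  classical
  unfold foldDev
  exact Measurable.ite measurableSet_Iio (by fun_prop)
    (Measurable.ite measurableSet_Ioi (by fun_prop) (by fun_prop))

lemma ae_abs_ne (c : ℝ) : ∀ᵐ D ∂devLaw, |D| ≠ c := by
  have h0 : ∀ c : ℝ, ∀ᵐ D ∂devLaw, D ≠ c := fun c =>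
    devLaw_absolutelyContinuous (by simp)
  filter_upwards [h0 c, h0 (-c)] with D h1 h2 h
  rcases abs_choice D with h3 | h3
  · exact h1 (h3 ▸ h)
  · exact h2 (by linarith)

/-- The four pieces of the folded lobe have pairwise equal mass by symmetry of the law, which
accounts for the factors 2 in front of two integrals. -/
lemma devLaw_lobe {n : ℕ} (hn : n ≤ p.nTilde) :
    devLaw.real (foldDev ⁻¹' lobe p n) = p.probLobe n := by
  set a : ℝ := (n : ℝ) / p.Nb with ha
  set b : ℝ := ((n : ℝ) + 1) / p.Nb with hb
  have hN := Nb_pos p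
  have hab : a ≤ b := by rw [ha, hb]; gcongr; linarith
  have ha0 : 0 ≤ a := by positivity
  -- From n ≤ ⌊N_b/2⌋ − 1 follows 2(n+1) ≤ N_b: every active lobe lies in [0, 1/2].
  have hb2 : b ≤ 1 / 2 := by
    rw [hb, div_le_div_iff₀ hN two_pos]
    have h2 := p.two_le_Nb
    have : (n + 1) * 2 ≤ 1 * p.Nb := by unfold nTilde at hn; omega
    exact_mod_cast this
  have hl : lobe p n = Ioc a b := rfl
  have hm : ∀ S : Set ℝ, MeasurableSet S → Integrable (fun D => S.indicator (1 : ℝ → ℝ) D) devLaw :=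
    fun S hS => (integrable_indicator_iff hS).2 (integrable_const (1 : ℝ)).integrableOn
  have hm' : ∀ S : Set ℝ, MeasurableSet S → Integrable (fun D => S.indicator (1 : ℝ → ℝ) (-D)) devLaw :=
    fun S hS => (integrable_indicator_iff (measurable_neg hS)).2
      (integrable_const (1 : ℝ)).integrableOn
  have hi : ∀ S : Set ℝ, MeasurableSet S → ∫ D, S.indicator (1 : ℝ → ℝ) D ∂devLaw = devLaw.real S :=
    fun S hS => integral_indicator_one hS
  have hi' : ∀ S : Set ℝ, MeasurableSet S → ∫ D, S.indicator (1 : ℝ → ℝ) (-D) ∂devLaw = devLaw.real S :=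
    fun S hS => by
      rw [← devLaw_neg hS]
      exact integral_indicator_one (measurable_neg hS)
  rw [← integral_indicator_one (measurable_foldDev (by rw [hl]; exact measurableSet_Ioc))]
  have e : ∀ᵐ D ∂devLaw, (foldDev ⁻¹' lobe p n).indicator (1 : ℝ → ℝ) D =
      (Ioc a b).indicator 1 D + (Ioc a b).indicator 1 (-D) +
      (Ioc (1 - b) (1 - a)).indicator 1 D + (Ioc (1 - b) (1 - a)).indicator 1 (-D) := by
    filter_upwards [ae_foldDev, ae_abs_ne (1 - a), ae_abs_ne (1 - b), ae_abs_ne (1 / 2)] with D h1 h2 h3 h4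
    exact h1.2 a b ha0 hb2 h2 h3 h4
  rw [integral_congr_ae e, integral_add, integral_add, integral_add, hi _ measurableSet_Ioc,
    hi' _ measurableSet_Ioc, hi _ measurableSet_Ioc, hi' _ measurableSet_Ioc, devLaw_real_Ioc hab,
    devLaw_real_Ioc (by linarith), probLobe]
  · ring
  · exact hm _ measurableSet_Ioc
  · exact hm' _ measurableSet_Ioc
  · exact (hm _ measurableSet_Ioc).add (hm' _ measurableSet_Ioc)
  · exact hm _ measurableSet_Ioc
  · exact ((hm _ measurableSet_Ioc).add (hm' _ measurableSet_Ioc)).add (hm _ measurableSet_Ioc)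
  · exact hm' _ measurableSet_Ioc

lemma gain_nTilde_succ : p.gain (p.nTilde + 1) = 0 := by
  unfold gain
  rw [if_neg (by omega), if_neg (by omega)]

/-- Law of the gain of the discrete antenna pattern. -/
lemma integral_comp_gB (F : ℝ → ℂ) : ∫ D, F (p.gB D) ∂devLaw =
    ∑ n ∈ Finset.range (p.nTilde + 2), (p.probGain n : ℂ) * F (p.gain n) := by
  have hm : ∀ n, MeasurableSet (foldDev ⁻¹' lobe p n) := fun n => measurable_foldDev measurableSet_Ioc
  have e : ∀ᵐ D ∂devLaw, F (p.gB D) = F 0 + ∑ n ∈ Finset.range (p.nTilde + 1),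
      (foldDev ⁻¹' lobe p n).indicator (fun _ => F (p.gain n) - F 0) D := by
    filter_upwards [ae_foldDev] with D hD
    rw [gB_eq_gainCore, comp_gainCore_eq p F hD.1]
    rfl
  have hint : ∀ n, Integrable ((foldDev ⁻¹' lobe p n).indicator fun _ => F (p.gain n) - F 0) devLaw :=
    fun n => (integrable_indicator_iff (hm n)).2 (integrable_const _).integrableOn
  rw [integral_congr_ae e, integral_add (integrable_const _) (integrable_finsetSum _ fun n _ => hint n),
    integral_finsetSum _ fun n _ => hint n, Finset.sum_range_succ _ (p.nTilde + 1), gain_nTilde_succ]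
  have e1 : ∀ n ∈ Finset.range (p.nTilde + 1),
      ∫ D, (foldDev ⁻¹' lobe p n).indicator (fun _ => F (p.gain n) - F 0) D ∂devLaw =
        (p.probGain n : ℂ) * F (p.gain n) - (p.probLobe n : ℂ) * F 0 := by
    intro n hn
    have hn' : n ≤ p.nTilde := by simpa [Nat.lt_succ_iff] using hn
    rw [integral_indicator (hm n), setIntegral_const, devLaw_lobe p hn', probGain, if_pos hn',
      Complex.real_smul]
    ring
  rw [Finset.sum_congr rfl e1, Finset.sum_sub_distrib, ← Finset.sum_mul, probGain,
    if_neg (by omega)]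
  simp
  ring

lemma gULA_nonneg (x : ℝ) : 0 ≤ p.gULA x := by
  unfold gULA; split_ifs <;> positivity

lemma gain_nonneg (n : ℕ) : 0 ≤ p.gain n := by
  have := p.delta_pos
  unfold gain
  split_ifs
  · exact mul_nonneg (by positivity) (gULA_nonneg p _)
  · exact mul_nonneg (by positivity) (gULA_nonneg p _)
  · exact le_rfl

lemma gB_nonneg (D : ℝ) : 0 ≤ p.gB D := by
  rw [gB_eq_gainCore]
  unfold gainCore
  split_ifs
  · exact gain_nonneg p 0
  · refine Finset.sum_nonneg fun n _ => ?_
    split_ifs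
    · exact gain_nonneg p n
    · exact le_rfl

lemma gB_le (D : ℝ) : p.gB D ≤ ∑ n ∈ Finset.range (p.nTilde + 1), p.gain n := by
  classical
  rw [gB_eq_gainCore]
  unfold gainCore
  split_ifs
  · exact Finset.single_le_sum (f := p.gain) (fun n _ => gain_nonneg p n) (by simp)
  · refine (Finset.sum_le_sum (g := p.gain) fun n _ => ?_).trans
      (Finset.sum_le_sum_of_subset_of_nonneg (fun n hn => ?_) fun n _ _ => gain_nonneg p n)
    · split_ifs
      · exact le_rfl
      · exact gain_nonneg p n
    · simp only [Finset.mem_Icc, Finset.mem_range] at *; omega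

lemma measurable_gB : Measurable p.gB := by
  classical
  have : p.gB = fun D => p.gainCore (foldDev D) := funext (gB_eq_gainCore p)
  rw [this]
  have hg : Measurable p.gainCore := by
    unfold gainCore
    refine Measurable.ite measurableSet_Iic measurable_const (Finset.measurable_sum _ fun n _ => ?_)
    exact Measurable.ite measurableSet_Ioc measurable_const measurable_const
  exact hg.comp measurable_foldDev

end AntennaPattern

end

end RisNet

namespace RisNet
noncomputable section

/-! ### The Gamma law with shape and rate m -/

section GammaTransform

set_option linter.unusedSectionVars false

open Filter Topology

lemma gammaPDFReal_of_neg (a r : ℝ) {h : ℝ} (hh : h < 0) : gammaPDFReal a r h = 0 := by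
  rw [gammaPDFReal, if_neg (not_le.2 hh)]

variable {m : ℕ} (hm : 1 ≤ m)

include hm

lemma toReal_gammaPDF (h : ℝ) : (gammaPDF m m h).toReal = (Ici 0).indicator (erlang m) h := by
  have hm0 : (0 : ℝ) < m := by exact_mod_cast hm
  rw [gammaPDF, ENNReal.toReal_ofReal (gammaPDFReal_nonneg hm0 hm0 h)]
  by_cases hh : 0 ≤ h
  · rw [indicator_of_mem (by exact hh), gammaPDFReal_eq_erlang hm hh]
  · rw [indicator_of_notMem (by exact hh), gammaPDFReal_of_neg _ _ (not_le.1 hh)]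

lemma isProbabilityMeasure_erlang : IsProbabilityMeasure (gammaMeasure m m) := by
  have hm0 : (0 : ℝ) < m := by exact_mod_cast hm
  exact isProbabilityMeasure_gammaMeasure hm0 hm0

lemma measurable_gammaPDF : Measurable (gammaPDF m m) :=
  ENNReal.measurable_ofReal.comp (measurable_gammaPDFReal m m)

lemma integral_gammaMeasure {E : Type*} [NormedAddCommGroup E] [NormedSpace ℝ E] (f : ℝ → E) :
    ∫ h, f h ∂(gammaMeasure m m) = ∫ h in Ioi 0, erlang m h • f h := by
  rw [gammaMeasure, integral_withDensity_eq_integral_toReal_smul (measurable_gammaPDF hm)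
    (Eventually.of_forall fun h => ENNReal.ofReal_lt_top), ← integral_Ici_eq_integral_Ioi,
    ← integral_indicator measurableSet_Ici]
  refine integral_congr_ae (Eventually.of_forall fun h => ?_)
  simp only [toReal_gammaPDF hm]
  by_cases hh : h ∈ Ici (0 : ℝ) <;> simp [hh]

lemma integrable_gammaMeasure_iff {E : Type*} [NormedAddCommGroup E] [NormedSpace ℝ E] (f : ℝ → E) :
    Integrable f (gammaMeasure m m) ↔ IntegrableOn (fun h => erlang m h • f h) (Ioi 0) := by
  rw [gammaMeasure, integrable_withDensity_iff_integrable_smul' (measurable_gammaPDF hm)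
    (Eventually.of_forall fun h => ENNReal.ofReal_lt_top), ← integrableOn_Ici_iff_integrableOn_Ioi,
    ← integrable_indicator_iff measurableSet_Ici]
  refine integrable_congr (Eventually.of_forall fun h => ?_)
  simp only [toReal_gammaPDF hm]
  by_cases hh : h ∈ Ici (0 : ℝ) <;> simp [hh]

lemma ae_gammaMeasure_nonneg : ∀ᵐ h ∂(gammaMeasure m m), 0 ≤ h := by
  have : (gammaMeasure m m) (Iio 0) = 0 := by
    rw [gammaMeasure, withDensity_apply _ measurableSet_Iio]
    exact lintegral_gammaPDF_of_nonpos le_rfl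
  rw [ae_iff]
  simpa [Iio] using this

lemma integrable_id_gammaMeasure : Integrable (fun h : ℝ => h) (gammaMeasure m m) := by
  rw [integrable_gammaMeasure_iff hm]
  have hm0 : (0 : ℝ) < m := by exact_mod_cast hm
  have h1 := integrableOn_rpow_mul_exp_neg_mul_rpow (p := 1) (s := m) (b := m) (by linarith) one_pos hm0
  refine IntegrableOn.congr_fun (Integrable.const_mul h1 ((m : ℝ) ^ m / (m - 1).factorial))
    (fun h _ => ?_) measurableSet_Ioi
  obtain ⟨n, rfl⟩ : ∃ n, m = n + 1 := ⟨m - 1, by omega⟩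
  rw [Real.rpow_one, Real.rpow_natCast, smul_eq_mul, erlang]
  simp only [Nat.add_sub_cancel, mul_pow, neg_mul]
  ring

/-- Characteristic function of the Gamma law with shape and rate `m`. -/
lemma integral_exp_gammaMeasure (y : ℝ) :
    ∫ h, Complex.exp (Complex.I * ((y * h : ℝ) : ℂ)) ∂(gammaMeasure m m) =
      ((1 - Complex.I * y / m) ^ m)⁻¹ := by
  have hm0 : (0 : ℝ) < m := by exact_mod_cast hm
  have hmC : (m : ℂ) ≠ 0 := by exact_mod_cast hm0.ne'
  obtain ⟨n, hn⟩ : ∃ n, m = n + 1 := ⟨m - 1, by omega⟩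
  set c : ℂ := m - Complex.I * y with hc
  have hcre : c.re = m := by simp [hc]
  have hc0 : c ≠ 0 := fun h => by
    have := congrArg Complex.re h
    rw [hcre] at this
    exact hm0.ne' (by simpa using this)
  -- An antiderivative of the integrand, with c = m − jy and k = m − 1 in the polynomial sums. It
  -- vanishes at infinity since Re c = m ≥ 1, and its value −m^m/c^m at 0 gives the transform.
  let F : ℝ → ℂ := fun h => -((m : ℂ) ^ m * (Complex.exp (-c * h) * expPolySum c n h))
  have hF : ∀ h : ℝ, HasDerivAt F ((erlang m h : ℂ) * Complex.exp (Complex.I * ((y * h : ℝ) : ℂ))) h := by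
    intro h
    have := (((mul_expPolySum hc0 n (h : ℂ)).const_mul ((m : ℂ) ^ m)).neg).comp_ofReal
    refine this.congr_deriv ?_
    rw [ofReal_erlang]
    have e : Complex.exp (-c * h) = Complex.exp (-(m * h)) * Complex.exp (Complex.I * ((y * h : ℝ) : ℂ)) := by
      rw [← Complex.exp_add]; congr 1; rw [hc]; push_cast; ring
    have e2 : m - 1 = n := by omega
    rw [e, e2, mul_pow, hn, pow_succ]
    ring
  have hterm : ∀ j : ℕ, Tendsto (fun h : ℝ => Complex.exp (-c * h) * (h : ℂ) ^ j) atTop (𝓝 0) := by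
    intro j
    refine squeeze_zero_norm' ?_ (Real.tendsto_pow_mul_exp_neg_atTop_nhds_zero j)
    filter_upwards [eventually_ge_atTop (0 : ℝ)] with h hh
    rw [norm_mul, norm_pow, Complex.norm_real, Real.norm_of_nonneg hh, Complex.norm_exp, mul_comm]
    have hm1 : (1 : ℝ) ≤ m := by exact_mod_cast hm
    have : (-c * (h : ℂ)).re ≤ -h := by
      rw [Complex.re_mul_ofReal, Complex.neg_re, hcre]
      nlinarith
    gcongr
  have hlim : Tendsto F atTop (𝓝 0) := by
    have h1 : Tendsto (fun h : ℝ => Complex.exp (-c * h) * expPolySum c n h) atTop (𝓝 0) := by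
      have e : ∀ h : ℝ, Complex.exp (-c * h) * expPolySum c n h = ∑ i ∈ Finset.range (n + 1),
          (Complex.exp (-c * h) * (h : ℂ) ^ (n - i)) * (((n - i).factorial : ℂ)⁻¹ * (c ^ (i + 1))⁻¹) := by
        intro h
        rw [expPolySum, Finset.mul_sum]
        refine Finset.sum_congr rfl fun i _ => ?_
        simp only [div_eq_mul_inv]; ring
      simp_rw [e]
      rw [← Finset.sum_const_zero (s := Finset.range (n + 1)) (M := ℂ)]
      refine tendsto_finsetSum _ fun i _ => ?_
      simpa using (hterm (n - i)).mul_const (((n - i).factorial : ℂ)⁻¹ * (c ^ (i + 1))⁻¹)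
    simpa [F] using (h1.const_mul ((m : ℂ) ^ m)).neg
  have := isProbabilityMeasure_erlang hm
  have hint : IntegrableOn (fun h : ℝ => (erlang m h : ℂ) * Complex.exp (Complex.I * ((y * h : ℝ) : ℂ)))
      (Ioi 0) := by
    have h1 : Integrable (fun h : ℝ => Complex.exp (Complex.I * ((y * h : ℝ) : ℂ))) (gammaMeasure m m) := by
      refine Integrable.of_bound (by fun_prop) 1 (Eventually.of_forall fun h => ?_)
      rw [Complex.norm_exp_I_mul_ofReal]
    simpa [Complex.real_smul] using (integrable_gammaMeasure_iff hm _).1 h1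
  rw [integral_gammaMeasure hm]
  simp only [Complex.real_smul]
  rw [integral_Ioi_of_hasDerivAt_of_tendsto (hF 0).continuousAt.continuousWithinAt (fun h _ => hF h) hint hlim]
  have e0 : expPolySum c n (0 : ℂ) = 1 / c ^ (n + 1) := by
    rw [expPolySum, Finset.sum_eq_single_of_mem n (by simp)]
    · simp
    · intro i hi hin
      have : n - i ≠ 0 := by have := Finset.mem_range.1 hi; omega
      simp [this]
  simp only [F, Complex.ofReal_zero, mul_zero, Complex.exp_zero, one_mul, e0, zero_sub, neg_neg]
  have e3 : 1 - Complex.I * y / m = c / m := by rw [hc]; field_simp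
  rw [e3, div_pow, inv_div, ← hn, mul_one_div]

end GammaTransform

/-! ### The single-link characteristic functions κ -/

section Kappa

open Params Filter

variable (p : Params)

lemma one_le_shape (v : LinkState) : 1 ≤ p.shape v := by
  cases v
  · exact p.one_le_mL
  · exact p.one_le_mN

lemma zeta_pos : 0 < p.zeta := by
  have := p.lamF_pos; have := Real.pi_pos
  unfold Params.zeta; positivity

lemma beta_pos : 0 < p.beta := by
  have := p.lamO_pos; have := p.Lo_pos; have := Real.pi_pos
  unfold Params.beta; positivity

/-- The fading law of an interfering link. -/
def fadeLaw (v : LinkState) : Measure ℝ := gammaMeasure (p.shape v) (p.shape v)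

instance (v : LinkState) : IsProbabilityMeasure (fadeLaw p v) :=
  isProbabilityMeasure_erlang (one_le_shape p v)

/-- The function `κ_v` on the imaginary axis is a characteristic function. -/
lemma kappa_eq_integral (v : LinkState) (y : ℝ) : p.kappa v (-(Complex.I * y)) =
    ∫ D, ∫ h, Complex.exp (Complex.I * ((y * p.gB D * h : ℝ) : ℂ)) ∂(fadeLaw p v) ∂devLaw := by
  have e : ∀ g : ℝ, ∫ h, Complex.exp (Complex.I * ((y * g * h : ℝ) : ℂ)) ∂(fadeLaw p v) =
      ((1 + -(Complex.I * y) * (g : ℂ) / (p.shape v : ℂ)) ^ p.shape v)⁻¹ := fun g => by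
    rw [fadeLaw, integral_exp_gammaMeasure (one_le_shape p v)]
    push_cast
    congr 2
    ring
  simp_rw [e]
  rw [integral_comp_gB p fun g => ((1 + -(Complex.I * y) * (g : ℂ) / (p.shape v : ℂ)) ^ p.shape v)⁻¹]
  rfl

lemma norm_kappa_le (v : LinkState) (y : ℝ) : ‖p.kappa v (-(Complex.I * y))‖ ≤ 1 := by
  rw [kappa_eq_integral]
  refine (norm_integral_le_of_norm_le_const (C := 1) (Eventually.of_forall fun D => ?_)).trans (by simp)
  refine (norm_integral_le_of_norm_le_const (C := 1) (Eventually.of_forall fun h => ?_)).trans (by simp)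
  rw [Complex.norm_exp_I_mul_ofReal]

/-- An upper bound of the product of an antenna gain with the mean of a fading power. -/
def gainFade (v : LinkState) : ℝ :=
  (∑ n ∈ Finset.range (p.nTilde + 1), p.gain n) * ∫ h, |h| ∂(fadeLaw p v)

lemma gainFade_nonneg (v : LinkState) : 0 ≤ gainFade p v :=
  mul_nonneg (Finset.sum_nonneg fun n _ => gain_nonneg p n) (integral_nonneg fun _ => abs_nonneg _)

/-- The estimate |e^{iθ} − 1| ≤ |θ| is averaged over bounded gain and fading of finite mean.
Linearity in y makes the exponent of the interference integrable at infinity and Lipschitz at x = 0.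
-/
lemma norm_kappa_sub_one_le (v : LinkState) (y : ℝ) :
    ‖p.kappa v (-(Complex.I * y)) - 1‖ ≤ gainFade p v * |y| := by
  have hi := (integrable_id_gammaMeasure (one_le_shape p v)).abs
  have key : ∀ D, ‖(∫ h, Complex.exp (Complex.I * ((y * p.gB D * h : ℝ) : ℂ)) ∂(fadeLaw p v)) - 1‖ ≤
      gainFade p v * |y| := by
    intro D
    have e : (1 : ℂ) = ∫ h, (1 : ℂ) ∂(fadeLaw p v) := by simp
    rw [e, ← integral_sub _ (integrable_const _)]
    · calc _ ≤ ∫ h, |y * p.gB D| * |h| ∂(fadeLaw p v) := by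
            refine norm_integral_le_of_norm_le (hi.const_mul _) (Eventually.of_forall fun h => ?_)
            rw [← abs_mul]
            exact Real.norm_exp_I_mul_ofReal_sub_one_le
        _ ≤ gainFade p v * |y| := by
            rw [integral_const_mul, gainFade, abs_mul, abs_of_nonneg (gB_nonneg p D)]
            have := gB_le p D
            have h0 : 0 ≤ ∫ h, |h| ∂(fadeLaw p v) := integral_nonneg fun _ => abs_nonneg _
            calc _ ≤ |y| * (∑ n ∈ Finset.range (p.nTilde + 1), p.gain n) * ∫ h, |h| ∂(fadeLaw p v) := by
                  gcongr
              _ = _ := by ring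
    · refine Integrable.of_bound (by fun_prop) 1 (Eventually.of_forall fun h => ?_)
      rw [Complex.norm_exp_I_mul_ofReal]
  have hm : Measurable fun D => ∫ h, Complex.exp (Complex.I * ((y * p.gB D * h : ℝ) : ℂ)) ∂(fadeLaw p v) := by
    have := measurable_gB p
    have h2 : Measurable fun q : ℝ × ℝ => Complex.exp (Complex.I * ((y * p.gB q.1 * q.2 : ℝ) : ℂ)) := by
      fun_prop
    exact (h2.stronglyMeasurable.integral_prod_right (ν := fadeLaw p v)).measurable
  have e : (1 : ℂ) = ∫ D, (1 : ℂ) ∂devLaw := by simp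
  rw [kappa_eq_integral, e, ← integral_sub _ (integrable_const _)]
  · exact (norm_integral_le_of_norm_le_const (Eventually.of_forall key)).trans (by simp)
  · refine Integrable.of_bound hm.aestronglyMeasurable 1 (Eventually.of_forall fun D => ?_)
    refine (norm_integral_le_of_norm_le_const (C := 1) (Eventually.of_forall fun h => ?_)).trans (by simp)
    rw [Complex.norm_exp_I_mul_ofReal]

lemma continuous_kappa_imag (v : LinkState) : Continuous fun y : ℝ => p.kappa v (-(Complex.I * y)) := by
  have hs : (p.shape v : ℂ) ≠ 0 := by
    have := one_le_shape p v
    exact_mod_cast (by omega : p.shape v ≠ 0)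
  unfold kappa
  refine continuous_finsetSum _ fun n _ => continuous_const.mul (Continuous.inv₀ (by fun_prop) fun y => ?_)
  refine pow_ne_zero _ fun h => ?_
  have := congrArg Complex.re h
  rw [show (-(Complex.I * (y : ℂ)) * (p.gain n : ℂ) / (p.shape v : ℂ)) =
    Complex.I * ((-(y * p.gain n / p.shape v) : ℝ) : ℂ) by push_cast; ring] at this
  simp at this

end Kappa

end

end RisNet

namespace RisNet
noncomputable section

/-! ### Power received from one BS as a function of its distance and marks -/

section Marks

open Params

set_option linter.unusedSectionVars false

variable (p : Params)

/-- The fading power of an interfering link in a given state. -/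
def markFade : LinkState → ℝ × ℝ × ℝ × ℝ × ℝ → ℝ
  | .L, m => m.2.2.2.1
  | .N, m => m.2.2.2.2

/-- Marks for which a link of length `d` is in a given state. -/
def markIn : LinkState → ℝ → Set (ℝ × ℝ × ℝ × ℝ × ℝ)
  | .L, d => {m | m.1 ≤ p.probState .L d}
  | .N, d => {m | ¬ m.1 ≤ p.probState .L d}

/-- Mean power received over a link of length `d` with unit gain. -/
def meanPow (v : LinkState) (d : ℝ) : ℝ := p.pb * p.zeta * d ^ (-p.alpha v)

/-- Power received over a link of length `d`, if it is in state `v`. -/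
def chanPow (v : LinkState) (d : ℝ) (m : ℝ × ℝ × ℝ × ℝ × ℝ) : ℝ :=
  meanPow p v d * p.gB (1 / 2 * Real.cos m.2.1 - 1 / 2 * Real.cos m.2.2.1) * markFade v m

/-- Contribution of links in state `v` to the received power. -/
def tauState (v : LinkState) (d : ℝ) (m : ℝ × ℝ × ℝ × ℝ × ℝ) : ℝ :=
  (markIn p v d).indicator (chanPow p v d) m

/-- Power received from a BS at distance `d`. -/
def tau (d : ℝ) (m : ℝ × ℝ × ℝ × ℝ × ℝ) : ℝ := tauState p .L d m + tauState p .N d m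

lemma measurable_markFade (v : LinkState) : Measurable (markFade v) := by
  cases v
  · exact measurable_fst.comp (measurable_snd.comp (measurable_snd.comp measurable_snd))
  · exact measurable_snd.comp (measurable_snd.comp (measurable_snd.comp measurable_snd))

lemma continuous_probState (v : LinkState) : Continuous (p.probState v) := by
  cases v
  · exact (by fun_prop : Continuous fun t => Real.exp (-p.beta * t))
  · exact (by fun_prop : Continuous fun t => 1 - Real.exp (-p.beta * t))

lemma measurableSet_markIn' (v : LinkState) :
    MeasurableSet {q : ℝ × ℝ × ℝ × ℝ × ℝ × ℝ | q.2 ∈ markIn p v q.1} := by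
  have h : MeasurableSet {q : ℝ × ℝ × ℝ × ℝ × ℝ × ℝ | q.2.1 ≤ p.probState .L q.1} :=
    measurableSet_le (by fun_prop) ((continuous_probState p .L).measurable.comp measurable_fst)
  cases v
  · exact h
  · exact h.compl

lemma measurable_chanPow (v : LinkState) :
    Measurable fun q : ℝ × ℝ × ℝ × ℝ × ℝ × ℝ => chanPow p v q.1 q.2 := by
  have h1 := measurable_gB p
  have h2 := measurable_markFade v
  unfold chanPow meanPow
  fun_prop

lemma measurable_tauState (v : LinkState) :
    Measurable fun q : ℝ × ℝ × ℝ × ℝ × ℝ × ℝ => tauState p v q.1 q.2 := by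
  have : (fun q : ℝ × ℝ × ℝ × ℝ × ℝ × ℝ => tauState p v q.1 q.2) =
      {q : ℝ × ℝ × ℝ × ℝ × ℝ × ℝ | q.2 ∈ markIn p v q.1}.indicator fun q => chanPow p v q.1 q.2 := rfl
  rw [this]
  exact (measurable_chanPow p v).indicator (measurableSet_markIn' p v)

lemma measurable_tau : Measurable fun q : ℝ × ℝ × ℝ × ℝ × ℝ × ℝ => tau p q.1 q.2 :=
  (measurable_tauState p .L).add (measurable_tauState p .N)

lemma tau_eq_of_mem {v : LinkState} {d : ℝ} {m : ℝ × ℝ × ℝ × ℝ × ℝ} (hm : m ∈ markIn p v d) :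
    tau p d m = chanPow p v d m := by
  cases v
  · have h2 : m ∉ markIn p .N d := fun h => h hm
    rw [tau, tauState, tauState, indicator_of_mem hm, indicator_of_notMem h2, add_zero]
  · have h2 : m ∉ markIn p .L d := fun h => hm h
    rw [tau, tauState, tauState, indicator_of_mem hm, indicator_of_notMem h2, zero_add]

lemma probState_mem (v : LinkState) {d : ℝ} (hd : 0 ≤ d) : p.probState v d ∈ Icc (0 : ℝ) 1 := by
  have h1 : Real.exp (-p.beta * d) ≤ 1 := Real.exp_le_one_iff.2 (by
    have := beta_pos p; nlinarith)
  have h2 := Real.exp_nonneg (-p.beta * d)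
  cases v
  · exact ⟨h2, h1⟩
  · exact ⟨sub_nonneg.2 h1, sub_le_self _ h2⟩

lemma probState_add (d : ℝ) : p.probState .L d + p.probState .N d = 1 :=
  add_sub_cancel _ _

/-- Characteristic function of the power received from a BS at distance `|d|`. -/
def psi (x d : ℝ) : ℂ :=
  (p.probState .L |d| : ℂ) * p.kappa .L (-(Complex.I * ((x * meanPow p .L |d| : ℝ) : ℂ))) +
    (p.probState .N |d| : ℂ) * p.kappa .N (-(Complex.I * ((x * meanPow p .N |d| : ℝ) : ℂ)))

lemma measurable_meanPow (v : LinkState) : Measurable (meanPow p v) := by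
  unfold meanPow; fun_prop

lemma meanPow_nonneg (v : LinkState) {d : ℝ} (hd : 0 ≤ d) : 0 ≤ meanPow p v d :=
  mul_nonneg (mul_nonneg p.pb_pos.le (zeta_pos p).le) (Real.rpow_nonneg hd _)

lemma measurable_psi (x : ℝ) : Measurable (psi p x) := by
  have hk : ∀ v, Measurable fun d : ℝ =>
      p.kappa v (-(Complex.I * ((x * meanPow p v |d| : ℝ) : ℂ))) := fun v =>
    (continuous_kappa_imag p v).measurable.comp
      (((measurable_meanPow p v).comp measurable_norm).const_mul x)
  have hp : ∀ v, Measurable fun d : ℝ => (p.probState v |d| : ℂ) := fun v =>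
    Complex.measurable_ofReal.comp ((continuous_probState p v).measurable.comp measurable_norm)
  exact ((hp .L).mul (hk .L)).add ((hp .N).mul (hk .N))

lemma norm_psi_le (x d : ℝ) : ‖psi p x d‖ ≤ 1 := by
  have h : ∀ v, ‖(p.probState v |d| : ℂ) * p.kappa v (-(Complex.I * ((x * meanPow p v |d| : ℝ) : ℂ)))‖ ≤
      p.probState v |d| := fun v => by
    rw [norm_mul, Complex.norm_real, Real.norm_of_nonneg (probState_mem p v (abs_nonneg d)).1]
    exact mul_le_of_le_one_right (probState_mem p v (abs_nonneg d)).1 (norm_kappa_le p v _)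
  exact (norm_add_le _ _).trans ((add_le_add (h .L) (h .N)).trans (probState_add p _).le)

/-- Upper bound of the mean power received over a link of length `d`. -/
def decay (v : LinkState) (d : ℝ) : ℝ := gainFade p v * (meanPow p v d * p.probState v d)

lemma decay_nonneg (v : LinkState) {d : ℝ} (hd : 0 ≤ d) : 0 ≤ decay p v d :=
  mul_nonneg (gainFade_nonneg p v) (mul_nonneg (meanPow_nonneg p v hd) (probState_mem p v hd).1)

lemma measurable_decay (v : LinkState) : Measurable (decay p v) :=
  ((measurable_meanPow p v).mul (continuous_probState p v).measurable).const_mul _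

lemma norm_probState_mul_kappa_sub_le (v : LinkState) (x : ℝ) {d : ℝ} (hd : 0 ≤ d) :
    ‖(p.probState v d : ℂ) * (p.kappa v (-(Complex.I * ((x * meanPow p v d : ℝ) : ℂ))) - 1)‖ ≤
      |x| * decay p v d := by
  have h0 := probState_mem p v hd
  rw [norm_mul, Complex.norm_real, Real.norm_of_nonneg h0.1]
  calc _ ≤ p.probState v d * (gainFade p v * |x * meanPow p v d|) :=
        mul_le_mul_of_nonneg_left (norm_kappa_sub_one_le p v _) h0.1
    _ = |x| * decay p v d := by
        rw [abs_mul, abs_of_nonneg (meanPow_nonneg p v hd), decay]; ring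

lemma psi_sub_one {x d : ℝ} (hd : 0 ≤ d) : psi p x d - 1 =
    (p.probState .L d : ℂ) * (p.kappa .L (-(Complex.I * ((x * meanPow p .L d : ℝ) : ℂ))) - 1) +
    (p.probState .N d : ℂ) * (p.kappa .N (-(Complex.I * ((x * meanPow p .N d : ℝ) : ℂ))) - 1) := by
  have h : (p.probState .L d : ℂ) + (p.probState .N d : ℂ) = 1 := by
    exact_mod_cast congrArg (fun z : ℝ => (z : ℂ)) (probState_add p d)
  rw [psi, abs_of_nonneg hd]; linear_combination h

lemma norm_psi_sub_one_le (x : ℝ) {d : ℝ} (hd : 0 ≤ d) :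
    ‖psi p x d - 1‖ ≤ |x| * (decay p .L d + decay p .N d) := by
  rw [psi_sub_one p hd, mul_add]
  exact (norm_add_le _ _).trans (add_le_add (norm_probState_mul_kappa_sub_le p .L x hd)
    (norm_probState_mul_kappa_sub_le p .N x hd))

/-- In state L the blockage factor e^{−βd} beats every power; in state N the condition α_N > 2 makes
d^{1−α_N} integrable at infinity. Staying beyond t > 0 avoids the singularity of the path loss at
the origin. -/
lemma integrableOn_mul_decay (v : LinkState) {t : ℝ} (ht : 0 < t) :
    IntegrableOn (fun d => d * decay p v d) (Ioi t) := by
  have hb := beta_pos p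
  cases v
  · have h1 : IntegrableOn (fun d => Real.exp (-p.beta * d)) (Ioi t) := integrableOn_exp_mul_Ioi (by linarith) t
    have h2 : ∀ d ∈ Ioi t, ‖d * decay p .L d‖ ≤ gainFade p .L * (p.pb * p.zeta) *
        (t ^ (-p.alphaL) * (d * Real.exp (-p.beta * d))) := by
      intro d hd
      have hd0 : 0 < d := ht.trans hd
      rw [Real.norm_of_nonneg (mul_nonneg hd0.le (decay_nonneg p .L hd0.le))]
      have h3 : d ^ (-p.alphaL) ≤ t ^ (-p.alphaL) :=
        Real.rpow_le_rpow_of_nonpos ht (le_of_lt hd) (by linarith [p.alphaL_pos])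
      have h4 : decay p .L d = gainFade p .L * (p.pb * p.zeta) * (d ^ (-p.alphaL) * Real.exp (-p.beta * d)) := by
        simp only [decay, meanPow, Params.alpha, Params.probState]; ring
      have h5 : 0 ≤ gainFade p .L * (p.pb * p.zeta) :=
        mul_nonneg (gainFade_nonneg p .L) (mul_nonneg p.pb_pos.le (zeta_pos p).le)
      calc _ = gainFade p .L * (p.pb * p.zeta) * (d ^ (-p.alphaL) * (d * Real.exp (-p.beta * d))) := by
            rw [h4]; ring
        _ ≤ _ := by gcongr
    have h6 : IntegrableOn (fun d => d * Real.exp (-p.beta * d)) (Ioi t) := by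
      have := integrableOn_rpow_mul_exp_neg_mul_rpow (p := 1) (s := 1) (b := p.beta) (by norm_num) one_pos hb
      refine (this.mono_set (Ioi_subset_Ioi ht.le)).congr_fun (fun d _ => ?_) measurableSet_Ioi
      simp
    refine Integrable.mono' (g := fun d => gainFade p .L * (p.pb * p.zeta) *
      (t ^ (-p.alphaL) * (d * Real.exp (-p.beta * d)))) ((h6.const_mul _).const_mul _)
      (measurable_id.mul (measurable_decay p .L)).aestronglyMeasurable ?_
    exact (ae_restrict_iff' measurableSet_Ioi).2 (Filter.Eventually.of_forall h2)
  · have h1 : IntegrableOn (fun d : ℝ => d ^ (1 - p.alphaN)) (Ioi t) :=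
      integrableOn_Ioi_rpow_of_lt (by linarith [p.two_lt_alphaN]) ht
    refine Integrable.mono' (g := fun d => gainFade p .N * (p.pb * p.zeta) * d ^ (1 - p.alphaN))
      (Integrable.const_mul h1 _) (measurable_id.mul (measurable_decay p .N)).aestronglyMeasurable ?_
    refine (ae_restrict_iff' measurableSet_Ioi).2 (Filter.Eventually.of_forall fun d hd => ?_)
    have hd0 : 0 < d := ht.trans hd
    rw [Real.norm_of_nonneg (mul_nonneg hd0.le (decay_nonneg p .N hd0.le))]
    have h5 : 0 ≤ gainFade p .N * (p.pb * p.zeta) :=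
      mul_nonneg (gainFade_nonneg p .N) (mul_nonneg p.pb_pos.le (zeta_pos p).le)
    have h3 : d ^ (1 - p.alphaN) = d * d ^ (-p.alphaN) := by
      rw [sub_eq_add_neg, Real.rpow_add hd0, Real.rpow_one]
    have h7 := (probState_mem p .N hd0.le)
    have h8 : 0 ≤ d * d ^ (-p.alphaN) := mul_nonneg hd0.le (Real.rpow_nonneg hd0.le _)
    calc d * decay p .N d = gainFade p .N * (p.pb * p.zeta) * (d * d ^ (-p.alphaN)) * p.probState .N d := by
          simp only [decay, meanPow, Params.alpha]; ring
      _ ≤ gainFade p .N * (p.pb * p.zeta) * (d * d ^ (-p.alphaN)) * 1 := by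
          exact mul_le_mul_of_nonneg_left h7.2 (mul_nonneg h5 h8)
      _ = _ := by rw [h3, mul_one]

end Marks

/-! ### Radial integrals against a homogeneous intensity -/

section Radial

lemma integral_comp_norm_homog {E : Type*} [NormedAddCommGroup E] [NormedSpace ℝ E] {lam : ℝ}
    (hl : 0 ≤ lam) (f : ℝ → E) :
    ∫ y, f ‖y‖ ∂(homog lam) = (2 * Real.pi * lam) • ∫ r in Ioi (0 : ℝ), r • f r := by
  have h := integral_fun_norm_addHaar (volume : Measure Plane) f
  simp only [finrank_euclideanSpace, Fintype.card_fin, Nat.add_one_sub_one, pow_one] at h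
  rw [homog, integral_smul_measure, h, ENNReal.toReal_ofReal hl, measureReal_def,
    EuclideanSpace.volume_ball_fin_two]
  simp only [ENNReal.ofReal_one, one_pow, one_mul, ENNReal.toReal_ofReal_eq_iff.2 Real.pi_nonneg]
  rw [← Nat.cast_smul_eq_nsmul ℝ, smul_smul, smul_smul]
  congr 1
  simp
  ring

lemma integrable_comp_norm_homog {E : Type*} [NormedAddCommGroup E] [NormedSpace ℝ E] (lam : ℝ)
    {f : ℝ → E} (hf : IntegrableOn (fun r => r • f r) (Ioi (0 : ℝ))) :
    Integrable (fun y : Plane => f ‖y‖) (homog lam) := by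
  refine Integrable.smul_measure ?_ ENNReal.ofReal_ne_top
  rw [integrable_fun_norm_addHaar]
  simpa using hf

end Radial

end

end RisNet

namespace RisNet
noncomputable section

/-! ### Averages over the marks of one BS -/

namespace Network

open Params

set_option linter.unusedSectionVars false

variable {Ω : Type*} [MeasurableSpace Ω] {P : Measure Ω} [IsProbabilityMeasure P] {p : Params}
  {ιb ιr : Type*} (M : Network P p ιb ιr)

lemma interfTerm_eq (v : LinkState) (ω : Ω) (i : ιb) [Decidable (M.IsTagged i ω)] :
    M.interfTerm v ω i = if M.IsTagged i ω then 0 else tauState p v ‖M.b i ω‖ (M.bsMark i ω) := by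
  have hiff : M.InState v i ω ↔ M.bsMark i ω ∈ markIn p v ‖M.b i ω‖ := by cases v <;> rfl
  unfold interfTerm
  by_cases h1 : M.IsTagged i ω
  · rw [if_pos h1, if_neg (fun h => h.1 h1)]
  · rw [if_neg h1, tauState]
    by_cases h2 : M.InState v i ω
    · rw [if_pos ⟨h1, h2⟩, indicator_of_mem (hiff.1 h2)]
      cases v <;> simp only [chanPow, meanPow, markFade, bsMark, dev] <;> ring
    · rw [if_neg (fun h => h2 h.2), indicator_of_notMem (fun h => h2 (hiff.2 h))]

lemma map_fade (v : LinkState) (i : ιb) : P.map (M.X (.fade v i)) = fadeLaw p v := M.X_law _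

lemma measurable_markFade_bsMark (v : LinkState) (i : ιb) :
    (fun ω => markFade v (M.bsMark i ω)) = M.X (.fade v i) := by cases v <;> rfl

lemma measureReal_losB (i : ιb) {c : ℝ} (hc : c ∈ Icc (0 : ℝ) 1) :
    P.real {ω | M.X (.losB i) ω ≤ c} = c := by
  have h : P.map (M.X (.losB i)) (Iic c) = ENNReal.ofReal c := by
    rw [M.X_law, markLaw, cond_apply measurableSet_Icc, show Icc (0 : ℝ) 1 ∩ Iic c = Icc 0 c by
      ext; simp only [mem_inter_iff, mem_Icc, mem_Iic]; constructor
      · rintro ⟨⟨h1, _⟩, h2⟩; exact ⟨h1, h2⟩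
      · rintro ⟨h1, h2⟩; exact ⟨⟨h1, h2.trans hc.2⟩, h2⟩]
    simp
  rw [Measure.map_apply (M.X_measurable _) measurableSet_Iic] at h
  rw [measureReal_def]
  change (P (M.X (.losB i) ⁻¹' Iic c)).toReal = c
  rw [h, ENNReal.toReal_ofReal hc.1]

/-- The event that the link of BS `i` would be in state `v` at distance `d`. -/
lemma measureReal_markIn (i : ιb) (v : LinkState) {d : ℝ} (hd : 0 ≤ d) :
    P.real {ω | M.bsMark i ω ∈ markIn p v d} = p.probState v d := by
  have h1 := M.measureReal_losB i (probState_mem p .L hd)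
  cases v
  · exact h1
  · have e : {ω | M.bsMark i ω ∈ markIn p .N d} = {ω | M.X (.losB i) ω ≤ p.probState .L d}ᶜ := rfl
    rw [e, probReal_compl_eq_one_sub (measurableSet_le (M.X_measurable _) measurable_const), h1]
    linarith [probState_add p d]

lemma map_angles (i : ιb) : P.map (fun ω => (M.X (.aod i) ω, M.X (.beam i) ω)) =
    angleLaw.prod angleLaw := by
  have h : IndepFun (M.X (.aod i)) (M.X (.beam i)) P := M.X_indep.indepFun (by simp)
  rw [(indepFun_iff_map_prod_eq_prod_map_map (M.X_measurable _).aemeasurable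
    (M.X_measurable _).aemeasurable).1 h, M.X_law, M.X_law]
  rfl

lemma indepFun_losB (v : LinkState) (i : ιb) : IndepFun (M.X (.losB i))
    (fun ω => ((M.X (.aod i) ω, M.X (.beam i) ω), M.X (.fade v i) ω)) P := by
  refine indepFun_of_blocks M.X_measurable M.X_indep (S := {.losB i})
    (T := {.aod i, .beam i, .fade v i}) (by simp) ?_ ?_
  · exact measurable_of_mem_block (f := M.X) (by simp)
  · exact ((measurable_of_mem_block (f := M.X) (by simp)).prodMk
      (measurable_of_mem_block (f := M.X) (by simp))).prodMk
      (measurable_of_mem_block (f := M.X) (by simp))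

lemma indepFun_angles_fade (v : LinkState) (i : ιb) :
    IndepFun (fun ω => (M.X (.aod i) ω, M.X (.beam i) ω)) (M.X (.fade v i)) P := by
  refine indepFun_of_blocks M.X_measurable M.X_indep (S := {.aod i, .beam i})
    (T := {.fade v i}) (by simp) ?_ ?_
  · exact (measurable_of_mem_block (f := M.X) (by simp)).prodMk
      (measurable_of_mem_block (f := M.X) (by simp))
  · exact measurable_of_mem_block (f := M.X) (by simp)

lemma integral_exp_gain_fade (v : LinkState) (i : ιb) (y : ℝ) :
    ∫ ω, Complex.exp (Complex.I * ((y * p.gB (M.dev i ω) * M.X (.fade v i) ω : ℝ) : ℂ)) ∂P =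
      p.kappa v (-(Complex.I * y)) := by
  have hg := measurable_gB p
  have hang : Measurable fun ω => (M.X (.aod i) ω, M.X (.beam i) ω) :=
    (M.X_measurable _).prodMk (M.X_measurable _)
  have h := integral_indep_eq hang (M.X_measurable (.fade v i)) (M.indepFun_angles_fade v i)
    (f := fun a h => Complex.exp (Complex.I *
      ((y * p.gB (1 / 2 * Real.cos a.1 - 1 / 2 * Real.cos a.2) * h : ℝ) : ℂ))) (by fun_prop) (C := 1)
    (fun a h => (Complex.norm_exp_I_mul_ofReal _).le)
  refine h.trans ?_
  rw [kappa_eq_integral, devLaw, ← M.map_angles i, integral_map measurable_devMap.aemeasurable,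
    integral_map hang.aemeasurable]
  · refine integral_congr_ae (Filter.Eventually.of_forall fun ω => ?_)
    beta_reduce
    rw [← M.map_fade v i, integral_map (M.X_measurable _).aemeasurable (by fun_prop)]
  all_goals
    have h2 : Measurable fun q : ℝ × ℝ => Complex.exp (Complex.I * ((y * p.gB q.1 * q.2 : ℝ) : ℂ)) := by
      fun_prop
    have h3 : Measurable fun D => ∫ h, Complex.exp (Complex.I * ((y * p.gB D * h : ℝ) : ℂ)) ∂(fadeLaw p v) :=
      (h2.stronglyMeasurable.integral_prod_right (ν := fadeLaw p v)).measurable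
  · exact (h3.comp measurable_devMap).aestronglyMeasurable
  · exact h3.aestronglyMeasurable

/-- The blockage variable that decides the state is independent of angles and fading, so the mean
splits into the probability of the state and κ at the mean power of that state. -/
lemma integral_indicator_exp_tau (i : ιb) (v : LinkState) (x : ℝ) {d : ℝ} (hd : 0 ≤ d) :
    ∫ ω, (markIn p v d).indicator (fun m => Complex.exp (Complex.I * ((x * tau p d m : ℝ) : ℂ)))
      (M.bsMark i ω) ∂P =
      (p.probState v d : ℂ) * p.kappa v (-(Complex.I * ((x * meanPow p v d : ℝ) : ℂ))) := by
  have hg := measurable_gB p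
  let S : Set ℝ := match v with
    | .L => Iic (p.probState .L d)
    | .N => (Iic (p.probState .L d))ᶜ
  have hS : MeasurableSet S := by cases v; exacts [measurableSet_Iic, measurableSet_Iic.compl]
  have hSm : ∀ ω, M.bsMark i ω ∈ markIn p v d ↔ M.X (.losB i) ω ∈ S := by
    intro ω; cases v <;> rfl
  let F : (ℝ × ℝ) × ℝ → ℂ := fun q => Complex.exp (Complex.I * ((x * meanPow p v d *
    p.gB (1 / 2 * Real.cos q.1.1 - 1 / 2 * Real.cos q.1.2) * q.2 : ℝ) : ℂ))
  have hF : Measurable F := by fun_prop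
  have hI : Measurable (S.indicator (1 : ℝ → ℂ)) := measurable_one.indicator hS
  have hrest : Measurable fun ω => ((M.X (.aod i) ω, M.X (.beam i) ω), M.X (.fade v i) ω) :=
    ((M.X_measurable _).prodMk (M.X_measurable _)).prodMk (M.X_measurable _)
  have e : ∀ ω, (markIn p v d).indicator (fun m => Complex.exp (Complex.I * ((x * tau p d m : ℝ) : ℂ)))
      (M.bsMark i ω) = S.indicator (1 : ℝ → ℂ) (M.X (.losB i) ω) *
        F ((M.X (.aod i) ω, M.X (.beam i) ω), M.X (.fade v i) ω) := by
    intro ω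
    by_cases h : M.bsMark i ω ∈ markIn p v d
    · rw [indicator_of_mem h, indicator_of_mem ((hSm ω).1 h), Pi.one_apply, one_mul, tau_eq_of_mem p h]
      simp only [F, chanPow]
      have : markFade v (M.bsMark i ω) = M.X (.fade v i) ω :=
        congrFun (M.measurable_markFade_bsMark v i) ω
      rw [this]
      simp only [bsMark]
      congr 3
      ring
    · rw [indicator_of_notMem h, indicator_of_notMem (fun q => h ((hSm ω).2 q)), zero_mul]
  simp_rw [e]
  refine (IndepFun.integral_fun_mul_eq_mul_integral ((M.indepFun_losB v i).comp hI hF)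
    (hI.comp (M.X_measurable _)).aestronglyMeasurable (hF.comp hrest).aestronglyMeasurable).trans ?_
  congr 1
  · have : (fun ω => S.indicator (1 : ℝ → ℂ) (M.X (.losB i) ω)) =
        ({ω | M.bsMark i ω ∈ markIn p v d}).indicator fun _ => (1 : ℂ) := by
      ext ω
      by_cases h : M.bsMark i ω ∈ markIn p v d
      · rw [indicator_of_mem ((hSm ω).1 h), indicator_of_mem (by exact h)]; rfl
      · rw [indicator_of_notMem (fun q => h ((hSm ω).2 q)), indicator_of_notMem (by exact h)]
    have hm : MeasurableSet {ω | M.bsMark i ω ∈ markIn p v d} := by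
      simp_rw [hSm]; exact M.X_measurable _ hS
    have e2 : (∫ ω, (S.indicator (1 : ℝ → ℂ) ∘ M.X (.losB i)) ω ∂P) = (p.probState v d : ℂ) := by
      change ∫ ω, S.indicator (1 : ℝ → ℂ) (M.X (.losB i) ω) ∂P = _
      rw [this, integral_indicator hm, setIntegral_const, M.measureReal_markIn i v hd]
      simp
    exact e2
  · exact M.integral_exp_gain_fade v i (x * meanPow p v d)

lemma integral_exp_tau (i : ιb) (x : ℝ) {d : ℝ} (hd : 0 ≤ d) :
    ∫ ω, Complex.exp (Complex.I * ((x * tau p d (M.bsMark i ω) : ℝ) : ℂ)) ∂P = psi p x d := by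
  have hm : ∀ v, Measurable fun ω => (markIn p v d).indicator
      (fun m => Complex.exp (Complex.I * ((x * tau p d m : ℝ) : ℂ))) (M.bsMark i ω) := fun v => by
    have h1 : MeasurableSet (markIn p v d) :=
      (measurable_prodMk_left (x := d)) (measurableSet_markIn' p v)
    have h2 : Measurable fun m => tau p d m := (measurable_tau p).comp measurable_prodMk_left
    exact (Measurable.indicator (by fun_prop) h1).comp (M.measurable_bsMark i)
  have hi : ∀ v, Integrable (fun ω => (markIn p v d).indicator
      (fun m => Complex.exp (Complex.I * ((x * tau p d m : ℝ) : ℂ))) (M.bsMark i ω)) P := fun v => by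
    refine Integrable.of_bound (hm v).aestronglyMeasurable 1 (Filter.Eventually.of_forall fun ω => ?_)
    refine (norm_indicator_le_norm_self _ _).trans ?_
    rw [Complex.norm_exp_I_mul_ofReal]
  rw [psi, abs_of_nonneg hd, ← M.integral_indicator_exp_tau i .L x hd,
    ← M.integral_indicator_exp_tau i .N x hd, ← integral_add (hi .L) (hi .N)]
  refine integral_congr_ae (Filter.Eventually.of_forall fun ω => ?_)
  beta_reduce
  by_cases h : M.bsMark i ω ∈ markIn p .L d
  · have h2 : M.bsMark i ω ∉ markIn p .N d := fun q => q h
    rw [indicator_of_mem h, indicator_of_notMem h2, add_zero]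
  · have h2 : M.bsMark i ω ∈ markIn p .N d := h
    rw [indicator_of_notMem h, indicator_of_mem h2, zero_add]

/-- The gain is at most the sum of all levels, and state and fading are independent; the product of
their means, with the path loss, is the quantity that is integrable against the planar intensity. -/
lemma lintegral_tauState_le (i : ιb) (v : LinkState) {d : ℝ} (hd : 0 ≤ d) :
    ∫⁻ ω, ENNReal.ofReal |tauState p v d (M.bsMark i ω)| ∂P ≤ ENNReal.ofReal (decay p v d) := by
  set G : ℝ := ∑ n ∈ Finset.range (p.nTilde + 1), p.gain n with hG
  have hG0 : 0 ≤ G := Finset.sum_nonneg fun n _ => gain_nonneg p n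
  have hc := meanPow_nonneg p v hd
  have hm : MeasurableSet {ω | M.bsMark i ω ∈ markIn p v d} :=
    ((measurable_prodMk_left (x := d)).comp (M.measurable_bsMark i)) (measurableSet_markIn' p v)
  have hle : ∀ ω, ENNReal.ofReal |tauState p v d (M.bsMark i ω)| ≤
      ENNReal.ofReal (meanPow p v d * G) *
        ({ω | M.bsMark i ω ∈ markIn p v d}.indicator 1 ω * ENNReal.ofReal |M.X (.fade v i) ω|) := by
    intro ω
    by_cases h : M.bsMark i ω ∈ markIn p v d
    · rw [tauState, indicator_of_mem h, indicator_of_mem (by exact h), Pi.one_apply, one_mul,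
        ← ENNReal.ofReal_mul (mul_nonneg hc hG0)]
      refine ENNReal.ofReal_le_ofReal ?_
      have : markFade v (M.bsMark i ω) = M.X (.fade v i) ω :=
        congrFun (M.measurable_markFade_bsMark v i) ω
      rw [chanPow, this, abs_mul, abs_mul, abs_of_nonneg hc, abs_of_nonneg (gB_nonneg p _)]
      have := gB_le p (1 / 2 * Real.cos (M.bsMark i ω).2.1 - 1 / 2 * Real.cos (M.bsMark i ω).2.2.1)
      gcongr
    · rw [tauState, indicator_of_notMem h, abs_zero, ENNReal.ofReal_zero]; exact bot_le
  have hind : IndepFun (fun ω => {ω | M.bsMark i ω ∈ markIn p v d}.indicator (1 : Ω → ENNReal) ω)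
      (fun ω => ENNReal.ofReal |M.X (.fade v i) ω|) P := by
    let S : Set ℝ := match v with
      | .L => Iic (p.probState .L d)
      | .N => (Iic (p.probState .L d))ᶜ
    have hS : MeasurableSet S := by cases v; exacts [measurableSet_Iic, measurableSet_Iic.compl]
    have e : (fun ω => {ω | M.bsMark i ω ∈ markIn p v d}.indicator (1 : Ω → ENNReal) ω) =
        S.indicator 1 ∘ M.X (.losB i) := by
      ext ω; cases v <;> rfl
    rw [e]
    exact (M.indepFun_losB v i).comp (φ := S.indicator (1 : ℝ → ENNReal)) (measurable_one.indicator hS)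
      (ψ := fun q => ENNReal.ofReal |q.2|) (by fun_prop)
  have hf : Measurable fun ω => ENNReal.ofReal |M.X (.fade v i) ω| :=
    ENNReal.measurable_ofReal.comp (M.X_measurable _).norm
  have hfade : ∫⁻ ω, ENNReal.ofReal |M.X (.fade v i) ω| ∂P = ENNReal.ofReal (∫ h, |h| ∂(fadeLaw p v)) := by
    have hi : Integrable (fun h : ℝ => |h|) (fadeLaw p v) :=
      (integrable_id_gammaMeasure (one_le_shape p v)).abs
    rw [ofReal_integral_eq_lintegral_ofReal hi (Filter.Eventually.of_forall fun _ => abs_nonneg _),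
      ← M.map_fade v i, lintegral_map (by fun_prop) (M.X_measurable _)]
  calc _ ≤ _ := lintegral_mono hle
    _ = ENNReal.ofReal (meanPow p v d * G) * (ENNReal.ofReal (p.probState v d) *
        ENNReal.ofReal (∫ h, |h| ∂(fadeLaw p v))) := by
      have h1 := lintegral_mul_eq_lintegral_mul_lintegral_of_indepFun''
        (measurable_one.indicator hm).aemeasurable hf.aemeasurable hind
      rw [hfade, lintegral_indicator_one hm] at h1
      rw [← M.measureReal_markIn i v hd, ofReal_measureReal, ← h1]
      exact lintegral_const_mul _ ((measurable_one.indicator hm).mul hf)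
    _ = ENNReal.ofReal (decay p v d) := by
      rw [← ENNReal.ofReal_mul (probState_mem p v hd).1, ← ENNReal.ofReal_mul (mul_nonneg hc hG0)]
      congr 1
      rw [decay, gainFade, ← hG]; ring

end Network

end

end RisNet

namespace RisNet
noncomputable section

/-! ### Removing the truncation of the plane -/

section Limits

open Filter Topology Params

/-- A truncated product is the exponential of a finite partial sum, and absolute summability makes
these sums converge. -/
lemma tendsto_finprod_exp {ι : Type*} [Countable ι] {c r : ι → ℝ} (hc : Summable fun k => |c k|)
    (hr : ∀ R : ℝ, {k | r k ≤ R}.Finite) (S : Set ι) (x : ℝ) {g : ℕ → ι → ℂ}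
    (hg1 : ∀ (n : ℕ) k, k ∈ S → r k ≤ n → g n k = Complex.exp (Complex.I * ((x * c k : ℝ) : ℂ)))
    (hg2 : ∀ (n : ℕ) k, ¬ (k ∈ S ∧ r k ≤ n) → g n k = 1) :
    Tendsto (fun n : ℕ => ∏ᶠ k, g n k) atTop
      (𝓝 (Complex.exp (Complex.I * ((x * ∑' k, S.indicator c k : ℝ) : ℂ)))) := by
  have e : ∀ n : ℕ, ∏ᶠ k, g n k = Complex.exp (Complex.I * ((x * ∑' k, (S ∩ {k | r k ≤ n}).indicator c k : ℝ) : ℂ)) := by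
    intro n
    rw [finprod_eq_prod_toFinset (hr n) (fun i hi => hg2 n i fun q => hi q.2),
      tsum_eq_sum (s := (hr n).toFinset), Finset.mul_sum, Complex.ofReal_sum, Finset.mul_sum, Complex.exp_sum]
    · refine Finset.prod_congr rfl fun k hk => ?_
      have hk' : r k ≤ n := by simpa using hk
      by_cases hS : k ∈ S
      · rw [hg1 n k hS hk', indicator_of_mem (show k ∈ S ∩ {k | r k ≤ n} from ⟨hS, hk'⟩)]
      · rw [hg2 n k fun q => hS q.1, indicator_of_notMem (fun q => hS q.1)]; simp
    · intro k hk
      exact indicator_of_notMem (fun q => hk (by simpa using q.2)) _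
  simp_rw [e]
  have h : Tendsto (fun n : ℕ => ∑' k, (S ∩ {k | r k ≤ n}).indicator c k) atTop (𝓝 (∑' k, S.indicator c k)) := by
    refine tendsto_tsum_of_dominated_convergence hc (fun k => ?_) (Eventually.of_forall fun n k =>
      norm_indicator_le_norm_self _ _)
    refine tendsto_const_nhds.congr' ?_
    obtain ⟨n0, hn0⟩ := exists_nat_ge (r k)
    filter_upwards [eventually_ge_atTop n0] with n hn
    have hk : r k ≤ n := hn0.trans (by exact_mod_cast hn)
    by_cases hS : k ∈ S
    · rw [indicator_of_mem hS, indicator_of_mem (show k ∈ S ∩ {k | r k ≤ n} from ⟨hS, hk⟩)]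
    · rw [indicator_of_notMem hS, indicator_of_notMem fun q => hS q.1]
  have hcont : Continuous fun z : ℝ => Complex.exp (Complex.I * ((x * z : ℝ) : ℂ)) := by fun_prop
  exact (hcont.tendsto _).comp h

variable (p : Params)

lemma integrableOn_mul_psi_sub_one (x : ℝ) {t : ℝ} (ht : 0 < t) :
    IntegrableOn (fun r => r • (Ioi t).indicator (fun d => psi p x d - 1) r) (Ioi 0) := by
  have h : IntegrableOn (fun r => |x| * (r * decay p .L r + r * decay p .N r)) (Ioi t) :=
    ((integrableOn_mul_decay p .L ht).add (integrableOn_mul_decay p .N ht)).const_mul _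
  have h2 : IntegrableOn (fun r : ℝ => r • (psi p x r - 1)) (Ioi t) := by
    refine Integrable.mono' h (Measurable.aestronglyMeasurable ?_) ?_
    · exact measurable_id.smul ((measurable_psi p x).sub_const 1)
    · refine (ae_restrict_iff' measurableSet_Ioi).2 (Eventually.of_forall fun r hr => ?_)
      have hr0 : 0 < r := ht.trans hr
      rw [norm_smul, Real.norm_of_nonneg hr0.le]
      calc _ ≤ r * (|x| * (decay p .L r + decay p .N r)) := by
            gcongr; exact norm_psi_sub_one_le p x hr0.le
        _ = _ := by ring
  have e : (fun r => r • (Ioi t).indicator (fun d => psi p x d - 1) r) =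
      (Ioi t).indicator fun r => r • (psi p x r - 1) := by
    ext r
    by_cases hr : r ∈ Ioi t
    · rw [indicator_of_mem hr, indicator_of_mem hr]
    · rw [indicator_of_notMem hr, indicator_of_notMem hr, smul_zero]
  rw [e]
  exact (h2.integrable_indicator measurableSet_Ioi).integrableOn

lemma meanPow_cast (v : LinkState) (x d : ℝ) :
    -(Complex.I * x) * (p.pb : ℂ) * (p.zeta : ℂ) * ((d ^ (-p.alpha v) : ℝ) : ℂ) =
      -(Complex.I * ((x * meanPow p v d : ℝ) : ℂ)) := by
  rw [meanPow]; push_cast; ring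

/-- The exponents of the two states merge because the state probabilities add up to one: Σ_v 𝒫_v(κ_v
− 1) = ψ − 1. -/
lemma laplaceI_eq (x : ℝ) {t : ℝ} (ht : 0 < t) : p.laplaceI t (-(Complex.I * x)) =
    Complex.exp ((2 * Real.pi * p.lamB) • ∫ r in Ioi t, r • (psi p x r - 1)) := by
  have hi : ∀ v, IntegrableOn (fun d : ℝ => (1 - p.kappa v (-(Complex.I * ((x * meanPow p v d : ℝ) : ℂ)))) *
      (d : ℂ) * (p.probState v d : ℂ)) (Ioi t) := fun v => by
    refine Integrable.mono' (Integrable.const_mul (integrableOn_mul_decay p v ht) |x|)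
      (Measurable.aestronglyMeasurable ?_) ?_
    · refine ((measurable_const.sub ?_).mul Complex.measurable_ofReal).mul
        (Complex.measurable_ofReal.comp (continuous_probState p v).measurable)
      exact (continuous_kappa_imag p v).measurable.comp ((measurable_meanPow p v).const_mul x)
    · refine (ae_restrict_iff' measurableSet_Ioi).2 (Eventually.of_forall fun r hr => ?_)
      have hr0 : 0 < r := ht.trans hr
      have := norm_probState_mul_kappa_sub_le p v x hr0.le
      rw [mul_assoc, norm_mul, norm_mul, norm_sub_rev, Complex.norm_real r, Real.norm_of_nonneg hr0.le]
      rw [norm_mul] at this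
      calc _ = r * (‖(p.probState v r : ℂ)‖ *
            ‖p.kappa v (-(Complex.I * ((x * meanPow p v r : ℝ) : ℂ))) - 1‖) := by ring
        _ ≤ r * (|x| * decay p v r) := by gcongr
        _ = _ := by ring
  rw [laplaceI, laplaceState, laplaceState, ← Complex.exp_add]
  simp only [meanPow_cast]
  congr 1
  rw [← mul_add, ← integral_add (hi .L) (hi .N), Complex.real_smul]
  push_cast
  rw [neg_mul, neg_mul, neg_mul, ← mul_neg, ← integral_neg]
  congr 1
  refine setIntegral_congr_fun measurableSet_Ioi fun r hr => ?_
  simp only [Complex.real_smul]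
  rw [psi_sub_one p (ht.trans hr).le]
  push_cast
  ring

/-- In polar coordinates |ψ − 1| is integrable outside the disc of radius t, and it dominates all
truncations. -/
lemma tendsto_annLaplace_psi (x : ℝ) {t : ℝ} (ht : 0 < t) :
    Tendsto (fun n : ℕ => annLaplace p.lamB (psi p x) n t) atTop (𝓝 (p.laplaceI t (-(Complex.I * x)))) := by
  have hl := p.lamB_pos.le
  let f : ℝ → ℂ := (Ioi t).indicator fun d => psi p x d - 1
  have hf := integrable_comp_norm_homog p.lamB (integrableOn_mul_psi_sub_one p x ht)
  have e : p.laplaceI t (-(Complex.I * x)) = Complex.exp (∫ y, f ‖y‖ ∂(homog p.lamB)) := by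
    rw [laplaceI_eq p x ht, integral_comp_norm_homog hl]
    congr 2
    have h1 : ∀ r, r • f r = (Ioi t).indicator (fun r => r • (psi p x r - 1)) r := fun r => by
      by_cases hr : r ∈ Ioi t
      · simp only [f]; rw [indicator_of_mem hr, indicator_of_mem hr]
      · simp only [f]; rw [indicator_of_notMem hr, indicator_of_notMem hr, smul_zero]
    simp_rw [h1]
    rw [setIntegral_indicator measurableSet_Ioi, Ioi_inter_Ioi, max_eq_right ht.le]
  rw [e]
  refine (Complex.continuous_exp.tendsto _).comp ?_
  refine tendsto_integral_of_dominated_convergence (fun y : Plane => ‖f ‖y‖‖)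
    (fun n => ((measurable_annFactor_right (measurable_psi p x) n t).sub_const 1).aestronglyMeasurable)
    hf.norm (fun n => Eventually.of_forall fun y => ?_) (Eventually.of_forall fun y => ?_)
  · by_cases h : t < ‖y‖ ∧ ‖y‖ ≤ n
    · rw [annFactor_of_mem h]
      simp only [f]
      rw [indicator_of_mem (by exact h.1)]
    · rw [annFactor_of_notMem h, sub_self, norm_zero]; exact norm_nonneg _
  · refine tendsto_const_nhds.congr' ?_
    obtain ⟨n0, hn0⟩ := exists_nat_ge ‖y‖
    filter_upwards [eventually_ge_atTop n0] with n hn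
    have hk : ‖y‖ ≤ n := hn0.trans (by exact_mod_cast hn)
    simp only [f]
    by_cases h : t < ‖y‖
    · rw [annFactor_of_mem ⟨h, hk⟩, indicator_of_mem (by exact h)]
    · rw [annFactor_of_notMem fun q => h q.1, indicator_of_notMem (by exact h), sub_self]

lemma norm_laplaceI_sub_one_le {t : ℝ} (ht : 0 < t) (hb : ∀ x, 0 < x → ‖p.laplaceI t (-(Complex.I * (x : ℝ)))‖ ≤ 1) :
    ∃ K, ∀ x : ℝ, 0 < x → ‖p.laplaceI t (-(Complex.I * x)) - 1‖ ≤ K * x := by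
  set D := ∫ r in Ioi t, (r * decay p .L r + r * decay p .N r) with hD
  have hint : IntegrableOn (fun r => r * decay p .L r + r * decay p .N r) (Ioi t) :=
    (integrableOn_mul_decay p .L ht).add (integrableOn_mul_decay p .N ht)
  have hD0 : 0 ≤ D := setIntegral_nonneg measurableSet_Ioi fun r hr => by
    have hr0 : 0 ≤ r := (ht.trans hr).le
    exact add_nonneg (mul_nonneg hr0 (decay_nonneg p _ hr0)) (mul_nonneg hr0 (decay_nonneg p _ hr0))
  set c : ℝ := 2 * Real.pi * p.lamB with hc
  have hc0 : 0 ≤ c := by have := p.lamB_pos; positivity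
  -- The exponent has modulus at most cDx. If this is at most 1, then |e^z − 1| ≤ 2|z|; otherwise
  -- the trivial bound 2 is already smaller than 2cDx.
  refine ⟨2 * (c * D), fun x hx => ?_⟩
  have h1 : ‖c • ∫ r in Ioi t, r • (psi p x r - 1)‖ ≤ c * D * x := by
    rw [norm_smul, Real.norm_of_nonneg hc0, mul_assoc c D x]
    refine mul_le_mul_of_nonneg_left ?_ hc0
    rw [hD, mul_comm, ← integral_const_mul]
    refine norm_integral_le_of_norm_le (Integrable.const_mul hint x) ?_
    refine (ae_restrict_iff' measurableSet_Ioi).2 (Eventually.of_forall fun r hr => ?_)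
    have hr0 : 0 < r := ht.trans hr
    rw [norm_smul, Real.norm_of_nonneg hr0.le]
    calc _ ≤ r * (|x| * (decay p .L r + decay p .N r)) := by
          gcongr; exact norm_psi_sub_one_le p x hr0.le
      _ = _ := by rw [abs_of_pos hx]; ring
  by_cases hs : c * D * x ≤ 1
  · rw [laplaceI_eq p x ht]
    refine (Complex.norm_exp_sub_one_le (h1.trans hs)).trans ?_
    nlinarith
  · refine (norm_sub_le _ _).trans ?_
    rw [norm_one]
    have := hb x hx
    nlinarith

end Limits

/-! ### Convergence of the interference and its law for a fixed inner radius -/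

namespace Network

open Params Filter Topology

set_option linter.unusedSectionVars false

variable {Ω : Type*} [MeasurableSpace Ω] {P : Measure Ω} [IsProbabilityMeasure P] {p : Params}
  {ιb ιr : Type*} [Countable ιb] (M : Network P p ιb ιr)

/-- The marks of a BS are independent of its position, so they are averaged at a frozen position,
which produces the deterministic bound on the mean power. -/
lemma lintegral_far_tauState_le (v : LinkState) (k : ιb) :
    ∫⁻ ω, {y : Plane | 1 < ‖y‖}.indicator
      (fun y => ENNReal.ofReal |tauState p v ‖y‖ (M.bsMark k ω)|) (M.b k ω) ∂P ≤
    ∫⁻ ω, {y : Plane | 1 < ‖y‖}.indicator (fun y => ENNReal.ofReal (decay p v ‖y‖)) (M.b k ω) ∂P := by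
  have hb := M.b_poisson.1 k
  have hm := M.measurable_bsMark k
  have hS : MeasurableSet {y : Plane | 1 < ‖y‖} := measurableSet_lt measurable_const measurable_norm
  have hind : IndepFun (M.b k) (M.bsMark k) P :=
    M.indepFun_b_bsMark.comp (measurable_pi_apply k) (measurable_pi_apply k)
  have hF : Measurable fun q : Plane × (ℝ × ℝ × ℝ × ℝ × ℝ) =>
      {y : Plane | 1 < ‖y‖}.indicator (fun y => ENNReal.ofReal |tauState p v ‖y‖ q.2|) q.1 := by
    have h1 : Measurable fun q : Plane × (ℝ × ℝ × ℝ × ℝ × ℝ) => ENNReal.ofReal |tauState p v ‖q.1‖ q.2| :=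
      ENNReal.measurable_ofReal.comp
        (((measurable_tauState p v).comp (measurable_fst.norm.prodMk measurable_snd)).norm)
    exact h1.indicator (measurable_fst hS)
  have hG : Measurable fun y : Plane => {y : Plane | 1 < ‖y‖}.indicator
      (fun y => ENNReal.ofReal (decay p v ‖y‖)) y :=
    (ENNReal.measurable_ofReal.comp ((measurable_decay p v).comp measurable_norm)).indicator hS
  have e := lintegral_map (μ := P) hF (hb.prodMk hm)
  rw [(indepFun_iff_map_prod_eq_prod_map_map hb.aemeasurable hm.aemeasurable).1 hind,
    lintegral_prod _ hF.aemeasurable] at e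
  have e2 := lintegral_map (μ := P) hG hb
  refine (e.symm.le.trans ?_).trans e2.le
  refine lintegral_mono fun y => ?_
  refine (lintegral_map (hF.comp (measurable_prodMk_left (x := y))) hm).le.trans ?_
  simp only [Function.comp_apply]
  by_cases hy : 1 < ‖y‖
  · simp only [indicator_of_mem (show y ∈ {y : Plane | 1 < ‖y‖} from hy)]
    exact M.lintegral_tauState_le k v (norm_nonneg y)
  · simp only [indicator_of_notMem (show y ∉ {y : Plane | 1 < ‖y‖} from hy)]
    simp

/-- Campbell's formula makes the expected sum over BSs beyond distance 1 finite. Closer BSs may have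
no mean because of the path-loss singularity, but almost surely there are finitely many of them. -/
lemma ae_summable_tauState : ∀ᵐ ω ∂P, ∀ v,
    Summable fun k => |tauState p v ‖M.b k ω‖ (M.bsMark k ω)| := by
  have hS : MeasurableSet {y : Plane | 1 < ‖y‖} := measurableSet_lt measurable_const measurable_norm
  have key : ∀ v, ∀ᵐ ω ∂P, ∑' k, {y : Plane | 1 < ‖y‖}.indicator
      (fun y => ENNReal.ofReal |tauState p v ‖y‖ (M.bsMark k ω)|) (M.b k ω) < ⊤ := by
    intro v
    have hG : Measurable ({y : Plane | 1 < ‖y‖}.indicator fun y => ENNReal.ofReal (decay p v ‖y‖)) :=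
      (ENNReal.measurable_ofReal.comp ((measurable_decay p v).comp measurable_norm)).indicator hS
    have hF : ∀ k, Measurable fun ω => {y : Plane | 1 < ‖y‖}.indicator
        (fun y => ENNReal.ofReal |tauState p v ‖y‖ (M.bsMark k ω)|) (M.b k ω) := fun k => by
      have h1 : Measurable fun ω => ENNReal.ofReal |tauState p v ‖M.b k ω‖ (M.bsMark k ω)| :=
        ENNReal.measurable_ofReal.comp
          (((measurable_tauState p v).comp ((M.b_poisson.1 k).norm.prodMk (M.measurable_bsMark k))).norm)
      exact h1.indicator (M.b_poisson.1 k hS)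
    refine ae_lt_top (Measurable.tsum hF) ?_
    rw [lintegral_tsum fun k => (hF k).aemeasurable]
    refine ne_top_of_le_ne_top ?_ (ENNReal.tsum_le_tsum fun k => M.lintegral_far_tauState_le v k)
    rw [M.b_poisson.tsum_lintegral (Λ := homog p.lamB) hG]
    have hint : Integrable (fun y : Plane => (Ioi (1 : ℝ)).indicator (decay p v) ‖y‖) (homog p.lamB) := by
      refine integrable_comp_norm_homog p.lamB ?_
      have e : (fun r => r • (Ioi (1 : ℝ)).indicator (decay p v) r) =
          (Ioi (1 : ℝ)).indicator fun r => r * decay p v r := by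
        ext r
        by_cases hr : r ∈ Ioi (1 : ℝ)
        · rw [indicator_of_mem hr, indicator_of_mem hr, smul_eq_mul]
        · rw [indicator_of_notMem hr, indicator_of_notMem hr, smul_zero]
      rw [e]
      exact ((integrableOn_mul_decay p v one_pos).integrable_indicator measurableSet_Ioi).integrableOn
    refine ne_of_lt (lt_of_le_of_lt (le_of_eq ?_) hint.lintegral_lt_top)
    refine lintegral_congr fun y => ?_
    by_cases hy : 1 < ‖y‖
    · rw [indicator_of_mem (by exact hy), indicator_of_mem (by exact hy)]
    · rw [indicator_of_notMem (by exact hy), indicator_of_notMem (by exact hy), ENNReal.ofReal_zero]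
  have hfin := M.b_poisson.ae_locallyFinite (lam := p.lamB)
  filter_upwards [key .L, key .N, hfin] with ω h1 h2 h3 v
  have h : ∑' k, {y : Plane | 1 < ‖y‖}.indicator
      (fun y => ENNReal.ofReal |tauState p v ‖y‖ (M.bsMark k ω)|) (M.b k ω) < ⊤ := by
    cases v; exacts [h1, h2]
  -- The far contributions agree with all contributions outside the finite set of BSs within
  -- distance 1.
  refine (ENNReal.summable_toReal h.ne).congr_cofinite ?_
  have : {k | ‖M.b k ω‖ ≤ 1}ᶜ ∈ cofinite := (h3 1).compl_mem_cofinite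
  filter_upwards [this] with k hk
  rw [indicator_of_mem (by simpa using hk), ENNReal.toReal_ofReal (abs_nonneg _)]

lemma ae_summable_tau : ∀ᵐ ω ∂P, Summable fun k => |tau p ‖M.b k ω‖ (M.bsMark k ω)| := by
  filter_upwards [M.ae_summable_tauState] with ω h
  exact Summable.of_nonneg_of_le (fun k => abs_nonneg _) (fun k => abs_add_le _ _) ((h .L).add (h .N))

lemma ae_summable_interfTerm : ∀ᵐ ω ∂P, ∀ v, Summable (M.interfTerm v ω) := by
  classical
  filter_upwards [M.ae_summable_tauState] with ω h v
  refine Summable.of_norm_bounded (h v) fun k => ?_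
  rw [M.interfTerm_eq v ω k]
  split_ifs
  · simp
  · exact le_rfl

/-- Total power received from the BSs farther than `t`. -/
def farSum (t : ℝ) (ω : Ω) : ℝ :=
  ∑' k, {k | t < ‖M.b k ω‖}.indicator (fun k => tau p ‖M.b k ω‖ (M.bsMark k ω)) k

lemma measurable_tau_comp (k : ιb) : Measurable fun ω => tau p ‖M.b k ω‖ (M.bsMark k ω) :=
  (measurable_tau p).comp ((M.b_poisson.1 k).norm.prodMk (M.measurable_bsMark k))

lemma measurable_farSum : Measurable fun q : ℝ × Ω => M.farSum q.1 q.2 := by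
  refine Measurable.tsum fun k => ?_
  have h1 : Measurable fun q : ℝ × Ω => tau p ‖M.b k q.2‖ (M.bsMark k q.2) :=
    (M.measurable_tau_comp k).comp measurable_snd
  exact h1.indicator (s := {q : ℝ × Ω | q.1 < ‖M.b k q.2‖})
    (measurableSet_lt measurable_fst ((M.b_poisson.1 k).comp measurable_snd).norm)

/-- The tagged BS sits exactly on the circle of radius t_bu and is excluded by strictness; all other
BSs are strictly farther. So the sum over untagged BSs is a sum over a region. -/
lemma ae_interference_eq : ∀ᵐ ω ∂P, M.interference ω = M.farSum (M.tBU ω) ω := by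
  classical
  filter_upwards [M.ae_summable_interfTerm, M.b_poisson.ae_exists_isNearest p.lamB_pos] with ω h1 ⟨i, hi⟩
  have ht : M.tBU ω = ‖M.b i ω‖ := congrArg norm hi.nearestPos_eq
  rw [interference, ← (h1 .L).tsum_add (h1 .N), farSum]
  refine tsum_congr fun k => ?_
  rw [M.interfTerm_eq .L ω k, M.interfTerm_eq .N ω k]
  by_cases hk : M.IsTagged k ω
  · have hki : k = i := IsNearest.unique (b := fun i => M.b i ω) hk hi
    rw [if_pos hk, if_pos hk, add_zero, indicator_of_notMem]
    simp [ht, hki]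
  · have hki : k ≠ i := fun e => hk (e ▸ hi)
    rw [if_neg hk, if_neg hk, indicator_of_mem (by rw [mem_ofPred_eq, ht]; exact hi k hki)]
    rfl

/-- For a deterministic radius the truncated characteristic function is a marked Laplace functional.
Both sides converge as the truncation is removed: the products by summability, the exponents by
integrability. -/
lemma integral_exp_farSum (x : ℝ) {t : ℝ} (ht : 0 < t) :
    ∫ ω, Complex.exp (Complex.I * ((x * M.farSum t ω : ℝ) : ℂ)) ∂P = p.laplaceI t (-(Complex.I * x)) := by
  classical
  have hfin := M.b_poisson.ae_locallyFinite (lam := p.lamB)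
  let f : ℕ → Plane → (ℝ × ℝ × ℝ × ℝ × ℝ) → ℂ := fun n y m =>
    if t < ‖y‖ ∧ ‖y‖ ≤ n then Complex.exp (Complex.I * ((x * tau p ‖y‖ m : ℝ) : ℂ)) else 1
  have hf : ∀ n, Measurable (Function.uncurry (f n)) := fun n => by
    have h1 : Measurable fun q : Plane × (ℝ × ℝ × ℝ × ℝ × ℝ) => tau p ‖q.1‖ q.2 :=
      (measurable_tau p).comp (measurable_fst.norm.prodMk measurable_snd)
    refine Measurable.ite ?_ (by fun_prop) measurable_const
    exact measurable_fst (measurableSet_annulus t n)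
  have hfpos : ∀ (n : ℕ) (y : Plane) m, t < ‖y‖ → ‖y‖ ≤ n →
      f n y m = Complex.exp (Complex.I * ((x * tau p ‖y‖ m : ℝ) : ℂ)) := fun n y m h1 h2 => if_pos ⟨h1, h2⟩
  have hfneg : ∀ (n : ℕ) (y : Plane) m, ¬ (t < ‖y‖ ∧ ‖y‖ ≤ n) → f n y m = 1 := fun n y m h => if_neg h
  have hf1 : ∀ n y m, ‖f n y m‖ ≤ 1 := fun n y m => by
    simp only [f]; split_ifs
    · rw [Complex.norm_exp_I_mul_ofReal]
    · simp
  have hfB : ∀ n : ℕ, ∀ y ∉ Metric.closedBall (0 : Plane) n, ∀ m, f n y m = 1 := fun n y hy m =>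
    if_neg fun q => hy (by simpa using q.2)
  have hfg : ∀ (n : ℕ) y k, ∫ ω', f n y (M.bsMark k ω') ∂P = annFactor (psi p x) n t y := by
    intro n y k
    by_cases h : t < ‖y‖ ∧ ‖y‖ ≤ n
    · simp only [f, if_pos h]
      rw [annFactor_of_mem h, M.integral_exp_tau k x (norm_nonneg y)]
    · simp only [f, if_neg h]
      rw [annFactor_of_notMem h]; simp
  have key : ∀ n : ℕ, ∫ ω, ∏ᶠ k, f n (M.b k ω) (M.bsMark k ω) ∂P = annLaplace p.lamB (psi p x) n t := fun n =>
    M.b_poisson.integral_finprod_marks (Λ := homog p.lamB) M.measurable_bsMark M.indepFun_b_bsMark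
      M.iIndepFun_bsMark (hf n) (hf1 n) measurableSet_closedBall (homog_closedBall_ne_top _ _) (hfB n)
      (measurable_annFactor_right (measurable_psi p x) n t) (hfg n)
      (fun y hy => annFactor_of_notMem fun q => hy (by simpa using q.2))
      (norm_annFactor_le (norm_psi_le p x) n t)
  have hfc : ∀ n k, Measurable fun ω => f n (M.b k ω) (M.bsMark k ω) := fun n k =>
    Measurable.comp (f := fun ω => (M.b k ω, M.bsMark k ω)) (hf n)
      ((M.b_poisson.1 k).prodMk (M.measurable_bsMark k))
  clear_value f
  refine tendsto_nhds_unique (f := fun n : ℕ => ∫ ω, ∏ᶠ k, f n (M.b k ω) (M.bsMark k ω) ∂P)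
    (l := atTop) ?_ (by simpa only [key] using tendsto_annLaplace_psi p x ht)
  refine tendsto_integral_of_dominated_convergence (fun _ => 1) (fun n => ?_) (integrable_const _)
    (fun n => ?_) ?_
  · refine aestronglyMeasurable_finprod (S := fun ω => {i | ‖M.b i ω‖ ≤ n})
      (fun k => hfc n k) ?_
    filter_upwards [hfin] with ω hω
    exact ⟨hω n, fun i hi => hfneg n _ _ fun q => hi q.2⟩
  · filter_upwards [hfin] with ω hω
    exact norm_finprod_le_one (hω n) (fun i hi => hfneg n _ _ fun q => hi q.2) fun k => hf1 _ _ _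
  · filter_upwards [hfin, M.ae_summable_tau] with ω h1 h2
    have := tendsto_finprod_exp (c := fun k => tau p ‖M.b k ω‖ (M.bsMark k ω))
      (r := fun k => ‖M.b k ω‖) h2 h1 {k | t < ‖M.b k ω‖} x
      (g := fun n k => f n (M.b k ω) (M.bsMark k ω)) (fun n k hk hn => hfpos n _ _ hk hn)
      (fun n k hk => hfneg n _ _ hk)
    exact this

/-- Law of the interference when the serving BS is at distance `t`. -/
def interfLaw (t : ℝ) : Measure ℝ := P.map (M.farSum t)

lemma measurable_farSum_right (t : ℝ) : Measurable (M.farSum t) :=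
  M.measurable_farSum.comp measurable_prodMk_left

instance (t : ℝ) : IsProbabilityMeasure (M.interfLaw t) :=
  Measure.isProbabilityMeasure_map (M.measurable_farSum_right t).aemeasurable

lemma charFun_interfLaw (x : ℝ) {t : ℝ} (ht : 0 < t) :
    charFun (M.interfLaw t) x = p.laplaceI t (-(Complex.I * x)) := by
  rw [← M.integral_exp_farSum x ht, charFun_apply_real, interfLaw,
    integral_map (M.measurable_farSum_right t).aemeasurable (by fun_prop)]
  refine integral_congr_ae (Eventually.of_forall fun ω => ?_)
  beta_reduce
  congr 1
  push_cast
  ring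

lemma ae_fade_nonneg : ∀ᵐ ω ∂P, ∀ k v, 0 ≤ M.X (.fade v k) ω := by
  have h : ∀ v, ∀ᵐ ω ∂P, ∀ k, 0 ≤ M.X (.fade v k) ω := fun v => ae_all_iff.2 fun k => by
    have h1 := ae_gammaMeasure_nonneg (one_le_shape p v)
    rw [← fadeLaw, ← M.map_fade v k] at h1
    exact ae_of_ae_map (M.X_measurable _).aemeasurable h1
  filter_upwards [h .L, h .N] with ω h1 h2 k v
  cases v; exacts [h1 k, h2 k]

lemma ae_tau_nonneg : ∀ᵐ ω ∂P, ∀ k, 0 ≤ tau p ‖M.b k ω‖ (M.bsMark k ω) := by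
  filter_upwards [M.ae_fade_nonneg] with ω h k
  have hs : ∀ v, 0 ≤ tauState p v ‖M.b k ω‖ (M.bsMark k ω) := fun v => by
    by_cases hm : M.bsMark k ω ∈ markIn p v ‖M.b k ω‖
    · rw [tauState, indicator_of_mem hm, chanPow]
      refine mul_nonneg (mul_nonneg (meanPow_nonneg p v (norm_nonneg _)) (gB_nonneg p _)) ?_
      rw [congrFun (M.measurable_markFade_bsMark v k) ω]
      exact h k v
    · rw [tauState, indicator_of_notMem hm]
  exact add_nonneg (hs .L) (hs .N)

lemma interfLaw_Iio (t : ℝ) : M.interfLaw t (Iio 0) = 0 := by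
  rw [interfLaw, Measure.map_apply (M.measurable_farSum_right t) measurableSet_Iio]
  have : ∀ᵐ ω ∂P, 0 ≤ M.farSum t ω := by
    filter_upwards [M.ae_tau_nonneg] with ω h
    exact tsum_nonneg fun k => indicator_nonneg (fun k _ => h k) k
  rw [ae_iff] at this
  simpa [Iio, preimage] using this

end Network

end

end RisNet

namespace RisNet
noncomputable section

/-! ### Nearest distance, tagged state and interference jointly -/

namespace Network

open Filter Topology Params

set_option linter.unusedSectionVars false

variable {Ω : Type*} [MeasurableSpace Ω] {P : Measure Ω} [IsProbabilityMeasure P] {p : Params}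
  {ιb ιr : Type*} [Countable ιb] (M : Network P p ιb ιr)

lemma tBU_eq (ω : Ω) : M.tBU ω = ‖nearestPos fun i => M.b i ω‖ := rfl

lemma measurable_tBU : Measurable M.tBU := measurable_tagged_norm M.b_poisson.1

lemma ae_tBU_pos : ∀ᵐ ω ∂P, 0 < M.tBU ω := by
  filter_upwards [M.b_poisson.ae_ne_zero (lam := p.lamB), M.b_poisson.ae_exists_isNearest p.lamB_pos]
    with ω h ⟨i, hi⟩
  rw [M.tBU_eq, hi.nearestPos_eq]
  exact norm_pos_iff.2 (h i)

/-- The tagged link is in state `v`. -/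
def TagState (v : LinkState) (ω : Ω) : Prop := ∃ i, M.IsTagged i ω ∧ M.InState v i ω

lemma inState_iff (v : LinkState) (i : ιb) (ω : Ω) :
    M.InState v i ω ↔ M.bsMark i ω ∈ markIn p v ‖M.b i ω‖ := by cases v <;> rfl

lemma tagState_iff {ω : Ω} {i : ιb} (hi : IsNearest (fun i => M.b i ω) i) (v : LinkState) :
    M.TagState v ω ↔ M.bsMark i ω ∈ markIn p v ‖M.b i ω‖ := by
  refine ⟨fun ⟨j, hj, hs⟩ => ?_, fun h => ⟨i, hi, (M.inState_iff v i ω).2 h⟩⟩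
  have hji : j = i := IsNearest.unique (b := fun i => M.b i ω) hj hi
  exact hji ▸ (M.inState_iff v j ω).1 hs

/-- Configurations of positions and marks of the BSs for which the tagged link is in state `v`. -/
def tagStateSet (p : Params) (ιb : Type*) (v : LinkState) :
    Set ((ιb → Plane) × (ιb → ℝ × ℝ × ℝ × ℝ × ℝ)) :=
  {q | ∃ i, IsNearest q.1 i ∧ q.2 i ∈ markIn p v ‖q.1 i‖}

lemma measurableSet_tagStateSet (v : LinkState) : MeasurableSet (tagStateSet p ιb v) := by
  have : tagStateSet p ιb v = ⋃ i, (Prod.fst ⁻¹' {b | IsNearest b i}) ∩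
      (fun q : (ιb → Plane) × (ιb → ℝ × ℝ × ℝ × ℝ × ℝ) => (‖q.1 i‖, q.2 i)) ⁻¹'
        {q | q.2 ∈ markIn p v q.1} := by
    ext q; simp [tagStateSet]
  rw [this]
  refine MeasurableSet.iUnion fun i => (measurable_fst (measurableSet_isNearest i)).inter ?_
  refine MeasurableSet.preimage (measurableSet_markIn' p v) (Measurable.prodMk ?_ ?_) <;> fun_prop

lemma tagState_iff_mem (v : LinkState) (ω : Ω) : M.TagState v ω ↔
    ((fun i => M.b i ω), (fun i => M.bsMark i ω)) ∈ tagStateSet p ιb v :=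
  exists_congr fun i => and_congr Iff.rfl (M.inState_iff v i ω)

lemma measurableSet_tagState (v : LinkState) : MeasurableSet {ω | M.TagState v ω} := by
  simp_rw [M.tagState_iff_mem v]
  exact (M.measurable_b.prodMk M.measurable_bsMark') (measurableSet_tagStateSet v)

open Classical in
/-- Factor of BS `k` in the characteristic function of the interference, on the event that the
tagged link is in state `v`, truncated at distance `n`. -/
def bsFactor (p : Params) (v : LinkState) (x : ℝ) (n : ℕ) (k : ιb) (b : ιb → Plane)
    (m : ℝ × ℝ × ℝ × ℝ × ℝ) : ℂ :=
  if IsNearest b k then (if m ∈ markIn p v ‖b k‖ then 1 else 0)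
  else if ‖b k‖ ≤ n then Complex.exp (Complex.I * ((x * tau p ‖b k‖ m : ℝ) : ℂ)) else 1

lemma measurable_bsFactor (v : LinkState) (x : ℝ) (n : ℕ) (k : ιb) :
    Measurable (Function.uncurry (bsFactor p v x n k)) := by
  have hk : Measurable fun q : (ιb → Plane) × (ℝ × ℝ × ℝ × ℝ × ℝ) => (‖q.1 k‖, q.2) := by fun_prop
  have h1 : Measurable fun q : (ιb → Plane) × (ℝ × ℝ × ℝ × ℝ × ℝ) => tau p ‖q.1 k‖ q.2 :=
    (measurable_tau p).comp hk
  refine Measurable.ite (measurable_fst (measurableSet_isNearest k)) ?_ ?_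
  · exact Measurable.ite (hk (measurableSet_markIn' p v)) measurable_const measurable_const
  · refine Measurable.ite ?_ (by fun_prop) measurable_const
    exact measurableSet_le (by fun_prop) measurable_const

lemma norm_bsFactor_le (v : LinkState) (x : ℝ) (n : ℕ) (k : ιb) (b : ιb → Plane)
    (m : ℝ × ℝ × ℝ × ℝ × ℝ) : ‖bsFactor p v x n k b m‖ ≤ 1 := by
  rw [bsFactor]
  split_ifs
  · simp
  · simp
  · rw [Complex.norm_exp_I_mul_ofReal]
  · simp

lemma bsFactor_of_notMem {v : LinkState} {x : ℝ} {n : ℕ} {b : ιb → Plane} {i k : ιb}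
    (hi : IsNearest b i) (hk : k ∉ insert i {k | ‖b k‖ ≤ n}) (m : ℝ × ℝ × ℝ × ℝ × ℝ) :
    bsFactor p v x n k b m = 1 := by
  have h1 : ¬ IsNearest b k := fun h => hk (Or.inl (h.unique hi))
  rw [bsFactor, if_neg h1]
  exact if_neg fun h => hk (Or.inr h)

lemma integral_bsFactor (v : LinkState) (x : ℝ) (n : ℕ) (k : ιb) (b : ιb → Plane)
    {i : ιb} (hi : IsNearest b i) :
    ∫ ω, bsFactor p v x n k b (M.bsMark k ω) ∂P =
      open Classical in if k = i then (p.probState v ‖b i‖ : ℂ) else annFactor (psi p x) n ‖b i‖ (b k) := by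
  classical
  by_cases hk : k = i
  · subst hk
    simp only [bsFactor, if_pos hi, if_true]
    rw [← M.measureReal_markIn k v (norm_nonneg _), ← integral_indicator_one]
    · rw [← integral_complex_ofReal]
      refine integral_congr_ae (Eventually.of_forall fun ω => ?_)
      by_cases h : M.bsMark k ω ∈ markIn p v ‖b k‖
      · simp [h]
      · simp [h]
    · exact ((measurable_prodMk_left (x := ‖b k‖)).comp (M.measurable_bsMark k))
        (measurableSet_markIn' p v)
  · have h1 : ¬ IsNearest b k := fun h => hk (h.unique hi)
    simp only [bsFactor, if_neg h1, if_neg hk]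
    by_cases hn : ‖b k‖ ≤ n
    · simp only [if_pos hn]
      rw [M.integral_exp_tau k x (norm_nonneg _), annFactor_of_mem ⟨hi k hk, hn⟩]
    · simp only [if_neg hn]
      rw [annFactor_of_notMem fun q => hn q.2]; simp

/-- Marks first: the factor of the nearest BS averages to the state probability, every other factor
to ψ on the annulus. What remains involves positions only, and the theorem on the process beyond its
nearest point applies with the state probability absorbed in the test function. -/
lemma integral_comp_mul_bsFactor (v : LinkState) (x : ℝ) (n : ℕ) {G : ℝ → ℂ} (hG : Measurable G)
    {C : ℝ} (hGC : ∀ t, ‖G t‖ ≤ C) :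
    ∫ ω, G (M.tBU ω) * ∏ᶠ k, bsFactor p v x n k (fun i => M.b i ω) (M.bsMark k ω) ∂P =
      ∫ ω, G (M.tBU ω) * (p.probState v (M.tBU ω) * annLaplace p.lamB (psi p x) n (M.tBU ω)) ∂P := by
  classical
  have hC0 : 0 ≤ C := (norm_nonneg _).trans (hGC 0)
  -- The absolute value keeps the state probability in [0, 1] at negative arguments, so that the
  -- test function is bounded on all of ℝ.
  have hP : Measurable fun t : ℝ => (p.probState v |t| : ℂ) :=
    (Complex.continuous_ofReal.comp ((continuous_probState p v).comp continuous_abs)).measurable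
  have hP1 : ∀ t, ‖(p.probState v |t| : ℂ)‖ ≤ 1 := fun t => by
    have := probState_mem p v (abs_nonneg t)
    rw [Complex.norm_real, Real.norm_of_nonneg this.1]; exact this.2
  have h2 := M.b_poisson.integral_comp_mul_annProd p.lamB_pos (measurable_psi p x) (norm_psi_le p x) n
    (hG.mul hP) (C := C) (fun t => by
      rw [Pi.mul_apply, norm_mul]
      calc ‖G t‖ * ‖(p.probState v |t| : ℂ)‖ ≤ C * 1 := by gcongr; exacts [hGC t, hP1 t]
        _ = C := mul_one C)
  simp only [← M.tBU_eq] at h2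
  have hT : ∀ ω, |M.tBU ω| = M.tBU ω := fun ω => abs_of_nonneg (norm_nonneg _)
  simp only [Pi.mul_apply, hT, mul_assoc] at h2
  rw [← h2]
  refine integral_marks_of_tendsto (P := P) M.b_poisson.1 M.measurable_bsMark M.indepFun_b_bsMark
    M.iIndepFun_bsMark (A := fun b => G ‖nearestPos b‖) (hG.comp measurable_nearestPos.norm)
    (fun b => hGC _) (f := bsFactor p v x n) (measurable_bsFactor v x n)
    (norm_bsFactor_le v x n) ?_ ?_
  · filter_upwards [M.b_poisson.ae_locallyFinite (lam := p.lamB),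
      M.b_poisson.ae_exists_isNearest p.lamB_pos] with ω h1 ⟨i, hi⟩
    exact tendsto_prod_finprod ((h1 n).insert i) fun k hk => bsFactor_of_notMem hi hk _
  · filter_upwards [M.b_poisson.ae_locallyFinite (lam := p.lamB),
      M.b_poisson.ae_exists_isNearest p.lamB_pos] with ω h1 ⟨i, hi⟩
    set b := fun i => M.b i ω
    simp only [M.integral_bsFactor v x n _ b hi]
    have ht : M.tBU ω = ‖b i‖ := congrArg norm hi.nearestPos_eq
    have hsupp : ∀ k ∉ insert i {k | ‖b k‖ ≤ n},
        (if k = i then (p.probState v ‖b i‖ : ℂ) else annFactor (psi p x) n ‖b i‖ (b k)) = 1 := by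
      intro k hk
      rw [if_neg fun h => hk (Or.inl h), annFactor_of_notMem fun q => hk (Or.inr q.2)]
    have hfin : (insert i {k | ‖b k‖ ≤ n}).Finite := (h1 n).insert i
    have key := tendsto_prod_finprod hfin hsupp
    rw [← mul_finprod_cond_ne i (hfin.subset fun k hk => by
      by_contra h; exact hk (hsupp k h)), if_pos rfl] at key
    rw [ht]
    convert key using 4
    ext k
    rw [finprod_eq_if]
    -- The nearest BS lies on the inner circle of the annulus, so its annular factor is 1 and may be
    -- included in the product.
    by_cases hk : k = i
    · rw [if_neg (by simpa using hk), hk, annFactor_of_notMem fun q => lt_irrefl _ q.1]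
    · rw [if_pos hk, if_neg hk]

/-- The factor of the nearest BS is the indicator of its state; the others are exponentials of the
contributions whose sum is the interference. -/
lemma tendsto_finprod_bsFactor (v : LinkState) (x : ℝ) : ∀ᵐ ω ∂P,
    Tendsto (fun n : ℕ => ∏ᶠ k, bsFactor p v x n k (fun i => M.b i ω) (M.bsMark k ω)) atTop
      (𝓝 ({ω | M.TagState v ω}.indicator 1 ω *
        Complex.exp (Complex.I * ((x * M.interference ω : ℝ) : ℂ)))) := by
  classical
  filter_upwards [M.b_poisson.ae_locallyFinite (lam := p.lamB),
    M.b_poisson.ae_exists_isNearest p.lamB_pos, M.ae_summable_tau, M.ae_interference_eq]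
    with ω h1 ⟨i, hi⟩ hs hI
  have ht : M.tBU ω = ‖M.b i ω‖ := congrArg norm hi.nearestPos_eq
  have e : ∀ n : ℕ, ∏ᶠ k, bsFactor p v x n k (fun i => M.b i ω) (M.bsMark k ω) =
      {ω | M.TagState v ω}.indicator 1 ω *
        ∏ᶠ k, (if k = i then 1 else bsFactor p v x n k (fun i => M.b i ω) (M.bsMark k ω)) := by
    intro n
    rw [← mul_finprod_cond_ne i (((h1 n).insert i).subset fun k hk => by
      by_contra h; exact hk (bsFactor_of_notMem hi h _))]
    congr 1
    · rw [bsFactor, if_pos hi]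
      by_cases h : M.TagState v ω
      · rw [indicator_of_mem (by exact h), if_pos ((M.tagState_iff hi v).1 h)]; rfl
      · rw [indicator_of_notMem (by exact h), if_neg fun h' => h ((M.tagState_iff hi v).2 h')]
    · refine finprod_congr fun k => ?_
      rw [finprod_eq_if]
      by_cases hk : k = i
      · rw [if_neg (by simpa using hk), if_pos hk]
      · rw [if_pos hk, if_neg hk]
  simp_rw [e]
  refine Tendsto.const_mul _ ?_
  rw [hI, farSum]
  refine tendsto_finprod_exp hs h1 {k | M.tBU ω < ‖M.b k ω‖} x (fun n k hk hn => ?_) (fun n k hk => ?_)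
  · have hki : k ≠ i := by
      rintro rfl
      rw [mem_ofPred_eq, ht] at hk
      exact lt_irrefl _ hk
    rw [if_neg hki, bsFactor, if_neg (fun h => hki (h.unique hi)), if_pos hn]
  · by_cases hki : k = i
    · rw [if_pos hki]
    · rw [if_neg hki]
      refine bsFactor_of_notMem hi (fun h => ?_) _
      rcases h with h | h
      · exact hki h
      · refine hk ⟨?_, h⟩
        rw [mem_ofPred_eq, ht]
        exact hi k hki

lemma finite_insert_nearest : ∀ᵐ ω ∂P, ∃ i, IsNearest (fun i => M.b i ω) i ∧
    ∀ n : ℕ, (insert i {k | ‖M.b k ω‖ ≤ n}).Finite := by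
  filter_upwards [M.b_poisson.ae_locallyFinite (lam := p.lamB),
    M.b_poisson.ae_exists_isNearest p.lamB_pos] with ω h1 ⟨i, hi⟩
  exact ⟨i, hi, fun n => (h1 n).insert i⟩

lemma norm_finprod_bsFactor_le (v : LinkState) (x : ℝ) (n : ℕ) : ∀ᵐ ω ∂P,
    ‖∏ᶠ k, bsFactor p v x n k (fun i => M.b i ω) (M.bsMark k ω)‖ ≤ 1 := by
  filter_upwards [M.finite_insert_nearest] with ω ⟨i, hi, h⟩
  exact norm_finprod_le_one (h n) (fun k hk => bsFactor_of_notMem (b := fun i => M.b i ω) hi hk _)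
    fun k => norm_bsFactor_le _ _ _ _ _ _

lemma aestronglyMeasurable_finprod_bsFactor (v : LinkState) (x : ℝ) (n : ℕ) : AEStronglyMeasurable
    (fun ω => ∏ᶠ k, bsFactor p v x n k (fun i => M.b i ω) (M.bsMark k ω)) P := by
  refine aestronglyMeasurable_finprod (S := fun ω => {k | ‖M.b k ω‖ ≤ n} ∪
    {k | IsNearest (fun i => M.b i ω) k}) (fun k => ?_) ?_
  · exact Measurable.comp (f := fun ω => ((fun i => M.b i ω), M.bsMark k ω))
      (measurable_bsFactor v x n k) (M.measurable_b.prodMk (M.measurable_bsMark k))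
  · filter_upwards [M.finite_insert_nearest] with ω ⟨i, hi, h⟩
    constructor
    · refine (h n).subset ?_
      rintro k (hk | hk)
      · exact Or.inr hk
      · exact Or.inl (IsNearest.unique (b := fun i => M.b i ω) hk hi)
    · intro k hk
      refine bsFactor_of_notMem (b := fun i => M.b i ω) hi (fun h => hk ?_) _
      rcases h with h | h
      · right; rw [h]; exact hi
      · left; exact h

/-- Joint law of the nearest distance, the state of the tagged link and the interference. -/
lemma integral_tagState_exp (v : LinkState) (x : ℝ) {G : ℝ → ℂ} (hG : Measurable G)
    {C : ℝ} (hGC : ∀ t, ‖G t‖ ≤ C) :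
    ∫ ω, G (M.tBU ω) * ({ω | M.TagState v ω}.indicator 1 ω *
        Complex.exp (Complex.I * ((x * M.interference ω : ℝ) : ℂ))) ∂P =
      ∫ ω, G (M.tBU ω) * (p.probState v (M.tBU ω) * p.laplaceI (M.tBU ω) (-(Complex.I * x))) ∂P := by
  have hC0 : 0 ≤ C := (norm_nonneg _).trans (hGC 0)
  have hGT : AEStronglyMeasurable (fun ω => G (M.tBU ω)) P :=
    (hG.comp M.measurable_tBU).aestronglyMeasurable
  have hbd : ∀ (t : ℝ) (z : ℂ), ‖z‖ ≤ 1 → ‖G t * z‖ ≤ C := fun t z hz => by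
    rw [norm_mul]
    calc ‖G t‖ * ‖z‖ ≤ C * 1 := by gcongr; exact hGC t
      _ = C := mul_one C
  have l1 : Tendsto (fun n : ℕ => ∫ ω, G (M.tBU ω) *
      ∏ᶠ k, bsFactor p v x n k (fun i => M.b i ω) (M.bsMark k ω) ∂P) atTop (𝓝 (∫ ω, G (M.tBU ω) *
      ({ω | M.TagState v ω}.indicator 1 ω *
        Complex.exp (Complex.I * ((x * M.interference ω : ℝ) : ℂ))) ∂P)) := by
    refine tendsto_integral_of_dominated_convergence (fun _ => C)
      (fun n => hGT.mul (M.aestronglyMeasurable_finprod_bsFactor v x n)) (integrable_const _)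
      (fun n => ?_) ?_
    · filter_upwards [M.norm_finprod_bsFactor_le v x n] with ω h using hbd _ _ h
    · filter_upwards [M.tendsto_finprod_bsFactor v x] with ω h using h.const_mul _
  have l2 : Tendsto (fun n : ℕ => ∫ ω, G (M.tBU ω) *
      (p.probState v (M.tBU ω) * annLaplace p.lamB (psi p x) n (M.tBU ω)) ∂P) atTop
      (𝓝 (∫ ω, G (M.tBU ω) *
        (p.probState v (M.tBU ω) * p.laplaceI (M.tBU ω) (-(Complex.I * x))) ∂P)) := by
    refine tendsto_integral_of_dominated_convergence (fun _ => C) (fun n => hGT.mul ?_)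
      (integrable_const _) (fun n => Eventually.of_forall fun ω => hbd _ _ ?_) ?_
    · refine AEStronglyMeasurable.mul ?_ ?_
      · exact ((Complex.continuous_ofReal.comp (continuous_probState p v)).measurable.comp
          M.measurable_tBU).aestronglyMeasurable
      · exact ((measurable_annLaplace p.lamB (measurable_psi p x) n).comp
          M.measurable_tBU).aestronglyMeasurable
    · have h1 : p.probState v (M.tBU ω) ∈ Icc (0 : ℝ) 1 := probState_mem p v (norm_nonneg _)
      have h2 := M.b_poisson.norm_annLaplace_le (lam := p.lamB) (measurable_psi p x) (norm_psi_le p x) n (M.tBU ω)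
      rw [norm_mul, Complex.norm_real, Real.norm_of_nonneg h1.1]
      exact mul_le_one₀ h1.2 (norm_nonneg _) h2
    · filter_upwards [M.ae_tBU_pos] with ω h
      exact ((tendsto_annLaplace_psi p x h).const_mul _).const_mul _
  simp_rw [M.integral_comp_mul_bsFactor v x _ hG hGC] at l1
  exact tendsto_nhds_unique l1 l2

end Network

end

end RisNet

namespace RisNet
noncomputable section

/-! ### The closed form as an average over interference and fading -/

namespace Network

open Filter Topology Params

set_option linter.unusedSectionVars false

variable {Ω : Type*} [MeasurableSpace Ω] {P : Measure Ω} [IsProbabilityMeasure P] {p : Params}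
  {ιb ιr : Type*} [Countable ιb] (M : Network P p ιb ιr)

lemma Gb_pos : 0 < p.Gb := by
  rw [Gb, gULA, if_pos ⟨0, by simp⟩]; exact Nb_pos p

lemma Gr_pos : 0 < p.Gr := by
  have := p.one_le_Nr
  rw [Gr]; positivity

lemma pow_pos (q : Serving) {t s z : ℝ} (ht : 0 < t) (hs : q = .CL → 0 < s) (hz : q = .CL → 0 < z) :
    0 < p.pow q t s z := by
  have h1 := p.pb_pos
  have h2 := Gb_pos (p := p)
  have h3 := Gr_pos (p := p)
  have h4 := zeta_pos p
  cases q
  · exact mul_pos (by positivity) (Real.rpow_pos_of_pos ht _)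
  · exact mul_pos (by positivity) (Real.rpow_pos_of_pos (mul_pos (hs rfl) (hz rfl)) _)
  · exact mul_pos (by positivity) (Real.rpow_pos_of_pos ht _)

lemma one_le_servingShape (q : Serving) : 1 ≤ p.servingShape q := by
  cases q; exacts [p.one_le_mL, p.one_le_mL, p.one_le_mN]

include M in
-- On the imaginary axis the Laplace transform is the characteristic function of an actual random
-- sum, hence measurable and of modulus at most one; its Lipschitz bound at 0 comes from the
-- explicit exponent.
lemma integrableOn_gpIntegrand {m : ℕ} (hm : 1 ≤ m) {w t gam om : ℝ} (hw : 0 < w) (ht : 0 < t)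
    (hg : 0 < gam) (hU : p.noise * gam ≤ p.area * om) :
    IntegrableOn (p.gpIntegrand m w t gam om) (Ioi 0) := by
  have hb : ∀ x : ℝ, 0 < x → ‖p.laplaceI t (-(Complex.I * x))‖ ≤ 1 := fun x _ => by
    rw [← M.charFun_interfLaw x ht]
    exact norm_charFun_le_one x
  obtain ⟨K, hK⟩ := norm_laplaceI_sub_one_le p ht hb
  refine integrableOn_gp p hm hw hg hU (φ := fun x => p.laplaceI t (-(Complex.I * x))) ?_ hb hK
  have : (fun x : ℝ => p.laplaceI t (-(Complex.I * x))) = charFun (M.interfLaw t) := by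
    ext x; exact (M.charFun_interfLaw x ht).symm
  rw [this]
  exact stronglyMeasurable_charFun.measurable

/-- Probability that the fading puts the link in the required range, given mean power and
interference. -/
def goodProb (p : Params) (gam om : ℝ) (m : ℕ) (w u : ℝ) : ℝ :=
  (gammaMeasure m m).real (goodFading p.noise (p.area * om) gam w u)

lemma isProbabilityMeasure_gamma {m : ℕ} (hm : 1 ≤ m) : IsProbabilityMeasure (gammaMeasure m m) :=
  isProbabilityMeasure_gammaMeasure (by positivity) (by positivity)

lemma measurable_goodProb (gam om : ℝ) {m : ℕ} (hm : 1 ≤ m) :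
    Measurable fun q : ℝ × ℝ => goodProb p gam om m q.1 q.2 := by
  have := isProbabilityMeasure_gamma hm
  have hS : MeasurableSet {q : (ℝ × ℝ) × ℝ | gam * (p.noise + q.1.2) < q.1.1 * q.2 ∧
      q.1.1 * q.2 ≤ p.area * om - q.1.2} := by
    rw [ofPred_and]
    exact (measurableSet_lt (by fun_prop) (by fun_prop)).inter
      (measurableSet_le (by fun_prop) (by fun_prop))
  exact (measurable_measure_prodMk_left hS).ennreal_toReal

lemma goodProb_mem (gam om : ℝ) {m : ℕ} (hm : 1 ≤ m) (w u : ℝ) :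
    goodProb p gam om m w u ∈ Icc (0 : ℝ) 1 := by
  have := isProbabilityMeasure_gamma hm
  exact ⟨measureReal_nonneg, measureReal_le_one⟩

/-- Conditional joint probability, as an average over the interference. -/
def jointAvg (gam om : ℝ) (m : ℕ) (w t : ℝ) : ℝ := ∫ ω, goodProb p gam om m w (M.farSum t ω) ∂P

lemma jointAvg_eq (gam om : ℝ) {m : ℕ} (hm : 1 ≤ m) (w t : ℝ) :
    M.jointAvg gam om m w t = ∫ u, goodProb p gam om m w u ∂(M.interfLaw t) := by
  rw [interfLaw, integral_map (M.measurable_farSum_right t).aemeasurable]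
  · rfl
  · exact ((measurable_goodProb gam om hm).comp measurable_prodMk_left).aestronglyMeasurable

lemma measurable_jointAvg (gam om : ℝ) {m : ℕ} (hm : 1 ≤ m) :
    Measurable fun q : ℝ × ℝ => M.jointAvg gam om m q.1 q.2 := by
  have h0 : Measurable fun q : (ℝ × ℝ) × Ω => M.farSum q.1.2 q.2 :=
    Measurable.comp (f := fun q : (ℝ × ℝ) × Ω => (q.1.2, q.2)) M.measurable_farSum (by fun_prop)
  have h : Measurable fun q : (ℝ × ℝ) × Ω => goodProb p gam om m q.1.1 (M.farSum q.1.2 q.2) :=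
    Measurable.comp (f := fun q : (ℝ × ℝ) × Ω => (q.1.1, M.farSum q.1.2 q.2))
      (measurable_goodProb gam om hm) ((measurable_fst.comp measurable_fst).prodMk h0)
  exact h.stronglyMeasurable.integral_prod_right.measurable

lemma jointAvg_mem (gam om : ℝ) {m : ℕ} (hm : 1 ≤ m) (w t : ℝ) :
    M.jointAvg gam om m w t ∈ Icc (0 : ℝ) 1 := by
  have h := fun u => goodProb_mem (p := p) gam om hm w u
  refine ⟨integral_nonneg fun ω => (h _).1, ?_⟩
  calc M.jointAvg gam om m w t ≤ ∫ _ω, (1 : ℝ) ∂P :=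
        integral_mono_of_nonneg (Eventually.of_forall fun ω => (h _).1) (integrable_const _)
          (Eventually.of_forall fun ω => (h _).2)
    _ = 1 := by simp

/-- From here on the average replaces the closed form: it is visibly jointly measurable in w and t
and lies in [0, 1]. -/
lemma jointOf_eq_jointAvg {m : ℕ} (hm : 1 ≤ m) {w t gam : ℝ} (om : ℝ) (hw : 0 < w) (ht : 0 < t)
    (hg : 0 < gam) : p.jointOf m w t gam om = M.jointAvg gam om m w t := by
  rw [M.jointAvg_eq gam om hm]
  exact jointOf_eq_integral p hm hw hg (M.interfLaw t) (M.interfLaw_Iio t) t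
    (fun x _ => (M.charFun_interfLaw x ht).symm)
    fun hU => M.integrableOn_gpIntegrand hm hw ht hg hU

end Network

end

end RisNet

namespace RisNet
noncomputable section

/-! ### Half-planes containing two directions; polar coordinates -/

section Geometry

open Filter Topology

/-- Unit vector with a given polar angle. -/
def dir (φ : ℝ) : Plane := !₂[Real.cos φ, Real.sin φ]

lemma inner_plane (a b : Plane) : inner ℝ a b = a 0 * b 0 + a 1 * b 1 := by
  rw [PiLp.inner_apply, Fin.sum_univ_two]
  simp [mul_comm]

lemma inner_dir_dir (φ ψ : ℝ) : inner ℝ (dir φ) (dir ψ) = Real.cos (φ - ψ) := by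
  rw [inner_plane, Real.cos_sub]; simp [dir]

lemma norm_dir (φ : ℝ) : ‖dir φ‖ = 1 := by
  have h := real_inner_self_eq_norm_sq (dir φ)
  rw [inner_dir_dir, sub_self, Real.cos_zero] at h
  exact (sq_eq_sq₀ (norm_nonneg _) zero_le_one).1 (by rw [← h]; norm_num)

lemma exists_eq_smul_dir (a : Plane) : ∃ φ, a = ‖a‖ • dir φ := by
  set c : ℂ := ⟨a 0, a 1⟩
  have hc : ‖a‖ = ‖c‖ := by
    rw [EuclideanSpace.norm_eq, Fin.sum_univ_two, Complex.norm_eq_sqrt_sq_add_sq]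
    simp [c]
  refine ⟨c.arg, ?_⟩
  rw [hc]
  ext i
  fin_cases i
  · have h := Complex.norm_mul_cos_arg c
    simp only [dir, PiLp.smul_apply, smul_eq_mul]
    exact h.symm
  · have h := Complex.norm_mul_sin_arg c
    simp only [dir, PiLp.smul_apply, smul_eq_mul]
    exact h.symm

lemma continuous_dir : Continuous dir := by
  refine (PiLp.continuous_toLp 2 _).comp (continuous_pi fun i => ?_)
  fin_cases i
  · exact Real.continuous_cos
  · exact Real.continuous_sin

lemma measurable_dir : Measurable dir := continuous_dir.measurable

lemma cos_pos_iff_of_mem {φ : ℝ} (h : φ ∈ Ioc (-(Real.pi / 2)) (3 * Real.pi / 2)) :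
    0 < Real.cos φ ↔ φ < Real.pi / 2 := by
  constructor
  · intro hc
    by_contra hφ
    exact absurd hc (not_lt.2 (Real.cos_nonpos_of_pi_div_two_le_of_le (not_lt.1 hφ)
      (h.2.trans_eq (by ring))))
  · exact fun hφ => Real.cos_pos_of_mem_Ioo ⟨by linarith [h.1], hφ⟩

lemma periodic_indicator_two_front (d : ℝ) : Function.Periodic
    ({φ | 0 < Real.cos φ ∧ 0 < Real.cos (φ - d)}.indicator (fun _ => (1 : ℝ))) (2 * Real.pi) := fun φ => by
  have h : φ + 2 * Real.pi ∈ {φ | 0 < Real.cos φ ∧ 0 < Real.cos (φ - d)} ↔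
      φ ∈ {φ | 0 < Real.cos φ ∧ 0 < Real.cos (φ - d)} := by
    rw [mem_ofPred_eq, mem_ofPred_eq, Real.cos_add_two_pi,
      show φ + 2 * Real.pi - d = φ - d + 2 * Real.pi by ring, Real.cos_add_two_pi]
  by_cases hφ : φ ∈ {φ | 0 < Real.cos φ ∧ 0 < Real.cos (φ - d)}
  · rw [indicator_of_mem hφ, indicator_of_mem (h.2 hφ)]
  · rw [indicator_of_notMem hφ, indicator_of_notMem fun q => hφ (h.1 q)]

/-- Length of the set of angles in front of two directions that are `d` apart. -/
lemma integral_two_front (d : ℝ) :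
    ∫ φ in (0 : ℝ)..(2 * Real.pi), {φ | 0 < Real.cos φ ∧ 0 < Real.cos (φ - d)}.indicator (fun _ => (1 : ℝ)) φ =
      Real.pi - Real.arccos (Real.cos d) := by
  set e := Real.arccos (Real.cos d) with he
  have he0 : 0 ≤ e := Real.arccos_nonneg _
  have he1 : e ≤ Real.pi := Real.arccos_le_pi _
  have hce : Real.cos e = Real.cos d := Real.cos_arccos (Real.neg_one_le_cos _) (Real.cos_le_one _)
  set f := {φ | 0 < Real.cos φ ∧ 0 < Real.cos (φ - d)}.indicator (fun _ => (1 : ℝ)) with hf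
  have hper : Function.Periodic f (2 * Real.pi) := periodic_indicator_two_front d
  -- The window is shifted by periodicity so that the angles with positive cosine form a single
  -- interval (−π/2, π/2) of it.
  have h1 := hper.intervalIntegral_add_eq 0 (-(Real.pi / 2))
  rw [zero_add, show -(Real.pi / 2) + 2 * Real.pi = 3 * Real.pi / 2 by ring] at h1
  rw [h1, intervalIntegral.integral_of_le (by linarith [Real.pi_pos]), hf]
  have hpi := Real.pi_pos
  have key : ∀ a b : ℝ, a ≤ b → b - a = Real.pi - e → (∀ φ ∈ Ioc (-(Real.pi / 2)) (3 * Real.pi / 2),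
      (0 < Real.cos φ ∧ 0 < Real.cos (φ - d)) ↔ φ ∈ Ioo a b) → Ioo a b ⊆ Ioc (-(Real.pi / 2)) (3 * Real.pi / 2) →
      ∫ φ in Ioc (-(Real.pi / 2)) (3 * Real.pi / 2),
        {φ | 0 < Real.cos φ ∧ 0 < Real.cos (φ - d)}.indicator (fun _ => (1 : ℝ)) φ = Real.pi - e := by
    intro a b hab hba hiff hsub
    have : ∫ φ in Ioc (-(Real.pi / 2)) (3 * Real.pi / 2),
        {φ | 0 < Real.cos φ ∧ 0 < Real.cos (φ - d)}.indicator (fun _ => (1 : ℝ)) φ =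
        ∫ φ in Ioc (-(Real.pi / 2)) (3 * Real.pi / 2), (Ioo a b).indicator (fun _ => (1 : ℝ)) φ := by
      refine setIntegral_congr_fun measurableSet_Ioc fun φ hφ => ?_
      simp only [indicator, mem_ofPred_eq, hiff φ hφ]
    rw [this, setIntegral_indicator measurableSet_Ioo, inter_eq_self_of_subset_right hsub]
    simp [hba, he1]
  -- Modulo 2π, d is e or −e. The two half-circles then meet in (e − π/2, π/2) or in (−π/2, π/2 −
  -- e), an arc of length π − e either way.
  obtain ⟨k, hk | hk⟩ := Real.cos_eq_cos_iff.1 hce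
  · have hcd : ∀ φ, Real.cos (φ - d) = Real.cos (φ - e) := fun φ => by
      rw [hk, show φ - (2 * k * Real.pi + e) = φ - e - k * (2 * Real.pi) by ring, Real.cos_sub_int_mul_two_pi]
    refine key (e - Real.pi / 2) (Real.pi / 2) (by linarith) (by ring) (fun φ hφ => ?_) fun φ hφ =>
      ⟨by linarith [hφ.1], by linarith [hφ.2]⟩
    rw [cos_pos_iff_of_mem hφ, hcd, mem_Ioo, and_comm]
    refine and_congr_left fun h2 => ?_
    rw [← Real.cos_neg, cos_pos_iff_of_mem ⟨by linarith, by linarith [hφ.1]⟩]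
    constructor <;> intro h <;> linarith
  · have hcd : ∀ φ, Real.cos (φ - d) = Real.cos (φ + e) := fun φ => by
      rw [hk, show φ - (2 * k * Real.pi - e) = φ + e - k * (2 * Real.pi) by ring, Real.cos_sub_int_mul_two_pi]
    refine key (-(Real.pi / 2)) (Real.pi / 2 - e) (by linarith) (by ring) (fun φ hφ => ?_) fun φ hφ =>
      ⟨by linarith [hφ.1], by linarith [hφ.2]⟩
    rw [cos_pos_iff_of_mem hφ, hcd, mem_Ioo]
    constructor
    · rintro ⟨h1, h2⟩
      rw [cos_pos_iff_of_mem ⟨by linarith [hφ.1], by linarith⟩] at h2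
      exact ⟨hφ.1, by linarith⟩
    · rintro ⟨h1, h2⟩
      refine ⟨by linarith, ?_⟩
      rw [cos_pos_iff_of_mem ⟨by linarith [hφ.1], by linarith⟩]
      linarith

/-- Directions of a half-plane that contains two given vectors. -/
def frontSet (a b : Plane) : Set ℝ := {φ | 0 < inner ℝ (dir φ) a ∧ 0 < inner ℝ (dir φ) b}

lemma measurableSet_frontSet : MeasurableSet {q : (Plane × Plane) × ℝ | q.2 ∈ frontSet q.1.1 q.1.2} := by
  have hd : Measurable fun q : (Plane × Plane) × ℝ => dir q.2 := measurable_dir.comp measurable_snd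
  have h1 : Measurable fun q : (Plane × Plane) × ℝ => (inner ℝ (dir q.2) q.1.1 : ℝ) :=
    hd.inner (by fun_prop)
  have h2 : Measurable fun q : (Plane × Plane) × ℝ => (inner ℝ (dir q.2) q.1.2 : ℝ) :=
    hd.inner (by fun_prop)
  simp only [frontSet, ofPred_and]
  exact (measurableSet_lt measurable_const h1).inter (measurableSet_lt measurable_const h2)

lemma measurableSet_frontSet_right (a b : Plane) : MeasurableSet (frontSet a b) :=
  (measurable_prodMk_left (x := ((a, b) : Plane × Plane))) measurableSet_frontSet

/-- Only the angle between the two vectors matters: the corresponding open half-circles of normals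
overlap in an arc of length π minus that angle, and the uniform law divides by 2π. -/
lemma angleLaw_frontSet {a b : Plane} (ha : a ≠ 0) (hb : b ≠ 0) : angleLaw.real (frontSet a b) =
    1 / 2 - 1 / (2 * Real.pi) * Real.arccos (inner ℝ a b / (‖a‖ * ‖b‖)) := by
  have ha' := norm_pos_iff.2 ha
  have hb' := norm_pos_iff.2 hb
  obtain ⟨α, hα⟩ := exists_eq_smul_dir a
  obtain ⟨β, hβ⟩ := exists_eq_smul_dir b
  have e : frontSet a b = {φ | 0 < Real.cos (φ - α) ∧ 0 < Real.cos (φ - β)} := by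
    ext φ
    conv_lhs => rw [frontSet, mem_ofPred_eq, hα, hβ]
    rw [mem_ofPred_eq, inner_smul_right, inner_smul_right, inner_dir_dir,
      inner_dir_dir, mul_pos_iff_of_pos_left ha', mul_pos_iff_of_pos_left hb']
  have hi : inner ℝ a b / (‖a‖ * ‖b‖) = Real.cos (β - α) := by
    have : inner ℝ a b = ‖a‖ * ‖b‖ * Real.cos (β - α) := by
      conv_lhs => rw [hα, hβ, inner_smul_left, inner_smul_right, inner_dir_dir]
      rw [← Real.cos_neg, neg_sub]; simp; ring
    rw [this]; field_simp
  have h1 : angleLaw.real (frontSet a b) =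
      (2 * Real.pi)⁻¹ * ∫ φ in (0 : ℝ)..(2 * Real.pi), (frontSet a b).indicator (fun _ => (1 : ℝ)) φ := by
    rw [← smul_eq_mul, ← integral_angleLaw]
    exact (integral_indicator_one (measurableSet_frontSet_right a b)).symm
  set f := {φ | 0 < Real.cos φ ∧ 0 < Real.cos (φ - (β - α))}.indicator (fun _ => (1 : ℝ)) with hf
  have h2 : ∀ φ, (frontSet a b).indicator (fun _ => (1 : ℝ)) φ = f (φ - α) := fun φ => by
    rw [e, hf]
    simp only [indicator, mem_ofPred_eq]
    rw [show φ - α - (β - α) = φ - β by ring]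
  have hper : Function.Periodic f (2 * Real.pi) := periodic_indicator_two_front _
  have h3 := hper.intervalIntegral_add_eq 0 (0 - α)
  rw [zero_add, show 0 - α + 2 * Real.pi = 2 * Real.pi - α by ring] at h3
  have hpi := Real.pi_pos
  rw [h1, hi]
  simp_rw [h2]
  rw [intervalIntegral.integral_comp_sub_right, ← h3, hf, integral_two_front]
  field_simp

lemma integral_plane_polar {E : Type*} [NormedAddCommGroup E] [NormedSpace ℝ E] (f : Plane → E) :
    ∫ z, f z = ∫ q in Ioi (0 : ℝ) ×ˢ Ioo (-Real.pi) Real.pi, q.1 • f (q.1 • dir q.2) := by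
  have h1 := (PiLp.volume_preserving_toLp (Fin 2)).integral_comp
    (MeasurableEquiv.toLp 2 (Fin 2 → ℝ)).measurableEmbedding f
  have h2 := (volume_preserving_finTwoArrow ℝ).symm.integral_comp
    (MeasurableEquiv.finTwoArrow (α := ℝ)).symm.measurableEmbedding
    (fun x => f (WithLp.toLp 2 x))
  rw [← h1, ← h2, ← integral_comp_polarCoord_symm, polarCoord_target]
  refine setIntegral_congr_fun (measurableSet_Ioi.prod measurableSet_Ioo) fun q hq => ?_
  beta_reduce
  congr 2
  rw [polarCoord_symm_apply]
  ext i
  fin_cases i <;> simp [dir, MeasurableEquiv.finTwoArrow]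

end Geometry

end

end RisNet

namespace RisNet
noncomputable section

/-! ### Probability that a RIS at a given place offers a cascaded link -/

section ReflProb

open Filter Topology Params

lemma probRefl_mem (t s th : ℝ) : probRefl t s th ∈ Icc (0 : ℝ) 1 := by
  have hpi := Real.pi_pos
  rw [probRefl]
  set a := Real.arccos ((s - t * Real.cos th) / Real.sqrt (t ^ 2 + s ^ 2 - 2 * t * s * Real.cos th))
  have h0 : 0 ≤ a := Real.arccos_nonneg _
  have h1 : a ≤ Real.pi := Real.arccos_le_pi _
  have h2 : 1 / (2 * Real.pi) * a ≤ 1 / 2 := by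
    rw [one_div_mul_eq_div, div_le_iff₀ (by positivity)]; linarith
  have h3 : 0 ≤ 1 / (2 * Real.pi) * a := by positivity
  exact ⟨by linarith, by linarith⟩

lemma measurable_probRefl (t : ℝ) : Measurable fun q : ℝ × ℝ => probRefl t q.1 q.2 := by
  unfold probRefl
  have h : Measurable fun q : ℝ × ℝ =>
      (q.1 - t * Real.cos q.2) / Real.sqrt (t ^ 2 + q.1 ^ 2 - 2 * t * q.1 * Real.cos q.2) := by fun_prop
  exact measurable_const.sub ((Real.continuous_arccos.measurable.comp h).const_mul _)

lemma periodic_probRefl (t s : ℝ) : Function.Periodic (probRefl t s) (2 * Real.pi) := fun th => by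
  rw [probRefl, probRefl, Real.cos_add_two_pi]

/-- The argument of the arccosine is the cosine of the angle at the RIS between user and BS. In
polar coordinates a common factor u cancels, and only the difference of the polar angles survives.
-/
lemma probRefl_polar {t u φ θ : ℝ} (hu : 0 < u) :
    1 / 2 - 1 / (2 * Real.pi) * Real.arccos ((‖u • dir θ‖ ^ 2 - inner ℝ (t • dir φ) (u • dir θ)) /
      (‖u • dir θ‖ * ‖t • dir φ - u • dir θ‖)) = probRefl t u (θ - φ) := by
  have h1 : ‖u • dir θ‖ = u := by rw [norm_smul, norm_dir, mul_one, Real.norm_of_nonneg hu.le]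
  have h2 : inner ℝ (t • dir φ) (u • dir θ) = t * u * Real.cos (θ - φ) := by
    rw [inner_smul_left, inner_smul_right, inner_dir_dir, ← Real.cos_neg, neg_sub]; simp; ring
  have h3 : ‖t • dir φ - u • dir θ‖ = Real.sqrt (t ^ 2 + u ^ 2 - 2 * t * u * Real.cos (θ - φ)) := by
    rw [← Real.sqrt_sq (norm_nonneg _), norm_sub_sq_real, h1, h2, norm_smul, norm_dir, mul_one,
      Real.norm_eq_abs, sq_abs]
    congr 1; ring
  rw [probRefl, h1, h2, h3, show u ^ 2 - t * u * Real.cos (θ - φ) = u * (u - t * Real.cos (θ - φ)) by ring,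
    mul_div_mul_left _ _ hu.ne']

variable (p : Params)

lemma lamR_nonneg : 0 ≤ p.lamR := mul_nonneg p.mu_nonneg p.lamO_pos.le

/-- Probability that a RIS at `z` offers a cascaded link to a BS at `y`. -/
def offerProb (y z : Plane) : ℝ := p.probState .L ‖z‖ * angleLaw.real (frontSet (0 - z) (y - z))

lemma offerProb_mem (y z : Plane) : offerProb p y z ∈ Icc (0 : ℝ) 1 := by
  have h := probState_mem p .L (norm_nonneg z)
  exact ⟨mul_nonneg h.1 measureReal_nonneg, mul_le_one₀ h.2 measureReal_nonneg measureReal_le_one⟩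

lemma measurable_offerProb (y : Plane) : Measurable (offerProb p y) := by
  have h1 : Measurable fun z : Plane => p.probState .L ‖z‖ :=
    ((continuous_probState p .L).comp continuous_norm).measurable
  have h2 : Measurable fun z : Plane => angleLaw (frontSet (0 - z) (y - z)) := by
    have : MeasurableSet ((fun q : Plane × ℝ => ((0 - q.1, y - q.1), q.2)) ⁻¹'
        {q : (Plane × Plane) × ℝ | q.2 ∈ frontSet q.1.1 q.1.2}) :=
      measurableSet_frontSet.preimage (by fun_prop)
    exact measurable_measure_prodMk_left this
  exact h1.mul h2.ennreal_toReal

lemma offerProb_eq {y z : Plane} (hz : z ≠ 0) (hy : z ≠ y) : offerProb p y z =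
    p.probState .L ‖z‖ * (1 / 2 - 1 / (2 * Real.pi) *
      Real.arccos ((‖z‖ ^ 2 - inner ℝ y z) / (‖z‖ * ‖y - z‖))) := by
  rw [offerProb, angleLaw_frontSet (by simpa using hz) (sub_ne_zero.2 hy.symm), zero_sub, norm_neg,
    inner_neg_left, inner_sub_right, real_inner_self_eq_norm_sq, neg_sub, real_inner_comm]

lemma abs_probState_mul_probRefl_le {u : ℝ} (hu : 0 ≤ u) (t th : ℝ) :
    ‖p.probState .L u * probRefl t u th‖ ≤ 1 := by
  have h1 := probState_mem p .L hu
  have h2 := probRefl_mem t u th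
  rw [Real.norm_of_nonneg (mul_nonneg h1.1 h2.1)]
  exact mul_le_one₀ h1.2 h2.1 h2.2

/-- Mean number (per unit density) of RISs within distance `s` that offer a cascaded link. -/
lemma integral_offerProb (y : Plane) {s : ℝ} (hs : 0 ≤ s) :
    ∫ z, (Metric.ball (0 : Plane) s).indicator (offerProb p y) z =
      ∫ u in (0 : ℝ)..s, p.aBar ‖y‖ u * u := by
  obtain ⟨φ, hφ⟩ := exists_eq_smul_dir y
  set t := ‖y‖ with ht
  have e1 : ∫ z, (Metric.ball (0 : Plane) s).indicator (offerProb p y) z =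
      ∫ z, (Metric.ball (0 : Plane) s).indicator (fun z => p.probState .L ‖z‖ * (1 / 2 - 1 / (2 * Real.pi) *
      Real.arccos ((‖z‖ ^ 2 - inner ℝ y z) / (‖z‖ * ‖y - z‖)))) z := by
    refine integral_congr_ae ?_
    have h1 : ∀ᵐ z : Plane, z ≠ 0 := by
      rw [ae_iff]; simp
    have h2 : ∀ᵐ z : Plane, z ≠ y := by
      rw [ae_iff]; simp
    filter_upwards [h1, h2] with z hz hy
    by_cases h : z ∈ Metric.ball (0 : Plane) s
    · rw [indicator_of_mem h, indicator_of_mem h, offerProb_eq p hz hy]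
    · rw [indicator_of_notMem h, indicator_of_notMem h]
  let K : ℝ → ℝ → ℝ := fun u θ => p.probState .L u * probRefl t u θ
  have hK : Measurable fun q : ℝ × ℝ => K q.1 q.2 :=
    ((continuous_probState p .L).measurable.comp measurable_fst).mul (measurable_probRefl t)
  have hKb : ∀ u θ, 0 < u → ‖K u θ‖ ≤ 1 := fun u θ hu => abs_probState_mul_probRefl_le p hu.le t θ
  have e2 : ∫ q in Ioi (0 : ℝ) ×ˢ Ioo (-Real.pi) Real.pi, q.1 • (Metric.ball (0 : Plane) s).indicator
      (fun z => p.probState .L ‖z‖ * (1 / 2 - 1 / (2 * Real.pi) *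
      Real.arccos ((‖z‖ ^ 2 - inner ℝ y z) / (‖z‖ * ‖y - z‖)))) (q.1 • dir q.2) =
      ∫ q in Ioi (0 : ℝ) ×ˢ Ioo (-Real.pi) Real.pi,
        (Prod.fst ⁻¹' Iio s).indicator (fun q : ℝ × ℝ => q.1 * K q.1 (q.2 - φ)) q := by
    refine setIntegral_congr_fun (measurableSet_Ioi.prod measurableSet_Ioo) fun q hq => ?_
    have hq0 : 0 < q.1 := hq.1
    have hn : ‖q.1 • dir q.2‖ = q.1 := by
      rw [norm_smul, norm_dir, mul_one, Real.norm_of_nonneg hq0.le]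
    beta_reduce
    by_cases h : q.1 < s
    · rw [indicator_of_mem (by rw [mem_ball_zero_iff, hn]; exact h), indicator_of_mem (by exact h),
        smul_eq_mul]
      congr 1
      rw [hφ, probRefl_polar hq0, hn]
    · rw [indicator_of_notMem (by rw [mem_ball_zero_iff, hn]; exact h), indicator_of_notMem (by exact h),
        smul_zero]
  have e3 : Ioi (0 : ℝ) ×ˢ Ioo (-Real.pi) Real.pi ∩ Prod.fst ⁻¹' Iio s =
      Ioo 0 s ×ˢ Ioo (-Real.pi) Real.pi := by
    ext q
    simp only [mem_inter_iff, mem_prod, mem_Ioi, mem_Ioo, mem_preimage, mem_Iio]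
    tauto
  rw [e1, integral_plane_polar, e2, setIntegral_indicator (measurable_fst measurableSet_Iio), e3,
    Measure.volume_eq_prod, setIntegral_prod]
  · rw [intervalIntegral.integral_of_le hs, integral_Ioc_eq_integral_Ioo]
    refine setIntegral_congr_fun measurableSet_Ioo fun u hu => ?_
    -- Periodicity absorbs the polar angle φ of the BS: the mean number depends on y through its
    -- norm only.
    have hper : Function.Periodic (K u) (2 * Real.pi) := fun th => by
      simp only [K]; rw [periodic_probRefl t u]
    have h1 := hper.intervalIntegral_add_eq (-Real.pi - φ) (-Real.pi)
    rw [show -Real.pi - φ + 2 * Real.pi = Real.pi - φ by ring,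
      show -Real.pi + 2 * Real.pi = Real.pi by ring] at h1
    rw [integral_const_mul, ← integral_Ioc_eq_integral_Ioo,
      ← intervalIntegral.integral_of_le (by linarith [Real.pi_pos]),
      intervalIntegral.integral_comp_sub_right (K u), h1, mul_comm]
    rfl
  · refine Measure.integrableOn_of_bounded (M := s) ?_ ?_ ?_
    · rw [Measure.prod_prod]
      simp [ENNReal.mul_eq_top]
    · refine (measurable_fst.mul (hK.comp (f := fun q : ℝ × ℝ => (q.1, q.2 - φ)) ?_)).aestronglyMeasurable
      fun_prop
    · refine (ae_restrict_iff' (measurableSet_Ioo.prod measurableSet_Ioo)).2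
        (Eventually.of_forall fun q hq => ?_)
      have h0 : 0 < q.1 := hq.1.1
      rw [norm_mul, Real.norm_of_nonneg h0.le]
      calc q.1 * ‖K q.1 (q.2 - φ)‖ ≤ s * 1 := by
            have := hKb q.1 (q.2 - φ) h0
            have h2 : q.1 ≤ s := hq.1.2.le
            gcongr
        _ = s := mul_one s

end ReflProb

/-! ### Distance of the nearest offering RIS as a measurable infimum -/

section Offers

open Filter Topology Params

variable (p : Params)

/-- A RIS at `z` with mark `m` offers a cascaded link to a BS at `y`. -/
def Offered (y z : Plane) (m : ℝ × ℝ) : Prop :=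
  m.1 ≤ p.probState .L ‖z‖ ∧ m.2 ∈ frontSet (0 - z) (y - z)

lemma measurableSet_offered :
    MeasurableSet {q : Plane × Plane × (ℝ × ℝ) | Offered p q.1 q.2.1 q.2.2} := by
  have h1 : Measurable fun q : Plane × Plane × (ℝ × ℝ) => p.probState .L ‖q.2.1‖ :=
    (continuous_probState p .L).measurable.comp (by fun_prop)
  simp only [Offered, ofPred_and]
  refine (measurableSet_le (by fun_prop) h1).inter ?_
  exact measurableSet_frontSet.preimage
    (f := fun q : Plane × Plane × (ℝ × ℝ) => ((0 - q.2.1, q.1 - q.2.1), q.2.2.2)) (by fun_prop)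

variable {ι : Type*}

/-- Distance from the user to the nearest RIS that offers a cascaded link to a BS at `y`. -/
def offerDist (y : Plane) (w : (ι → Plane) × (ι → ℝ × ℝ)) : ENNReal :=
  ⨅ j, ⨅ _ : Offered p y (w.1 j) (w.2 j), ENNReal.ofReal ‖w.1 j‖

lemma le_offerDist_iff {y : Plane} {w : (ι → Plane) × (ι → ℝ × ℝ)} {c : ENNReal} :
    c ≤ offerDist p y w ↔ ∀ j, Offered p y (w.1 j) (w.2 j) → c ≤ ENNReal.ofReal ‖w.1 j‖ := by
  simp [offerDist]

lemma measurable_offerDist [Countable ι] :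
    Measurable fun q : Plane × ((ι → Plane) × (ι → ℝ × ℝ)) => offerDist p q.1 q.2 := by
  classical
  refine Measurable.iInf fun j => ?_
  simp_rw [iInf_eq_if]
  refine Measurable.ite ?_ (by fun_prop) measurable_const
  exact (measurableSet_offered p).preimage
    (f := fun q : Plane × ((ι → Plane) × (ι → ℝ × ℝ)) => (q.1, q.2.1 j, q.2.2 j)) (by fun_prop)

lemma offerDist_lt_top_iff {y : Plane} {w : (ι → Plane) × (ι → ℝ × ℝ)} :
    offerDist p y w < ⊤ ↔ ∃ j, Offered p y (w.1 j) (w.2 j) := by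
  simp [offerDist, iInf_lt_iff]

end Offers

/-! ### Void probabilities of the offering RISs -/

namespace Network

open Filter Topology Params

set_option linter.unusedSectionVars false

variable {Ω : Type*} [MeasurableSpace Ω] {P : Measure Ω} [IsProbabilityMeasure P] {p : Params}
  {ιb ιr : Type*} [Countable ιr] (M : Network P p ιb ιr)

/-- Positions and marks of the RISs. -/
def ris (ω : Ω) : (ιr → Plane) × (ιr → ℝ × ℝ) := (fun j => M.r j ω, fun j => M.risMark j ω)

lemma measurable_ris : Measurable M.ris := M.measurable_r.prodMk M.measurable_risMark'

lemma measureReal_offered (y z : Plane) (j : ιr) :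
    P.real {ω | Offered p y z (M.risMark j ω)} = offerProb p y z := by
  have h : IndepFun (M.X (.losR j)) (M.X (.orient j)) P := M.X_indep.indepFun (by simp)
  have h1 := h.measure_inter_preimage_eq_mul _ _ (measurableSet_Iic (a := p.probState .L ‖z‖))
    (measurableSet_frontSet_right (0 - z) (y - z))
  have e : {ω | Offered p y z (M.risMark j ω)} = M.X (.losR j) ⁻¹' Iic (p.probState .L ‖z‖) ∩
      M.X (.orient j) ⁻¹' frontSet (0 - z) (y - z) := rfl
  have hc := probState_mem p .L (norm_nonneg z)
  have h2 : P.map (M.X (.losR j)) (Iic (p.probState .L ‖z‖)) = ENNReal.ofReal (p.probState .L ‖z‖) := by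
    rw [M.X_law, markLaw, cond_apply measurableSet_Icc, show Icc (0 : ℝ) 1 ∩ Iic (p.probState .L ‖z‖) =
      Icc 0 (p.probState .L ‖z‖) by
      ext; simp only [mem_inter_iff, mem_Icc, mem_Iic]; constructor
      · rintro ⟨⟨h1, _⟩, h2⟩; exact ⟨h1, h2⟩
      · rintro ⟨h1, h2⟩; exact ⟨⟨h1, h2.trans hc.2⟩, h2⟩]
    simp
  have h3 : P.map (M.X (.orient j)) = angleLaw := M.X_law _
  rw [measureReal_def, e, h1, ENNReal.toReal_mul, ← Measure.map_apply (M.X_measurable _) measurableSet_Iic,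
    h2, ENNReal.toReal_ofReal hc.1, ← Measure.map_apply (M.X_measurable _)
      (measurableSet_frontSet_right (0 - z) (y - z)), h3]
  rfl

lemma measurableSet_le_offerDist (y : Plane) (c : ENNReal) :
    MeasurableSet {ω | c ≤ offerDist p y (M.ris ω)} := by
  have h : Measurable fun ω => offerDist p y (M.ris ω) :=
    Measurable.comp (f := fun ω => (y, M.ris ω)) (measurable_offerDist p)
      (measurable_const.prodMk M.measurable_ris)
  exact measurableSet_le measurable_const h

/-- No RIS within distance `s` offers a cascaded link. -/
lemma measureReal_le_offerDist (y : Plane) {s : ℝ} (hs : 0 ≤ s) :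
    P.real {ω | ENNReal.ofReal s ≤ offerDist p y (M.ris ω)} =
      Real.exp (-p.lamR * ∫ u in (0 : ℝ)..s, p.aBar ‖y‖ u * u) := by
  classical
  -- Thinning through the Laplace functional: the product of these zero-one factors is the indicator
  -- that no RIS within distance s offers a link, and averaging the marks leaves one minus the
  -- offering probability.
  let f : Plane → ℝ × ℝ → ℂ := fun z m => if ‖z‖ < s ∧ Offered p y z m then 0 else 1
  have hfm : Measurable (Function.uncurry f) := by
    refine Measurable.ite ?_ measurable_const measurable_const
    rw [ofPred_and]
    refine (measurableSet_lt (by fun_prop) measurable_const).inter ?_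
    exact (measurableSet_offered p).preimage
      (f := fun q : Plane × (ℝ × ℝ) => (y, q.1, q.2)) (by fun_prop)
  have hf1 : ∀ z m, ‖f z m‖ ≤ 1 := fun z m => by
    simp only [f]; split_ifs <;> simp
  have hfB : ∀ z ∉ Metric.ball (0 : Plane) s, ∀ m, f z m = 1 := fun z hz m =>
    if_neg fun q => hz (by simpa using q.1)
  let g : Plane → ℂ := fun z => 1 - (((Metric.ball (0 : Plane) s).indicator (offerProb p y) z : ℝ) : ℂ)
  have hg : Measurable g := measurable_const.sub (Complex.measurable_ofReal.comp
    ((measurable_offerProb p y).indicator measurableSet_ball))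
  have hfg : ∀ z k, ∫ ω, f z (M.risMark k ω) ∂P = g z := by
    intro z k
    by_cases hz : ‖z‖ < s
    · have hm : MeasurableSet {ω | Offered p y z (M.risMark k ω)} :=
        (measurableSet_offered p).preimage (f := fun ω => (y, z, M.risMark k ω))
          (measurable_const.prodMk (measurable_const.prodMk (M.measurable_risMark k)))
      have e : ∀ ω, f z (M.risMark k ω) =
          ((1 - {ω | Offered p y z (M.risMark k ω)}.indicator 1 ω : ℝ) : ℂ) := fun ω => by
        by_cases ho : Offered p y z (M.risMark k ω)
        · rw [indicator_of_mem (by exact ho)]; simp [f, hz, ho]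
        · rw [indicator_of_notMem (by exact ho)]; simp [f, hz, ho]
      have hi : Integrable ({ω | Offered p y z (M.risMark k ω)}.indicator (1 : Ω → ℝ)) P :=
        (integrable_const (1 : ℝ)).indicator hm
      simp_rw [e]
      rw [integral_complex_ofReal, integral_sub (integrable_const _) hi, integral_indicator_one hm, M.measureReal_offered]
      simp only [g]
      rw [indicator_of_mem (by simpa using hz)]
      simp
    · simp only [f, g]
      rw [indicator_of_notMem (by simpa using hz)]
      simp [hz]
  have hgB : ∀ z ∉ Metric.ball (0 : Plane) s, g z = 1 := fun z hz => by
    simp only [g]; rw [indicator_of_notMem hz]; simp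
  have hg1 : ∀ z, ‖g z‖ ≤ 1 := fun z => by
    by_cases hz : z ∈ Metric.ball (0 : Plane) s
    · simp only [g]
      rw [indicator_of_mem hz, ← Complex.ofReal_one, ← Complex.ofReal_sub, Complex.norm_real,
        Real.norm_of_nonneg (by linarith [(offerProb_mem p y z).2])]
      linarith [(offerProb_mem p y z).1]
    · rw [hgB z hz]; simp
  have hball : homog p.lamR (Metric.ball (0 : Plane) s) ≠ ⊤ :=
    ne_top_of_le_ne_top (homog_closedBall_ne_top p.lamR s) (measure_mono Metric.ball_subset_closedBall)
  have key := IsPoissonProcess.integral_finprod_marks (Λ := homog p.lamR) M.r_poisson M.measurable_risMark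
    M.indepFun_r_risMark M.iIndepFun_risMark hfm hf1 measurableSet_ball hball hfB hg hfg hgB hg1
  have e1 : ∫ z, (g z - 1) ∂(homog p.lamR) =
      ((-p.lamR * ∫ u in (0 : ℝ)..s, p.aBar ‖y‖ u * u : ℝ) : ℂ) := by
    rw [← integral_offerProb p y hs, homog, integral_smul_measure, ENNReal.toReal_ofReal (lamR_nonneg p)]
    have : ∀ z, g z - 1 = (((-(Metric.ball (0 : Plane) s).indicator (offerProb p y) z) : ℝ) : ℂ) := fun z => by
      simp only [g]; push_cast; ring
    simp_rw [this]
    rw [integral_complex_ofReal, integral_neg]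
    simp
  have e2 : ∫ ω, ∏ᶠ k, f (M.r k ω) (M.risMark k ω) ∂P =
      ((P.real {ω | ENNReal.ofReal s ≤ offerDist p y (M.ris ω)} : ℝ) : ℂ) := by
    rw [← integral_indicator_one (M.measurableSet_le_offerDist y _), ← integral_complex_ofReal]
    refine integral_congr_ae ?_
    have hlf := IsPoissonProcess.ae_locallyFinite (lam := p.lamR) M.r_poisson
    filter_upwards [hlf] with ω hω
    have hfin : ∀ i ∉ {i | ‖M.r i ω‖ ≤ s}, f (M.r i ω) (M.risMark i ω) = 1 := fun i hi =>
      if_neg fun q => hi q.1.le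
    rw [finprod_eq_prod_toFinset (hω s) hfin]
    by_cases h : ENNReal.ofReal s ≤ offerDist p y (M.ris ω)
    · rw [indicator_of_mem (by exact h)]
      rw [Finset.prod_eq_one]
      · simp
      · intro k _
        refine if_neg fun q => ?_
        have := (le_offerDist_iff p).1 h k q.2
        rw [ENNReal.ofReal_le_ofReal_iff (norm_nonneg _)] at this
        exact absurd q.1 (not_lt.2 this)
    · rw [indicator_of_notMem (by exact h)]
      rw [le_offerDist_iff] at h
      push Not at h
      obtain ⟨k, hk, hks⟩ := h
      have hks' : ‖M.r k ω‖ < s := (ENNReal.ofReal_lt_ofReal_iff_of_nonneg (norm_nonneg _)).1 hks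
      rw [Finset.prod_eq_zero (i := k)]
      · simp
      · simpa using hks'.le
      · exact if_pos ⟨hks', hk⟩
  rw [e1, e2, ← Complex.ofReal_exp] at key
  exact_mod_cast key

end Network

end

end RisNet

namespace RisNet
noncomputable section

/-! ### The defective density of the distance of the serving RIS -/

section OfferRate

open Filter Topology Params

/-- Tails are only known at positive levels: at 0 the RIS distance also carries the atom standing
for the absence of an offer. Exhausting the half-line by closed rays recovers the total mass. -/
lemma ext_of_Ici_of_pos {μ ν : Measure ℝ} [IsFiniteMeasure μ] (hμ : μ (Iic 0) = 0) (hν : ν (Iic 0) = 0)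
    (h : ∀ a, 0 < a → μ (Ici a) = ν (Ici a)) : μ = ν := by
  have hu : Ioi (0 : ℝ) = ⋃ n : ℕ, Ici (1 / ((n : ℝ) + 1)) := by
    ext x
    simp only [mem_Ioi, mem_iUnion, mem_Ici]
    exact ⟨fun hx => (exists_nat_one_div_lt hx).imp fun n hn => hn.le,
      fun ⟨n, hn⟩ => (Nat.one_div_pos_of_nat (n := n)).trans_le hn⟩
  have hmono : Monotone fun n : ℕ => Ici (1 / ((n : ℝ) + 1)) := fun m n hmn =>
    Ici_subset_Ici.2 (Nat.one_div_le_one_div hmn)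
  have h0 : μ (Ioi 0) = ν (Ioi 0) := by
    rw [hu, hmono.measure_iUnion, hmono.measure_iUnion]
    exact iSup_congr fun n => h _ Nat.one_div_pos_of_nat
  refine Measure.ext_of_Ici _ _ fun a => ?_
  rcases lt_or_ge 0 a with ha | ha
  · exact h a ha
  · have key : ∀ m : Measure ℝ, m (Iic 0) = 0 → m (Ici a) = m (Ioi 0) := fun m hm => by
      refine le_antisymm ?_ (measure_mono fun x hx => ha.trans (le_of_lt hx))
      calc m (Ici a) ≤ m (Iic 0 ∪ Ioi 0) := measure_mono (by simp)
        _ ≤ m (Iic 0) + m (Ioi 0) := measure_union_le _ _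
        _ = m (Ioi 0) := by rw [hm, zero_add]
    rw [key μ hμ, key ν hν, h0]

variable (p : Params)

lemma aBar_eq (t s : ℝ) : p.aBar t s = p.probState .L s * ∫ th in (-Real.pi)..Real.pi, probRefl t s th := by
  rw [aBar, intervalIntegral.integral_const_mul]

lemma measurable_probRefl_right (t s : ℝ) : Measurable (probRefl t s) :=
  Measurable.comp (f := fun th => (s, th)) (measurable_probRefl t) (by fun_prop)

lemma norm_probRefl_le (t s th : ℝ) : ‖probRefl t s th‖ ≤ 1 := by
  rw [Real.norm_of_nonneg (probRefl_mem t s th).1]; exact (probRefl_mem t s th).2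

/-- The denominator squared is (s − t cos θ)² + (t sin θ)², which vanishes for some s only if sin θ
= 0. So for almost every θ the integrand is continuous in s, and it is bounded by 1. -/
lemma continuous_integral_probRefl {t : ℝ} (ht : 0 < t) :
    Continuous fun s => ∫ th in (-Real.pi)..Real.pi, probRefl t s th := by
  have hpi := Real.pi_pos
  refine intervalIntegral.continuous_of_dominated_interval (bound := fun _ => 1)
    (fun s => (measurable_probRefl_right t s).aestronglyMeasurable)
    (fun s => Eventually.of_forall fun th _ => norm_probRefl_le t s th) (by simp) ?_
  have h1 : ∀ᵐ th : ℝ, th ≠ 0 := by rw [ae_iff]; simp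
  have h2 : ∀ᵐ th : ℝ, th ≠ Real.pi := by rw [ae_iff]; simp
  filter_upwards [h1, h2] with th hth0 hthpi hth
  rw [uIoc_of_le (by linarith)] at hth
  have hs : Real.sin th ≠ 0 := fun h =>
    hth0 ((Real.sin_eq_zero_iff_of_lt_of_lt hth.1 (lt_of_le_of_ne hth.2 hthpi)).1 h)
  have hpos : ∀ s : ℝ, 0 < t ^ 2 + s ^ 2 - 2 * t * s * Real.cos th := fun s => by
    have h3 : t ^ 2 + s ^ 2 - 2 * t * s * Real.cos th =
        (s - t * Real.cos th) ^ 2 + (t * Real.sin th) ^ 2 := by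
      have := Real.sin_sq_add_cos_sq th
      linear_combination (-t ^ 2) * this
    rw [h3]
    have : 0 < (t * Real.sin th) ^ 2 := by positivity
    positivity
  unfold probRefl
  refine continuous_const.sub (continuous_const.mul (Real.continuous_arccos.comp ?_))
  exact Continuous.div (by fun_prop) (by fun_prop) fun s => (Real.sqrt_pos.2 (hpos s)).ne'

lemma continuous_aBar {t : ℝ} (ht : 0 < t) : Continuous fun s => p.aBar t s := by
  simp_rw [aBar_eq]
  exact (continuous_probState p .L).mul (continuous_integral_probRefl ht)

lemma aBar_nonneg {s : ℝ} (hs : 0 ≤ s) (t : ℝ) : 0 ≤ p.aBar t s := by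
  rw [aBar_eq]
  exact mul_nonneg (probState_mem p .L hs).1 (intervalIntegral.integral_nonneg
    (by linarith [Real.pi_pos]) fun th _ => (probRefl_mem t s th).1)

lemma aBar_le {s : ℝ} (hs : 0 ≤ s) (t : ℝ) : p.aBar t s ≤ 2 * Real.pi * Real.exp (-p.beta * s) := by
  rw [aBar_eq]
  have h : ‖∫ th in (-Real.pi)..Real.pi, probRefl t s th‖ ≤ 1 * |Real.pi - -Real.pi| :=
    intervalIntegral.norm_integral_le_of_norm_le_const fun th _ => norm_probRefl_le t s th
  rw [one_mul, sub_neg_eq_add, ← two_mul, abs_of_pos (by positivity)] at h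
  have h2 := (le_abs_self _).trans h
  rw [mul_comm]
  exact mul_le_mul_of_nonneg_right h2 (probState_mem p .L hs).1

lemma integrableOn_aBar {t : ℝ} (ht : 0 < t) : IntegrableOn (fun s => p.aBar t s * s) (Ioi 0) := by
  have h : IntegrableOn (fun s : ℝ => s ^ (1 : ℝ) * Real.exp (-p.beta * s ^ (1 : ℝ))) (Ioi 0) :=
    integrableOn_rpow_mul_exp_neg_mul_rpow (by norm_num) zero_lt_one (beta_pos p)
  refine Integrable.mono' (Integrable.const_mul h (2 * Real.pi))
    ((continuous_aBar p ht).mul continuous_id).aestronglyMeasurable ?_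
  refine (ae_restrict_iff' measurableSet_Ioi).2 (Eventually.of_forall fun s hs => ?_)
  have hs0 : (0 : ℝ) ≤ s := le_of_lt hs
  rw [Real.norm_of_nonneg (mul_nonneg (aBar_nonneg p hs0 t) hs0), Real.rpow_one]
  calc p.aBar t s * s ≤ 2 * Real.pi * Real.exp (-p.beta * s) * s := by
        gcongr; exact aBar_le p hs0 t
    _ = _ := by ring

/-- Density of the distance of the nearest RIS that offers a cascaded link (a defective law). -/
def offerDensity (t s : ℝ) : ℝ :=
  p.lamR * s * p.aBar t s * Real.exp (-p.lamR * ∫ u in (0 : ℝ)..s, p.aBar t u * u)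

lemma offerDensity_nonneg {s : ℝ} (hs : 0 ≤ s) (t : ℝ) : 0 ≤ offerDensity p t s :=
  mul_nonneg (mul_nonneg (mul_nonneg (lamR_nonneg p) hs) (aBar_nonneg p hs t)) (Real.exp_pos _).le

lemma hasDerivAt_offerDensity {t : ℝ} (ht : 0 < t) (s : ℝ) :
    HasDerivAt (fun s => -Real.exp (-p.lamR * ∫ u in (0 : ℝ)..s, p.aBar t u * u)) (offerDensity p t s) s := by
  have hc : Continuous fun u => p.aBar t u * u := (continuous_aBar p ht).mul continuous_id
  have h1 := hc.integral_hasStrictDerivAt 0 s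
  exact ((h1.hasDerivAt.const_mul (-p.lamR)).exp.neg).congr_deriv (by rw [offerDensity]; ring)

lemma continuous_offerDensity {t : ℝ} (ht : 0 < t) : Continuous (offerDensity p t) := by
  have hc : Continuous fun u => p.aBar t u * u := (continuous_aBar p ht).mul continuous_id
  have h1 : Continuous fun s => ∫ u in (0 : ℝ)..s, p.aBar t u * u :=
    continuous_iff_continuousAt.2 fun s => (hc.integral_hasStrictDerivAt 0 s).hasDerivAt.continuousAt
  have := continuous_aBar p ht
  unfold offerDensity
  fun_prop

lemma tendsto_exp_aBar {t : ℝ} (ht : 0 < t) :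
    Tendsto (fun s => Real.exp (-p.lamR * ∫ u in (0 : ℝ)..s, p.aBar t u * u)) atTop
      (𝓝 (1 - p.probCL t)) := by
  have h := intervalIntegral_tendsto_integral_Ioi 0 (integrableOn_aBar p ht) tendsto_id
  rw [probCL, sub_sub_cancel]
  exact (Real.continuous_exp.tendsto _).comp (h.const_mul _)

/-- The density is nonnegative and the derivative of a function with a finite limit at infinity; no
estimate of its size is needed. -/
lemma integrableOn_offerDensity {t : ℝ} (ht : 0 < t) {a : ℝ} (ha : 0 ≤ a) :
    IntegrableOn (offerDensity p t) (Ioi a) :=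
  integrableOn_Ioi_deriv_of_nonneg (hasDerivAt_offerDensity p ht a).continuousAt.continuousWithinAt
    (fun s _ => hasDerivAt_offerDensity p ht s)
    (fun _ hs => offerDensity_nonneg p (ha.trans (le_of_lt hs)) t) (tendsto_exp_aBar p ht).neg

lemma integral_offerDensity {t : ℝ} (ht : 0 < t) {a : ℝ} (ha : 0 ≤ a) :
    ∫ s in Ioi a, offerDensity p t s =
      Real.exp (-p.lamR * ∫ u in (0 : ℝ)..a, p.aBar t u * u) - (1 - p.probCL t) := by
  rw [integral_Ioi_of_hasDerivAt_of_nonneg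
    (hasDerivAt_offerDensity p ht a).continuousAt.continuousWithinAt
    (fun s _ => hasDerivAt_offerDensity p ht s)
    (fun _ hs => offerDensity_nonneg p (ha.trans (le_of_lt hs)) t) (tendsto_exp_aBar p ht).neg]
  ring

lemma probCL_mem {t : ℝ} : p.probCL t ∈ Icc (0 : ℝ) 1 := by
  rw [probCL]
  have h0 : 0 ≤ ∫ s in Ioi (0 : ℝ), p.aBar t s * s :=
    setIntegral_nonneg measurableSet_Ioi fun s hs => mul_nonneg (aBar_nonneg p (le_of_lt hs) t) (le_of_lt hs)
  have h1 : Real.exp (-p.lamR * ∫ s in Ioi (0 : ℝ), p.aBar t s * s) ≤ 1 :=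
    Real.exp_le_one_iff.2 (mul_nonpos_of_nonpos_of_nonneg (neg_nonpos.2 (lamR_nonneg p)) h0)
  exact ⟨by linarith, by linarith [Real.exp_pos (-p.lamR * ∫ s in Ioi (0 : ℝ), p.aBar t s * s)]⟩

/-- If 𝒫_CL vanishes, the quotient defining the conditional density is void. But the total integral
of the defective density is 𝒫_CL, so that density is then zero almost everywhere and the identity
persists; this covers λ_r = 0. -/
lemma probCL_mul_pdfRU {t : ℝ} (ht : 0 < t) :
    ∀ᵐ s ∂volume.restrict (Ioi (0 : ℝ)), p.probCL t * p.pdfRU t s = offerDensity p t s := by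
  by_cases h : p.probCL t = 0
  · have h1 := integral_offerDensity p ht le_rfl
    rw [intervalIntegral.integral_same, mul_zero, Real.exp_zero, h, sub_zero, sub_self] at h1
    have h2 := (setIntegral_eq_zero_iff_of_nonneg_ae ((ae_restrict_iff' measurableSet_Ioi).2
      (Eventually.of_forall fun s hs => offerDensity_nonneg p (le_of_lt hs) t))
      (integrableOn_offerDensity p ht le_rfl)).1 h1
    filter_upwards [h2] with s hs
    rw [h, zero_mul, hs]; rfl
  · refine Eventually.of_forall fun s => ?_
    rw [pdfRU, mul_div_cancel₀ _ h, offerDensity]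

end OfferRate

/-! ### Law of the distance of the nearest offering RIS -/

namespace Network

open Filter Topology Params

set_option linter.unusedSectionVars false

variable {Ω : Type*} [MeasurableSpace Ω] {P : Measure Ω} [IsProbabilityMeasure P] {p : Params}
  {ιb ιr : Type*} [Countable ιr] (M : Network P p ιb ιr)

/-- Distance of the nearest RIS that offers a cascaded link to a BS at `y` (zero if there is none). -/
def risDist (y : Plane) (ω : Ω) : ℝ := (offerDist p y (M.ris ω)).toReal

lemma measurable_risDist : Measurable fun q : Plane × Ω => M.risDist q.1 q.2 :=
  (Measurable.comp (f := fun q : Plane × Ω => (q.1, M.ris q.2)) (measurable_offerDist p)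
    (measurable_fst.prodMk (M.measurable_ris.comp measurable_snd))).ennreal_toReal

lemma measurable_risDist_right (y : Plane) : Measurable (M.risDist y) :=
  Measurable.comp (f := fun ω => (y, ω)) M.measurable_risDist (by fun_prop)

/-- The absence of any offer is the decreasing limit of its absence within distance n, whose
probability is explicit. -/
lemma measureReal_offerDist_eq_top {y : Plane} (hy : y ≠ 0) :
    P.real {ω | offerDist p y (M.ris ω) = ⊤} = 1 - p.probCL ‖y‖ := by
  have e : {ω | offerDist p y (M.ris ω) = ⊤} =
      ⋂ n : ℕ, {ω | ENNReal.ofReal n ≤ offerDist p y (M.ris ω)} := by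
    ext ω
    simp only [mem_ofPred_eq, mem_iInter, ENNReal.ofReal_natCast]
    refine ⟨fun h n => h ▸ le_top, fun h => ?_⟩
    by_contra hne
    obtain ⟨n, hn⟩ := ENNReal.exists_nat_gt hne
    exact absurd (h n) (not_le.2 hn)
  have hanti : Antitone fun n : ℕ => {ω | ENNReal.ofReal n ≤ offerDist p y (M.ris ω)} :=
    fun m n hmn ω h => (ENNReal.ofReal_le_ofReal (by exact_mod_cast hmn)).trans h
  have h1 : Tendsto (fun n : ℕ => P.real {ω | ENNReal.ofReal n ≤ offerDist p y (M.ris ω)}) atTop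
      (𝓝 (P.real {ω | offerDist p y (M.ris ω) = ⊤})) := by
    rw [e]
    exact (ENNReal.tendsto_toReal (measure_ne_top _ _)).comp (tendsto_measure_iInter_atTop
      (fun n => (M.measurableSet_le_offerDist y _).nullMeasurableSet) hanti ⟨0, measure_ne_top _ _⟩)
  simp_rw [fun n : ℕ => M.measureReal_le_offerDist y (Nat.cast_nonneg n)] at h1
  exact tendsto_nhds_unique h1 ((tendsto_exp_aBar p (norm_pos_iff.2 hy)).comp tendsto_natCast_atTop_atTop)

lemma measureReal_le_risDist {y : Plane} (hy : y ≠ 0) {a : ℝ} (ha : 0 < a) :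
    P.real {ω | a ≤ M.risDist y ω} =
      Real.exp (-p.lamR * ∫ u in (0 : ℝ)..a, p.aBar ‖y‖ u * u) - (1 - p.probCL ‖y‖) := by
  have e : {ω | a ≤ M.risDist y ω} = {ω | ENNReal.ofReal a ≤ offerDist p y (M.ris ω)} \
      {ω | offerDist p y (M.ris ω) = ⊤} := by
    ext ω
    simp only [mem_ofPred_eq, Set.mem_sdiff, risDist]
    by_cases h : offerDist p y (M.ris ω) = ⊤
    · simp [h, ha]
    · simp [h, ENNReal.ofReal_le_iff_le_toReal h]
  rw [e, measureReal_sdiff (fun ω h => by rw [mem_ofPred_eq] at h ⊢; rw [h]; exact le_top),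
    M.measureReal_le_offerDist y ha.le, M.measureReal_offerDist_eq_top hy]
  have := M.measurableSet_le_offerDist y ⊤
  simpa only [top_le_iff] using this

/-- Restricting to positive distances discards the atom at 0; on the rest both measures have the
same tails. -/
lemma map_risDist_restrict {y : Plane} (hy : y ≠ 0) :
    (P.map (M.risDist y)).restrict (Ioi 0) =
      (volume.restrict (Ioi 0)).withDensity fun s => ENNReal.ofReal (offerDensity p ‖y‖ s) := by
  have ht := norm_pos_iff.2 hy
  have hm := M.measurable_risDist_right y
  have : IsProbabilityMeasure (P.map (M.risDist y)) := Measure.isProbabilityMeasure_map hm.aemeasurable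
  refine ext_of_Ici_of_pos ?_ ?_ fun a ha => ?_
  · rw [Measure.restrict_apply measurableSet_Iic, Iic_inter_Ioi, Ioc_self, measure_empty]
  · rw [withDensity_apply _ measurableSet_Iic, Measure.restrict_restrict measurableSet_Iic,
      Iic_inter_Ioi, Ioc_self, Measure.restrict_empty, lintegral_zero_measure]
  · have hs : Ici a ∩ Ioi 0 = Ici a := inter_eq_left.2 fun x hx => ha.trans_le hx
    rw [Measure.restrict_apply measurableSet_Ici, hs, withDensity_apply _ measurableSet_Ici,
      Measure.restrict_restrict measurableSet_Ici, hs, Measure.map_apply hm measurableSet_Ici,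
      setLIntegral_congr Ioi_ae_eq_Ici.symm, ← ofReal_integral_eq_lintegral_ofReal
        (integrableOn_offerDensity p ht ha.le), integral_offerDensity p ht ha.le,
      ← M.measureReal_le_risDist hy ha, ofReal_measureReal]
    · rfl
    · exact (ae_restrict_iff' measurableSet_Ioi).2
        (Eventually.of_forall fun s hs => offerDensity_nonneg p (ha.le.trans (le_of_lt hs)) _)

/-- Isotropy: the tails at positive levels involve the BS position only through its norm, and at
other levels they are trivial. -/
lemma map_risDist_congr {y y' : Plane} (hy : y ≠ 0) (h : ‖y‖ = ‖y'‖) :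
    P.map (M.risDist y) = P.map (M.risDist y') := by
  have hy' : y' ≠ 0 := norm_pos_iff.1 (h ▸ norm_pos_iff.2 hy)
  have hm := M.measurable_risDist_right y
  have hm' := M.measurable_risDist_right y'
  have : IsProbabilityMeasure (P.map (M.risDist y)) := Measure.isProbabilityMeasure_map hm.aemeasurable
  refine Measure.ext_of_Ici _ _ fun a => ?_
  rw [Measure.map_apply hm measurableSet_Ici, Measure.map_apply hm' measurableSet_Ici]
  rcases lt_or_ge 0 a with ha | ha
  · rw [← measureReal_eq_measureReal_iff]
    change P.real {ω | a ≤ M.risDist y ω} = P.real {ω | a ≤ M.risDist y' ω}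
    rw [M.measureReal_le_risDist hy ha, M.measureReal_le_risDist hy' ha, h]
  · have hu : ∀ z, M.risDist z ⁻¹' Ici a = univ := fun z =>
      eq_univ_of_forall fun ω => ha.trans ENNReal.toReal_nonneg
    rw [hu, hu]

end Network

end

end RisNet

namespace RisNet
noncomputable section

lemma measurable_of_eq_on_cover {Ω E ι : Type*} [MeasurableSpace Ω] [MeasurableSpace E] [Countable ι]
    {S : ι → Set Ω} (hS : ∀ i, MeasurableSet (S i)) {f : ι → Ω → E} (hf : ∀ i, Measurable (f i))
    {g : Ω → E} {c : E} (h1 : ∀ i, ∀ ω ∈ S i, g ω = f i ω) (h2 : ∀ ω, (∀ i, ω ∉ S i) → g ω = c) :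
    Measurable g := by
  intro A hA
  have : g ⁻¹' A = (⋃ i, S i ∩ f i ⁻¹' A) ∪ ((⋃ i, S i)ᶜ ∩ {_ω | c ∈ A}) := by
    ext ω
    by_cases h : ∃ i, ω ∈ S i
    · obtain ⟨i, hi⟩ := h
      have hn : ω ∉ (⋃ i, S i)ᶜ := fun q => q (mem_iUnion.2 ⟨i, hi⟩)
      simp only [mem_preimage, mem_union, mem_iUnion, mem_inter_iff, hn, false_and, or_false]
      constructor
      · exact fun h => ⟨i, hi, by rwa [← h1 i ω hi]⟩
      · rintro ⟨j, hj, h⟩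
        rwa [h1 j ω hj]
    · push Not at h
      have hn : ω ∈ (⋃ i, S i)ᶜ := by simpa using h
      simp only [mem_preimage, h2 ω h, mem_union, mem_iUnion, mem_inter_iff, h, false_and,
        exists_false, false_or, hn, true_and, mem_ofPred_eq]
  rw [this]
  exact (MeasurableSet.iUnion fun i => (hS i).inter (hf i hA)).union
    ((MeasurableSet.iUnion hS).compl.inter (MeasurableSet.const _))

/-! ### Measurability of the serving distances; the link type -/

namespace Network

open Filter Topology Params

set_option linter.unusedSectionVars false

variable {Ω : Type*} [MeasurableSpace Ω] {P : Measure Ω} [IsProbabilityMeasure P] {p : Params}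
  {ιb ιr : Type*} [Countable ιb] [Countable ιr] (M : Network P p ιb ιr)

lemma measurable_b0 : Measurable M.b0 := measurable_nearestPos.comp M.measurable_b

lemma offers_iff (j : ιr) (ω : Ω) :
    M.Offers j ω ↔ Offered p (M.b0 ω) ((M.ris ω).1 j) ((M.ris ω).2 j) := Iff.rfl

lemma measurableSet_offers (j : ιr) : MeasurableSet {ω | M.Offers j ω} :=
  (measurableSet_offered p).preimage (f := fun ω => (M.b0 ω, M.r j ω, M.risMark j ω))
    (M.measurable_b0.prodMk ((M.r_poisson.1 j).prodMk (M.measurable_risMark j)))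

lemma measurableSet_isServingRIS (j : ιr) : MeasurableSet {ω | M.IsServingRIS j ω} := by
  have : {ω | M.IsServingRIS j ω} = {ω | M.Offers j ω} ∩ ⋂ k, ⋂ (_ : k ≠ j),
      ({ω | M.Offers k ω}ᶜ ∪ {ω | ‖M.r j ω‖ < ‖M.r k ω‖}) := by
    ext ω
    simp only [IsServingRIS, mem_ofPred_eq, mem_inter_iff, mem_iInter, mem_union, mem_compl_iff,
      imp_iff_not_or]
  rw [this]
  exact (M.measurableSet_offers j).inter (MeasurableSet.iInter fun k => MeasurableSet.iInter fun _ =>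
    (M.measurableSet_offers k).compl.union
      (measurableSet_lt (M.r_poisson.1 j).norm (M.r_poisson.1 k).norm))

lemma tRU_eq_of_isServingRIS {j : ιr} {ω : Ω} (h : M.IsServingRIS j ω) : M.tRU ω = ‖M.r j ω‖ := by
  have hex : ∃ j, M.IsServingRIS j ω := ⟨j, h⟩
  have hj : hex.choose = j := by
    by_contra hne
    exact lt_asymm (hex.choose_spec.2 j (Ne.symm hne) h.1) (h.2 _ hne hex.choose_spec.1)
  rw [tRU, dif_pos hex, hj]

lemma tRU_eq_zero {ω : Ω} (h : ∀ j, ¬ M.IsServingRIS j ω) : M.tRU ω = 0 :=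
  dif_neg fun ⟨j, hj⟩ => h j hj

lemma measurable_tRU : Measurable M.tRU :=
  measurable_of_eq_on_cover M.measurableSet_isServingRIS (fun j => (M.r_poisson.1 j).norm)
    (fun _ _ h => M.tRU_eq_of_isServingRIS h) fun _ h => M.tRU_eq_zero h

/-- The primary distances of the network and the angle of the cascaded link. -/
def geom (ω : Ω) : ℝ × ℝ × ℝ := (M.tBU ω, M.tRU ω, M.X .angle ω)

lemma measurable_geom : Measurable M.geom :=
  M.measurable_tBU.prodMk (M.measurable_tRU.prodMk (M.X_measurable _))

lemma offerDist_eq_of_isServingRIS {j : ιr} {ω : Ω} (h : M.IsServingRIS j ω) :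
    offerDist p (M.b0 ω) (M.ris ω) = ENNReal.ofReal ‖M.r j ω‖ := by
  refine le_antisymm (iInf₂_le j ((M.offers_iff j ω).1 h.1)) ((le_offerDist_iff p).2 fun k hk => ?_)
  by_cases hkj : k = j
  · rw [hkj]; exact le_rfl
  · exact ENNReal.ofReal_le_ofReal (h.2 k hkj ((M.offers_iff k ω).2 hk)).le

/-- Local finiteness gives a nearest offering RIS, and almost sure distinctness of the norms makes
it strictly nearest. -/
lemma ae_exists_isServingRIS : ∀ᵐ ω ∂P, (∃ j, M.Offers j ω) → ∃ j, M.IsServingRIS j ω := by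
  filter_upwards [IsPoissonProcess.ae_locallyFinite (lam := p.lamR) M.r_poisson,
    IsPoissonProcess.ae_injective_norm (lam := p.lamR) (lamR_nonneg p) M.r_poisson] with ω h1 h2 ⟨j, hj⟩
  have hfin : {k | M.Offers k ω ∧ ‖M.r k ω‖ ≤ ‖M.r j ω‖}.Finite :=
    (h1 ‖M.r j ω‖).subset fun k hk => hk.2
  obtain ⟨i, hi, hmin⟩ := Set.exists_min_image _ (fun k => ‖M.r k ω‖) hfin ⟨j, hj, le_rfl⟩
  refine ⟨i, hi.1, fun k hk hko => ?_⟩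
  rcases le_or_gt ‖M.r k ω‖ ‖M.r j ω‖ with h | h
  · exact lt_of_le_of_ne (hmin k ⟨hko, h⟩) fun he => hk (h2 i k he).symm
  · exact hi.2.trans_lt h

lemma ae_tRU_eq : ∀ᵐ ω ∂P, M.tRU ω = M.risDist (M.b0 ω) ω := by
  filter_upwards [M.ae_exists_isServingRIS] with ω h
  by_cases ho : ∃ j, M.Offers j ω
  · obtain ⟨j, hj⟩ := h ho
    rw [M.tRU_eq_of_isServingRIS hj, risDist, M.offerDist_eq_of_isServingRIS hj,
      ENNReal.toReal_ofReal (norm_nonneg _)]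
  · have h1 : ¬ offerDist p (M.b0 ω) (M.ris ω) < ⊤ := fun q => ho ((offerDist_lt_top_iff p).1 q)
    rw [M.tRU_eq_zero fun j hj => ho ⟨j, hj.1⟩, risDist, not_lt_top_iff.1 h1, ENNReal.toReal_top]

/-- No RIS sits at the origin, so the default value 0 of the distance unambiguously marks the
absence of an offer. -/
lemma ae_exists_offers_iff : ∀ᵐ ω ∂P, (∃ j, M.Offers j ω) ↔ 0 < M.tRU ω := by
  filter_upwards [M.ae_exists_isServingRIS, IsPoissonProcess.ae_ne_zero (lam := p.lamR) M.r_poisson]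
    with ω h h0
  constructor
  · intro ho
    obtain ⟨j, hj⟩ := h ho
    rw [M.tRU_eq_of_isServingRIS hj]
    exact norm_pos_iff.2 (h0 j)
  · intro hpos
    by_contra ho
    rw [M.tRU_eq_zero fun j hj => ho ⟨j, hj.1⟩] at hpos
    exact lt_irrefl _ hpos

/-- State of the tagged link for each type of the serving link. -/
def tagOf : Serving → LinkState
  | .DL => .L
  | .CL => .N
  | .DN => .N

/-- Values of the RIS-user distance for each type of the serving link. -/
def rangeRU : Serving → Set ℝ
  | .DL => univ
  | .CL => Ioi 0
  | .DN => (Ioi 0)ᶜ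

lemma measurableSet_rangeRU (q : Serving) : MeasurableSet (rangeRU q) := by
  cases q
  exacts [MeasurableSet.univ, measurableSet_Ioi, measurableSet_Ioi.compl]

lemma ae_tagState_N_iff : ∀ᵐ ω ∂P, M.TagState .N ω ↔ ¬ M.TagState .L ω := by
  filter_upwards [M.b_poisson.ae_exists_isNearest p.lamB_pos] with ω ⟨i, hi⟩
  rw [M.tagState_iff hi, M.tagState_iff hi]
  rfl

/-- The link type becomes a condition on the tagged state together with a condition on the RIS
distance, which live on independent sides once the BS distance is fixed. -/
lemma ae_link_eq_iff : ∀ᵐ ω ∂P, ∀ q, M.link ω = q ↔ M.TagState (tagOf q) ω ∧ M.tRU ω ∈ rangeRU q := by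
  filter_upwards [M.ae_exists_offers_iff, M.ae_tagState_N_iff] with ω h1 h2 q
  have hl : M.link ω = open Classical in if M.TagState .L ω then Serving.DL
    else if ∃ j, M.Offers j ω then .CL else .DN := rfl
  rw [hl, h1]
  by_cases hL : M.TagState .L ω <;> by_cases ht : 0 < M.tRU ω <;> cases q <;>
    simp [hL, h2, ht, tagOf, rangeRU]
  all_goals exact not_lt.1 ht

lemma measurableSet_link (q : Serving) : MeasurableSet {ω | M.link ω = q} := by
  have hL := M.measurableSet_tagState .L
  have hC : MeasurableSet {ω | ∃ j, M.Offers j ω} := by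
    have : {ω | ∃ j, M.Offers j ω} = ⋃ j, {ω | M.Offers j ω} := by ext; simp
    rw [this]; exact MeasurableSet.iUnion M.measurableSet_offers
  have hl : ∀ ω, M.link ω = open Classical in if M.TagState .L ω then Serving.DL
    else if ∃ j, M.Offers j ω then .CL else .DN := fun _ => rfl
  cases q
  · convert hL using 1
    ext ω
    rw [mem_ofPred_eq, mem_ofPred_eq, hl]
    split_ifs <;> simp_all
  · convert hL.compl.inter hC using 1
    ext ω
    rw [mem_ofPred_eq, mem_inter_iff, mem_compl_iff, mem_ofPred_eq, mem_ofPred_eq, hl]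
    split_ifs <;> simp_all
  · convert hL.compl.inter hC.compl using 1
    ext ω
    rw [mem_ofPred_eq, mem_inter_iff, mem_compl_iff, mem_compl_iff, mem_ofPred_eq, mem_ofPred_eq, hl]
    split_ifs <;> simp_all

/-- At angle 0 the BS–RIS distance could vanish and the cascaded mean power degenerate; away from
it, positivity follows from t² + s² − 2ts cos θ = (t − s)² + 2ts(1 − cos θ). -/
lemma ae_angle_ne_zero : ∀ᵐ ω ∂P, M.X .angle ω ∈ Ioo (-Real.pi) Real.pi ∧ M.X .angle ω ≠ 0 := by
  have hpi := Real.pi_pos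
  have h0 : ∀ᵐ a ∂(volume.restrict (Ioo (-Real.pi) Real.pi)), a ∈ Ioo (-Real.pi) Real.pi ∧ a ≠ 0 := by
    filter_upwards [ae_restrict_mem measurableSet_Ioo,
      ae_restrict_of_ae (show ∀ᵐ a : ℝ, a ≠ 0 by rw [ae_iff]; simp)] with a h1 h2 using ⟨h1, h2⟩
  have h1 : ∀ᵐ a ∂(P.map (M.X .angle)), a ∈ Ioo (-Real.pi) Real.pi ∧ a ≠ 0 := by
    rw [M.X_law, markLaw, ProbabilityTheory.cond]
    exact Measure.ae_smul_measure h0 _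
  exact ae_of_ae_map (M.X_measurable _).aemeasurable h1

lemma distBR_pos {t s th : ℝ} (ht : 0 < t) (hs : 0 < s) (hth : th ∈ Ioo (-Real.pi) Real.pi) (h0 : th ≠ 0) :
    0 < distBR t s th := by
  have hc : Real.cos th < 1 := by
    refine lt_of_le_of_ne (Real.cos_le_one _) fun h => h0 ?_
    have h2 := Real.pi_pos
    exact (Real.cos_eq_one_iff_of_lt_of_lt (by linarith [hth.1]) (by linarith [hth.2])).1 h
  refine Real.sqrt_pos.2 ?_
  have h1 : 0 < t * s * (1 - Real.cos th) := mul_pos (mul_pos ht hs) (by linarith)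
  nlinarith [sq_nonneg (t - s)]

lemma pow_distBR_pos (q : Serving) {t s th : ℝ} (ht : 0 < t) (hs : s ∈ rangeRU q)
    (hth : th ∈ Ioo (-Real.pi) Real.pi) (h0 : th ≠ 0) : 0 < p.pow q t s (distBR t s th) := by
  refine pow_pos q ht ?_ ?_
  · rintro rfl; exact hs
  · rintro rfl; exact distBR_pos ht hs hth h0

lemma measurable_pow (q : Serving) : Measurable fun z : ℝ × ℝ × ℝ => p.pow q z.1 z.2.1 z.2.2 := by
  cases q <;> simp only [pow, powDirect, powCasc] <;> fun_prop

end Network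

end

end RisNet

namespace RisNet
noncomputable section

/-! ### Joint law of distances, angle and interference -/

namespace Network

open Filter Topology Params

set_option linter.unusedSectionVars false

variable {Ω : Type*} [MeasurableSpace Ω] {P : Measure Ω} [IsProbabilityMeasure P] {p : Params}
  {ιb ιr : Type*} [Countable ιb] [Countable ιr] (M : Network P p ιb ιr)

/-- Interference as a function of the positions and marks of the BSs. -/
def interfOf (p : Params) {ι : Type*} (u : (ι → Plane) × (ι → ℝ × ℝ × ℝ × ℝ × ℝ)) : ℝ :=
  ∑' k, {k | ‖nearestPos u.1‖ < ‖u.1 k‖}.indicator (fun k => tau p ‖u.1 k‖ (u.2 k)) k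

lemma measurable_interfOf : Measurable (interfOf p (ι := ιb)) := by
  refine Measurable.tsum fun k => ?_
  have hk : Measurable fun u : (ιb → Plane) × (ιb → ℝ × ℝ × ℝ × ℝ × ℝ) => (‖u.1 k‖, u.2 k) := by fun_prop
  have h1 : Measurable fun u : (ιb → Plane) × (ιb → ℝ × ℝ × ℝ × ℝ × ℝ) => tau p ‖u.1 k‖ (u.2 k) :=
    (measurable_tau p).comp hk
  exact h1.indicator (s := {u : (ιb → Plane) × (ιb → ℝ × ℝ × ℝ × ℝ × ℝ) | ‖nearestPos u.1‖ < ‖u.1 k‖})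
    (measurableSet_lt (measurable_nearestPos.comp measurable_fst).norm (by fun_prop))

/-- Positions and marks of the BSs. -/
def bss (ω : Ω) : (ιb → Plane) × (ιb → ℝ × ℝ × ℝ × ℝ × ℝ) := (fun i => M.b i ω, fun i => M.bsMark i ω)

lemma measurable_bss : Measurable M.bss := M.measurable_b.prodMk M.measurable_bsMark'

lemma ae_interference_eq_interfOf : ∀ᵐ ω ∂P, M.interference ω = interfOf p (M.bss ω) := by
  filter_upwards [M.ae_interference_eq] with ω h using h

lemma aemeasurable_interference : AEMeasurable M.interference P :=
  ⟨_, measurable_interfOf.comp M.measurable_bss, M.ae_interference_eq_interfOf⟩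

/-- Average of a function of the distances and the angle over the RISs, given the BS-user distance. -/
def risAvg (K : ℝ × ℝ × ℝ → ℂ) (t : ℝ) : ℂ :=
  ∫ ω, K (t, M.risDist (t • dir 0) ω, M.X .angle ω) ∂P

lemma measurable_risAvg {K : ℝ × ℝ × ℝ → ℂ} (hK : Measurable K) : Measurable (M.risAvg K) := by
  have h1 : Measurable fun q : ℝ × Ω => M.risDist (q.1 • dir 0) q.2 :=
    Measurable.comp (f := fun q : ℝ × Ω => (q.1 • dir 0, q.2)) M.measurable_risDist (by fun_prop)
  have h : Measurable fun q : ℝ × Ω => K (q.1, M.risDist (q.1 • dir 0) q.2, M.X .angle q.2) :=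
    hK.comp (measurable_fst.prodMk (h1.prodMk ((M.X_measurable _).comp measurable_snd)))
  exact h.stronglyMeasurable.integral_prod_right.measurable

lemma norm_risAvg_le {K : ℝ × ℝ × ℝ → ℂ} {C : ℝ} (hC : ∀ z, ‖K z‖ ≤ C) (t : ℝ) : ‖M.risAvg K t‖ ≤ C := by
  refine (norm_integral_le_of_norm_le_const (Eventually.of_forall fun ω => hC _)).trans ?_
  simp

lemma indepFun_risDist_angle (y : Plane) : IndepFun (M.risDist y) (M.X .angle) P := by
  have h : Measurable fun w : (ιr → Plane) × (ιr → ℝ × ℝ) => (offerDist p y w).toReal :=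
    (Measurable.comp (f := fun w : (ιr → Plane) × (ιr → ℝ × ℝ) => (y, w)) (measurable_offerDist p)
      measurable_prodMk_left).ennreal_toReal
  exact M.indepFun_ris_angle.comp h measurable_id

lemma map_risDist_angle (y : Plane) : P.map (fun ω => (M.risDist y ω, M.X .angle ω)) =
    (P.map (M.risDist y)).prod (P.map (M.X .angle)) :=
  (indepFun_iff_map_prod_eq_prod_map_map (M.measurable_risDist_right y).aemeasurable
    (M.X_measurable _).aemeasurable).1 (M.indepFun_risDist_angle y)

/-- The angle is independent of the RISs and the RIS distance has an isotropic law, so the BS may be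
placed on a fixed axis. -/
lemma integral_risDist_angle {y : Plane} (hy : y ≠ 0) {K : ℝ × ℝ × ℝ → ℂ} (hK : Measurable K) :
    ∫ ω, K (‖y‖, M.risDist y ω, M.X .angle ω) ∂P = M.risAvg K ‖y‖ := by
  have h : ∀ y' : Plane, ∫ ω, K (‖y‖, M.risDist y' ω, M.X .angle ω) ∂P =
      ∫ z, K (‖y‖, z) ∂((P.map (M.risDist y')).prod (P.map (M.X .angle))) := fun y' => by
    rw [← M.map_risDist_angle y', integral_map]
    · exact ((M.measurable_risDist_right y').prodMk (M.X_measurable _)).aemeasurable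
    · exact (hK.comp measurable_prodMk_left).aestronglyMeasurable
  have hn : ‖y‖ = ‖‖y‖ • dir 0‖ := by rw [norm_smul, norm_dir, mul_one, norm_norm]
  rw [risAvg, h, h, M.map_risDist_congr hy hn]

/-- Averaging over the RISs, given the BSs. -/
lemma integral_tagState_exp_geom (v : LinkState) (x : ℝ) {K : ℝ × ℝ × ℝ → ℂ} (hK : Measurable K)
    {C : ℝ} (hC : ∀ z, ‖K z‖ ≤ C) :
    ∫ ω, K (M.geom ω) * ({ω | M.TagState v ω}.indicator 1 ω *
        Complex.exp (Complex.I * ((x * M.interference ω : ℝ) : ℂ))) ∂P =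
      ∫ ω, M.risAvg K (M.tBU ω) * ({ω | M.TagState v ω}.indicator 1 ω *
        Complex.exp (Complex.I * ((x * M.interference ω : ℝ) : ℂ))) ∂P := by
  let B : ((ιb → Plane) × (ιb → ℝ × ℝ × ℝ × ℝ × ℝ)) → ℂ := fun u =>
    (tagStateSet p ιb v).indicator 1 u * Complex.exp (Complex.I * ((x * interfOf p u : ℝ) : ℂ))
  have hB : Measurable B := by
    have hI := measurable_interfOf (p := p) (ιb := ιb)
    exact (measurable_one.indicator (measurableSet_tagStateSet v)).mul (by fun_prop)
  have hB1 : ∀ u, ‖B u‖ ≤ 1 := fun u => by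
    simp only [B]
    rw [norm_mul, Complex.norm_exp_I_mul_ofReal, mul_one]
    by_cases h : u ∈ tagStateSet p ιb v
    · rw [indicator_of_mem h]; simp
    · rw [indicator_of_notMem h]; simp
  have hBω : ∀ ω, M.interference ω = interfOf p (M.bss ω) → {ω | M.TagState v ω}.indicator 1 ω *
        Complex.exp (Complex.I * ((x * M.interference ω : ℝ) : ℂ)) = B (M.bss ω) := fun ω h => by
    simp only [B]
    rw [h]
    congr 1
    by_cases hs : M.TagState v ω
    · rw [indicator_of_mem (by exact hs), indicator_of_mem (by exact (M.tagState_iff_mem v ω).1 hs)]; rfl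
    · rw [indicator_of_notMem (by exact hs),
        indicator_of_notMem (by exact fun q => hs ((M.tagState_iff_mem v ω).2 q))]
  let F : ((ιb → Plane) × (ιb → ℝ × ℝ × ℝ × ℝ × ℝ)) →
      ((ιr → Plane) × ((ιr → ℝ × ℝ) × ℝ)) → ℂ := fun u w =>
    K (‖nearestPos u.1‖, (offerDist p (nearestPos u.1) (w.1, w.2.1)).toReal, w.2.2) * B u
  have hF : Measurable (Function.uncurry F) := by
    have hn : Measurable fun q : ((ιb → Plane) × (ιb → ℝ × ℝ × ℝ × ℝ × ℝ)) ×
        ((ιr → Plane) × ((ιr → ℝ × ℝ) × ℝ)) => nearestPos q.1.1 :=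
      measurable_nearestPos.comp (by fun_prop)
    have h1 : Measurable fun q : ((ιb → Plane) × (ιb → ℝ × ℝ × ℝ × ℝ × ℝ)) ×
        ((ιr → Plane) × ((ιr → ℝ × ℝ) × ℝ)) => offerDist p (nearestPos q.1.1) (q.2.1, q.2.2.1) :=
      Measurable.comp (f := fun q : ((ιb → Plane) × (ιb → ℝ × ℝ × ℝ × ℝ × ℝ)) ×
        ((ιr → Plane) × ((ιr → ℝ × ℝ) × ℝ)) => (nearestPos q.1.1, (q.2.1, q.2.2.1)))
        (measurable_offerDist p) (hn.prodMk (by fun_prop))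
    have h2 := hn.norm.prodMk (h1.ennreal_toReal.prodMk
      (show Measurable fun q : ((ιb → Plane) × (ιb → ℝ × ℝ × ℝ × ℝ × ℝ)) ×
        ((ιr → Plane) × ((ιr → ℝ × ℝ) × ℝ)) => q.2.2.2 by fun_prop))
    exact (hK.comp h2).mul (hB.comp measurable_fst)
  have hC0 : 0 ≤ C := (norm_nonneg _).trans (hC 0)
  have hFC : ∀ u w, ‖F u w‖ ≤ C := fun u w => by
    simp only [F]
    rw [norm_mul]
    calc _ ≤ C * 1 := mul_le_mul (hC _) (hB1 _) (norm_nonneg _) hC0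
      _ = C := mul_one C
  have key := integral_indep_eq (P := P) M.measurable_bss (M.measurable_r.prodMk
    (M.measurable_risMark'.prodMk (M.X_measurable .angle))) M.indepFun_bsSide_risSide hF hFC
  have e1 : ∫ ω, K (M.geom ω) * ({ω | M.TagState v ω}.indicator 1 ω *
        Complex.exp (Complex.I * ((x * M.interference ω : ℝ) : ℂ))) ∂P =
      ∫ ω, F (M.bss ω) ((fun j => M.r j ω), ((fun j => M.risMark j ω), M.X .angle ω)) ∂P := by
    refine integral_congr_ae ?_
    filter_upwards [M.ae_tRU_eq, M.ae_interference_eq_interfOf] with ω h1 h2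
    rw [hBω ω h2, geom, h1]
    rfl
  rw [e1, key]
  refine integral_congr_ae ?_
  filter_upwards [M.ae_tBU_pos, M.ae_interference_eq_interfOf] with ω h1 h2
  rw [hBω ω h2]
  have h3 : ∀ ω', F (M.bss ω) ((fun j => M.r j ω'), ((fun j => M.risMark j ω'), M.X .angle ω')) =
      K (‖M.b0 ω‖, M.risDist (M.b0 ω) ω', M.X .angle ω') * B (M.bss ω) := fun ω' => rfl
  simp_rw [h3]
  rw [integral_mul_const, M.integral_risDist_angle (norm_pos_iff.1 h1) hK]
  rfl

/-- Law of the interference given the BS-user distance, as a kernel. -/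
def interfKernel : Kernel (ℝ × ℝ × ℝ) ℝ where
  toFun z := M.interfLaw z.1
  measurable' := by
    refine Measure.measurable_of_measurable_coe _ fun B hB => ?_
    have h : ∀ z : ℝ × ℝ × ℝ, M.interfLaw z.1 B = P (Prod.mk z.1 ⁻¹' ((fun q : ℝ × Ω => M.farSum q.1 q.2) ⁻¹' B)) :=
      fun z => Measure.map_apply (M.measurable_farSum_right z.1) hB
    simp_rw [h]
    exact (measurable_measure_prodMk_left (M.measurable_farSum hB)).comp measurable_fst

lemma interfKernel_apply (z : ℝ × ℝ × ℝ) : M.interfKernel z = M.interfLaw z.1 := rfl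

instance : IsMarkovKernel M.interfKernel := ⟨fun z => by rw [interfKernel_apply]; infer_instance⟩

lemma measurable_charFun_interfLaw (x : ℝ) : Measurable fun t => charFun (M.interfLaw t) x := by
  have h : ∀ t, charFun (M.interfLaw t) x = ∫ ω, Complex.exp (x * M.farSum t ω * Complex.I) ∂P := fun t => by
    rw [charFun_apply_real, interfLaw, integral_map (M.measurable_farSum_right t).aemeasurable (by fun_prop)]
  simp_rw [h]
  have hm := M.measurable_farSum
  have h2 : Measurable fun q : ℝ × Ω => Complex.exp (x * M.farSum q.1 q.2 * Complex.I) := by fun_prop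
  exact h2.stronglyMeasurable.integral_prod_right.measurable

lemma integral_tagState_exp_geom_eq (v : LinkState) (x : ℝ) {K : ℝ × ℝ × ℝ → ℂ} (hK : Measurable K)
    {C : ℝ} (hC : ∀ z, ‖K z‖ ≤ C) :
    ∫ ω, K (M.geom ω) * ({ω | M.TagState v ω}.indicator 1 ω *
        Complex.exp (Complex.I * ((x * M.interference ω : ℝ) : ℂ))) ∂P =
      ∫ ω, M.risAvg K (M.tBU ω) * (p.probState v (M.tBU ω) * charFun (M.interfLaw (M.tBU ω)) x) ∂P := by
  rw [M.integral_tagState_exp_geom v x hK hC,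
    M.integral_tagState_exp v x (M.measurable_risAvg hK) (M.norm_risAvg_le hC)]
  refine integral_congr_ae ?_
  filter_upwards [M.ae_tBU_pos] with ω h
  rw [M.charFun_interfLaw x h]

lemma integral_tagState_geom (v : LinkState) {K : ℝ × ℝ × ℝ → ℂ} (hK : Measurable K)
    {C : ℝ} (hC : ∀ z, ‖K z‖ ≤ C) :
    ∫ ω, K (M.geom ω) * {ω | M.TagState v ω}.indicator 1 ω ∂P =
      ∫ ω, M.risAvg K (M.tBU ω) * p.probState v (M.tBU ω) ∂P := by
  simpa using M.integral_tagState_exp_geom_eq v 0 hK hC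

/-- Given the distances, the angle and the state of the tagged link, the interference depends on
the BS-user distance only. -/
lemma integral_tagState_exp_eq_charFun (v : LinkState) (x : ℝ) {K : ℝ × ℝ × ℝ → ℂ} (hK : Measurable K)
    {C : ℝ} (hC : ∀ z, ‖K z‖ ≤ C) :
    ∫ ω, K (M.geom ω) * ({ω | M.TagState v ω}.indicator 1 ω *
        Complex.exp (Complex.I * ((x * M.interference ω : ℝ) : ℂ))) ∂P =
      ∫ ω, K (M.geom ω) * charFun (M.interfLaw (M.tBU ω)) x * {ω | M.TagState v ω}.indicator 1 ω ∂P := by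
  -- The characteristic function depends on the BS distance only, so it can be absorbed into the
  -- test function and the same identity used at frequency 0.
  have hK' : Measurable fun z : ℝ × ℝ × ℝ => K z * charFun (M.interfLaw z.1) x :=
    hK.mul ((M.measurable_charFun_interfLaw x).comp measurable_fst)
  have hC0 : 0 ≤ C := (norm_nonneg _).trans (hC 0)
  have h := M.integral_tagState_geom v hK' (C := C) (fun z => by
    rw [norm_mul]
    calc _ ≤ C * 1 := mul_le_mul (hC z) (norm_charFun_le_one x) (norm_nonneg _) hC0
      _ = C := mul_one C)
  refine (M.integral_tagState_exp_geom_eq v x hK hC).trans (Eq.trans ?_ h.symm)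
  refine integral_congr_ae (Eventually.of_forall fun ω => ?_)
  beta_reduce
  rw [risAvg, risAvg]
  dsimp only
  rw [integral_mul_const]
  ring

/-- Joint law of the distances, the angle and the interference, for a given state of the tagged
link. -/
lemma map_geom_interference (v : LinkState) :
    (P.restrict {ω | M.TagState v ω}).map (fun ω => (M.geom ω, M.interference ω)) =
      ((P.restrict {ω | M.TagState v ω}).map M.geom) ⊗ₘ M.interfKernel := by
  have hI := M.aemeasurable_interference.mono_measure (Measure.restrict_le_self (s := {ω | M.TagState v ω}))
  have hS := M.measurableSet_tagState v
  -- A linear functional on the pair splits as L₁(z) + xu. The first part supplies a bounded test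
  -- function of distances and angle, the second the characteristic function of the interference.
  refine Measure.ext_of_charFunDual (funext fun L => ?_)
  set L1 : ℝ × ℝ × ℝ → ℝ := fun z => L (z, 0) with hL1
  set x : ℝ := L (0, 1) with hx
  have hL1m : Measurable L1 := (L.continuous.comp (by fun_prop : Continuous fun z : ℝ × ℝ × ℝ => (z, (0 : ℝ)))).measurable
  have hL : ∀ z u, L (z, u) = L1 z + x * u := fun z u => by
    rw [hL1, hx, mul_comm, ← smul_eq_mul, ← map_smul, ← map_add]; simp
  have hK : Measurable fun z => Complex.exp (Complex.I * ((L1 z : ℝ) : ℂ)) := by fun_prop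
  have hK1 : ∀ z, ‖Complex.exp (Complex.I * ((L1 z : ℝ) : ℂ))‖ ≤ 1 := fun z => by
    rw [Complex.norm_exp_I_mul_ofReal]
  have hind : ∀ (F : Ω → ℂ), ∫ ω in {ω | M.TagState v ω}, F ω ∂P =
      ∫ ω, F ω * {ω | M.TagState v ω}.indicator 1 ω ∂P := fun F => by
    rw [← integral_indicator hS]
    refine integral_congr_ae (Eventually.of_forall fun ω => ?_)
    beta_reduce
    by_cases hs : M.TagState v ω
    · rw [indicator_of_mem (by exact hs), indicator_of_mem (by exact hs)]; simp
    · rw [indicator_of_notMem (by exact hs), indicator_of_notMem (by exact hs)]; simp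
  have hbd : ∀ y : (ℝ × ℝ × ℝ) × ℝ, ‖Complex.exp (L y * Complex.I)‖ ≤ 1 := fun y => by
    rw [Complex.norm_exp_ofReal_mul_I]
  have hLm : Measurable fun y : (ℝ × ℝ × ℝ) × ℝ => Complex.exp (L y * Complex.I) := by
    have := L.continuous.measurable
    fun_prop
  rw [charFunDual_apply, charFunDual_apply, integral_map (M.measurable_geom.aemeasurable.prodMk hI)
    hLm.aestronglyMeasurable, Measure.integral_compProd (Integrable.of_bound hLm.aestronglyMeasurable 1
      (Eventually.of_forall hbd)), integral_map M.measurable_geom.aemeasurable, hind, hind]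
  · have key := M.integral_tagState_exp_eq_charFun v x hK hK1
    refine Eq.trans ?_ (key.trans ?_)
    · refine integral_congr_ae (Eventually.of_forall fun ω => ?_)
      beta_reduce
      rw [hL, mul_comm ({ω | M.TagState v ω}.indicator 1 ω : ℂ), ← mul_assoc, ← Complex.exp_add]
      congr 2
      push_cast; ring
    · refine integral_congr_ae (Eventually.of_forall fun ω => ?_)
      beta_reduce
      congr 1
      rw [interfKernel_apply, charFun_apply_real, ← integral_const_mul]
      refine integral_congr_ae (Eventually.of_forall fun u => ?_)
      beta_reduce
      rw [hL, ← Complex.exp_add]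
      congr 1
      push_cast
      rw [geom]
      ring
  · exact (hLm.stronglyMeasurable.integral_kernel_prod_right' (κ := M.interfKernel)).aestronglyMeasurable

end Network

end

end RisNet

namespace RisNet
noncomputable section

lemma measureReal_prodMk_mem_of_indepFun {Ω α β : Type*} [MeasurableSpace Ω] [MeasurableSpace α]
    [MeasurableSpace β] {P : Measure Ω} [IsProbabilityMeasure P] {V : Ω → α} {H : Ω → β}
    (hV : Measurable V) (hH : Measurable H) (h : IndepFun V H P) {S : Set (α × β)} (hS : MeasurableSet S) :
    P.real {ω | (V ω, H ω) ∈ S} = ∫ ω, (P.map H).real (Prod.mk (V ω) ⁻¹' S) ∂P := by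
  have hmV := Measure.isProbabilityMeasure_map (μ := P) hV.aemeasurable
  have hmH := Measure.isProbabilityMeasure_map (μ := P) hH.aemeasurable
  have hm : Measurable fun x => P.map H (Prod.mk x ⁻¹' S) := measurable_measure_prodMk_left hS
  have h1 : P {ω | (V ω, H ω) ∈ S} = ∫⁻ ω, P.map H (Prod.mk (V ω) ⁻¹' S) ∂P := by
    rw [← lintegral_map hm hV, ← Measure.prod_apply hS,
      ← (indepFun_iff_map_prod_eq_prod_map_map hV.aemeasurable hH.aemeasurable).1 h,
      Measure.map_apply (hV.prodMk hH) hS]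
    rfl
  rw [measureReal_def, h1]
  exact (integral_toReal (hm.comp hV).aemeasurable
    (Filter.Eventually.of_forall fun ω => measure_lt_top _ _)).symm

/-! ### Integrating out the serving fading and the interference -/

namespace Network

open Filter Topology Params

set_option linter.unusedSectionVars false

variable {Ω : Type*} [MeasurableSpace Ω] {P : Measure Ω} [IsProbabilityMeasure P] {p : Params}
  {ιb ιr : Type*} [Countable ιb] [Countable ιr] (M : Network P p ιb ιr)

/-- Positions and marks of the whole network except for the fading of the serving link. -/
def env (ω : Ω) : ((ιb → Plane) × (ιb → ℝ × ℝ × ℝ × ℝ × ℝ)) × ((ιr → Plane) × (ιr → ℝ × ℝ)) × ℝ :=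
  (M.bss ω, M.ris ω, M.X .angle ω)

lemma measurable_env : Measurable M.env :=
  M.measurable_bss.prodMk (M.measurable_ris.prodMk (M.X_measurable _))

lemma indepFun_env_serve (q : Serving) : IndepFun M.env (M.X (.serve q)) P :=
  (M.indepFun_network_serve q).comp
    (φ := fun z : ((ιb → Plane) × (ιr → Plane)) × (ιb → ℝ × ℝ × ℝ × ℝ × ℝ) × (ιr → ℝ × ℝ) × ℝ =>
      ((z.1.1, z.2.1), (z.1.2, z.2.2.1), z.2.2.2)) (by fun_prop) measurable_id

/-- The distances and the angle as functions of the positions and marks. -/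
def geomOf (p : Params) {ιb ιr : Type*}
    (z : ((ιb → Plane) × (ιb → ℝ × ℝ × ℝ × ℝ × ℝ)) × ((ιr → Plane) × (ιr → ℝ × ℝ)) × ℝ) : ℝ × ℝ × ℝ :=
  (‖nearestPos z.1.1‖, (offerDist p (nearestPos z.1.1) z.2.1).toReal, z.2.2)

lemma measurable_geomOf : Measurable (geomOf p (ιb := ιb) (ιr := ιr)) := by
  have hn : Measurable fun z : ((ιb → Plane) × (ιb → ℝ × ℝ × ℝ × ℝ × ℝ)) ×
      ((ιr → Plane) × (ιr → ℝ × ℝ)) × ℝ => nearestPos z.1.1 := measurable_nearestPos.comp (by fun_prop)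
  have h1 : Measurable fun z : ((ιb → Plane) × (ιb → ℝ × ℝ × ℝ × ℝ × ℝ)) ×
      ((ιr → Plane) × (ιr → ℝ × ℝ)) × ℝ => offerDist p (nearestPos z.1.1) z.2.1 :=
    Measurable.comp (f := fun z : ((ιb → Plane) × (ιb → ℝ × ℝ × ℝ × ℝ × ℝ)) ×
      ((ιr → Plane) × (ιr → ℝ × ℝ)) × ℝ => (nearestPos z.1.1, z.2.1)) (measurable_offerDist p)
      (hn.prodMk (by fun_prop))
  exact hn.norm.prodMk (h1.ennreal_toReal.prodMk (by fun_prop))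

lemma ae_geom_eq : ∀ᵐ ω ∂P, M.geom ω = geomOf p (M.env ω) := by
  filter_upwards [M.ae_tRU_eq] with ω h
  rw [geom, h]; rfl

lemma ae_interference_nonneg : ∀ᵐ ω ∂P, 0 ≤ M.interference ω := by
  filter_upwards [M.ae_interference_eq, M.ae_tau_nonneg] with ω h1 h2
  rw [h1]
  exact tsum_nonneg fun k => indicator_nonneg (fun k _ => h2 k) k

variable (gam om : ℝ)

/-- Averaging over the fading of the serving link. -/
lemma measureReal_goodFading (q : Serving) (v : LinkState) {w : ℝ × ℝ × ℝ → ℝ} (hw : Measurable w)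
    {A : Set (ℝ × ℝ × ℝ)} (hA : MeasurableSet A) :
    P.real {ω | M.TagState v ω ∧ M.geom ω ∈ A ∧
      M.X (.serve q) ω ∈ goodFading p.noise (p.area * om) gam (w (M.geom ω)) (M.interference ω)} =
    ∫ ω in {ω | M.TagState v ω}, A.indicator (fun z => goodProb p gam om (p.servingShape q) (w z)
      (M.interference ω)) (M.geom ω) ∂P := by
  have hwg : Measurable fun z => w (geomOf p (ιb := ιb) (ιr := ιr) z) := hw.comp measurable_geomOf
  have hI : Measurable fun z : ((ιb → Plane) × (ιb → ℝ × ℝ × ℝ × ℝ × ℝ)) ×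
      ((ιr → Plane) × (ιr → ℝ × ℝ)) × ℝ => interfOf p z.1 := measurable_interfOf.comp measurable_fst
  let S : Set ((((ιb → Plane) × (ιb → ℝ × ℝ × ℝ × ℝ × ℝ)) × ((ιr → Plane) × (ιr → ℝ × ℝ)) × ℝ) × ℝ) :=
    {y | y.1.1 ∈ tagStateSet p ιb v ∧ geomOf p y.1 ∈ A ∧
      y.2 ∈ goodFading p.noise (p.area * om) gam (w (geomOf p y.1)) (interfOf p y.1.1)}
  have hS : MeasurableSet S := by
    have hfst : Measurable fun y : (((ιb → Plane) × (ιb → ℝ × ℝ × ℝ × ℝ × ℝ)) ×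
      ((ιr → Plane) × (ιr → ℝ × ℝ)) × ℝ) × ℝ => y.1 := measurable_fst
    have hwg' := hwg.comp hfst
    have hI' := hI.comp hfst
    simp only [Function.comp_def] at hwg' hI'
    simp only [S, goodFading, ofPred_and]
    refine MeasurableSet.inter ?_ (MeasurableSet.inter ?_ (MeasurableSet.inter ?_ ?_))
    · exact (measurable_fst.comp measurable_fst) (measurableSet_tagStateSet v)
    · exact (measurable_geomOf.comp measurable_fst) hA
    · exact measurableSet_lt ((hI'.const_add _).const_mul _) (hwg'.mul measurable_snd)
    · exact measurableSet_le (hwg'.mul measurable_snd) (hI'.const_sub _)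
  have h1 := measureReal_prodMk_mem_of_indepFun M.measurable_env (M.X_measurable (.serve q))
    (M.indepFun_env_serve q) hS
  have h2 : P.real {ω | M.TagState v ω ∧ M.geom ω ∈ A ∧
      M.X (.serve q) ω ∈ goodFading p.noise (p.area * om) gam (w (M.geom ω)) (M.interference ω)} =
      P.real {ω | (M.env ω, M.X (.serve q) ω) ∈ S} := by
    refine measureReal_congr ?_
    filter_upwards [M.ae_geom_eq, M.ae_interference_eq_interfOf] with ω hg hi
    refine propext ?_
    change (M.TagState v ω ∧ M.geom ω ∈ A ∧ _) ↔ _ ∧ _ ∧ _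
    rw [hg, hi, M.tagState_iff_mem]
    rfl
  rw [h2, h1, ← integral_indicator (M.measurableSet_tagState v)]
  refine integral_congr_ae ?_
  filter_upwards [M.ae_geom_eq, M.ae_interference_eq_interfOf] with ω hg hi
  have hl : P.map (M.X (.serve q)) = gammaMeasure (p.servingShape q) (p.servingShape q) := M.X_law _
  by_cases hs : M.TagState v ω
  · have hs' := (M.tagState_iff_mem v ω).1 hs
    rw [indicator_of_mem (by exact hs)]
    by_cases ha : M.geom ω ∈ A
    · rw [indicator_of_mem ha, hl, goodProb, hi, hg]
      congr 1
      ext h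
      exact ⟨fun hh => hh.2.2, fun hh => ⟨hs', hg ▸ ha, hh⟩⟩
    · rw [indicator_of_notMem ha]
      have : Prod.mk (M.env ω) ⁻¹' S = ∅ := by
        ext h
        simp only [mem_empty_iff_false, iff_false]
        exact fun hh => ha (hg ▸ hh.2.1)
      rw [this, measureReal_empty]
  · rw [indicator_of_notMem (by exact hs)]
    have : Prod.mk (M.env ω) ⁻¹' S = ∅ := by
      ext h
      simp only [mem_empty_iff_false, iff_false]
      exact fun hh => hs ((M.tagState_iff_mem v ω).2 hh.1)
    rw [this, measureReal_empty]

/-- Averaging over the interference. -/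
lemma integral_goodProb (v : LinkState) {m : ℕ} (hm : 1 ≤ m) {w : ℝ × ℝ × ℝ → ℝ} (hw : Measurable w)
    {A : Set (ℝ × ℝ × ℝ)} (hA : MeasurableSet A) :
    ∫ ω in {ω | M.TagState v ω}, A.indicator (fun z => goodProb p gam om m (w z) (M.interference ω))
      (M.geom ω) ∂P =
    ∫ ω in {ω | M.TagState v ω}, A.indicator (fun z => M.jointAvg gam om m (w z) z.1) (M.geom ω) ∂P := by
  have hI := M.aemeasurable_interference.mono_measure (Measure.restrict_le_self (s := {ω | M.TagState v ω}))
  let F : (ℝ × ℝ × ℝ) × ℝ → ℝ := fun y => A.indicator (fun z => goodProb p gam om m (w z) y.2) y.1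
  have hF : Measurable F := by
    have h1 : Measurable fun y : (ℝ × ℝ × ℝ) × ℝ => goodProb p gam om m (w y.1) y.2 :=
      Measurable.comp (f := fun y : (ℝ × ℝ × ℝ) × ℝ => (w y.1, y.2)) (measurable_goodProb gam om hm)
        (by fun_prop)
    exact h1.indicator (s := Prod.fst ⁻¹' A) (measurable_fst hA)
  have hF1 : ∀ y, ‖F y‖ ≤ 1 := fun y => by
    by_cases hy : y.1 ∈ A
    · have := goodProb_mem (p := p) gam om hm (w y.1) y.2
      simp only [F]
      rw [indicator_of_mem hy, Real.norm_of_nonneg this.1]; exact this.2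
    · simp only [F]
      rw [indicator_of_notMem hy]; simp
  have h1 := integral_map (μ := P.restrict {ω | M.TagState v ω})
    (M.measurable_geom.aemeasurable.prodMk hI) hF.aestronglyMeasurable
  rw [M.map_geom_interference v, Measure.integral_compProd (Integrable.of_bound hF.aestronglyMeasurable 1
    (Eventually.of_forall hF1)), integral_map M.measurable_geom.aemeasurable
      (hF.stronglyMeasurable.integral_kernel_prod_right' (κ := M.interfKernel)).aestronglyMeasurable] at h1
  refine h1.symm.trans (integral_congr_ae (Eventually.of_forall fun ω => ?_))
  beta_reduce
  simp only [F]
  by_cases ha : M.geom ω ∈ A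
  · simp only [indicator_of_mem ha]
    rw [M.jointAvg_eq gam om hm, interfKernel_apply]
  · simp only [indicator_of_notMem ha]
    simp

/-- Mean serving power as a function of the distances and the angle. -/
def powOf (p : Params) (q : Serving) (z : ℝ × ℝ × ℝ) : ℝ := p.pow q z.1 z.2.1 (distBR z.1 z.2.1 z.2.2)

lemma measurable_powOf (q : Serving) : Measurable (powOf p q) := by
  refine Measurable.comp (f := fun z : ℝ × ℝ × ℝ => (z.1, z.2.1, distBR z.1 z.2.1 z.2.2))
    (measurable_pow q) ?_
  unfold distBR
  fun_prop

/-- Conditional joint probability for link type `q`, as an average over the interference. -/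
def jointGeom (q : Serving) (z : ℝ × ℝ × ℝ) : ℝ :=
  M.jointAvg gam om (p.servingShape q) (powOf p q z) z.1

lemma measurable_jointGeom (q : Serving) : Measurable (M.jointGeom gam om q) :=
  Measurable.comp (f := fun z : ℝ × ℝ × ℝ => (powOf p q z, z.1))
    (M.measurable_jointAvg gam om (one_le_servingShape q)) ((measurable_powOf q).prodMk measurable_fst)

lemma jointGeom_mem (q : Serving) (z : ℝ × ℝ × ℝ) : M.jointGeom gam om q z ∈ Icc (0 : ℝ) 1 :=
  M.jointAvg_mem gam om (one_le_servingShape q) _ _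

/-- The event that both constraints hold on a link of type `q`. -/
def goodEvent (q : Serving) : Set Ω := {ω | gam < M.sinrOf q ω ∧ M.emfeOf q ω ≤ om}

/-- Nonnegative interference makes the SINR denominator positive, so both ratios can be cleared and
become bounds on the serving power. -/
lemma ae_mem_goodEvent_iff (q : Serving) : ∀ᵐ ω ∂P, ω ∈ M.goodEvent gam om q ↔
    M.X (.serve q) ω ∈ goodFading p.noise (p.area * om) gam (powOf p q (M.geom ω)) (M.interference ω) := by
  filter_upwards [M.ae_interference_nonneg] with ω hI
  have h1 : 0 < p.noise + M.interference ω := add_pos_of_pos_of_nonneg p.noise_pos hI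
  change (gam < M.servingPower q ω / (p.noise + M.interference ω) ∧
    (M.servingPower q ω + M.interference ω) / p.area ≤ om) ↔
      (gam * (p.noise + M.interference ω) < M.servingPower q ω ∧
        M.servingPower q ω ≤ p.area * om - M.interference ω)
  rw [lt_div_iff₀ h1, div_le_iff₀ (area_pos p), le_sub_iff_add_le, mul_comm om]

lemma nullMeasurableSet_goodEvent (q : Serving) : NullMeasurableSet (M.goodEvent gam om q) P := by
  have hI := M.aemeasurable_interference
  have hw : AEMeasurable (fun ω => powOf p q (M.geom ω) * M.X (.serve q) ω) P :=
    (((measurable_powOf q).comp M.measurable_geom).mul (M.X_measurable _)).aemeasurable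
  have h1 : NullMeasurableSet {ω | gam * (p.noise + M.interference ω) <
      powOf p q (M.geom ω) * M.X (.serve q) ω} P :=
    nullMeasurableSet_lt ((hI.const_add _).const_mul _) hw
  have h2 : NullMeasurableSet {ω | powOf p q (M.geom ω) * M.X (.serve q) ω ≤
      p.area * om - M.interference ω} P := nullMeasurableSet_le hw (hI.const_sub _)
  refine (h1.inter h2).congr ?_
  filter_upwards [M.ae_mem_goodEvent_iff gam om q] with ω h
  exact propext h.symm

/-- Joint probability of both constraints, for a link of type `q` and a range of distances. -/
lemma measureReal_link_inter (q : Serving) {A : Set (ℝ × ℝ × ℝ)} (hA : MeasurableSet A) :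
    P.real ({ω | M.link ω = q} ∩ M.geom ⁻¹' A ∩ M.goodEvent gam om q) =
      ∫ ω in {ω | M.link ω = q} ∩ M.geom ⁻¹' A, M.jointGeom gam om q (M.geom ω) ∂P := by
  have hA' : MeasurableSet (A ∩ {z : ℝ × ℝ × ℝ | z.2.1 ∈ rangeRU q}) :=
    hA.inter ((measurable_fst.comp measurable_snd) (measurableSet_rangeRU q))
  have h1 := M.measureReal_goodFading gam om q (tagOf q) (measurable_powOf (p := p) q) hA'
  rw [M.integral_goodProb gam om (tagOf q) (one_le_servingShape q) (measurable_powOf (p := p) q) hA'] at h1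
  refine Eq.trans (measureReal_congr ?_) (h1.trans ?_)
  · filter_upwards [M.ae_link_eq_iff, M.ae_mem_goodEvent_iff gam om q] with ω hl hg
    refine propext ?_
    change ((M.link ω = q ∧ M.geom ω ∈ A) ∧ ω ∈ M.goodEvent gam om q) ↔
      (_ ∧ (M.geom ω ∈ A ∧ M.tRU ω ∈ rangeRU q) ∧ _)
    rw [hl q, hg]
    tauto
  · rw [← integral_indicator (M.measurableSet_tagState _),
      ← integral_indicator ((M.measurableSet_link q).inter (M.measurable_geom hA))]
    refine integral_congr_ae ?_
    filter_upwards [M.ae_link_eq_iff] with ω hl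
    by_cases hs : M.TagState (tagOf q) ω
    · rw [indicator_of_mem (by exact hs)]
      by_cases ha : M.geom ω ∈ A ∩ {z : ℝ × ℝ × ℝ | z.2.1 ∈ rangeRU q}
      · rw [indicator_of_mem ha, indicator_of_mem (by exact ⟨(hl q).2 ⟨hs, ha.2⟩, ha.1⟩)]
        rfl
      · rw [indicator_of_notMem ha, indicator_of_notMem]
        exact fun hh => ha ⟨hh.2, ((hl q).1 hh.1).2⟩
    · rw [indicator_of_notMem (by exact hs), indicator_of_notMem]
      exact fun hh => hs ((hl q).1 hh.1).1

lemma ae_jointCond_eq (q : Serving) (hg : 0 < gam) : ∀ᵐ ω ∂P, M.link ω = q →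
    p.jointCond gam om q (M.tBU ω) (M.tRU ω) (M.tBR ω) = M.jointGeom gam om q (M.geom ω) := by
  filter_upwards [M.ae_link_eq_iff, M.ae_tBU_pos, M.ae_angle_ne_zero] with ω hl ht hθ hq
  exact M.jointOf_eq_jointAvg (one_le_servingShape q) om
    (pow_distBR_pos q ht ((hl q).1 hq).2 hθ.1 hθ.2) ht hg

end Network

end

end RisNet

namespace RisNet
noncomputable section

/-! ### Conditional probability given the link type and its distances -/

namespace Network

open Filter Topology Params

set_option linter.unusedSectionVars false

variable {Ω : Type*} [MeasurableSpace Ω] {P : Measure Ω} [IsProbabilityMeasure P] {p : Params}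
  {ιb ιr : Type*} [Countable ιb] [Countable ιr] (M : Network P p ιb ιr) (gam om : ℝ)

/-- The map d extracts the distances that generate the conditioning σ-algebra. The defining
integrals of the conditional expectation run over preimages under d, where the restricted identity
for each link type applies. Measurability follows because the averaged probability factors through
d. -/
lemma condProb_goodEvent_of_factor (hg : 0 < gam) (q : Serving) {E : Type*} [MeasurableSpace E]
    {d : ℝ × ℝ × ℝ → E} (hd : Measurable d) {j : E → ℝ} (hj : Measurable j)
    (hjd : ∀ z, M.jointGeom gam om q z = j (d z)) :
    (cond P {ω | M.link ω = q})⟦M.goodEvent gam om q |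
        MeasurableSpace.comap (fun ω => d (M.geom ω)) inferInstance⟧ =ᵐ[cond P {ω | M.link ω = q}]
      fun ω => p.jointCond gam om q (M.tBU ω) (M.tRU ω) (M.tBR ω) := by
  set S := {ω | M.link ω = q} with hSdef
  have hS : MeasurableSet S := M.measurableSet_link q
  -- A link type of probability zero, such as CL when λ_r = 0, has the zero measure as its
  -- conditional measure, and the claim is empty.
  by_cases h0 : P S = 0
  · rw [cond_eq_zero_of_meas_eq_zero h0]
    simp [Filter.EventuallyEq]
  have hprob : IsProbabilityMeasure (cond P S) := cond_isProbabilityMeasure h0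
  have hm : MeasurableSpace.comap (fun ω => d (M.geom ω)) inferInstance ≤ ‹MeasurableSpace Ω› :=
    (hd.comp M.measurable_geom).comap_le
  have hac : cond P S ≪ P := cond_absolutelyContinuous
  have hE : NullMeasurableSet (M.goodEvent gam om q) (cond P S) :=
    (M.nullMeasurableSet_goodEvent gam om q).mono_ac hac
  have hgj : (fun ω => p.jointCond gam om q (M.tBU ω) (M.tRU ω) (M.tBR ω)) =ᵐ[cond P S]
      fun ω => M.jointGeom gam om q (M.geom ω) := by
    filter_upwards [hac.ae_le (M.ae_jointCond_eq gam om q hg), ae_cond_mem hS] with ω h1 h2 using h1 h2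
  have hJi : Integrable (fun ω => M.jointGeom gam om q (M.geom ω)) (cond P S) := by
    refine Integrable.of_bound
      ((M.measurable_jointGeom gam om q).comp M.measurable_geom).aestronglyMeasurable 1
      (Eventually.of_forall fun ω => ?_)
    have := M.jointGeom_mem gam om q (M.geom ω)
    rw [Real.norm_of_nonneg this.1]; exact this.2
  refine (ae_eq_condExp_of_forall_setIntegral_eq hm ?_ ?_ ?_ ?_).symm
  · exact (integrable_const (1 : ℝ)).indicator₀ hE
  · exact fun s _ _ => (hJi.congr hgj.symm).integrableOn
  · rintro s ⟨B, hB, rfl⟩ -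
    rw [integral_congr_ae (ae_restrict_of_ae hgj)]
    have hs : MeasurableSet ((fun ω => d (M.geom ω)) ⁻¹' B) := hd.comp M.measurable_geom hB
    have hr : (cond P S).restrict ((fun ω => d (M.geom ω)) ⁻¹' B) =
        (P S)⁻¹ • P.restrict (S ∩ M.geom ⁻¹' (d ⁻¹' B)) := by
      rw [ProbabilityTheory.cond, Measure.restrict_smul, Measure.restrict_restrict hs, inter_comm]
      rfl
    rw [hr, integral_smul_measure, integral_smul_measure,
      ← M.measureReal_link_inter gam om q (hd hB)]
    congr 1
    have hE' : NullMeasurableSet (M.goodEvent gam om q) (P.restrict (S ∩ M.geom ⁻¹' (d ⁻¹' B))) :=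
      (M.nullMeasurableSet_goodEvent gam om q).mono_ac Measure.absolutelyContinuous_restrict
    rw [integral_indicator₀ hE', setIntegral_const, smul_eq_mul, mul_one, measureReal_def, measureReal_def,
      Measure.restrict_apply₀ hE', inter_comm]
  · refine (AEStronglyMeasurable.congr ?_ hgj.symm)
    have h1 : (fun ω => M.jointGeom gam om q (M.geom ω)) = j ∘ fun ω => d (M.geom ω) :=
      funext fun ω => hjd _
    rw [h1]
    exact (hj.comp (comap_measurable _)).stronglyMeasurable.aestronglyMeasurable

/-- Conditional joint probability given the link type and the serving distances. -/
lemma condProb_goodEvent (hg : 0 < gam) (q : Serving) :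
    (cond P {ω | M.link ω = q})⟦M.goodEvent gam om q | M.distSigma q⟧ =ᵐ[cond P {ω | M.link ω = q}]
      fun ω => p.jointCond gam om q (M.tBU ω) (M.tRU ω) (M.tBR ω) := by
  have hj : ∀ q : Serving, Measurable fun z : ℝ × ℝ × ℝ =>
      M.jointAvg gam om (p.servingShape q) (p.pow q z.1 z.2.1 z.2.2) z.1 := fun q =>
    Measurable.comp (f := fun z : ℝ × ℝ × ℝ => (p.pow q z.1 z.2.1 z.2.2, z.1))
      (M.measurable_jointAvg gam om (one_le_servingShape q)) ((measurable_pow q).prodMk measurable_fst)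
  -- For the direct types the mean power ignores the last two arguments, so zeros serve as
  -- placeholders.
  have hj0 : ∀ q : Serving, Measurable fun t : ℝ =>
      M.jointAvg gam om (p.servingShape q) (p.pow q t 0 0) t := fun q =>
    Measurable.comp (f := fun t : ℝ => (t, (0 : ℝ), (0 : ℝ))) (hj q) (by fun_prop)
  cases q
  · exact M.condProb_goodEvent_of_factor gam om hg .DL (d := fun z => z.1) measurable_fst (hj0 .DL)
      fun z => rfl
  · exact M.condProb_goodEvent_of_factor gam om hg .CL (d := fun z => (z.1, z.2.1, distBR z.1 z.2.1 z.2.2))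
      (by unfold distBR; fun_prop) (hj .CL) fun z => rfl
  · exact M.condProb_goodEvent_of_factor gam om hg .DN (d := fun z => z.1) measurable_fst (hj0 .DN)
      fun z => rfl

end Network

end

end RisNet

namespace RisNet
noncomputable section

/-! ### Law of the distance of the nearest BS -/

section NearestLaw

open Filter Topology Params

variable (p : Params)

lemma continuous_pdfBU : Continuous p.pdfBU := by unfold pdfBU; fun_prop

lemma pdfBU_nonneg {t : ℝ} (ht : 0 ≤ t) : 0 ≤ p.pdfBU t := by
  have := p.lamB_pos
  have := Real.pi_pos
  unfold pdfBU; positivity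

lemma hasDerivAt_pdfBU (t : ℝ) :
    HasDerivAt (fun t => -Real.exp (-Real.pi * p.lamB * t ^ 2)) (p.pdfBU t) t := by
  refine (((hasDerivAt_pow 2 t).const_mul (-Real.pi * p.lamB)).exp.neg).congr_deriv ?_
  rw [pdfBU]; norm_num; ring

lemma tendsto_exp_pdfBU : Tendsto (fun t => -Real.exp (-Real.pi * p.lamB * t ^ 2)) atTop (𝓝 0) := by
  rw [← neg_zero]
  refine (Real.tendsto_exp_atBot.comp ?_).neg
  exact (tendsto_pow_atTop two_ne_zero).const_mul_atTop_of_neg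
    (by have := p.lamB_pos; have := Real.pi_pos; nlinarith [mul_pos Real.pi_pos p.lamB_pos])

lemma integrableOn_pdfBU {a : ℝ} (ha : 0 ≤ a) : IntegrableOn p.pdfBU (Ioi a) :=
  integrableOn_Ioi_deriv_of_nonneg (hasDerivAt_pdfBU p a).continuousAt.continuousWithinAt
    (fun s _ => hasDerivAt_pdfBU p s) (fun _ hs => pdfBU_nonneg p (ha.trans (le_of_lt hs)))
    (tendsto_exp_pdfBU p)

lemma integral_pdfBU {a : ℝ} (ha : 0 ≤ a) :
    ∫ t in Ioi a, p.pdfBU t = Real.exp (-Real.pi * p.lamB * a ^ 2) := by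
  rw [integral_Ioi_of_hasDerivAt_of_nonneg (hasDerivAt_pdfBU p a).continuousAt.continuousWithinAt
    (fun s _ => hasDerivAt_pdfBU p s) (fun _ hs => pdfBU_nonneg p (ha.trans (le_of_lt hs)))
    (tendsto_exp_pdfBU p)]
  ring

/-- Law of the BS-user distance. -/
def lawBU : Measure ℝ := (volume.restrict (Ioi 0)).withDensity fun t => ENNReal.ofReal (p.pdfBU t)

lemma lawBU_Ioi (a : ℝ) :
    lawBU p (Ioi a) = ENNReal.ofReal (Real.exp (-Real.pi * p.lamB * (max a 0) ^ 2)) := by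
  rw [lawBU, withDensity_apply _ measurableSet_Ioi, Measure.restrict_restrict measurableSet_Ioi,
    Ioi_inter_Ioi, ← integral_pdfBU p (le_max_right a 0), ofReal_integral_eq_lintegral_ofReal
      (integrableOn_pdfBU p (le_max_right a 0))]
  exact (ae_restrict_iff' measurableSet_Ioi).2
    (Eventually.of_forall fun s hs => pdfBU_nonneg p ((le_max_right a 0).trans (le_of_lt hs)))

instance : IsProbabilityMeasure (lawBU p) := by
  constructor
  have h : lawBU p (Iic 0) = 0 := by
    rw [lawBU, withDensity_apply _ measurableSet_Iic, Measure.restrict_restrict measurableSet_Iic,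
      Iic_inter_Ioi, Ioc_self, Measure.restrict_empty, lintegral_zero_measure]
  have h0 := lawBU_Ioi p 0
  simp only [max_self, ne_eq, OfNat.ofNat_ne_zero, not_false_eq_true, zero_pow, mul_zero, Real.exp_zero,
    ENNReal.ofReal_one] at h0
  rw [← Iic_union_Ioi (a := (0 : ℝ)), measure_union (Iic_disjoint_Ioi le_rfl) measurableSet_Ioi, h, h0,
    zero_add]

lemma integral_lawBU (f : ℝ → ℝ) : ∫ t, f t ∂(lawBU p) = ∫ t in Ioi 0, f t * p.pdfBU t := by
  have hm : Measurable fun t => ENNReal.ofReal (p.pdfBU t) := (continuous_pdfBU p).measurable.ennreal_ofReal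
  rw [lawBU, integral_withDensity_eq_integral_toReal_smul hm (Eventually.of_forall fun t => ENNReal.ofReal_lt_top)]
  refine setIntegral_congr_fun measurableSet_Ioi fun t ht => ?_
  rw [ENNReal.toReal_ofReal (pdfBU_nonneg p (le_of_lt ht)), smul_eq_mul, mul_comm]

end NearestLaw

/-! ### Averaging over the distances -/

namespace Network

open Filter Topology Params

set_option linter.unusedSectionVars false

variable {Ω : Type*} [MeasurableSpace Ω] {P : Measure Ω} [IsProbabilityMeasure P] {p : Params}
  {ιb ιr : Type*} [Countable ιb] [Countable ιr] (M : Network P p ιb ιr) (gam om : ℝ)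

lemma map_tBU : P.map M.tBU = lawBU p := by
  have hT := M.measurable_tBU
  have := Measure.isProbabilityMeasure_map (μ := P) hT.aemeasurable
  refine Measure.ext_of_Iic _ _ fun a => ?_
  rw [← compl_Ioi, prob_compl_eq_one_sub measurableSet_Ioi, prob_compl_eq_one_sub measurableSet_Ioi,
    lawBU_Ioi, Measure.map_apply hT measurableSet_Ioi]
  congr 1
  rcases le_or_gt 0 a with ha | ha
  · have h := M.b_poisson.measure_lt_norm_nearestPos p.lamB_pos ha
    rw [max_eq_left ha]
    refine Eq.trans h ?_
    congr 2; ring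
  · have hu : M.tBU ⁻¹' Ioi a = univ := eq_univ_of_forall fun ω => ha.trans_le (norm_nonneg _)
    rw [hu, measure_univ, max_eq_right ha.le]; simp

/-- Conditional joint probability restricted to the range of distances of link type `q`. -/
def jointRange (q : Serving) : ℝ × ℝ × ℝ → ℝ :=
  {z : ℝ × ℝ × ℝ | z.2.1 ∈ rangeRU q}.indicator (M.jointGeom gam om q)

lemma measurable_jointRange (q : Serving) : Measurable (M.jointRange gam om q) :=
  (M.measurable_jointGeom gam om q).indicator
    ((measurable_fst.comp measurable_snd) (measurableSet_rangeRU q))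

lemma jointRange_mem (q : Serving) (z : ℝ × ℝ × ℝ) : M.jointRange gam om q z ∈ Icc (0 : ℝ) 1 := by
  by_cases h : z.2.1 ∈ rangeRU q
  · rw [jointRange, indicator_of_mem (by exact h)]; exact M.jointGeom_mem gam om q z
  · rw [jointRange, indicator_of_notMem (by exact h)]; simp

lemma norm_jointRange_le (q : Serving) (z : ℝ × ℝ × ℝ) : ‖M.jointRange gam om q z‖ ≤ 1 := by
  rw [Real.norm_of_nonneg (M.jointRange_mem gam om q z).1]; exact (M.jointRange_mem gam om q z).2

/-- Average over the RISs of the conditional joint probability for link type `q`. -/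
def jointMean (q : Serving) (t : ℝ) : ℝ :=
  ∫ ω, M.jointRange gam om q (t, M.risDist (t • dir 0) ω, M.X .angle ω) ∂P

lemma ofReal_jointMean (q : Serving) (t : ℝ) :
    (M.jointMean gam om q t : ℂ) = M.risAvg (fun z => (M.jointRange gam om q z : ℂ)) t := by
  rw [risAvg, integral_complex_ofReal]; rfl

lemma measurable_jointMean (q : Serving) : Measurable (M.jointMean gam om q) := by
  have h := Complex.measurable_re.comp (M.measurable_risAvg (K := fun z => (M.jointRange gam om q z : ℂ))
    (Complex.measurable_ofReal.comp (M.measurable_jointRange gam om q)))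
  have e : Complex.re ∘ M.risAvg (fun z => (M.jointRange gam om q z : ℂ)) = M.jointMean gam om q := by
    ext t; rw [Function.comp_apply, ← ofReal_jointMean, Complex.ofReal_re]
  rwa [e] at h

lemma norm_jointMean_le (q : Serving) (t : ℝ) : ‖M.jointMean gam om q t‖ ≤ 1 := by
  refine (norm_integral_le_of_norm_le_const
    (Eventually.of_forall fun ω => M.norm_jointRange_le gam om q _)).trans ?_
  simp

/-- The condition on the RIS distance is built into the integrand, so the link event reduces to the
tagged state; given the BS distance the latter is independent of the RIS side and contributes its
probability as a factor. -/
lemma integral_link_jointGeom (q : Serving) :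
    ∫ ω in {ω | M.link ω = q}, M.jointGeom gam om q (M.geom ω) ∂P =
      ∫ ω, M.jointMean gam om q (M.tBU ω) * p.probState (tagOf q) (M.tBU ω) ∂P := by
  have hK : Measurable fun z => (M.jointRange gam om q z : ℂ) :=
    Complex.measurable_ofReal.comp (M.measurable_jointRange gam om q)
  have h := M.integral_tagState_geom (tagOf q) hK (C := 1) fun z => by
    rw [Complex.norm_real]; exact M.norm_jointRange_le gam om q z
  have e1 : ∫ ω, (M.jointRange gam om q (M.geom ω) : ℂ) * {ω | M.TagState (tagOf q) ω}.indicator 1 ω ∂P =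
      ((∫ ω in {ω | M.link ω = q}, M.jointGeom gam om q (M.geom ω) ∂P : ℝ) : ℂ) := by
    rw [← integral_indicator (M.measurableSet_link q), ← integral_complex_ofReal]
    refine integral_congr_ae ?_
    filter_upwards [M.ae_link_eq_iff] with ω hl
    by_cases hs : M.TagState (tagOf q) ω
    · rw [indicator_of_mem (by exact hs), Pi.one_apply, mul_one]
      by_cases ha : M.tRU ω ∈ rangeRU q
      · rw [jointRange, indicator_of_mem (by exact ha), indicator_of_mem (by exact (hl q).2 ⟨hs, ha⟩)]
      · rw [jointRange, indicator_of_notMem (by exact ha),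
          indicator_of_notMem (by exact fun hh => ha ((hl q).1 hh).2)]
    · rw [indicator_of_notMem (by exact hs), indicator_of_notMem (by exact fun hh => hs ((hl q).1 hh).1)]
      simp
  have e2 : ∫ ω, M.risAvg (fun z => (M.jointRange gam om q z : ℂ)) (M.tBU ω) *
      (p.probState (tagOf q) (M.tBU ω) : ℂ) ∂P =
      ((∫ ω, M.jointMean gam om q (M.tBU ω) * p.probState (tagOf q) (M.tBU ω) ∂P : ℝ) : ℂ) := by
    rw [← integral_complex_ofReal]
    refine integral_congr_ae (Eventually.of_forall fun ω => ?_)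
    beta_reduce
    rw [← ofReal_jointMean, Complex.ofReal_mul]
  rw [e1, e2] at h
  exact_mod_cast h

/-- Joint probability on a link of type `q`, averaged over the BS-user distance. -/
lemma measureReal_link_goodEvent (q : Serving) :
    P.real ({ω | M.link ω = q} ∩ M.goodEvent gam om q) =
      ∫ t in Ioi 0, M.jointMean gam om q t * p.probState (tagOf q) t * p.pdfBU t := by
  have h := M.measureReal_link_inter gam om q MeasurableSet.univ
  rw [preimage_univ, inter_univ] at h
  rw [h, M.integral_link_jointGeom, ← integral_lawBU, ← M.map_tBU, integral_map M.measurable_tBU.aemeasurable]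
  exact ((M.measurable_jointMean gam om q).mul
    (continuous_probState p (tagOf q)).measurable).aestronglyMeasurable

lemma integrableOn_jointMean (q : Serving) :
    IntegrableOn (fun t => M.jointMean gam om q t * p.probState (tagOf q) t * p.pdfBU t) (Ioi 0) := by
  refine Integrable.bdd_mul (c := 1) (integrableOn_pdfBU p le_rfl) ?_ ?_
  · exact ((M.measurable_jointMean gam om q).mul
      (continuous_probState p (tagOf q)).measurable).aestronglyMeasurable
  · refine (ae_restrict_iff' measurableSet_Ioi).2 (Eventually.of_forall fun t ht => ?_)
    have h1 := probState_mem p (tagOf q) (le_of_lt ht)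
    rw [norm_mul, Real.norm_of_nonneg h1.1]
    exact mul_le_one₀ (M.norm_jointMean_le gam om q t) h1.1 h1.2

lemma norm_smul_dir_zero {t : ℝ} (ht : 0 < t) : ‖t • dir 0‖ = t := by
  rw [norm_smul, norm_dir, mul_one, Real.norm_of_nonneg ht.le]

lemma smul_dir_zero_ne {t : ℝ} (ht : 0 < t) : t • dir 0 ≠ 0 :=
  norm_pos_iff.1 (by rwa [norm_smul_dir_zero ht])

lemma measureReal_risDist_pos {t : ℝ} (ht : 0 < t) :
    P.real {ω | M.risDist (t • dir 0) ω ∈ Ioi 0} = p.probCL t := by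
  have hm := M.measurable_risDist_right (t • dir 0)
  have h : P {ω | M.risDist (t • dir 0) ω ∈ Ioi 0} =
      (P.map (M.risDist (t • dir 0))).restrict (Ioi 0) univ := by
    rw [Measure.restrict_apply_univ, Measure.map_apply hm measurableSet_Ioi]; rfl
  rw [measureReal_def, h, M.map_risDist_restrict (smul_dir_zero_ne ht), withDensity_apply _ MeasurableSet.univ,
    Measure.restrict_univ, norm_smul_dir_zero ht, ← ofReal_integral_eq_lintegral_ofReal
      (integrableOn_offerDensity p ht le_rfl), integral_offerDensity p ht le_rfl,
      ENNReal.toReal_ofReal]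
  · simp
  · simpa using (probCL_mem p (t := t)).1
  · exact (ae_restrict_iff' measurableSet_Ioi).2
      (Eventually.of_forall fun s hs => offerDensity_nonneg p (le_of_lt hs) _)

lemma jointMean_DL {t : ℝ} (hg : 0 < gam) (ht : 0 < t) :
    M.jointMean gam om .DL t = p.jointDirect gam om .L t := by
  have h : ∀ s th, M.jointRange gam om .DL (t, s, th) = p.jointDirect gam om .L t := fun s th => by
    rw [jointRange, indicator_of_mem (by exact mem_univ _)]
    exact (M.jointOf_eq_jointAvg p.one_le_mL om (pow_pos (p := p) .DL (s := 0) (z := 0) ht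
      (by simp) (by simp)) ht hg).symm
  rw [jointMean]
  simp_rw [h]
  simp

/-- The integrand does not depend on RIS distance or angle, so only the probability that no RIS
offers a link remains. -/
lemma jointMean_DN {t : ℝ} (hg : 0 < gam) (ht : 0 < t) :
    M.jointMean gam om .DN t = (1 - p.probCL t) * p.jointDirect gam om .N t := by
  have hm : MeasurableSet {ω | M.risDist (t • dir 0) ω ∈ Ioi 0} :=
    M.measurable_risDist_right (t • dir 0) measurableSet_Ioi
  have h : ∀ s th, M.jointGeom gam om .DN (t, s, th) = p.jointDirect gam om .N t := fun s th =>
    (M.jointOf_eq_jointAvg p.one_le_mN om (pow_pos (p := p) .DN (s := 0) (z := 0) ht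
      (by simp) (by simp)) ht hg).symm
  have e : ∀ ω, M.jointRange gam om .DN (t, M.risDist (t • dir 0) ω, M.X .angle ω) =
      {ω | M.risDist (t • dir 0) ω ∈ Ioi 0}ᶜ.indicator (fun _ => p.jointDirect gam om .N t) ω := fun ω => by
    by_cases hω : M.risDist (t • dir 0) ω ∈ Ioi 0
    · rw [jointRange, indicator_of_notMem (by exact fun hh => hh hω),
        indicator_of_notMem (by exact fun hh => hh hω)]
    · rw [jointRange, indicator_of_mem (by exact hω), indicator_of_mem (by exact hω), h]
  rw [jointMean]
  simp_rw [e]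
  rw [integral_indicator hm.compl, setIntegral_const, smul_eq_mul, probReal_compl_eq_one_sub hm,
    M.measureReal_risDist_pos ht]

lemma jointCasc_eq {t s th : ℝ} (hg : 0 < gam) (ht : 0 < t) (hs : 0 < s)
    (hth : th ∈ Ioo (-Real.pi) Real.pi) (h0 : th ≠ 0) :
    p.jointCasc gam om t s th = M.jointGeom gam om .CL (t, s, th) :=
  M.jointOf_eq_jointAvg p.one_le_mL om (pow_distBR_pos (p := p) .CL ht (show s ∈ Ioi 0 from hs) hth h0) ht hg

lemma integral_angle (f : ℝ → ℝ) : ∫ th, f th ∂(P.map (M.X .angle)) =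
    1 / (2 * Real.pi) * ∫ th in (-Real.pi)..Real.pi, f th := by
  have hpi := Real.pi_pos
  rw [M.X_law, markLaw, ProbabilityTheory.cond, integral_smul_measure, Real.volume_Ioo, sub_neg_eq_add,
    ← two_mul, ENNReal.toReal_inv, ENNReal.toReal_ofReal (by positivity),
    intervalIntegral.integral_of_le (by linarith), integral_Ioc_eq_integral_Ioo, one_div, smul_eq_mul]

/-- RIS distance and angle have a product law. The restriction to positive distances removes the
atom at 0, and the rest has the defective density. -/
lemma jointMean_CL {t : ℝ} (ht : 0 < t) : M.jointMean gam om .CL t =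
    ∫ s in Ioi 0, offerDensity p t s *
      (1 / (2 * Real.pi) * ∫ th in (-Real.pi)..Real.pi, M.jointGeom gam om .CL (t, s, th)) := by
  have hy := smul_dir_zero_ne ht
  have hR := M.measurable_jointRange gam om .CL
  have hJ := M.measurable_jointGeom gam om .CL
  have h1 : Measurable fun z : ℝ × ℝ => M.jointRange gam om .CL (t, z) := hR.comp measurable_prodMk_left
  have hm := M.measurable_risDist_right (t • dir 0)
  have := Measure.isProbabilityMeasure_map (μ := P) hm.aemeasurable
  have := Measure.isProbabilityMeasure_map (μ := P) (M.X_measurable .angle).aemeasurable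
  have e1 : M.jointMean gam om .CL t = ∫ z, M.jointRange gam om .CL (t, z)
      ∂((P.map (M.risDist (t • dir 0))).prod (P.map (M.X .angle))) := by
    rw [← M.map_risDist_angle, integral_map (hm.prodMk (M.X_measurable _)).aemeasurable
      h1.aestronglyMeasurable]
    rfl
  have e2 : ∀ s, ∫ th, M.jointRange gam om .CL (t, s, th) ∂(P.map (M.X .angle)) =
      (Ioi 0).indicator (fun s => 1 / (2 * Real.pi) *
        ∫ th in (-Real.pi)..Real.pi, M.jointGeom gam om .CL (t, s, th)) s := fun s => by
    by_cases hs : s ∈ Ioi (0 : ℝ)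
    · have : ∀ th, M.jointRange gam om .CL (t, s, th) = M.jointGeom gam om .CL (t, s, th) := fun th =>
        indicator_of_mem (by exact hs) _
      simp_rw [this]
      rw [indicator_of_mem hs, M.integral_angle]
    · have : ∀ th, M.jointRange gam om .CL (t, s, th) = 0 := fun th =>
        indicator_of_notMem (by exact hs) _
      simp_rw [this]
      rw [indicator_of_notMem hs, integral_zero]
  have hd : Measurable fun s => ENNReal.ofReal (offerDensity p t s) :=
    (continuous_offerDensity p ht).measurable.ennreal_ofReal
  rw [e1, integral_prod _ (Integrable.of_bound h1.aestronglyMeasurable 1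
    (Eventually.of_forall fun z => M.norm_jointRange_le gam om _ _))]
  simp_rw [e2]
  rw [integral_indicator measurableSet_Ioi, M.map_risDist_restrict hy, norm_smul_dir_zero ht,
    integral_withDensity_eq_integral_toReal_smul hd (Eventually.of_forall fun s => ENNReal.ofReal_lt_top)]
  refine setIntegral_congr_fun measurableSet_Ioi fun s hs => ?_
  rw [ENNReal.toReal_ofReal (offerDensity_nonneg p (le_of_lt hs) t), smul_eq_mul]

/-- The factor 𝒫_CL in the association probability cancels the normalisation of the RIS density; the
exceptional angles 0 and π, where the closed form is not matched with the average, are null. -/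
lemma integral_cascIntegrand {t : ℝ} (hg : 0 < gam) (ht : 0 < t) :
    ∫ s in Ioi (0 : ℝ), ∫ th in (-Real.pi)..Real.pi, p.cascIntegrand gam om t s th =
      M.jointMean gam om .CL t * p.probState .N t := by
  rw [M.jointMean_CL gam om ht, ← integral_mul_const]
  refine integral_congr_ae ?_
  filter_upwards [probCL_mul_pdfRU p ht, ae_restrict_mem measurableSet_Ioi] with s hs hs0
  have e : ∫ th in (-Real.pi)..Real.pi, p.cascIntegrand gam om t s th =
      ∫ th in (-Real.pi)..Real.pi, offerDensity p t s * (1 / (2 * Real.pi)) * p.probState .N t *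
        M.jointGeom gam om .CL (t, s, th) := by
    refine intervalIntegral.integral_congr_ae ?_
    have h1 : ∀ᵐ th : ℝ, th ≠ 0 := by rw [ae_iff]; simp
    have h2 : ∀ᵐ th : ℝ, th ≠ Real.pi := by rw [ae_iff]; simp
    filter_upwards [h1, h2] with th hth0 hthpi hth
    rw [uIoc_of_le (by linarith [Real.pi_pos])] at hth
    rw [cascIntegrand, M.jointCasc_eq gam om hg ht hs0 ⟨hth.1, lt_of_le_of_ne hth.2 hthpi⟩ hth0, ← hs, assoc]
    ring
  rw [e, intervalIntegral.integral_const_mul]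
  ring

include M in
-- Up to null sets the integrand is the defective density times a constant and a factor in [0, 1].
lemma integrableOn_cascIntegrand {t : ℝ} (hg : 0 < gam) (ht : 0 < t) :
    IntegrableOn (fun y : ℝ × ℝ => p.cascIntegrand gam om t y.1 y.2)
      (Ioi 0 ×ˢ Ioo (-Real.pi) Real.pi) := by
  have hμ : (volume : Measure (ℝ × ℝ)).restrict (Ioi 0 ×ˢ Ioo (-Real.pi) Real.pi) =
      (volume.restrict (Ioi 0)).prod (volume.restrict (Ioo (-Real.pi) Real.pi)) := by
    rw [Measure.prod_restrict]; rfl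
  rw [IntegrableOn, hμ]
  have h1 : Integrable (fun y : ℝ × ℝ => offerDensity p t y.1 * (1 / (2 * Real.pi) * p.probState .N t))
      ((volume.restrict (Ioi 0)).prod (volume.restrict (Ioo (-Real.pi) Real.pi))) :=
    Integrable.mul_prod (g := fun _ => 1 / (2 * Real.pi) * p.probState .N t)
      (integrableOn_offerDensity p ht le_rfl) (integrable_const _)
  have hJ : Measurable fun y : ℝ × ℝ => M.jointGeom gam om .CL (t, y) :=
    (M.measurable_jointGeom gam om .CL).comp measurable_prodMk_left
  have h2 := Integrable.bdd_mul (c := 1) h1 hJ.aestronglyMeasurable (Eventually.of_forall fun y => by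
    have := M.jointGeom_mem gam om .CL (t, y)
    rw [Real.norm_of_nonneg this.1]; exact this.2)
  refine h2.congr ?_
  have a1 := Measure.quasiMeasurePreserving_fst (μ := volume.restrict (Ioi (0 : ℝ)))
    (ν := volume.restrict (Ioo (-Real.pi) Real.pi)) |>.ae
      ((probCL_mul_pdfRU p ht).and (ae_restrict_mem measurableSet_Ioi))
  have h0 : ∀ᵐ th : ℝ, th ≠ 0 := by rw [ae_iff]; simp
  have a2 := Measure.quasiMeasurePreserving_snd (μ := volume.restrict (Ioi (0 : ℝ)))
    (ν := volume.restrict (Ioo (-Real.pi) Real.pi)) |>.ae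
      ((ae_restrict_of_ae h0).and (ae_restrict_mem measurableSet_Ioo))
  filter_upwards [a1, a2] with y hy1 hy2
  rw [cascIntegrand, M.jointCasc_eq gam om hg ht hy1.2 hy2.2 hy2.1, ← hy1.1, assoc]
  ring

lemma avgIntegrand_eq {t : ℝ} (hg : 0 < gam) (ht : 0 < t) : p.avgIntegrand gam om t =
    M.jointMean gam om .DL t * p.probState .L t * p.pdfBU t +
      M.jointMean gam om .CL t * p.probState .N t * p.pdfBU t +
      M.jointMean gam om .DN t * p.probState .N t * p.pdfBU t := by
  rw [avgIntegrand, M.integral_cascIntegrand gam om hg ht, M.jointMean_DL gam om hg ht,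
    M.jointMean_DN gam om hg ht, assoc, assoc]
  ring

include M in
lemma integrableOn_avgIntegrand (hg : 0 < gam) : IntegrableOn (p.avgIntegrand gam om) (Ioi 0) :=
  (((M.integrableOn_jointMean gam om .DL).add (M.integrableOn_jointMean gam om .CL)).add
    (M.integrableOn_jointMean gam om .DN)).congr_fun
    (fun _ ht => (M.avgIntegrand_eq gam om hg ht).symm) measurableSet_Ioi

/-- Joint probability of both constraints. -/
lemma measureReal_sinr_emfe (hg : 0 < gam) :
    P.real {ω | gam < M.sinr ω ∧ M.emfe ω ≤ om} = ∫ t in Ioi (0 : ℝ), p.avgIntegrand gam om t := by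
  set E := {ω | gam < M.sinr ω ∧ M.emfe ω ≤ om} with hE
  have hq : ∀ q, E ∩ {ω | M.link ω = q} = {ω | M.link ω = q} ∩ M.goodEvent gam om q := fun q => by
    ext ω
    simp only [hE, goodEvent, sinr, emfe, mem_inter_iff, mem_ofPred_eq]
    constructor
    · rintro ⟨h, rfl⟩; exact ⟨rfl, h⟩
    · rintro ⟨rfl, h⟩; exact ⟨h, rfl⟩
  have hsplit : P.real E = P.real (E ∩ {ω | M.link ω = .DL}) + P.real (E ∩ {ω | M.link ω = .CL}) +
      P.real (E ∩ {ω | M.link ω = .DN}) := by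
    rw [← measureReal_inter_add_sdiff (s := E) (M.measurableSet_link .DL), add_assoc]
    congr 1
    rw [← measureReal_inter_add_sdiff (s := E \ {ω | M.link ω = .DL}) (M.measurableSet_link .CL)]
    congr 2 <;>
    · ext ω
      simp only [mem_inter_iff, Set.mem_sdiff, mem_ofPred_eq]
      cases M.link ω <;> simp
  have h12 : IntegrableOn (fun t => M.jointMean gam om .DL t * p.probState .L t * p.pdfBU t +
      M.jointMean gam om .CL t * p.probState .N t * p.pdfBU t) (Ioi 0) :=
    (M.integrableOn_jointMean gam om .DL).add (M.integrableOn_jointMean gam om .CL)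
  rw [hsplit, hq, hq, hq, M.measureReal_link_goodEvent, M.measureReal_link_goodEvent,
    M.measureReal_link_goodEvent, ← integral_add (M.integrableOn_jointMean gam om .DL)
      (M.integrableOn_jointMean gam om .CL)]
  refine (integral_add h12 (M.integrableOn_jointMean gam om .DN)).symm.trans ?_
  exact setIntegral_congr_fun measurableSet_Ioi fun t ht => (M.avgIntegrand_eq gam om hg ht).symm

end Network

end

end RisNet

/-! ### The theorem -/

theorem theorem3 {Ω ιb ιr : Type*} [MeasurableSpace Ω] (P : Measure Ω) [IsProbabilityMeasure P]
    [Countable ιb] [Countable ιr] (p : RisNet.Params) (M : RisNet.Network P p ιb ιr)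
    (γ ω : ℝ) (hγ : 0 < γ) :
    -- the interference series converges almost surely
    (∀ᵐ w ∂P, Summable (M.interfTerm .L w) ∧ Summable (M.interfTerm .N w)) ∧
    -- the Gil-Pelaez integrals converge absolutely
    (p.noise * γ ≤ p.area * ω → ∀ (q : RisNet.Serving) (t s z : ℝ), 0 < t → 0 < s → 0 < z →
      IntegrableOn (p.gpIntegrand (p.servingShape q) (p.pow q t s z) t γ ω) (Ioi 0)) ∧
    -- conditional joint probability, given the link type and the serving distances
    (∀ q : RisNet.Serving,
      (cond P {w | M.link w = q})⟦{w | γ < M.sinrOf q w ∧ M.emfeOf q w ≤ ω} | M.distSigma q⟧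
        =ᵐ[cond P {w | M.link w = q}]
          fun w => p.jointCond γ ω q (M.tBU w) (M.tRU w) (M.tBR w)) ∧
    -- joint probability, averaged over the distances and the association
    (∀ᵐ t ∂volume.restrict (Ioi (0 : ℝ)),
      IntegrableOn (fun y : ℝ × ℝ => p.cascIntegrand γ ω t y.1 y.2)
        (Ioi 0 ×ˢ Ioo (-Real.pi) Real.pi)) ∧
    IntegrableOn (p.avgIntegrand γ ω) (Ioi 0) ∧
    P.real {w | γ < M.sinr w ∧ M.emfe w ≤ ω} = ∫ t in Ioi (0 : ℝ), p.avgIntegrand γ ω t := by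
  refine ⟨?_, ?_, fun q => M.condProb_goodEvent γ ω hγ q, ?_, M.integrableOn_avgIntegrand γ ω hγ,
    M.measureReal_sinr_emfe γ ω hγ⟩
  · filter_upwards [M.ae_summable_interfTerm] with w h using ⟨h .L, h .N⟩
  · intro hU q t s z ht hs hz
    exact M.integrableOn_gpIntegrand (RisNet.Network.one_le_servingShape q)
      (RisNet.Network.pow_pos q ht (fun _ => hs) fun _ => hz) ht hγ hU
  · filter_upwards [ae_restrict_mem measurableSet_Ioi] with t ht
    exact M.integrableOn_cascIntegrand γ ω hγ ht
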